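/- **Setting.** Let $m>0$, $\langle\xi\rangle=\sqrt{m^2+|\xi|^2}$, and let $H^s=H^s(\mathbb R^n)$ be the space of real tempered distributions $\varphi$ on $\mathbb R^n$ with $\|\varphi\|_{H^s}:=\|\langle\xi\rangle^s\widehat\varphi\|_{L^2}<\infty$; for vector valued maps, the norms of the components are added. Let $E=E_1\oplus E_2$ with $E_1=\mathbb R^{d_1}$, $E_2=\mathbb R^{d_2}$, and let $$L=\begin{pmatrix}\gamma^0\partial_0+P_1(\vec\partial)&0\\0&\partial_0^2+P_2(\vec\partial)\end{pmatrix}$$ act on maps $u=(u_1,u_2):\mathbb R\times\mathbb R^n\to E$, where $\gamma^0\in\mathrm{End}(E_1)$ is invertible, $P_1,P_2$ are polynomials in $\vec\partial=(\partial_1,\dots,\partial_n)$ with coefficients in $\mathrm{End}(E_1)$, $\mathrm{End}(E_2)$, of degrees at most $q$ and $2q$, $q\ge1$; $i(\gamma^0)^{-1}P_1(i\xi)$ is Hermitian and $P_2(i\xi)\ge\alpha(\mu_0+|\xi|^{2q})$ (as Hermitian matrices) for all $\xi\in\mathbb R^n$, with constants $\alpha>0$, $\mu_0\ge0$. Let $N(u,\partial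 u)=(N_1(u),N_2(u,\partial_0u_2,\vec\partial u))$, where $N_1$, $N_2$ are given by power series at the origin, with values in $E_1$, $E_2$, with positive radius of convergence and without constant term. Assume that one of the following holds: (i) $N_2$ does not depend on $\partial u$ and $s>n/2$; (ii) $N_2$ is affine in $\partial u$ and $s>n/2>s-q\ge0$; (iii) $s>n/2+1$, and moreover $s-q>n/2$ or $N_2$ does not depend on $\partial_0u_2$ (for $q=1$ this additional condition is automatic). For a (non degenerate) interval $I$ let $\mathcal F^s(I)=C^0(I,H^s(\mathbb R^n,E))\cap C^1(I,H^{s-q}(\mathbb R^n,E))$, let $\mathrm{Cau}^s=H^s(\mathbb R^n,E)\times H^{s-q}(\mathbb R^n,E_2)$ with the sum of the norms, $[u]_t=(u|_t,\partial_0u_2|_t)\in\mathrm{Cau}^s$ the Cauchy data of $u$ at time $t$, and let $\mathcal E_0(I)$ be the space of the weak solutions $\varphi\in\mathcal F^s(I)$ of $L\varphi=0$ with $\|\varphi\|:=\sup_{\tau\in I}\|[\varphi]_\tau\|<\infty$. For $u\in\mathcal F^s(J)$, $J\subset I$, $t\in J$, let $\Theta_tu\in\mathcal E_0(I)$ be the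 solution of $L\varphi=0$ with $[\varphi]_t=[u]_t$. Let $V_t(\varphi)$ be the solution $\psi\in\mathcal E_0(I)$ of $L\psi=0$ with $\psi_1|_t=(\gamma^0)^{-1}N_1(\varphi|_t)$, $\psi_2|_t=0$, $\partial_0\psi_2|_t=N_2(\varphi,\partial\varphi)|_t$; that is, $V_t(\varphi)=\int_{y^0=t}G(\cdot-y)N(\varphi,\partial\varphi)(y)\,d\vec y$, where $LG=0$ and $L(1_{x^0\ge0}G)=\delta\otimes1_E$. For a normed space $\mathbb X$, an analytic functional is a formal series $f=\sum_pf^{(p)}$ of continuous symmetric $p$-linear forms on $\mathbb X$; its radius of convergence is that of $\sum_p\|f^{(p)}\|z^p$, and $\mathbb F_\rho$ is the space of those $f$ with $\sum_p\|f^{(p)}\|\rho^p<\infty$. Such an $f$ defines the function $f(\varphi)=\sum_pf^{(p)}(\varphi,\dots,\varphi)$. Put $(V_t\cdot f)(\varphi)=\delta f_\varphi(V_t(\varphi))$, where $\delta f_\varphi$ is the differential of $f$ at $\varphi$, and $$U_{t_1}^{t_2}f=T\exp\Big(\int_{t_1}^{t_2}ds\,V_s\cdot\Big)f:=\sum_{j\ge0}\int_{t_1<\tau_1<\dots<\tau_j<t_2}V_{\tau_j}\cdots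 V_{\tau_1}\cdot f\;d\tau$$ if $t_1\le t_2$, and the same with the factor $(-1)^j$ and $t_2<\tau_j<\dots<\tau_1<t_1$ if $t_2<t_1$. **Theorem.** Let $\ell\in[0,\infty]$, with $\ell<\infty$ if $\mu_0=0$, and let $r>0$. There are constants $\bar t>0$ and $0<R\le R'$, which depend only on the equation, on $m$, $s$, $\ell$ and on $r$, such that the following holds for every interval $I\subset\mathbb R$, not reduced to a point, of length at most $\ell$. 1. For every $t\in I$ and $c\in\mathrm{Cau}^s$ there is exactly one $\varphi\in\mathcal E_0(I)$ with $[\varphi]_t=c$ (so that $\Theta_tu$ is well defined), and for every $t\in I$ and every $\varphi\in\mathcal E_0(I)$ with $\|\varphi\|<R'$ the vector $V_t(\varphi)\in\mathcal E_0(I)$ is well defined. 2. Let $t_1,t_2\in I$ with $|t_2-t_1|<\bar t$, and let $f$ be an analytic functional on $\mathcal E_0(I)$ with radius of convergence at least $r$. Then $U_{t_1}^{t_2}f$ is well defined, as an element $g$ of $\mathbb F_{R'}$ (in particular its radius of convergence is at least $R>0$): on the ball $\|\varphi\|<R'$ the functions $V_{\tau_j}\cdots V_{\tau_1}\cdot f$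 are given by elements of $\mathbb F_{R'}$ and are integrable in $(\tau_1,\dots,\tau_j)$ for each fixed $\varphi$, the integrals are elements of $\mathbb F_{R'}$, and their series converges absolutely in $\mathbb F_{R'}$ to $g$. 3. With $t_1,t_2,f$ as in 2, let $J\subset I$ be an interval, not reduced to a point, with $t_1,t_2\in J$, and let $u\in\mathcal F^s(J)$ be a weak solution of $Lu+N(u,\partial u)=0$ such that $\|[u]_t\|<R$ for some $t$ between $t_1$ and $t_2$ (for instance $t=t_1$ or $t=t_2$). Then $\|\Theta_{t_1}u\|<r$, $\|\Theta_{t_2}u\|<R'$ and $$(U_{t_1}^{t_2}f)(\Theta_{t_2}u)=f(\Theta_{t_1}u).$$ -/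

import Mathlib

open MeasureTheory Set Filter Topology
open scoped ENNReal FourierTransform LineDeriv ContDiff BoundedContinuousFunction ComplexOrder

noncomputable section

/-! ## Sobolev spaces `H^s(ℝⁿ)` -/

/-- The Euclidean space `ℝⁿ`. -/
abbrev Space (n : ℕ) := EuclideanSpace ℝ (Fin n)

/-- Complex tempered distributions on `ℝⁿ`. -/
abbrev Distr (n : ℕ) := TemperedDistribution (Space n) ℂ

/-- The weight `⟨ξ⟩^s = (m² + |ξ|²)^{s/2}` at the frequency `ξ = 2πζ`. -/
def japanese (n : ℕ) (m s : ℝ) (ζ : Space n) : ℝ :=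
  (m ^ 2 + ‖(2 * Real.pi) • ζ‖ ^ 2) ^ (s / 2)

/-- The weight `⟨ξ⟩^s` times `(2π)^{n/2}`.
Mathlib's Fourier transform is `𝓕 φ ζ = ∫ φ(x) e^{-2πi x·ζ} dx`, so that
`‖sobWeight · 𝓕 φ‖_{L²(dζ)}` equals `‖⟨ξ⟩^s φ̂‖_{L²(dξ)}` for `φ̂ ξ = ∫ φ(x) e^{-i x·ξ} dx`. -/
def sobWeight (n : ℕ) (m s : ℝ) (ζ : Space n) : ℝ :=
  (2 * Real.pi) ^ ((n : ℝ) / 2) * japanese n m s ζ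

/-- A tempered distribution is real if it is real on real test functions. -/
def IsRealDistr {n : ℕ} (T : Distr n) : Prop :=
  ∀ h : SchwartzMap (Space n) ℂ, (∀ x, (h x).im = 0) → (T h).im = 0

/-- `⟨ξ⟩^s φ̂` is represented by the `L²` function `g`. -/
def HasSobSymbol {n : ℕ} (m s : ℝ) (T : Distr n) (g : Lp ℂ 2 (volume : Measure (Space n))) :
    Prop :=
  TemperedDistribution.smulLeftCLM ℂ (fun ζ => (sobWeight n m s ζ : ℂ)) (𝓕 T) =
    Lp.toTemperedDistribution g

theorem japanese_temperate (n : ℕ) (m s : ℝ) [hm : Fact (0 < m)] :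
    Function.HasTemperateGrowth (fun ζ : Space n => (japanese n m s ζ : ℂ)) := by
  have hm0 : 0 < m := hm.out
  have h1 : (fun ζ : Space n => japanese n m s ζ) =
      fun ζ : Space n => (m ^ 2) ^ (s / 2) *
        (fun x : Space n => (1 + ‖x‖ ^ 2) ^ (s / 2))
          (((2 * Real.pi / m) • ContinuousLinearMap.id ℝ (Space n)) ζ) := by
    funext ζ
    have h2 : m ^ 2 + ‖(2 * Real.pi) • ζ‖ ^ 2 =
        m ^ 2 * (1 + ‖(2 * Real.pi / m) • ζ‖ ^ 2) := by
      rw [norm_smul, norm_smul, Real.norm_eq_abs, Real.norm_eq_abs, mul_pow, mul_pow, sq_abs,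
        sq_abs]
      field_simp
    simp only [japanese, h2]
    rw [Real.mul_rpow (by positivity) (by positivity)]
    rfl
  have h3 : Function.HasTemperateGrowth (fun ζ : Space n => japanese n m s ζ) := by
    rw [h1]
    refine (Function.HasTemperateGrowth.const _).mul ?_
    exact (Function.hasTemperateGrowth_one_add_norm_sq_rpow (Space n) (s / 2)).comp
      (ContinuousLinearMap.hasTemperateGrowth _)
  exact Function.HasTemperateGrowth.comp
    (Function.Complex.hasTemperateGrowth_ofReal) h3

theorem sobWeight_temperate (n : ℕ) (m s : ℝ) [hm : Fact (0 < m)] :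
    Function.HasTemperateGrowth (fun ζ : Space n => (sobWeight n m s ζ : ℂ)) := by
  have h := (Function.HasTemperateGrowth.const (E := Space n)
    (((2 * Real.pi) ^ ((n : ℝ) / 2) : ℝ) : ℂ)).mul (japanese_temperate n m s)
  have e : (fun ζ : Space n => (sobWeight n m s ζ : ℂ)) =
      (fun _ : Space n => (((2 * Real.pi) ^ ((n : ℝ) / 2) : ℝ) : ℂ)) *
        (fun ζ : Space n => (japanese n m s ζ : ℂ)) := by
    funext ζ
    simp only [Pi.mul_apply, sobWeight, japanese, Complex.ofReal_mul]
  rw [e]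
  exact h

theorem sobWeight_mul (n : ℕ) (m s s' : ℝ) [hm : Fact (0 < m)] :
    (fun ζ : Space n => (sobWeight n m s ζ : ℂ)) *
      (fun ζ : Space n => (japanese n m (s' - s) ζ : ℂ)) =
      fun ζ : Space n => (sobWeight n m s' ζ : ℂ) := by
  have hm0 : 0 < m := hm.out
  funext ζ
  have hpos : 0 < m ^ 2 + ‖(2 * Real.pi) • ζ‖ ^ 2 := by positivity
  simp only [Pi.mul_apply, ← Complex.ofReal_mul]
  congr 1
  have : s' / 2 = s / 2 + (s' - s) / 2 := by ring
  simp only [sobWeight, japanese]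
  rw [this, Real.rpow_add hpos]
  ring

theorem HasSobSymbol.add {n : ℕ} {m s : ℝ} {T T' : Distr n}
    {g g' : Lp ℂ 2 (volume : Measure (Space n))} (h : HasSobSymbol m s T g)
    (h' : HasSobSymbol m s T' g') : HasSobSymbol m s (T + T') (g + g') := by
  unfold HasSobSymbol at *
  rw [FourierTransform.fourier_add, map_add, h, h']
  exact ((Lp.toTemperedDistributionCLM ℂ volume 2).map_add g g').symm

theorem HasSobSymbol.smul {n : ℕ} {m s : ℝ} {T : Distr n} (c : ℝ)
    {g : Lp ℂ 2 (volume : Measure (Space n))} (h : HasSobSymbol m s T g) :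
    HasSobSymbol m s (c • T) (c • g) := by
  have e1 : c • T = (c : ℂ) • T := by ext x; simp
  have e2 : c • g = (c : ℂ) • g := by
    exact (Complex.coe_smul c g).symm
  unfold HasSobSymbol at *
  rw [e1, e2, FourierTransform.fourier_smul, map_smul, h]
  exact ((Lp.toTemperedDistributionCLM ℂ volume 2).map_smul (c : ℂ) g).symm

theorem HasSobSymbol.unique {n : ℕ} {m s : ℝ} {T : Distr n}
    {g g' : Lp ℂ 2 (volume : Measure (Space n))} (h : HasSobSymbol m s T g)
    (h' : HasSobSymbol m s T g') : g = g' := by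
  have hk := Lp.ker_toTemperedDistributionCLM_eq_bot (F := ℂ) (μ := (volume : Measure (Space n)))
    (p := 2)
  exact LinearMap.ker_eq_bot.mp hk (h.symm.trans h')

/-- The real vector space underlying `H^s(ℝⁿ)`. -/
def sobolevSubmodule (n : ℕ) (m s : ℝ) : Submodule ℝ (Distr n) where
  carrier := {T | IsRealDistr T ∧ ∃ g, HasSobSymbol m s T g}
  add_mem' := by
    rintro T T' ⟨hT, g, hg⟩ ⟨hT', g', hg'⟩
    refine ⟨fun h hh => ?_, g + g', hg.add hg'⟩
    simp [hT h hh, hT' h hh]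
  zero_mem' := by
    refine ⟨fun h _ => by simp, 0, ?_⟩
    unfold HasSobSymbol
    have e : 𝓕 (0 : Distr n) = 0 := by ext x; simp
    rw [e, map_zero]
    exact ((Lp.toTemperedDistributionCLM ℂ volume 2).map_zero).symm
  smul_mem' := by
    rintro c T ⟨hT, g, hg⟩
    refine ⟨fun h hh => ?_, c • g, hg.smul c⟩
    simp [hT h hh]

/-- The real Sobolev space `H^s(ℝⁿ)`: real tempered distributions `φ` with `⟨ξ⟩^s φ̂ ∈ L²`. -/
def Sob (n : ℕ) (m s : ℝ) : Type := sobolevSubmodule n m s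

namespace Sob

variable {n : ℕ} {m s : ℝ}

instance : AddCommGroup (Sob n m s) := inferInstanceAs (AddCommGroup (sobolevSubmodule n m s))

instance : Module ℝ (Sob n m s) := inferInstanceAs (Module ℝ (sobolevSubmodule n m s))

/-- The underlying distribution. -/
def toDistr : Sob n m s →ₗ[ℝ] Distr n := (sobolevSubmodule n m s).subtype

/-- The `L²` function `⟨ξ⟩^s φ̂`. -/
def symbol : Sob n m s →ₗ[ℝ] Lp ℂ 2 (volume : Measure (Space n)) where
  toFun T := T.2.2.choose
  map_add' T T' := (T + T').2.2.choose_spec.unique (T.2.2.choose_spec.add T'.2.2.choose_spec)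
  map_smul' c T := (c • T).2.2.choose_spec.unique (T.2.2.choose_spec.smul c)

theorem hasSobSymbol (T : Sob n m s) : HasSobSymbol m s T.toDistr T.symbol :=
  T.2.2.choose_spec

theorem symbol_injective [hm : Fact (0 < m)] :
    Function.Injective (symbol : Sob n m s → Lp ℂ 2 (volume : Measure (Space n))) := by
  intro T T' h
  have e : TemperedDistribution.smulLeftCLM ℂ (fun ζ => (sobWeight n m s ζ : ℂ)) (𝓕 T.toDistr) =
      TemperedDistribution.smulLeftCLM ℂ (fun ζ => (sobWeight n m s ζ : ℂ)) (𝓕 T'.toDistr) := by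
    have h1 := T.hasSobSymbol
    have h2 := T'.hasSobSymbol
    unfold HasSobSymbol at h1 h2
    rw [h1, h2, h]
  apply_fun TemperedDistribution.smulLeftCLM ℂ (fun ζ => (sobWeight n m (-s) ζ : ℂ)) at e
  rw [TemperedDistribution.smulLeftCLM_smulLeftCLM_apply (sobWeight_temperate n m s)
      (sobWeight_temperate n m (-s)),
    TemperedDistribution.smulLeftCLM_smulLeftCLM_apply (sobWeight_temperate n m s)
      (sobWeight_temperate n m (-s))] at e
  have hw : (fun ζ : Space n => (sobWeight n m s ζ : ℂ)) *
      (fun ζ : Space n => (sobWeight n m (-s) ζ : ℂ)) =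
      fun _ => (((2 * Real.pi) ^ ((n : ℝ) / 2) * (2 * Real.pi) ^ ((n : ℝ) / 2) : ℝ) : ℂ) := by
    have hm0 : 0 < m := hm.out
    funext ζ
    have hpos : 0 < m ^ 2 + ‖(2 * Real.pi) • ζ‖ ^ 2 := by positivity
    simp only [Pi.mul_apply, ← Complex.ofReal_mul]
    congr 1
    simp only [sobWeight, japanese]
    rw [neg_div, Real.rpow_neg hpos.le]
    have := (Real.rpow_pos_of_pos hpos (s / 2)).ne'
    field_simp
  rw [hw, TemperedDistribution.smulLeftCLM_const, TemperedDistribution.smulLeftCLM_const] at e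
  have hc : (((2 * Real.pi) ^ ((n : ℝ) / 2) * (2 * Real.pi) ^ ((n : ℝ) / 2) : ℝ) : ℂ) ≠ 0 := by
    rw [Complex.ofReal_ne_zero]
    positivity
  have e2 : 𝓕 T.toDistr = 𝓕 T'.toDistr := smul_right_injective _ hc e
  have e3 : T.toDistr = T'.toDistr := by
    have := congrArg (fun S => 𝓕⁻ S) e2
    simpa using this
  exact Subtype.ext e3

/-- The norm `‖φ‖_{H^s} = ‖⟨ξ⟩^s φ̂‖_{L²}`. -/
instance [Fact (0 < m)] : NormedAddCommGroup (Sob n m s) :=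
  NormedAddCommGroup.induced (Sob n m s) (Lp ℂ 2 (volume : Measure (Space n))) symbol
    symbol_injective

instance [Fact (0 < m)] : NormedSpace ℝ (Sob n m s) :=
  NormedSpace.induced ℝ (Sob n m s) (Lp ℂ 2 (volume : Measure (Space n))) symbol

theorem mem_of_le [hm : Fact (0 < m)] {s' : ℝ} (h : s' ≤ s) (T : Sob n m s) :
    T.toDistr ∈ sobolevSubmodule n m s' := by
  have hm0 : 0 < m := hm.out
  refine ⟨T.2.1, ?_⟩
  set w : Space n → ℂ := fun ζ => (japanese n m (s' - s) ζ : ℂ) with hw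
  have hwT : w.HasTemperateGrowth := japanese_temperate n m (s' - s)
  have hbd : ∀ ζ, ‖w ζ‖ ≤ (m ^ 2) ^ ((s' - s) / 2) := by
    intro ζ
    have hpos : 0 < m ^ 2 := by positivity
    simp only [hw, japanese]
    rw [Complex.norm_real, Real.norm_of_nonneg (by positivity)]
    refine Real.rpow_le_rpow_of_nonpos hpos ?_ (by linarith)
    nlinarith [sq_nonneg ‖(2 * Real.pi) • ζ‖]
  have hmem : MemLp w ∞ (volume : Measure (Space n)) :=
    memLp_top_of_bound hwT.1.continuous.aestronglyMeasurable _ (Eventually.of_forall hbd)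
  refine ⟨(hmem.toLp w) • T.symbol, ?_⟩
  have hT := T.hasSobSymbol
  unfold HasSobSymbol at hT ⊢
  rw [Lp.toTemperedDistribution_smul_eq hwT hmem, ← hT,
    TemperedDistribution.smulLeftCLM_smulLeftCLM_apply (sobWeight_temperate n m s) hwT,
    sobWeight_mul n m s s']

/-- The inclusion `H^s ⊆ H^{s'}` for `s' ≤ s`. -/
def incl [Fact (0 < m)] {s' : ℝ} (h : s' ≤ s) : Sob n m s →ₗ[ℝ] Sob n m s' where
  toFun T := ⟨T.toDistr, mem_of_le h T⟩
  map_add' _ _ := rfl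
  map_smul' _ _ := rfl

end Sob

/-- `H^s(ℝⁿ, ℝ^ι)`, with the norm `∑ i, ‖φ i‖_{H^s}`. -/
abbrev SobVec (n : ℕ) (m s : ℝ) (ι : Type) : Type := PiLp 1 (fun _ : ι => Sob n m s)

/-! ## The linear operator -/

/-- The matrix `P(iξ)`, for a matrix `P` of polynomials. -/
def symbolMatrix {n d : ℕ} (P : Matrix (Fin d) (Fin d) (MvPolynomial (Fin n) ℝ)) (ξ : Space n) :
    Matrix (Fin d) (Fin d) ℂ :=
  P.map (fun p => MvPolynomial.aeval (fun j => Complex.I * (ξ j : ℂ)) p)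

/-- The operators `L = diag(γ⁰ ∂₀ + P₁(∂), ∂₀² + P₂(∂))` acting on maps `u = (u₁, u₂)` from
`ℝ × ℝⁿ` to `E = E₁ ⊕ E₂`, where `E₁ = ℝ^{d₁}` and `E₂ = ℝ^{d₂}`. The last field contains that
`P₂(iξ)` is a positive Hermitian matrix. -/
structure LinOp (n d₁ d₂ : ℕ) where
  /-- The order of `P₁`, and half the order of `P₂`. -/
  r : ℕ
  r_pos : 0 < r
  γ₀ : Matrix (Fin d₁) (Fin d₁) ℝ
  γ₀_inv : IsUnit γ₀.det
  P₁ : Matrix (Fin d₁) (Fin d₁) (MvPolynomial (Fin n) ℝ)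
  P₂ : Matrix (Fin d₂) (Fin d₂) (MvPolynomial (Fin n) ℝ)
  deg_P₁ : ∀ i j, (P₁ i j).totalDegree ≤ r
  deg_P₂ : ∀ i j, (P₂ i j).totalDegree ≤ 2 * r
  hermitian : ∀ ξ : Space n,
    (Complex.I • (γ₀⁻¹.map (fun a : ℝ => (a : ℂ)) * symbolMatrix P₁ ξ)).IsHermitian
  α : ℝ
  α_pos : 0 < α
  μ₀ : ℝ
  μ₀_nonneg : 0 ≤ μ₀
  elliptic : ∀ ξ : Space n,
    (symbolMatrix P₂ ξ - ((α * (μ₀ + ‖ξ‖ ^ (2 * r)) : ℝ) : ℂ) • 1).PosSemidef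

/-- The index set of the coordinates of `E = E₁ ⊕ E₂`. -/
abbrev Comp (d₁ d₂ : ℕ) := Fin d₁ ⊕ Fin d₂

/-- The partial derivative `∂_j` of distributions. -/
def partialD {n : ℕ} (j : Fin n) : Module.End ℝ (Distr n) :=
  (LineDeriv.lineDerivOpCLM ℂ (Distr n)
    (EuclideanSpace.single j (1 : ℝ) : Space n)).toLinearMap.restrictScalars ℝ

/-- The operator `P(∂)`, for a scalar polynomial `P`. -/
def polyD {n : ℕ} (p : MvPolynomial (Fin n) ℝ) : Module.End ℝ (Distr n) :=
  ∑ a ∈ p.support, p.coeff a • ((List.finRange n).map fun j => partialD j ^ a j).prod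

namespace LinOp

variable {n d₁ d₂ : ℕ} (L : LinOp n d₁ d₂)

theorem sub_le (s : ℝ) : s - L.r ≤ s := by
  have : (0 : ℝ) ≤ L.r := Nat.cast_nonneg _
  linarith

/-- The first `d₁` components of `L u + F`, tested against `η(t) h(x)`. -/
def pairing₁ (u F : ℝ → Comp d₁ d₂ → Distr n) (η : ℝ → ℝ) (h : SchwartzMap (Space n) ℂ)
    (i : Fin d₁) (t : ℝ) : ℂ :=
  -((deriv η t : ℝ) : ℂ) * ∑ j, (L.γ₀ i j : ℂ) * u t (Sum.inl j) h +
    ((η t : ℝ) : ℂ) * (∑ j, polyD (L.P₁ i j) (u t (Sum.inl j)) h + F t (Sum.inl i) h)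

/-- The last `d₂` components of `L u + F`, tested against `η(t) h(x)`. -/
def pairing₂ (u F : ℝ → Comp d₁ d₂ → Distr n) (η : ℝ → ℝ) (h : SchwartzMap (Space n) ℂ)
    (i : Fin d₂) (t : ℝ) : ℂ :=
  ((iteratedDeriv 2 η t : ℝ) : ℂ) * u t (Sum.inr i) h +
    ((η t : ℝ) : ℂ) * (∑ j, polyD (L.P₂ i j) (u t (Sum.inr j)) h + F t (Sum.inr i) h)

theorem pairing₁_add (u u' : ℝ → Comp d₁ d₂ → Distr n) (η : ℝ → ℝ)
    (h : SchwartzMap (Space n) ℂ) (i : Fin d₁) :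
    L.pairing₁ (u + u') 0 η h i = L.pairing₁ u 0 η h i + L.pairing₁ u' 0 η h i := by
  funext t
  simp [pairing₁, mul_add, Finset.sum_add_distrib]
  ring

theorem pairing₂_add (u u' : ℝ → Comp d₁ d₂ → Distr n) (η : ℝ → ℝ)
    (h : SchwartzMap (Space n) ℂ) (i : Fin d₂) :
    L.pairing₂ (u + u') 0 η h i = L.pairing₂ u 0 η h i + L.pairing₂ u' 0 η h i := by
  funext t
  simp [pairing₂, mul_add, Finset.sum_add_distrib]
  ring

theorem pairing₁_smul (a : ℝ) (u : ℝ → Comp d₁ d₂ → Distr n) (η : ℝ → ℝ)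
    (h : SchwartzMap (Space n) ℂ) (i : Fin d₁) :
    L.pairing₁ (a • u) 0 η h i = a • L.pairing₁ u 0 η h i := by
  have e : ∀ T : Distr n, (a • T) h = (a : ℂ) * T h := fun T => by simp
  funext t
  simp only [pairing₁, Pi.smul_apply, map_smul, Pi.zero_apply, Complex.real_smul, e]
  have h1 : ∑ j, (L.γ₀ i j : ℂ) * ((a : ℂ) * u t (Sum.inl j) h) =
      (a : ℂ) * ∑ j, (L.γ₀ i j : ℂ) * u t (Sum.inl j) h := by
    rw [Finset.mul_sum]
    exact Finset.sum_congr rfl fun j _ => by ring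
  rw [h1, ← Finset.mul_sum, show (0 : Distr n) h = 0 from rfl]
  ring

theorem pairing₂_smul (a : ℝ) (u : ℝ → Comp d₁ d₂ → Distr n) (η : ℝ → ℝ)
    (h : SchwartzMap (Space n) ℂ) (i : Fin d₂) :
    L.pairing₂ (a • u) 0 η h i = a • L.pairing₂ u 0 η h i := by
  have e : ∀ T : Distr n, (a • T) h = (a : ℂ) * T h := fun T => by simp
  funext t
  simp only [pairing₂, Pi.smul_apply, map_smul, Pi.zero_apply, Complex.real_smul, e]
  rw [← Finset.mul_sum, show (0 : Distr n) h = 0 from rfl]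
  ring

theorem pairing₁_zero (η : ℝ → ℝ) (h : SchwartzMap (Space n) ℂ) (i : Fin d₁) :
    L.pairing₁ 0 0 η h i = 0 := by
  funext t
  simp [pairing₁]

theorem pairing₂_zero (η : ℝ → ℝ) (h : SchwartzMap (Space n) ℂ) (i : Fin d₂) :
    L.pairing₂ 0 0 η h i = 0 := by
  funext t
  simp [pairing₂]

/-- `L u + F = 0` weakly on `I × ℝⁿ`. The test functions `η(t) h(x)` suffice, because their linear
combinations are dense. -/
def WeakEq (I : Set ℝ) (u F : ℝ → Comp d₁ d₂ → Distr n) : Prop :=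
  ∀ η : ℝ → ℝ, ContDiff ℝ ∞ η → HasCompactSupport η → tsupport η ⊆ interior I →
    ∀ h : SchwartzMap (Space n) ℂ,
      (∀ i, Integrable (L.pairing₁ u F η h i) ∧ ∫ t, L.pairing₁ u F η h i t = 0) ∧
      (∀ i, Integrable (L.pairing₂ u F η h i) ∧ ∫ t, L.pairing₂ u F η h i t = 0)

variable (m s : ℝ)

/-- The space `H^s(ℝⁿ, E) × H^{s-r}(ℝⁿ, E₂)` of Cauchy data, with the sum of the two norms. -/
def Cau : Type :=
  WithLp 1 (SobVec n m s (Comp d₁ d₂) × SobVec n m (s - L.r) (Fin d₂))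

variable [Fact (0 < m)]

instance : NormedAddCommGroup (L.Cau m s) :=
  inferInstanceAs (NormedAddCommGroup
    (WithLp 1 (SobVec n m s (Comp d₁ d₂) × SobVec n m (s - L.r) (Fin d₂))))

instance : NormedSpace ℝ (L.Cau m s) :=
  inferInstanceAs (NormedSpace ℝ
    (WithLp 1 (SobVec n m s (Comp d₁ d₂) × SobVec n m (s - L.r) (Fin d₂))))

variable {m s}

/-- `u` belongs to `C⁰(I, H^s(ℝⁿ, E)) ∩ C¹(I, H^{s-r}(ℝⁿ, E))`. Values outside `I` play no role. -/
def MemF (I : Set ℝ) (u : ℝ → SobVec n m s (Comp d₁ d₂)) : Prop :=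
  ContinuousOn u I ∧ ∀ i, ContDiffOn ℝ 1 (fun t => Sob.incl (L.sub_le s) (u t i)) I

/-- The Cauchy data `[u]_t = (u|_t, ∂₀u₂|_t)`. -/
def cauchyData (I : Set ℝ) (u : ℝ → SobVec n m s (Comp d₁ d₂)) (t : ℝ) : L.Cau m s :=
  WithLp.toLp 1 (u t, WithLp.toLp 1 fun i =>
    derivWithin (fun τ => Sob.incl (L.sub_le s) (u τ (Sum.inr i))) I t)

theorem cauchyData_add {I : Set ℝ} {u u' : ℝ → SobVec n m s (Comp d₁ d₂)} (hu : L.MemF I u)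
    (hu' : L.MemF I u') {t : ℝ} (ht : t ∈ I) :
    L.cauchyData I (u + u') t = L.cauchyData I u t + L.cauchyData I u' t := by
  have key : ∀ i, derivWithin (fun τ => Sob.incl (L.sub_le s) ((u + u') τ (Sum.inr i))) I t =
      derivWithin (fun τ => Sob.incl (L.sub_le s) (u τ (Sum.inr i))) I t +
      derivWithin (fun τ => Sob.incl (L.sub_le s) (u' τ (Sum.inr i))) I t := by
    intro i
    have h1 := (hu.2 (Sum.inr i)).differentiableOn one_ne_zero t ht
    have h2 := (hu'.2 (Sum.inr i)).differentiableOn one_ne_zero t ht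
    rw [← derivWithin_fun_add h1 h2]
    refine congrArg (fun f => derivWithin f I t) (funext fun τ => ?_)
    exact map_add (Sob.incl (L.sub_le s)) (u τ (Sum.inr i)) (u' τ (Sum.inr i))
  simp only [cauchyData, key]
  rfl

theorem cauchyData_smul (a : ℝ) {I : Set ℝ} {u : ℝ → SobVec n m s (Comp d₁ d₂)}
    (hu : L.MemF I u) {t : ℝ} (ht : t ∈ I) :
    L.cauchyData I (a • u) t = a • L.cauchyData I u t := by
  have key : ∀ i, derivWithin (fun τ => Sob.incl (L.sub_le s) ((a • u) τ (Sum.inr i))) I t =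
      a • derivWithin (fun τ => Sob.incl (L.sub_le s) (u τ (Sum.inr i))) I t := by
    intro i
    have h1 := (hu.2 (Sum.inr i)).differentiableOn one_ne_zero t ht
    rw [← derivWithin_fun_const_smul a h1]
    refine congrArg (fun f => derivWithin f I t) (funext fun τ => ?_)
    exact map_smul (Sob.incl (L.sub_le s)) a (u τ (Sum.inr i))
  simp only [cauchyData, key]
  rfl

/-- The distributions underlying the components of `u`. -/
def distrs (u : ℝ → SobVec n m s (Comp d₁ d₂)) : ℝ → Comp d₁ d₂ → Distr n :=
  fun t i => (u t i).toDistr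

variable (m s)

/-- The space of the (bounded) solutions `φ ∈ C⁰(I, H^s) ∩ C¹(I, H^{s-r})` of `L φ = 0`, with the
norm `sup_{t ∈ I} ‖[φ]_t‖`. A solution `φ` is represented by the map `t ↦ [φ]_t`, which
determines it since the first component of `[φ]_t` is `φ|_t`. -/
def E₀ (I : Set ℝ) : Submodule ℝ (I →ᵇ L.Cau m s) where
  carrier := {c | ∃ u : ℝ → SobVec n m s (Comp d₁ d₂), L.MemF I u ∧
    (∀ t : I, c t = L.cauchyData I u t) ∧ L.WeakEq I (distrs u) 0}
  zero_mem' := by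
    refine ⟨0, ⟨continuousOn_const, fun i => ?_⟩, fun t => ?_, ?_⟩
    · simpa using contDiffOn_const
    · simp [cauchyData]
      rfl
    · have e : distrs (0 : ℝ → SobVec n m s (Comp d₁ d₂)) = 0 := by
        funext t i
        exact map_zero Sob.toDistr
      intro η _ _ _ h
      rw [e]
      exact ⟨fun i => by simp [L.pairing₁_zero], fun i => by simp [L.pairing₂_zero]⟩
  add_mem' := by
    rintro c c' ⟨u, hu, hc, hw⟩ ⟨u', hu', hc', hw'⟩
    refine ⟨u + u', ⟨hu.1.add hu'.1, fun i => ?_⟩, fun t => ?_, ?_⟩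
    · have h := (hu.2 i).add (hu'.2 i)
      refine h.congr fun t _ => ?_
      exact map_add (Sob.incl (L.sub_le s)) (u t i) (u' t i)
    · rw [BoundedContinuousFunction.coe_add, Pi.add_apply, hc, hc']
      exact (L.cauchyData_add hu hu' t.2).symm
    · have e : distrs (u + u') = distrs u + distrs u' := by
        funext t i
        exact map_add Sob.toDistr (u t i) (u' t i)
      intro η h1 h2 h3 h
      obtain ⟨ha, hb⟩ := hw η h1 h2 h3 h
      obtain ⟨ha', hb'⟩ := hw' η h1 h2 h3 h
      rw [e]
      refine ⟨fun i => ?_, fun i => ?_⟩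
      · rw [L.pairing₁_add]
        refine ⟨(ha i).1.add (ha' i).1, ?_⟩
        rw [integral_add' (ha i).1 (ha' i).1, (ha i).2, (ha' i).2, add_zero]
      · rw [L.pairing₂_add]
        refine ⟨(hb i).1.add (hb' i).1, ?_⟩
        rw [integral_add' (hb i).1 (hb' i).1, (hb i).2, (hb' i).2, add_zero]
  smul_mem' := by
    rintro a c ⟨u, hu, hc, hw⟩
    refine ⟨a • u, ⟨hu.1.const_smul a, fun i => ?_⟩, fun t => ?_, ?_⟩
    · have h := (hu.2 i).const_smul a
      refine h.congr fun t _ => ?_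
      exact map_smul (Sob.incl (L.sub_le s)) a (u t i)
    · change a • c t = _
      rw [hc]
      exact (L.cauchyData_smul a hu t.2).symm
    · have e : distrs (a • u) = a • distrs u := by
        funext t i
        exact map_smul Sob.toDistr a (u t i)
      intro η h1 h2 h3 h
      obtain ⟨ha, hb⟩ := hw η h1 h2 h3 h
      rw [e]
      refine ⟨fun i => ?_, fun i => ?_⟩
      · rw [L.pairing₁_smul]
        refine ⟨(ha i).1.smul a, ?_⟩
        have := integral_smul (μ := (volume : Measure ℝ)) a (L.pairing₁ (distrs u) 0 η h i)
        rw [(ha i).2, smul_zero] at this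
        exact this
      · rw [L.pairing₂_smul]
        refine ⟨(hb i).1.smul a, ?_⟩
        have := integral_smul (μ := (volume : Measure ℝ)) a (L.pairing₂ (distrs u) 0 η h i)
        rw [(hb i).2, smul_zero] at this
        exact this

variable {m s}

/-- The Cauchy data at time `t` of a solution of `L φ = 0`. -/
def dataAt {I : Set ℝ} (φ : L.E₀ m s I) (t : ℝ) : L.Cau m s :=
  open Classical in if ht : t ∈ I then φ.1 ⟨t, ht⟩ else 0

/-- `Φ_t c`: the solution of `L φ = 0` with Cauchy data `c` at time `t`. -/
def Phi (I : Set ℝ) (t : ℝ) (c : L.Cau m s) : L.E₀ m s I :=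
  open Classical in if h : ∃ φ : L.E₀ m s I, L.dataAt φ t = c then h.choose else 0

/-- `Θ_t u`: the solution of `L φ = 0` on `I` with the same Cauchy data as `u` at time `t`, where
`u` is defined for times in `J`. -/
def Theta (I J : Set ℝ) (t : ℝ) (u : ℝ → SobVec n m s (Comp d₁ d₂)) : L.E₀ m s I :=
  L.Phi I t (L.cauchyData J u t)

end LinOp

/-! ## The nonlinearity -/

/-- The space `E₍₁₎ = E × E₂ × L(ℝⁿ, E)` of the values of `(u, ∂₀u₂, ∂₁u, …, ∂ₙu)`. -/
abbrev FirstJet (n d₁ d₂ : ℕ) : Type :=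
  (Comp d₁ d₂ → ℝ) × (Fin d₂ → ℝ) × (Fin n → Comp d₁ d₂ → ℝ)

/-- The nonlinearity `N(u, ∂u) = (N₁(u), N₂(u, ∂u))`, given by the power series of `N₁` and `N₂`
at the origin. -/
structure Nonlinearity (n d₁ d₂ : ℕ) where
  N₁ : FormalMultilinearSeries ℝ (Comp d₁ d₂ → ℝ) (Fin d₁ → ℝ)
  N₂ : FormalMultilinearSeries ℝ (FirstJet n d₁ d₂) (Fin d₂ → ℝ)

/-- The real function `w` represents the distribution `T`. -/
def IsRepr {n : ℕ} (T : Distr n) (w : Space n → ℝ) : Prop :=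
  AEStronglyMeasurable w ∧ ∀ h : SchwartzMap (Space n) ℂ,
    Integrable (fun x => h x * (w x : ℂ)) ∧ T h = ∫ x, h x * (w x : ℂ)

/-- The real function which represents `T` (and `0` if there is none). It is unique up to
equality almost everywhere. -/
def reprFun {n : ℕ} (T : Distr n) : Space n → ℝ :=
  open Classical in if h : ∃ w, IsRepr T w then h.choose else 0

namespace Nonlinearity

variable {n d₁ d₂ : ℕ} (N : Nonlinearity n d₁ d₂) (L : LinOp n d₁ d₂)

/-- The homogeneous term of degree `k` of `N₂`, at `(u, (∂₀u₂, ∂₁u, …, ∂ₙu))`. -/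
def hom₂ (k : ℕ) (u : Comp d₁ d₂ → ℝ) (d : (Fin d₂ → ℝ) × (Fin n → Comp d₁ d₂ → ℝ)) :
    Fin d₂ → ℝ :=
  N.N₂ k (fun _ => (u, d))

/-- `N₂` does not depend on `∂u`. -/
def IndepDeriv : Prop := ∀ k u d d', N.hom₂ k u d = N.hom₂ k u d'

/-- `N₂` does not depend on `∂₀u₂`. -/
def IndepTimeDeriv : Prop := ∀ k u a a' b, N.hom₂ k u (a, b) = N.hom₂ k u (a', b)

/-- `N₂` is affine in `∂u`. -/
def AffineDeriv : Prop :=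
  ∀ k u d d', ∀ c : ℝ,
    N.hom₂ k u ((1 - c) • d + c • d') = (1 - c) • N.hom₂ k u d + c • N.hom₂ k u d'

/-- `N₁` and `N₂` have a positive radius of convergence and vanish at the origin, and one of the
three conditions on the regularity `s` and on the dependence of `N₂` on `∂u` is satisfied. -/
def Admissible (s : ℝ) : Prop :=
  0 < N.N₁.radius ∧ 0 < N.N₂.radius ∧ N.N₁ 0 = 0 ∧ N.N₂ 0 = 0 ∧
    ((N.IndepDeriv ∧ (n : ℝ) / 2 < s) ∨
      (N.AffineDeriv ∧ (n : ℝ) / 2 < s ∧ s - L.r < (n : ℝ) / 2 ∧ 0 ≤ s - L.r) ∨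
      ((n : ℝ) / 2 + 1 < s ∧ ((n : ℝ) / 2 < s - L.r ∨ N.IndepTimeDeriv)))

variable {L} {m s : ℝ} [Fact (0 < m)]

/-- The values at `x` of `(ψ, χ, ∂₁ψ, …, ∂ₙψ)`, for Cauchy data `(ψ, χ)`. -/
def jetFun (c : L.Cau m s) (x : Space n) : FirstJet n d₁ d₂ :=
  (fun i => reprFun (c.fst i).toDistr x, fun i => reprFun (c.snd i).toDistr x,
    fun j i => reprFun (partialD j (c.fst i).toDistr) x)

/-- The distribution `M` is the function `N(u, ∂u)`, for `u` with Cauchy data `c`. -/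
def IsValue (c : L.Cau m s) (M : Comp d₁ d₂ → Distr n) : Prop :=
  ∃ y : Space n → Comp d₁ d₂ → ℝ, (∀ i, IsRepr (M i) (fun x => y x i)) ∧
    ∀ᵐ x, HasSum (fun k => N.N₁ k (fun _ => (jetFun c x).1)) (fun i => y x (Sum.inl i)) ∧
      HasSum (fun k => N.N₂ k (fun _ => jetFun c x)) (fun i => y x (Sum.inr i))

variable (L)

/-- `u ∈ C⁰(J, H^s) ∩ C¹(J, H^{s-r})` is a weak solution of `L u + N(u, ∂u) = 0`. -/
def IsSolution (J : Set ℝ) (u : ℝ → SobVec n m s (Comp d₁ d₂)) : Prop :=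
  L.MemF J u ∧ ∃ F : ℝ → Comp d₁ d₂ → Distr n,
    (∀ t ∈ J, N.IsValue (L.cauchyData J u t) (F t)) ∧ L.WeakEq J (LinOp.distrs u) F

variable {L}

/-- `ψ = ∫ G(· - y) N(φ, ∂φ)(y) dy` over `y⁰ = t`. As `L G = 0` and the data at time `0` of `G` are
`G₁ = (γ⁰)⁻¹ δ`, `G₂ = 0` and `∂₀G₂ = δ`, this is the solution of `L ψ = 0` with the data
`ψ₁ = (γ⁰)⁻¹ N₁`, `ψ₂ = 0`, `∂₀ψ₂ = N₂` at time `t`. -/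
def IsLagrangeDuhamel {I : Set ℝ} (t : ℝ) (φ ψ : L.E₀ m s I) : Prop :=
  ∃ M : Comp d₁ d₂ → Distr n, N.IsValue (L.dataAt φ t) M ∧
    (∀ i, ((L.dataAt ψ t).fst (Sum.inl i)).toDistr = ∑ j, L.γ₀⁻¹ i j • M (Sum.inl j)) ∧
    (∀ i, ((L.dataAt ψ t).fst (Sum.inr i)).toDistr = 0) ∧
    (∀ i, ((L.dataAt ψ t).snd i).toDistr = M (Sum.inr i))

/-- The Lagrange–Duhamel vector field `V_t`. -/
def V (I : Set ℝ) (t : ℝ) (φ : L.E₀ m s I) : L.E₀ m s I :=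
  open Classical in if h : ∃ ψ, N.IsLagrangeDuhamel t φ ψ then h.choose else 0

end Nonlinearity

/-! ## Analytic functionals and the chronological exponential -/

section Chronological

variable {X : Type} [NormedAddCommGroup X] [NormedSpace ℝ X]

/-- The formal series `f = ∑ f^{(p)}` has symmetric terms. -/
def SymmSeries (f : FormalMultilinearSeries ℝ X ℝ) : Prop :=
  ∀ (p : ℕ) (σ : Equiv.Perm (Fin p)) (v : Fin p → X), f p (v ∘ σ) = f p v

/-- `f` belongs to the space `𝔽_R(X)`, i.e. `∑ ‖f^{(p)}‖ R^p < ∞`. -/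
def MemFunctionals (R : ℝ) (f : FormalMultilinearSeries ℝ X ℝ) : Prop :=
  SymmSeries f ∧ Summable fun p => ‖f p‖ * R ^ p

/-- The operator `V·`, i.e. `(V·f)(φ) = δf_φ(V(φ))`. -/
def vectorFieldOp (V : X → X) (f : X → ℝ) : X → ℝ :=
  fun φ => lineDeriv ℝ f φ (V φ)

/-- `V_{τ_j}· ⋯ V_{τ_1}· f`. -/
def iteratedOp (V : ℝ → X → X) (f : X → ℝ) : (j : ℕ) → (Fin j → ℝ) → X → ℝ
  | 0, _ => f
  | j + 1, τ => vectorFieldOp (V (τ (Fin.last j))) (iteratedOp V f j (Fin.init τ))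

/-- The times `t₁ < τ_1 < ⋯ < τ_j < t₂`, or `t₂ < τ_j < ⋯ < τ_1 < t₁` if `t₂ < t₁`. -/
def orderedTimes (t₁ t₂ : ℝ) (j : ℕ) : Set (Fin j → ℝ) :=
  if t₁ ≤ t₂ then {τ | StrictMono τ ∧ ∀ i, τ i ∈ Ioo t₁ t₂}
  else {τ | StrictAnti τ ∧ ∀ i, τ i ∈ Ioo t₂ t₁}

/-- The term of order `j` of the chronological exponential, applied to `f`, at `φ`. -/
def chronTerm (V : ℝ → X → X) (t₁ t₂ : ℝ) (f : X → ℝ) (j : ℕ) (φ : X) : ℝ :=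
  (if t₁ ≤ t₂ then 1 else (-1) ^ j) * ∫ τ in orderedTimes t₁ t₂ j, iteratedOp V f j τ φ

/-- The chronological exponential `U = Texp (∫_{t₁}^{t₂} V_s· ds)` is well defined on `f`, on the
ball of radius `R`, and `U f = g`: the iterated derivatives are analytic functionals in `𝔽_R`, they
are integrable in time, the integrals are functionals in `𝔽_R`, and their series converges
absolutely in `𝔽_R` to `g`. -/
structure IsChronExp (V : ℝ → X → X) (t₁ t₂ : ℝ) (f : FormalMultilinearSeries ℝ X ℝ) (R : ℝ)
    (g : FormalMultilinearSeries ℝ X ℝ) : Prop where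
  iterated : ∀ j, ∀ τ ∈ orderedTimes t₁ t₂ j, ∃ a : FormalMultilinearSeries ℝ X ℝ,
    MemFunctionals R a ∧ ∀ φ, ‖φ‖ < R → iteratedOp V f.sum j τ φ = a.sum φ
  integrable : ∀ j φ, ‖φ‖ < R →
    IntegrableOn (fun τ => iteratedOp V f.sum j τ φ) (orderedTimes t₁ t₂ j)
  series : ∃ T : ℕ → FormalMultilinearSeries ℝ X ℝ,
    (∀ j, MemFunctionals R (T j)) ∧
    (∀ j φ, ‖φ‖ < R → (T j).sum φ = chronTerm V t₁ t₂ f.sum j φ) ∧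
    (Summable fun j => ∑' p, ‖T j p‖ * R ^ p) ∧
    ∀ p, HasSum (fun j => T j p) (g p)
  mem : MemFunctionals R g

end Chronological

end

open MeasureTheory Set Filter Topology
open scoped ENNReal FourierTransform LineDeriv ContDiff BoundedContinuousFunction ComplexOrder

noncomputable section


/-! The theorem is Dyson's expansion in the interaction picture. Let `Θ_t u` be the linear solution
that has the Cauchy data of `u` at time `t`. The formula of Duhamel says that this curve in `E₀`
satisfies `dΘ_t u / dt = -V_t(Θ_t u)`: the unbounded linear part has disappeared, and `V_t` is an
analytic vector field on a ball of a normed space. For an analytic functional `F`, the function `t ↦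
F(Θ_t u)` then has the derivative `-(V_t · F)(Θ_t u)`. Integrating from `t₁` to `t₂` and applying
the same to `V_t · F`, again and again, expands `f(Θ_{t₁} u)` in the iterated integrals of `V_{τ_j}
⋯ V_{τ_1} · f` at `Θ_{t₂} u`, with a remainder of order `J` (`sum_chronTerm_add_remainder`).

Convergence is of Cauchy–Kovalevskaya type. By Cauchy's estimate, `V_t ·` maps functionals of radius
`ρ'` to those of radius `ρ < ρ'` with norm at most `K / (ρ' - ρ)` (`summable_derivMajorant`). With
the radius lowered from `r₀` to `R` in `j` equal steps, `j` derivations cost `(j K / (r₀ - R)) ^ j`;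
the simplex of ordered times has volume at most `|t₂ - t₁| ^ j / j!`, and `j ^ j / j! ≤ e ^ j`
leaves a geometric series for short times (`tsum_iteratedMajorant_le`). The remainder obeys the same
bound. All this is `exists_isChronExp`, for time dependent vector fields on an arbitrary normed
space whose Taylor coefficients are bounded and continuous in time for fixed arguments.

The rest of the file verifies its hypotheses. The linear equation is a first-order system for the
Cauchy data, solved by Fourier multipliers `exp(t A(ξ))`. Conservation of charge and of energy
bounds them on `H^s × H^{s-r}`, for all times if `μ₀ > 0` and for bounded times otherwise, which is
why `ℓ` is finite for `μ₀ = 0` (`LinOp.exists_flow_bound`). Weak solutions satisfy the formula of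
Duhamel without loss of derivatives: it is first derived in spaces with `r` orders less, and lifted
since the forcing is continuous in the original space (`LinOp.hasDerivWithinAt_flow_cauchyData`).

For the nonlinearity, `H^a` with `a > n/2` is an algebra and acts on `H^σ` for `0 ≤ σ ≤ a`
(`Sob.exists_mul`). Each alternative on `N₂` and `s` is made so that `N₂` takes values in `H^{s-r}`;
thus `((γ⁰)⁻¹ N₁, 0, N₂)` is a convergent power series from Cauchy data to Cauchy data
(`Nonlinearity.Admissible.exists_field`), and `V_t` is this series conjugated by the linear
evolution. A continuity argument finally shows that a solution which is small at one time between
`t₁` and `t₂` stays small between them (`Nonlinearity.IsField.norm_cauchyData_lt`), so that `Θ` does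
not leave the ball of radius `R'`. -/

/-! ## Symmetrization and the derivative of a functional along a vector field -/

section DerivSeries

variable {X : Type} [NormedAddCommGroup X] [NormedSpace ℝ X]

/-- The symmetrization of a multilinear form. -/
def symmetrize {p : ℕ} (f : ContinuousMultilinearMap ℝ (fun _ : Fin p => X) ℝ) :
    ContinuousMultilinearMap ℝ (fun _ : Fin p => X) ℝ :=
  ((p.factorial : ℝ)⁻¹) • ∑ σ : Equiv.Perm (Fin p), f.domDomCongr σ

theorem symmetrize_apply {p : ℕ} (f : ContinuousMultilinearMap ℝ (fun _ : Fin p => X) ℝ)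
    (v : Fin p → X) :
    symmetrize f v = ((p.factorial : ℝ)⁻¹) * ∑ σ : Equiv.Perm (Fin p), f (fun i => v (σ i)) := by
  simp [symmetrize, sum_apply]

theorem symmetrize_const {p : ℕ} (f : ContinuousMultilinearMap ℝ (fun _ : Fin p => X) ℝ) (x : X) :
    symmetrize f (fun _ => x) = f (fun _ => x) := by
  rw [symmetrize_apply]
  have : (p.factorial : ℝ) ≠ 0 := by positivity
  simp [Finset.card_univ, Fintype.card_perm]
  field_simp

theorem symmetrize_comp_perm {p : ℕ} (f : ContinuousMultilinearMap ℝ (fun _ : Fin p => X) ℝ)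
    (σ : Equiv.Perm (Fin p)) (v : Fin p → X) : symmetrize f (v ∘ σ) = symmetrize f v := by
  rw [symmetrize_apply, symmetrize_apply]
  congr 1
  exact Fintype.sum_equiv (Equiv.mulLeft σ) _ _ fun τ => rfl

theorem norm_symmetrize_le {p : ℕ} (f : ContinuousMultilinearMap ℝ (fun _ : Fin p => X) ℝ) :
    ‖symmetrize f‖ ≤ ‖f‖ := by
  have h0 : (0 : ℝ) < p.factorial := by positivity
  rw [symmetrize, norm_smul, norm_inv, Real.norm_of_nonneg h0.le, inv_mul_le_iff₀ h0]
  refine (norm_sum_le _ _).trans ?_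
  simp [ContinuousMultilinearMap.norm_domDomCongr, Finset.card_univ, Fintype.card_perm]

/-- The multilinear form `(v, w) ↦ a(v, W(w))`, where `W(w)` is inserted at the last place. -/
def insertLast {p k : ℕ} (a : ContinuousMultilinearMap ℝ (fun _ : Fin (p + 1) => X) ℝ)
    (W : ContinuousMultilinearMap ℝ (fun _ : Fin k => X) X) :
    ContinuousMultilinearMap ℝ (fun _ : Fin p ⊕ Fin k => X) ℝ :=
  (((ContinuousLinearMap.compContinuousMultilinearMapL ℝ (fun _ : Fin k => X) X ℝ).flip
    W).compContinuousMultilinearMap a.curryRight).uncurrySum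

theorem insertLast_apply {p k : ℕ} (a : ContinuousMultilinearMap ℝ (fun _ : Fin (p + 1) => X) ℝ)
    (W : ContinuousMultilinearMap ℝ (fun _ : Fin k => X) X) (v : Fin p ⊕ Fin k → X) :
    insertLast a W v =
      a (Fin.snoc (α := fun _ => X) (fun i => v (Sum.inl i)) (W fun i => v (Sum.inr i))) := rfl

theorem norm_insertLast_le {p k : ℕ}
    (a : ContinuousMultilinearMap ℝ (fun _ : Fin (p + 1) => X) ℝ)
    (W : ContinuousMultilinearMap ℝ (fun _ : Fin k => X) X) :
    ‖insertLast a W‖ ≤ ‖a‖ * ‖W‖ := by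
  refine ContinuousMultilinearMap.opNorm_le_bound (by positivity) fun v => ?_
  rw [insertLast_apply]
  refine (a.le_opNorm _).trans ?_
  rw [Fin.prod_univ_castSucc, Fintype.prod_sum_type]
  simp only [Fin.snoc_castSucc, Fin.snoc_last]
  have := W.le_opNorm fun i => v (Sum.inr i)
  calc _ ≤ ‖a‖ * ((∏ i, ‖v (Sum.inl i)‖) * (‖W‖ * ∏ i, ‖v (Sum.inr i)‖)) := by gcongr
    _ = _ := by ring

/-- The identification of `p + (q - p)` with `q` slots. -/
def splitEquiv (q : ℕ) (p : Fin (q + 1)) : Fin p ⊕ Fin (q - p) ≃ Fin q :=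
  finSumFinEquiv.trans (finCongr (by omega))

/-- The power series of `φ ↦ δa_φ(W(φ))`. -/
def derivSeries (W : FormalMultilinearSeries ℝ X X) (a : FormalMultilinearSeries ℝ X ℝ) :
    FormalMultilinearSeries ℝ X ℝ := fun q =>
  -- The factor `p + 1` counts the slots of a symmetric `(p + 1)`-form in which the vector field can
  -- be inserted. Symmetrizing keeps the diagonal values, does not increase the norm, and allows the
  -- next derivation to use the same rule.
  symmetrize (∑ p : Fin (q + 1), ((p : ℝ) + 1) •
    (insertLast (a (p + 1)) (W (q - p))).domDomCongr (splitEquiv q p))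

theorem derivSeries_apply (W : FormalMultilinearSeries ℝ X X) (a : FormalMultilinearSeries ℝ X ℝ)
    (q : ℕ) (v : Fin q → X) :
    derivSeries W a q v = ((q.factorial : ℝ)⁻¹) * ∑ σ : Equiv.Perm (Fin q),
      ∑ p : Fin (q + 1), ((p : ℝ) + 1) * a (p + 1) (Fin.snoc (α := fun _ => X)
        (fun i => v (σ (splitEquiv q p (Sum.inl i))))
        (W (q - p) fun i => v (σ (splitEquiv q p (Sum.inr i))))) := by
  rw [derivSeries, symmetrize_apply]
  simp [sum_apply, insertLast_apply]

theorem derivSeries_const (W : FormalMultilinearSeries ℝ X X)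
    (a : FormalMultilinearSeries ℝ X ℝ) (q : ℕ) (x : X) :
    derivSeries W a q (fun _ => x) = ∑ p ∈ Finset.range (q + 1), ((p : ℝ) + 1) *
      a (p + 1) (Fin.snoc (α := fun _ => X) (fun _ => x) (W (q - p) fun _ => x)) := by
  rw [derivSeries, symmetrize_const, ← Fin.sum_univ_eq_sum_range (fun p => ((p : ℝ) + 1) *
      a (p + 1) (Fin.snoc (α := fun _ => X) (fun _ => x) (W (q - p) fun _ => x)))]
  simp [sum_apply, insertLast_apply]

theorem derivSeries_symm (W : FormalMultilinearSeries ℝ X X)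
    (a : FormalMultilinearSeries ℝ X ℝ) : SymmSeries (derivSeries W a) :=
  fun _ σ v => symmetrize_comp_perm _ σ v

/-- The majorant of `derivSeries`. -/
def derivMajorant (v b : ℕ → ℝ) (q : ℕ) : ℝ :=
  ∑ p ∈ Finset.range (q + 1), ((p : ℝ) + 1) * b (p + 1) * v (q - p)

theorem norm_derivSeries_le {W : FormalMultilinearSeries ℝ X X}
    {a : FormalMultilinearSeries ℝ X ℝ} {v b : ℕ → ℝ} (hW : ∀ k, ‖W k‖ ≤ v k)
    (ha : ∀ p, ‖a p‖ ≤ b p) (q : ℕ) : ‖derivSeries W a q‖ ≤ derivMajorant v b q := by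
  refine (norm_symmetrize_le _).trans ?_
  rw [derivMajorant, ← Fin.sum_univ_eq_sum_range (fun p => ((p : ℝ) + 1) * b (p + 1) * v (q - p))]
  refine (norm_sum_le _ _).trans (Finset.sum_le_sum fun p _ => ?_)
  rw [norm_smul, ContinuousMultilinearMap.norm_domDomCongr, mul_assoc,
    Real.norm_of_nonneg (by positivity)]
  refine mul_le_mul_of_nonneg_left ((norm_insertLast_le _ _).trans ?_) (by positivity)
  exact mul_le_mul (ha _) (hW _) (norm_nonneg _) ((norm_nonneg _).trans (ha _))

/-- One has `ρ' ^ (p + 1) - ρ ^ (p + 1) ≥ (p + 1) ρ ^ p (ρ' - ρ)`; dropping the subtracted power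
leaves a Cauchy estimate for the derivative of a monomial. -/
theorem succ_mul_pow_mul_sub_le {ρ ρ' : ℝ} (h0 : 0 ≤ ρ) (h : ρ ≤ ρ') (p : ℕ) :
    ((p : ℝ) + 1) * ρ ^ p * (ρ' - ρ) ≤ ρ' ^ (p + 1) := by
  induction p with
  | zero => simp; linarith
  | succ p ih =>
    have h1 : ρ ^ (p + 1) ≤ ρ' ^ (p + 1) := by gcongr
    have h2 : ((p : ℝ) + 1) * ρ ^ p * (ρ' - ρ) * ρ ≤ ρ' ^ (p + 1) * ρ := by gcongr
    have h3 : ρ ^ (p + 1) * (ρ' - ρ) ≤ ρ' ^ (p + 1) * (ρ' - ρ) := by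
      have : 0 ≤ ρ' - ρ := by linarith
      gcongr
    push_cast
    calc _ = ((p : ℝ) + 1) * ρ ^ p * (ρ' - ρ) * ρ + ρ ^ (p + 1) * (ρ' - ρ) := by ring
      _ ≤ ρ' ^ (p + 1) * ρ + ρ' ^ (p + 1) * (ρ' - ρ) := add_le_add h2 h3
      _ = _ := by ring

/-- Cauchy's estimate for majorants: differentiation is bounded from radius `ρ'` to radius `ρ`, at
the price of the factor `1 / (ρ' - ρ)`. -/
theorem summable_succ_mul {b : ℕ → ℝ} (hb : ∀ p, 0 ≤ b p) {ρ ρ' : ℝ} (h0 : 0 ≤ ρ) (h : ρ < ρ')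
    (hs : Summable fun p => b p * ρ' ^ p) :
    Summable (fun p : ℕ => ((p : ℝ) + 1) * b (p + 1) * ρ ^ p) ∧
      ∑' p : ℕ, ((p : ℝ) + 1) * b (p + 1) * ρ ^ p ≤ (∑' p, b p * ρ' ^ p) / (ρ' - ρ) := by
  have hd : 0 < ρ' - ρ := by linarith
  have hs1 : Summable fun p => b (p + 1) * ρ' ^ (p + 1) / (ρ' - ρ) :=
    ((summable_nat_add_iff 1).2 hs).div_const _
  have hle : ∀ p : ℕ, ((p : ℝ) + 1) * b (p + 1) * ρ ^ p ≤ b (p + 1) * ρ' ^ (p + 1) / (ρ' - ρ) := by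
    intro p
    rw [le_div_iff₀ hd]
    have := mul_le_mul_of_nonneg_left (succ_mul_pow_mul_sub_le h0 h.le p) (hb (p + 1))
    linarith
  have hnn : ∀ p : ℕ, 0 ≤ ((p : ℝ) + 1) * b (p + 1) * ρ ^ p := fun p => by
    have := hb (p + 1); positivity
  have hs2 := Summable.of_nonneg_of_le hnn hle hs1
  refine ⟨hs2, (hs2.tsum_le_tsum hle hs1).trans ?_⟩
  rw [tsum_div_const]
  refine div_le_div_of_nonneg_right ?_ hd.le
  rw [Summable.tsum_eq_zero_add hs]
  have := hb 0
  simp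
  exact this

theorem derivMajorant_nonneg {v b : ℕ → ℝ} (hv : ∀ k, 0 ≤ v k) (hb : ∀ p, 0 ≤ b p) (q : ℕ) :
    0 ≤ derivMajorant v b q :=
  Finset.sum_nonneg fun p _ => by
    have := hv (q - p); have := hb (p + 1); positivity

theorem derivMajorant_mul_pow (v b : ℕ → ℝ) (ρ : ℝ) (q : ℕ) :
    derivMajorant v b q * ρ ^ q =
      ∑ p ∈ Finset.range (q + 1), (((p : ℝ) + 1) * b (p + 1) * ρ ^ p) * (v (q - p) * ρ ^ (q - p)) := by
  rw [derivMajorant, Finset.sum_mul]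
  refine Finset.sum_congr rfl fun p hp => ?_
  have : ρ ^ q = ρ ^ p * ρ ^ (q - p) := by
    rw [← pow_add]; congr 1; have := Finset.mem_range.1 hp; omega
  rw [this]; ring

/-- The majorant is a Cauchy product of the differentiated majorant `b` with `v`. Hence a derivation
along a vector field is bounded from `𝔽_ρ'` to `𝔽_ρ` by the size of the field over `ρ' - ρ`; the
convergence of the chronological exponential rests on this. -/
theorem summable_derivMajorant {v b : ℕ → ℝ} (hv : ∀ k, 0 ≤ v k) (hb : ∀ p, 0 ≤ b p) {ρ ρ' : ℝ}
    (h0 : 0 ≤ ρ) (h : ρ < ρ') (hs : Summable fun p => b p * ρ' ^ p)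
    (hsv : Summable fun k => v k * ρ ^ k) :
    Summable (fun q => derivMajorant v b q * ρ ^ q) ∧
      ∑' q, derivMajorant v b q * ρ ^ q ≤
        (∑' p, b p * ρ' ^ p) / (ρ' - ρ) * ∑' k, v k * ρ ^ k := by
  obtain ⟨h1, h2⟩ := summable_succ_mul hb h0 h hs
  have h1' : Summable fun p : ℕ => ‖((p : ℝ) + 1) * b (p + 1) * ρ ^ p‖ := h1.abs
  have hsv' : Summable fun k => ‖v k * ρ ^ k‖ := hsv.abs
  simp only [derivMajorant_mul_pow]
  refine ⟨(summable_norm_sum_mul_range_of_summable_norm h1' hsv').of_norm, ?_⟩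
  rw [← tsum_mul_tsum_eq_tsum_sum_range_of_summable_norm h1' hsv']
  refine mul_le_mul_of_nonneg_right h2 (tsum_nonneg fun k => ?_)
  have := hv k; positivity

/-- The functional defined by a symmetric series is differentiable, with the expected derivative. -/
theorem SymmSeries.lineDeriv_sum {a : FormalMultilinearSeries ℝ X ℝ} (ha : SymmSeries a) {ρ : ℝ}
    (hs : Summable fun p => ‖a p‖ * ρ ^ p) {x : X} (hx : ‖x‖ < ρ) :
    ∃ a' : X →L[ℝ] ℝ, HasFDerivAt a.sum a' x ∧ ∀ y, HasSum (fun p : ℕ => ((p : ℝ) + 1) *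
      a (p + 1) (Fin.snoc (α := fun _ => X) (fun _ => x) y)) (a' y) := by
  -- Termwise differentiation needs a bound that is uniform on a ball containing `x`; an
  -- intermediate radius provides it through Cauchy's estimate.
  obtain ⟨ρ₁, hx1, h1ρ⟩ := exists_between hx
  have h0 : 0 ≤ ρ₁ := (norm_nonneg x).trans hx1.le
  obtain ⟨hsum, -⟩ := summable_succ_mul (b := fun p => ‖a p‖) (fun p => norm_nonneg _) h0 h1ρ hs
  let g : ℕ → X → (X →L[ℝ] ℝ) := fun p z => ((p : ℝ) + 1) • (a (p + 1)).curryRight (fun _ => z)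
  let f' : ℕ → X → (X →L[ℝ] ℝ) := fun p => Nat.casesOn p (fun _ => 0) g
  have hg : ∀ p z, ‖z‖ < ρ₁ → ‖g p z‖ ≤ ((p : ℝ) + 1) * ‖a (p + 1)‖ * ρ₁ ^ p := by
    intro p z hz
    rw [norm_smul, Real.norm_of_nonneg (by positivity), mul_assoc]
    gcongr
    refine ((a (p + 1)).curryRight.le_opNorm _).trans ?_
    simp only [Finset.prod_const, Finset.card_univ, Fintype.card_fin,
      ContinuousMultilinearMap.curryRight_norm]
    gcongr
  let u : ℕ → ℝ := fun p => Nat.casesOn p 0 fun p => ((p : ℝ) + 1) * ‖a (p + 1)‖ * ρ₁ ^ p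
  have hu : Summable u := (summable_nat_add_iff 1).1 hsum
  have hder : ∀ p, ∀ z ∈ Metric.ball (0 : X) ρ₁,
      HasFDerivAt (fun z => a p fun _ => z) (f' p z) z := by
    intro p z _
    have h := HasFDerivAt.multilinear_comp (a p) (g := fun _ z => z)
      (g' := fun _ => ContinuousLinearMap.id ℝ X) (x := z) (fun _ => hasFDerivAt_id z)
    refine h.congr_fderiv (Eq.symm ?_)
    ext y
    cases p with
    | zero => simp [f']
    | succ p =>
      simp only [f', g, smul_apply, ContinuousMultilinearMap.curryRight_apply,
        smul_eq_mul, ContinuousLinearMap.comp_id]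
      -- By symmetry, the increment in slot `i` can be exchanged with the last slot, so the `p + 1`
      -- partial derivatives coincide.
      have key : ∀ i : Fin (p + 1), (a (p + 1)).toContinuousLinearMap (fun _ => z) i y =
          a (p + 1) (Fin.snoc (α := fun _ => X) (fun _ => z) y) := by
        intro i
        rw [ContinuousMultilinearMap.toContinuousLinearMap_apply,
          ← ha (p + 1) (Equiv.swap i (Fin.last p)) (Fin.snoc (α := fun _ => X) (fun _ => z) y)]
        congr 1
        funext j
        by_cases hj : j = i
        · subst hj; simp
        · rw [Function.update_of_ne hj]
          by_cases hl : j = Fin.last p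
          · subst hl
            simp only [Function.comp, Equiv.swap_apply_right]
            have : i ≠ Fin.last p := fun h => hj h.symm
            obtain ⟨i', rfl⟩ := Fin.exists_castSucc_eq.2 this
            simp
          · simp only [Function.comp, Equiv.swap_apply_of_ne_of_ne hj hl]
            obtain ⟨j', rfl⟩ := Fin.exists_castSucc_eq.2 hl
            simp
      rw [sum_apply]
      simp [key]
  have hbd : ∀ p, ∀ z ∈ Metric.ball (0 : X) ρ₁, ‖f' p z‖ ≤ u p := by
    intro p z hz
    cases p with
    | zero => simp [f', u]
    | succ p => exact hg p z (by simpa using hz)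
  have hx1' : x ∈ Metric.ball (0 : X) ρ₁ := by simpa using hx1
  have hsx : Summable fun p => a p fun _ => x := by
    refine Summable.of_norm_bounded hs fun p => ((a p).le_opNorm _).trans ?_
    simp only [Finset.prod_const, Finset.card_univ, Fintype.card_fin]
    gcongr
  refine ⟨∑' p, f' p x, hasFDerivAt_tsum_of_isPreconnected hu Metric.isOpen_ball
    (convex_ball _ _).isPreconnected hder hbd hx1' hsx hx1', fun y => ?_⟩
  have hf' : Summable fun p => f' p x := Summable.of_norm_bounded hu fun p => hbd p x hx1'
  have h2 : HasSum (fun p => f' (p + 1) x) (∑' p, f' p x) := by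
    rw [hasSum_nat_add_iff (f := fun p => f' p x) 1]
    simpa [f'] using hf'.hasSum
  exact h2.mapL (ContinuousLinearMap.apply ℝ ℝ y)

theorem norm_apply_const_le {F : Type*} [NormedAddCommGroup F] [NormedSpace ℝ F] {p : ℕ}
    (a : ContinuousMultilinearMap ℝ (fun _ : Fin p => X) F) {b ρ : ℝ} (hb : ‖a‖ ≤ b) {x : X}
    (hx : ‖x‖ ≤ ρ) : ‖a fun _ => x‖ ≤ b * ρ ^ p := by
  refine (a.le_opNorm _).trans ?_
  simp only [Finset.prod_const, Finset.card_univ, Fintype.card_fin]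
  have := (norm_nonneg a).trans hb
  gcongr

/-- The power series `derivSeries W a` represents `δa(W)`. -/
theorem hasFDerivAt_sum_derivSeries {a : FormalMultilinearSeries ℝ X ℝ} (ha : SymmSeries a)
    {W : FormalMultilinearSeries ℝ X X} {v b : ℕ → ℝ} (hW : ∀ k, ‖W k‖ ≤ v k)
    (hab : ∀ p, ‖a p‖ ≤ b p) {ρ : ℝ} (hs : Summable fun p => b p * ρ ^ p)
    (hsv : Summable fun k => v k * ρ ^ k) {x y : X} (hx : ‖x‖ < ρ)
    (hy : HasSum (fun k => W k fun _ => x) y) :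
    ∃ a' : X →L[ℝ] ℝ, HasFDerivAt a.sum a' x ∧ a' y = (derivSeries W a).sum x := by
  have hρ : 0 ≤ ρ := (norm_nonneg x).trans hx.le
  have hsa : Summable fun p => ‖a p‖ * ρ ^ p :=
    hs.of_nonneg_of_le (fun p => by positivity) fun p => by gcongr; exact hab p
  obtain ⟨a', h1, h2⟩ := ha.lineDeriv_sum hsa hx
  refine ⟨a', h1, ?_⟩
  have hb0 : ∀ p, 0 ≤ b p := fun p => (norm_nonneg _).trans (hab p)
  have hv0 : ∀ p, 0 ≤ v p := fun p => (norm_nonneg _).trans (hW p)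
  -- Inserting the series of `W` into the differential of `a` gives this double series, which
  -- converges absolutely because `‖x‖ < ρ`. Its sum is `a' y`; regrouped along `p + k = q` it is
  -- the series of `derivSeries`.
  let F : ℕ → ℕ → ℝ := fun p k =>
    ((p : ℝ) + 1) * a (p + 1) (Fin.snoc (α := fun _ => X) (fun _ => x) (W k fun _ => x))
  have hFb : ∀ p k, ‖F p k‖ ≤ (((p : ℝ) + 1) * b (p + 1) * ‖x‖ ^ p) * (v k * ‖x‖ ^ k) := by
    intro p k
    simp only [F]
    rw [norm_mul, Real.norm_of_nonneg (by positivity), mul_assoc, mul_assoc]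
    gcongr
    refine ((a (p + 1)).le_opNorm _).trans ?_
    rw [Fin.prod_univ_castSucc]
    simp only [Fin.snoc_castSucc, Fin.snoc_last, Finset.prod_const, Finset.card_univ,
      Fintype.card_fin]
    have := hb0 (p + 1)
    gcongr
    · exact hab _
    · exact norm_apply_const_le _ (hW k) le_rfl
  obtain ⟨hs1, -⟩ := summable_succ_mul hb0 (norm_nonneg x) hx hs
  have hs2 : Summable fun k => v k * ‖x‖ ^ k :=
    hsv.of_nonneg_of_le (fun k => by have := hv0 k; positivity) fun k => by
      have := hv0 k; gcongr
  have hsF : Summable fun z : ℕ × ℕ => F z.1 z.2 := by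
    refine Summable.of_norm_bounded (hs1.mul_of_nonneg hs2 (fun p => ?_) fun k => ?_)
      fun z => hFb z.1 z.2
    · have := hb0 (p + 1); positivity
    · have := hv0 k; positivity
  have e1 : a' y = ∑' z : ℕ × ℕ, F z.1 z.2 := by
    rw [hsF.tsum_prod, ← (hy.mapL a').tsum_eq]
    have hG : ∀ k, a' (W k fun _ => x) = ∑' p, F p k := fun k => (h2 _).tsum_eq.symm
    simp_rw [hG]
    exact (hsF.tsum_comm)
  have h3 := Finset.HasAntidiagonal.sigmaAntidiagonalEquivProd.tsum_eq (fun z : ℕ × ℕ => F z.1 z.2)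
  have h4 := ((Finset.HasAntidiagonal.sigmaAntidiagonalEquivProd.summable_iff).2 hsF).tsum_sigma
  rw [e1, FormalMultilinearSeries.sum, ← h3]
  refine h4.trans (tsum_congr fun q => ?_)
  rw [derivSeries_const, ← Finset.Nat.sum_antidiagonal_eq_sum_range_succ (fun p k => F p k)]
  rw [tsum_fintype, Finset.univ_eq_attach]
  exact Finset.sum_attach (Finset.HasAntidiagonal.antidiagonal q) fun z : ℕ × ℕ => F z.1 z.2

end DerivSeries

/-! ## The chronological exponential -/

/-! ### Simplices of ordered times -/

section OrderedTimes

theorem orderedTimes_subset (t₁ t₂ : ℝ) (j : ℕ) :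
    orderedTimes t₁ t₂ j ⊆ univ.pi fun _ => Ioo (min t₁ t₂) (max t₁ t₂) := by
  intro τ hτ i _
  unfold orderedTimes at hτ
  split_ifs at hτ with h
  · rw [min_eq_left h, max_eq_right h]; exact hτ.2 i
  · rw [min_eq_right (not_le.1 h).le, max_eq_left (not_le.1 h).le]; exact hτ.2 i

theorem orderedTimes_mem_uIcc {t₁ t₂ : ℝ} {j : ℕ} {τ : Fin j → ℝ} (hτ : τ ∈ orderedTimes t₁ t₂ j)
    (i : Fin j) : τ i ∈ uIcc t₁ t₂ :=
  Ioo_subset_Icc_self (orderedTimes_subset t₁ t₂ j hτ i (mem_univ i))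

theorem measurableSet_orderedTimes (t₁ t₂ : ℝ) (j : ℕ) : MeasurableSet (orderedTimes t₁ t₂ j) := by
  have h1 : ∀ a b : ℝ, MeasurableSet {τ : Fin j → ℝ | ∀ i, τ i ∈ Ioo a b} := fun a b => by
    simp only [ofPred_forall]
    exact MeasurableSet.iInter fun i => measurableSet_Ioo.preimage (measurable_pi_apply i)
  unfold orderedTimes
  split_ifs
  · refine MeasurableSet.inter ?_ (h1 _ _)
    have e : {τ : Fin j → ℝ | StrictMono τ} = ⋂ i, ⋂ k, ⋂ (_ : i < k), {τ | τ i < τ k} := by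
      ext τ; simp [StrictMono]
    change MeasurableSet {τ : Fin j → ℝ | StrictMono τ}
    rw [e]
    exact MeasurableSet.iInter fun i => MeasurableSet.iInter fun k => MeasurableSet.iInter fun _ =>
      measurableSet_lt (measurable_pi_apply i) (measurable_pi_apply k)
  · refine MeasurableSet.inter ?_ (h1 _ _)
    have e : {τ : Fin j → ℝ | StrictAnti τ} = ⋂ i, ⋂ k, ⋂ (_ : i < k), {τ | τ k < τ i} := by
      ext τ; simp [StrictAnti]
    change MeasurableSet {τ : Fin j → ℝ | StrictAnti τ}
    rw [e]
    exact MeasurableSet.iInter fun i => MeasurableSet.iInter fun k => MeasurableSet.iInter fun _ =>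
      measurableSet_lt (measurable_pi_apply k) (measurable_pi_apply i)

/-- A strictly monotone enumeration is determined by its range, so a tuple has at most one ordered
rearrangement: the permuted simplices are disjoint. The decreasing case follows by changing signs.
-/
theorem eq_of_comp_mem_orderedTimes {t₁ t₂ : ℝ} {j : ℕ} {τ : Fin j → ℝ} {σ σ' : Equiv.Perm (Fin j)}
    (h : τ ∘ σ ∈ orderedTimes t₁ t₂ j) (h' : τ ∘ σ' ∈ orderedTimes t₁ t₂ j) : σ = σ' := by
  have hr : ∀ (g : Fin j → ℝ), range (g ∘ σ) = range (g ∘ σ') := fun g => by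
    rw [σ.surjective.range_comp, σ'.surjective.range_comp]
  unfold orderedTimes at h h'
  split_ifs at h h'
  · have e := (StrictMono.range_inj h.1 h'.1).1 (hr τ)
    ext1 i
    have : τ ∘ σ = τ ∘ σ' := e
    have hi : Function.Injective τ := by
      have := h.1.injective
      rwa [← σ.injective_comp]
    exact hi (congrFun this i)
  · have e := (StrictMono.range_inj (f := (fun i => - τ i) ∘ σ) (g := (fun i => - τ i) ∘ σ')
      (fun i k hik => neg_lt_neg (h.1 hik)) (fun i k hik => neg_lt_neg (h'.1 hik))).1 (hr _)
    ext1 i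
    have hi : Function.Injective τ := by
      have := h.1.injective
      rwa [← σ.injective_comp]
    exact hi (neg_injective (congrFun e i))

theorem volume_orderedTimes_lt_top (t₁ t₂ : ℝ) (j : ℕ) :
    volume (orderedTimes t₁ t₂ j) < ⊤ := by
  refine (measure_mono (orderedTimes_subset t₁ t₂ j)).trans_lt ?_
  rw [Real.volume_pi_Ioo]
  exact ENNReal.prod_lt_top fun _ _ => ENNReal.ofReal_lt_top

/-- The `j!` images of the simplex under permutations of the coordinates are disjoint, have the same
volume, and lie in a cube of side `|t₂ - t₁|`. -/
theorem volume_orderedTimes_le (t₁ t₂ : ℝ) (j : ℕ) :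
    (volume (orderedTimes t₁ t₂ j)).toReal ≤ |t₂ - t₁| ^ j / j.factorial := by
  set A : Equiv.Perm (Fin j) → Set (Fin j → ℝ) := fun σ =>
    (fun τ => τ ∘ σ) ⁻¹' orderedTimes t₁ t₂ j with hA
  have hmp : ∀ σ : Equiv.Perm (Fin j),
      MeasurePreserving (fun τ : Fin j → ℝ => τ ∘ σ) volume volume := by
    intro σ
    have := volume_measurePreserving_piCongrLeft (fun _ : Fin j => ℝ) σ.symm
    convert this using 1
    funext τ i
    simp [MeasurableEquiv.piCongrLeft, Equiv.piCongrLeft, Equiv.piCongrLeft']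
  have hv : ∀ σ, volume (A σ) = volume (orderedTimes t₁ t₂ j) := fun σ =>
    (hmp σ).measure_preimage (measurableSet_orderedTimes t₁ t₂ j).nullMeasurableSet
  have hd : Pairwise (Function.onFun Disjoint A) := by
    intro σ σ' hne
    refine Set.disjoint_left.2 fun τ h h' => hne ?_
    exact eq_of_comp_mem_orderedTimes h h'
  have hm : ∀ σ, MeasurableSet (A σ) := fun σ =>
    (measurableSet_orderedTimes t₁ t₂ j).preimage (hmp σ).measurable
  have hsub : ⋃ σ, A σ ⊆ univ.pi fun _ => Ioo (min t₁ t₂) (max t₁ t₂) := by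
    intro τ hτ i _
    obtain ⟨σ, hσ⟩ := mem_iUnion.1 hτ
    simpa using orderedTimes_subset t₁ t₂ j hσ (σ.symm i) (mem_univ _)
  have h1 := measure_mono (μ := volume) hsub
  rw [measure_iUnion hd hm, tsum_fintype, Finset.sum_congr rfl fun σ _ => hv σ,
    Real.volume_pi_Ioo] at h1
  simp only [max_sub_min_eq_abs, Finset.prod_const, Finset.sum_const, Finset.card_univ,
    Fintype.card_perm, Fintype.card_fin, nsmul_eq_mul] at h1
  have h2 := ENNReal.toReal_mono (by finiteness) h1
  rw [ENNReal.toReal_mul, ENNReal.toReal_pow, ENNReal.toReal_ofReal (abs_nonneg _),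
    ENNReal.toReal_natCast] at h2
  rw [le_div_iff₀ (by positivity)]
  linarith

/-- The last of the ordered times, or `t₁` if there are none. -/
def lastTime (t₁ : ℝ) : (j : ℕ) → (Fin j → ℝ) → ℝ
  | 0, _ => t₁
  | _ + 1, τ => τ (Fin.last _)

theorem continuous_lastTime (t₁ : ℝ) (j : ℕ) : Continuous (lastTime t₁ j) := by
  cases j with
  | zero => exact continuous_const
  | succ j => exact continuous_apply (Fin.last j)

theorem strictMono_snoc_iff {j : ℕ} (t₁ : ℝ) (τ : Fin j → ℝ) (t : ℝ) (h0 : ∀ i, t₁ < τ i) :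
    StrictMono (Fin.snoc (α := fun _ => ℝ) τ t : Fin (j + 1) → ℝ) ∧ t₁ < t ↔
      StrictMono τ ∧ lastTime t₁ j τ < t := by
  constructor
  · rintro ⟨h, h1⟩
    refine ⟨fun i k hik => ?_, ?_⟩
    · have := h (Fin.castSucc_lt_castSucc_iff.2 hik)
      simpa using this
    · cases j with
      | zero => exact h1
      | succ j =>
        have := h (Fin.castSucc_lt_last (Fin.last j))
        simpa [lastTime] using this
  · rintro ⟨h, h1⟩
    have hk : ∀ i, τ i < t := by
      intro i
      cases j with
      | zero => exact i.elim0
      | succ j => exact (h.monotone (Fin.le_last i)).trans_lt h1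
    refine ⟨?_, ?_⟩
    · intro i k hik
      induction k using Fin.lastCases with
      | last =>
        obtain ⟨i, rfl⟩ := Fin.exists_castSucc_eq.2 hik.ne
        simpa using hk i
      | cast k =>
        obtain ⟨i, rfl⟩ := Fin.exists_castSucc_eq.2 (hik.trans (Fin.castSucc_lt_last k)).ne
        simpa using h (Fin.castSucc_lt_castSucc_iff.1 hik)
    · cases j with
      | zero => exact h1
      | succ j => exact (h0 (Fin.last j)).trans h1

/-- The simplex of dimension `j + 1` fibres over that of dimension `j`, the new time running between
the previous last time and `t₂`. The convention that `lastTime` is `t₁` for `j = 0`, and the use of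
min and max, let one statement cover the empty tuple and both orientations. -/
theorem snoc_mem_orderedTimes {t₁ t₂ : ℝ} {j : ℕ} {τ : Fin j → ℝ} {t : ℝ} :
    (Fin.snoc (α := fun _ => ℝ) τ t : Fin (j + 1) → ℝ) ∈ orderedTimes t₁ t₂ (j + 1) ↔
      τ ∈ orderedTimes t₁ t₂ j ∧
        t ∈ Ioo (min (lastTime t₁ j τ) t₂) (max (lastTime t₁ j τ) t₂) := by
  have hl : ∀ t₁ t₂ : ℝ, t₁ ≤ t₂ → ∀ τ : Fin j → ℝ, ∀ t : ℝ,
      (StrictMono (Fin.snoc (α := fun _ => ℝ) τ t : Fin (j + 1) → ℝ) ∧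
        ∀ i, (Fin.snoc (α := fun _ => ℝ) τ t : Fin (j + 1) → ℝ) i ∈ Ioo t₁ t₂) ↔
      (StrictMono τ ∧ ∀ i, τ i ∈ Ioo t₁ t₂) ∧ lastTime t₁ j τ < t ∧ t < t₂ := by
    intro t₁ t₂ _ τ t
    rw [Fin.forall_fin_succ']
    simp only [Fin.snoc_castSucc, Fin.snoc_last]
    constructor
    · rintro ⟨h1, h2, h3⟩
      have := (strictMono_snoc_iff t₁ τ t fun i => (h2 i).1).1 ⟨h1, h3.1⟩
      exact ⟨⟨this.1, h2⟩, this.2, h3.2⟩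
    · rintro ⟨⟨h1, h2⟩, h3, h4⟩
      have := (strictMono_snoc_iff t₁ τ t fun i => (h2 i).1).2 ⟨h1, h3⟩
      exact ⟨this.1, h2, this.2, h4⟩
  by_cases h : t₁ ≤ t₂
  · simp only [orderedTimes, if_pos h, mem_ofPred_eq]
    rw [hl t₁ t₂ h]
    refine and_congr_right fun hτ => ?_
    have : lastTime t₁ j τ ≤ t₂ := by
      cases j with
      | zero => exact h
      | succ j => exact (hτ.2 _).2.le
    rw [min_eq_left this, max_eq_right this, mem_Ioo]
  · simp only [orderedTimes, if_neg h, mem_ofPred_eq]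
    -- Changing the sign of all times reduces the decreasing case to the increasing one.
    have hneg : ∀ {k : ℕ} (σ : Fin k → ℝ), (StrictAnti σ ∧ ∀ i, σ i ∈ Ioo t₂ t₁) ↔
        (StrictMono (fun i => -σ i) ∧ ∀ i, -σ i ∈ Ioo (-t₁) (-t₂)) := by
      intro k σ
      refine and_congr ⟨fun h i k hik => neg_lt_neg (h hik), fun h i k hik => ?_⟩ ?_
      · exact neg_lt_neg_iff.1 (h hik)
      · refine forall_congr' fun i => ?_
        simp only [mem_Ioo, neg_lt_neg_iff]
        exact and_comm
    have e : (fun i => -(Fin.snoc (α := fun _ => ℝ) τ t : Fin (j + 1) → ℝ) i) =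
        Fin.snoc (α := fun _ => ℝ) (fun i => -τ i) (-t) := by
      funext i
      induction i using Fin.lastCases with
      | last => simp
      | cast i => simp
    have el : lastTime (-t₁) j (fun i => -τ i) = - lastTime t₁ j τ := by
      cases j <;> rfl
    have h' := (not_le.1 h)
    have := hl (-t₁) (-t₂) (by linarith) (fun i => -τ i) (-t)
    rw [← e] at this
    rw [hneg, hneg τ]
    refine this.trans (and_congr_right fun hτ => ?_)
    rw [el]
    have : t₂ ≤ lastTime t₁ j τ := by
      cases j with
      | zero => exact h'.le
      | succ j => exact (neg_lt_neg_iff.1 (hτ.2 _).2).le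
    rw [min_eq_right this, max_eq_left this, mem_Ioo, neg_lt_neg_iff, neg_lt_neg_iff]
    exact and_comm

end OrderedTimes

/-! ### Power series, bounds and continuity of the iterated derivatives -/

section ChronExp

variable {X : Type} [NormedAddCommGroup X] [NormedSpace ℝ X]

/-- The series of the functional `V_{τ_j}· ⋯ V_{τ_1}· f`, for the vector fields with the series
`W τ`. -/
def iteratedSeries (W : ℝ → FormalMultilinearSeries ℝ X X) (f : FormalMultilinearSeries ℝ X ℝ) :
    (j : ℕ) → (Fin j → ℝ) → FormalMultilinearSeries ℝ X ℝ
  | 0, _ => f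
  | j + 1, τ => derivSeries (W (τ (Fin.last j))) (iteratedSeries W f j (Fin.init τ))

/-- The majorant of `iteratedSeries`. -/
def iteratedMajorant (v b : ℕ → ℝ) : ℕ → ℕ → ℝ
  | 0 => b
  | j + 1 => derivMajorant v (iteratedMajorant v b j)

theorem iteratedMajorant_nonneg {v b : ℕ → ℝ} (hv : ∀ k, 0 ≤ v k) (hb : ∀ p, 0 ≤ b p) (j q : ℕ) :
    0 ≤ iteratedMajorant v b j q := by
  induction j generalizing q with
  | zero => exact hb q
  | succ j ih => exact derivMajorant_nonneg hv ih q

theorem norm_iteratedSeries_le {W : ℝ → FormalMultilinearSeries ℝ X X}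
    {f : FormalMultilinearSeries ℝ X ℝ} {v b : ℕ → ℝ} (hW : ∀ t k, ‖W t k‖ ≤ v k)
    (hf : ∀ p, ‖f p‖ ≤ b p) (j : ℕ) (τ : Fin j → ℝ) (q : ℕ) :
    ‖iteratedSeries W f j τ q‖ ≤ iteratedMajorant v b j q := by
  induction j generalizing q with
  | zero => exact hf q
  | succ j ih => exact norm_derivSeries_le (hW _) (ih _) q

theorem iteratedSeries_symm (W : ℝ → FormalMultilinearSeries ℝ X X)
    {f : FormalMultilinearSeries ℝ X ℝ} (hf : SymmSeries f) (j : ℕ) (τ : Fin j → ℝ) :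
    SymmSeries (iteratedSeries W f j τ) := by
  cases j with
  | zero => exact hf
  | succ j => exact derivSeries_symm _ _

/-- Each of the `j` derivations uses up a width `δ` of the radius and costs a factor `K / δ`, where
`K = ∑ v k r₀ ^ k`. The condition `ρ + j δ ≤ r₀` says that the total width is available. -/
theorem summable_iteratedMajorant {v b : ℕ → ℝ} (hv : ∀ k, 0 ≤ v k) (hb : ∀ p, 0 ≤ b p)
    {r₀ δ : ℝ} (hδ : 0 < δ) (hsb : Summable fun p => b p * r₀ ^ p)
    (hsv : Summable fun k => v k * r₀ ^ k) (j : ℕ) {ρ : ℝ} (hρ : 0 ≤ ρ) (h : ρ + j * δ ≤ r₀) :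
    Summable (fun q => iteratedMajorant v b j q * ρ ^ q) ∧
      ∑' q, iteratedMajorant v b j q * ρ ^ q ≤
        (∑' p, b p * r₀ ^ p) * ((∑' k, v k * r₀ ^ k) / δ) ^ j := by
  have mono : ∀ {c : ℕ → ℝ}, (∀ k, 0 ≤ c k) → (Summable fun k => c k * r₀ ^ k) →
      ∀ {ρ : ℝ}, 0 ≤ ρ → ρ ≤ r₀ → (Summable fun k => c k * ρ ^ k) ∧
        ∑' k, c k * ρ ^ k ≤ ∑' k, c k * r₀ ^ k := by
    intro c hc hs ρ hρ h
    have hle : ∀ k, c k * ρ ^ k ≤ c k * r₀ ^ k := fun k => by have := hc k; gcongr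
    have hs' := hs.of_nonneg_of_le (fun k => by have := hc k; positivity) hle
    exact ⟨hs', hs'.tsum_le_tsum hle hs⟩
  induction j generalizing ρ with
  | zero =>
    have := mono hb hsb hρ (by simpa using h)
    simpa [iteratedMajorant] using this
  | succ j ih =>
    push_cast at h
    obtain ⟨h1, h2⟩ := ih (ρ := ρ + δ) (by linarith) (by linarith)
    have hjδ : 0 ≤ (j : ℝ) * δ := by positivity
    obtain ⟨hv1, hv2⟩ := mono hv hsv hρ (by linarith)
    obtain ⟨h3, h4⟩ := summable_derivMajorant hv (iteratedMajorant_nonneg hv hb j) hρ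
      (by linarith : ρ < ρ + δ) h1 hv1
    refine ⟨h3, h4.trans ?_⟩
    have hb0 : 0 ≤ ∑' p, b p * r₀ ^ p := tsum_nonneg fun p => by
      have := hb p
      have : 0 ≤ r₀ := by linarith
      positivity
    have hv0 : 0 ≤ ∑' k, v k * ρ ^ k := tsum_nonneg fun k => by have := hv k; positivity
    rw [add_sub_cancel_left, pow_succ, ← mul_assoc, div_mul_eq_mul_div, mul_div_assoc]
    have hv3 := hv0.trans hv2
    have hpos : 0 ≤ (∑' p, b p * r₀ ^ p) * ((∑' k, v k * r₀ ^ k) / δ) ^ j := by positivity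
    gcongr

/-- A bounded family of multilinear maps is equicontinuous on bounded sets, so continuity in the
parameter for fixed arguments implies joint continuity. This form is chosen because the linear
evolution is continuous in time on vectors, and no continuity in operator norm is used. -/
theorem continuous_apply_of_equibounded {T : Type*} [TopologicalSpace T] {p : ℕ}
    {F : Type*} [NormedAddCommGroup F] [NormedSpace ℝ F]
    {a : T → ContinuousMultilinearMap ℝ (fun _ : Fin p => X) F} {b : ℝ} (hb : ∀ t, ‖a t‖ ≤ b)
    (ha : ∀ x, Continuous fun t => a t x) {y : T → Fin p → X} (hy : Continuous y) :
    Continuous fun t => a t (y t) := by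
  refine continuous_iff_continuousAt.2 fun t₀ => ?_
  have h1 : Tendsto (fun t => a t (y t) - a t (y t₀)) (𝓝 t₀) (𝓝 0) := by
    have h2 : Tendsto (fun t => b * p * max ‖y t‖ ‖y t₀‖ ^ (p - 1) * ‖y t - y t₀‖) (𝓝 t₀)
        (𝓝 (b * p * max ‖y t₀‖ ‖y t₀‖ ^ (p - 1) * ‖y t₀ - y t₀‖)) := by
      refine ContinuousAt.tendsto (f := fun t =>
        b * p * max ‖y t‖ ‖y t₀‖ ^ (p - 1) * ‖y t - y t₀‖) ?_
      fun_prop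
    rw [sub_self, norm_zero, mul_zero] at h2
    refine squeeze_zero_norm (fun t => ?_) h2
    have := (a t).norm_image_sub_le (y t) (y t₀)
    rw [Fintype.card_fin] at this
    refine this.trans ?_
    gcongr
    exact hb t
  have h3 := h1.add ((ha (y t₀)).tendsto t₀)
  simpa [ContinuousAt] using h3

theorem continuous_iteratedSeries {W : ℝ → FormalMultilinearSeries ℝ X X}
    {f : FormalMultilinearSeries ℝ X ℝ} {v : ℕ → ℝ} (hW : ∀ t k, ‖W t k‖ ≤ v k)
    (hc : ∀ k x, Continuous fun t => W t k x) (j q : ℕ) (x : Fin q → X) :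
    Continuous fun τ : Fin j → ℝ => iteratedSeries W f j τ q x := by
  induction j generalizing q with
  | zero => exact (continuous_const : Continuous fun _ : Fin 0 → ℝ => f q x)
  | succ j ih =>
    simp only [iteratedSeries, derivSeries_apply]
    refine Continuous.mul continuous_const (continuous_finsetSum _ fun σ _ =>
      continuous_finsetSum _ fun p _ => Continuous.mul continuous_const ?_)
    have hinit : Continuous fun τ : Fin (j + 1) → ℝ => (Fin.init τ : Fin j → ℝ) := by
      unfold Fin.init
      fun_prop
    refine continuous_apply_of_equibounded (T := Fin (j + 1) → ℝ)
      (a := fun τ => iteratedSeries W f j (Fin.init τ) (p + 1))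
      (b := iteratedMajorant v (fun p => ‖f p‖) j (p + 1))
      (fun τ => norm_iteratedSeries_le hW (fun _ => le_rfl) j _ _)
      (fun x => (ih (p + 1) x).comp hinit) ?_
    refine continuous_pi fun i => ?_
    induction i using Fin.lastCases with
    | last =>
      simp only [Fin.snoc_last]
      exact (hc _ _).comp (continuous_apply (Fin.last j))
    | cast i => simpa using continuous_const

theorem continuous_sum_iteratedSeries {W : ℝ → FormalMultilinearSeries ℝ X X}
    {f : FormalMultilinearSeries ℝ X ℝ} {v : ℕ → ℝ} (hW : ∀ t k, ‖W t k‖ ≤ v k)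
    (hc : ∀ k x, Continuous fun t => W t k x) (j : ℕ) {ρ : ℝ}
    (hs : Summable fun q => iteratedMajorant v (fun p => ‖f p‖) j q * ρ ^ q)
    {T : Type*} [TopologicalSpace T] {τ : T → Fin j → ℝ} (hτ : Continuous τ) {x : T → X}
    (hx : Continuous x) (hxρ : ∀ t, ‖x t‖ ≤ ρ) :
    Continuous fun t => (iteratedSeries W f j (τ t)).sum (x t) := by
  refine continuous_tsum (fun q => ?_) hs fun q t => ?_
  · exact continuous_apply_of_equibounded
      (a := fun t => iteratedSeries W f j (τ t) q)
      (fun t => norm_iteratedSeries_le hW (fun _ => le_rfl) j _ _)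
      (fun y => (continuous_iteratedSeries hW hc j q y).comp hτ) (continuous_pi fun _ => hx)
  · exact norm_apply_const_le _ (norm_iteratedSeries_le hW (fun _ => le_rfl) j _ _) (hxρ t)

/-- `V·` is defined by line derivatives of functions. Near each point of the ball the function is
the sum of a convergent symmetric series, and its derivative along `V` is then the sum of
`derivSeries`. -/
theorem iteratedOp_eq {V : ℝ → X → X} {W : ℝ → FormalMultilinearSeries ℝ X X}
    {f : FormalMultilinearSeries ℝ X ℝ} {v : ℕ → ℝ} {S : Set ℝ} {r₀ ρ : ℝ} (hρ : ρ < r₀)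
    (hW : ∀ t k, ‖W t k‖ ≤ v k)
    (hV : ∀ t ∈ S, ∀ x, ‖x‖ < r₀ → HasSum (fun k => W t k fun _ => x) (V t x))
    (hf : SymmSeries f) (hsf : Summable fun p => ‖f p‖ * r₀ ^ p)
    (hsv : Summable fun k => v k * r₀ ^ k) (j : ℕ) (τ : Fin j → ℝ) (hτ : ∀ i, τ i ∈ S) (x : X)
    (hx : ‖x‖ < ρ) : iteratedOp V f.sum j τ x = (iteratedSeries W f j τ).sum x := by
  have hρ0 : 0 ≤ ρ := (norm_nonneg x).trans hx.le
  have hv : ∀ k, 0 ≤ v k := fun k => (norm_nonneg _).trans (hW 0 k)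
  have mono : Summable fun k => v k * ρ ^ k :=
    hsv.of_nonneg_of_le (fun k => by have := hv k; positivity) fun k => by
      have := hv k; gcongr
  induction j generalizing x with
  | zero => rfl
  | succ j ih =>
    -- With this width, `j` derivations leave at least the radius `ρ`; only summability is used
    -- here, not the size of the bound.
    have hδ : 0 < (r₀ - ρ) / (j + 1) := by
      have : 0 < r₀ - ρ := by linarith
      positivity
    obtain ⟨hs, -⟩ := summable_iteratedMajorant hv (fun p => norm_nonneg (f p)) hδ hsf hsv j hρ0
      (by
        have : (j : ℝ) * ((r₀ - ρ) / (j + 1)) ≤ r₀ - ρ := by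
          rw [mul_div_assoc', div_le_iff₀ (by positivity)]
          nlinarith
        linarith)
    obtain ⟨a', h1, h2⟩ := hasFDerivAt_sum_derivSeries
      (iteratedSeries_symm W hf j (Fin.init τ)) (hW (τ (Fin.last j)))
      (norm_iteratedSeries_le hW (fun _ => le_rfl) j _) hs mono hx
      (hV _ (hτ _) x (hx.trans hρ))
    -- The line derivative at `x` depends on values near `x`, and the induction hypothesis holds on
    -- the whole open ball.
    have hev : iteratedOp V f.sum j (Fin.init τ) =ᶠ[𝓝 x]
        (iteratedSeries W f j (Fin.init τ)).sum := by
      have : Metric.ball (0 : X) ρ ∈ 𝓝 x := Metric.isOpen_ball.mem_nhds (by simpa using hx)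
      filter_upwards [this] with y hy
      exact ih _ (fun i => hτ _) y (by simpa using hy)
    change lineDeriv ℝ (iteratedOp V f.sum j (Fin.init τ)) x (V (τ (Fin.last j)) x) = _
    rw [hev.lineDeriv_eq, (h1.hasLineDerivAt _).lineDeriv, h2]
    rfl

/-- The orientation of the pair `(t₁, t₂)`. -/
def orient (t₁ t₂ : ℝ) : ℝ := if t₁ ≤ t₂ then 1 else -1

theorem chronTerm_eq (V : ℝ → X → X) (t₁ t₂ : ℝ) (f : X → ℝ) (j : ℕ) (x : X) :
    chronTerm V t₁ t₂ f j x =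
      orient t₁ t₂ ^ j * ∫ τ in orderedTimes t₁ t₂ j, iteratedOp V f j τ x := by
  unfold chronTerm orient
  split_ifs <;> simp

theorem abs_orient_pow (t₁ t₂ : ℝ) (j : ℕ) : |orient t₁ t₂ ^ j| = 1 := by
  unfold orient
  split_ifs <;> simp

theorem integrableOn_orderedTimes {t₁ t₂ : ℝ} {j : ℕ} {F : (Fin j → ℝ) → ℝ} (hF : Continuous F) :
    IntegrableOn F (orderedTimes t₁ t₂ j) := by
  have hK : IsCompact (univ.pi fun _ : Fin j => Icc (min t₁ t₂) (max t₁ t₂)) :=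
    isCompact_univ_pi fun _ => isCompact_Icc
  refine (hF.continuousOn.integrableOn_compact hK).mono_set ?_
  exact (orderedTimes_subset t₁ t₂ j).trans (pi_mono fun _ _ => Ioo_subset_Icc_self)

theorem norm_integral_orderedTimes_le {t₁ t₂ : ℝ} {j : ℕ} {F : (Fin j → ℝ) → ℝ} {c : ℝ}
    (hc : 0 ≤ c) (hF : ∀ τ, ‖F τ‖ ≤ c) :
    ‖∫ τ in orderedTimes t₁ t₂ j, F τ‖ ≤ c * (|t₂ - t₁| ^ j / j.factorial) := by
  refine (norm_setIntegral_le_of_norm_le_const (volume_orderedTimes_lt_top t₁ t₂ j)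
    fun τ _ => hF τ).trans ?_
  gcongr
  exact volume_orderedTimes_le t₁ t₂ j

/-- Fubini's theorem for the integral over the last of the ordered times. -/
theorem integral_orderedTimes_succ {t₁ t₂ : ℝ} {j : ℕ} {F : (Fin (j + 1) → ℝ) → ℝ}
    (hF : Continuous F) :
    ∫ τ in orderedTimes t₁ t₂ (j + 1), F τ = ∫ τ in orderedTimes t₁ t₂ j,
      orient t₁ t₂ * ∫ t in (lastTime t₁ j τ)..t₂, F (Fin.snoc (α := fun _ => ℝ) τ t) := by
  set e := MeasurableEquiv.piFinSuccAbove (fun _ : Fin (j + 1) => ℝ) (Fin.last j) with he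
  have hmp : MeasurePreserving e volume volume :=
    volume_preserving_piFinSuccAbove (fun _ : Fin (j + 1) => ℝ) (Fin.last j)
  have hes : ∀ z : ℝ × (Fin j → ℝ), e.symm z = Fin.snoc (α := fun _ => ℝ) z.2 z.1 := by
    intro z
    exact Fin.insertNth_last' z.1 z.2
  set O := orderedTimes t₁ t₂ (j + 1) with hO
  have hOm := measurableSet_orderedTimes t₁ t₂ (j + 1)
  have hint : Integrable (O.indicator F) :=
    (integrable_indicator_iff hOm).2 (integrableOn_orderedTimes hF)
  have h1 : ∫ τ in O, F τ = ∫ z : ℝ × (Fin j → ℝ), O.indicator F (e.symm z) := by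
    rw [← integral_indicator hOm]
    exact ((hmp.symm e).integral_comp e.symm.measurableEmbedding (O.indicator F)).symm
  have hint2 : Integrable (fun z : ℝ × (Fin j → ℝ) => O.indicator F (e.symm z)) :=
    ((hmp.symm e).integrable_comp_emb e.symm.measurableEmbedding).2 hint
  rw [h1, Measure.volume_eq_prod, integral_prod_symm _ hint2,
    ← integral_indicator (measurableSet_orderedTimes t₁ t₂ j)]
  refine integral_congr_ae (Eventually.of_forall fun τ => ?_)
  simp only [hes]
  by_cases hτ : τ ∈ orderedTimes t₁ t₂ j
  · rw [indicator_of_mem hτ]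
    have h2 : ∀ t, O.indicator F (Fin.snoc (α := fun _ => ℝ) τ t) =
        (Ioo (min (lastTime t₁ j τ) t₂) (max (lastTime t₁ j τ) t₂)).indicator
          (fun t => F (Fin.snoc (α := fun _ => ℝ) τ t)) t := by
      intro t
      by_cases ht : t ∈ Ioo (min (lastTime t₁ j τ) t₂) (max (lastTime t₁ j τ) t₂)
      · rw [indicator_of_mem ht, indicator_of_mem (snoc_mem_orderedTimes.2 ⟨hτ, ht⟩)]
      · rw [indicator_of_notMem ht,
          indicator_of_notMem fun h => ht (snoc_mem_orderedTimes.1 h).2]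
    simp_rw [h2]
    rw [integral_indicator measurableSet_Ioo, ← integral_Ioc_eq_integral_Ioo]
    -- The factor `orient` compensates the sign of the oriented integral from the last time to `t₂`,
    -- so that both sides are integrals over the set of times in between.
    unfold orient
    split_ifs with h
    · have hl : lastTime t₁ j τ ≤ t₂ := by
        cases j with
        | zero => exact h
        | succ j =>
          have := orderedTimes_subset _ _ _ hτ (Fin.last j) (mem_univ _)
          rw [max_eq_right h] at this
          exact this.2.le
      rw [min_eq_left hl, max_eq_right hl, intervalIntegral.integral_of_le hl, one_mul]
    · have hl : t₂ ≤ lastTime t₁ j τ := by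
        cases j with
        | zero => exact (not_le.1 h).le
        | succ j =>
          have := orderedTimes_subset _ _ _ hτ (Fin.last j) (mem_univ _)
          rw [min_eq_right (not_le.1 h).le] at this
          exact this.1.le
      rw [min_eq_right hl, max_eq_left hl, intervalIntegral.integral_of_ge hl, neg_one_mul, neg_neg]
  · rw [indicator_of_notMem hτ]
    refine integral_eq_zero_of_ae (Eventually.of_forall fun t => ?_)
    exact indicator_of_notMem (fun h => hτ (snoc_mem_orderedTimes.1 h).1) _

/-- The integral of a bounded, pointwise continuous family of multilinear forms. -/
def integralForm {j p : ℕ} (t₁ t₂ : ℝ)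
    (a : (Fin j → ℝ) → ContinuousMultilinearMap ℝ (fun _ : Fin p => X) ℝ) (b : ℝ)
    (hb : ∀ τ, ‖a τ‖ ≤ b) (ha : ∀ x, Continuous fun τ => a τ x) :
    ContinuousMultilinearMap ℝ (fun _ : Fin p => X) ℝ :=
  MultilinearMap.mkContinuous
    { toFun := fun x => orient t₁ t₂ ^ j * ∫ τ in orderedTimes t₁ t₂ j, a τ x
      map_update_add' := by
        intro _ x i y z
        simp only [ContinuousMultilinearMap.map_update_add]
        rw [integral_add (integrableOn_orderedTimes (ha _)) (integrableOn_orderedTimes (ha _)),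
          mul_add]
      map_update_smul' := by
        intro _ x i c y
        simp only [ContinuousMultilinearMap.map_update_smul]
        rw [integral_smul, mul_smul_comm] }
    (b * (|t₂ - t₁| ^ j / j.factorial)) fun x => by
      have hb0 : 0 ≤ b := (norm_nonneg _).trans (hb 0)
      have := norm_integral_orderedTimes_le (t₁ := t₁) (t₂ := t₂) (F := fun τ => a τ x)
        (c := b * ∏ i, ‖x i‖) (by positivity) fun τ => ((a τ).le_opNorm x).trans (by
          gcongr; exact hb τ)
      change ‖orient t₁ t₂ ^ j * ∫ τ in orderedTimes t₁ t₂ j, a τ x‖ ≤ _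
      rw [norm_mul, Real.norm_eq_abs (orient t₁ t₂ ^ j), abs_orient_pow, one_mul]
      refine this.trans (le_of_eq (by ring))

theorem integralForm_apply {j p : ℕ} (t₁ t₂ : ℝ)
    (a : (Fin j → ℝ) → ContinuousMultilinearMap ℝ (fun _ : Fin p => X) ℝ) (b : ℝ)
    (hb : ∀ τ, ‖a τ‖ ≤ b) (ha : ∀ x, Continuous fun τ => a τ x) (x : Fin p → X) :
    integralForm t₁ t₂ a b hb ha x = orient t₁ t₂ ^ j * ∫ τ in orderedTimes t₁ t₂ j, a τ x := rfl

theorem norm_integralForm_le {j p : ℕ} (t₁ t₂ : ℝ)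
    (a : (Fin j → ℝ) → ContinuousMultilinearMap ℝ (fun _ : Fin p => X) ℝ) (b : ℝ)
    (hb : ∀ τ, ‖a τ‖ ≤ b) (ha : ∀ x, Continuous fun τ => a τ x) :
    ‖integralForm t₁ t₂ a b hb ha‖ ≤ b * (|t₂ - t₁| ^ j / j.factorial) := by
  have hb0 : 0 ≤ b := (norm_nonneg _).trans (hb 0)
  exact MultilinearMap.mkContinuous_norm_le _ (by positivity) _

end ChronExp

/-! ### Convergence of the chronological exponential, and its value along integral curves -/

section ChronExpExists

variable {X : Type} [NormedAddCommGroup X] [NormedSpace ℝ X]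

/-- The width `r₀ - R` is divided into `j` equal steps, so that `j` derivations cost `(j K / (r₀ -
R)) ^ j`. The volume factor `T ^ j / j!` compensates this because `j ^ j / j! ≤ e ^ j`, and a
geometric bound remains. For `j = 0` there is nothing to divide. -/
theorem tsum_iteratedMajorant_le {v b : ℕ → ℝ} (hv : ∀ k, 0 ≤ v k) (hb : ∀ p, 0 ≤ b p)
    {r₀ R T : ℝ} (hR : 0 < R) (hRr : R < r₀) (hT : 0 ≤ T) (hsb : Summable fun p => b p * r₀ ^ p)
    (hsv : Summable fun k => v k * r₀ ^ k) (j : ℕ) :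
    Summable (fun q => iteratedMajorant v b j q * R ^ q) ∧
      (∑' q, iteratedMajorant v b j q * R ^ q) * (T ^ j / j.factorial) ≤
        (∑' p, b p * r₀ ^ p) * (T * (Real.exp 1 * ∑' k, v k * r₀ ^ k) / (r₀ - R)) ^ j := by
  have hd : 0 < r₀ - R := by linarith
  have h0 : 0 ≤ r₀ := by linarith
  set K := ∑' k, v k * r₀ ^ k with hK
  set C := ∑' p, b p * r₀ ^ p with hC
  have hK0 : 0 ≤ K := tsum_nonneg fun k => by have := hv k; positivity
  have hC0 : 0 ≤ C := tsum_nonneg fun k => by have := hb k; positivity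
  rcases Nat.eq_zero_or_pos j with rfl | hj
  · have := summable_iteratedMajorant hv hb hd hsb hsv 0 hR.le (by simpa using hRr.le)
    refine ⟨this.1, ?_⟩
    simpa using this.2
  · have hj' : (0 : ℝ) < j := by exact_mod_cast hj
    obtain ⟨h1, h2⟩ := summable_iteratedMajorant hv hb (δ := (r₀ - R) / j) (by positivity) hsb hsv j
      hR.le (by rw [mul_div_cancel₀ _ hj'.ne']; linarith)
    refine ⟨h1, ?_⟩
    calc _ ≤ C * (K / ((r₀ - R) / j)) ^ j * (T ^ j / j.factorial) := by gcongr
      _ = C * (T * K / (r₀ - R)) ^ j * ((j : ℝ) ^ j / j.factorial) := by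
        rw [div_div_eq_mul_div, mul_div_assoc', mul_div_assoc', mul_assoc, ← mul_pow]
        rw [mul_assoc, ← mul_pow]
        congr 3
        field_simp
      _ ≤ C * (T * K / (r₀ - R)) ^ j * (Real.exp 1) ^ j := by
        have := Real.pow_div_factorial_le_exp j hj'.le j
        rw [← Real.exp_one_pow] at this
        gcongr
      _ = _ := by
        rw [mul_assoc, ← mul_pow]
        congr 2
        ring

/-- The expansion of `f(Θ_{t₁})` along an integral curve of `-V`, with the remainder of order
`J`. -/
theorem sum_chronTerm_add_remainder {V : ℝ → X → X} {W : ℝ → FormalMultilinearSeries ℝ X X}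
    {f : FormalMultilinearSeries ℝ X ℝ} {v : ℕ → ℝ} {r₀ R t₁ t₂ : ℝ} (hR : 0 < R) (hRr : R < r₀)
    (hW : ∀ t k, ‖W t k‖ ≤ v k) (hc : ∀ k x, Continuous fun t => W t k x)
    (hV : ∀ t ∈ uIcc t₁ t₂, ∀ x, ‖x‖ < r₀ → HasSum (fun k => W t k fun _ => x) (V t x))
    (hf : SymmSeries f) (hsf : Summable fun p => ‖f p‖ * r₀ ^ p)
    (hsv : Summable fun k => v k * r₀ ^ k) {Θ : ℝ → X}
    (hΘR : ∀ t ∈ uIcc t₁ t₂, ‖Θ t‖ < R)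
    (hΘ : ∀ t ∈ uIcc t₁ t₂, HasDerivWithinAt Θ (-(V t (Θ t))) (uIcc t₁ t₂) t) (J : ℕ) :
    f.sum (Θ t₁) = ∑ j ∈ Finset.range J, chronTerm V t₁ t₂ f.sum j (Θ t₂) +
      orient t₁ t₂ ^ J * ∫ τ in orderedTimes t₁ t₂ J,
        (iteratedSeries W f J τ).sum (Θ (lastTime t₁ J τ)) := by
  have hv : ∀ k, 0 ≤ v k := fun k => (norm_nonneg _).trans (hW 0 k)
  have hM : ∀ j, Summable fun q => iteratedMajorant v (fun p => ‖f p‖) j q * R ^ q := fun j =>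
    (tsum_iteratedMajorant_le hv (fun p => norm_nonneg (f p)) hR hRr le_rfl hsf hsv j).1
  -- a continuous extension of the curve
  set cl : ℝ → ℝ := fun t => max (min t₁ t₂) (min t (max t₁ t₂)) with hcl
  have hclm : ∀ t, cl t ∈ uIcc t₁ t₂ := fun t =>
    ⟨le_max_left _ _, max_le (min_le_max) (min_le_right _ _)⟩
  have hcle : ∀ t ∈ uIcc t₁ t₂, cl t = t := fun t ht => by
    simp only [hcl]
    rw [min_eq_left ht.2, max_eq_right ht.1]
  have hΘc : Continuous (Θ ∘ cl) := by
    have h1 : ContinuousOn Θ (uIcc t₁ t₂) := fun t ht => (hΘ t ht).continuousWithinAt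
    exact h1.comp_continuous (by fun_prop) hclm
  have hΘcR : ∀ t, ‖(Θ ∘ cl) t‖ ≤ R := fun t => (hΘR _ (hclm t)).le
  have hlast : ∀ j, ∀ τ ∈ orderedTimes t₁ t₂ j, lastTime t₁ j τ ∈ uIcc t₁ t₂ := by
    intro j τ hτ
    cases j with
    | zero => exact left_mem_uIcc
    | succ j => exact orderedTimes_mem_uIcc hτ _
  have ht₂ : t₂ ∈ uIcc t₁ t₂ := right_mem_uIcc
  induction J with
  | zero =>
    have hO : orderedTimes t₁ t₂ 0 = univ := by
      unfold orderedTimes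
      split_ifs
      · exact eq_univ_of_forall fun τ => ⟨fun i => i.elim0, fun i => i.elim0⟩
      · exact eq_univ_of_forall fun τ => ⟨fun i => i.elim0, fun i => i.elim0⟩
    have hu : (volume : Measure (Fin 0 → ℝ)) univ = 1 := by
      rw [volume_pi, Measure.pi_univ]
      simp
    simp [hO, iteratedSeries, lastTime, Measure.real, hu]
  | succ J ih =>
    rw [ih, Finset.sum_range_succ, add_assoc]
    congr 1
    rw [chronTerm_eq]
    have hF : Continuous fun τ : Fin (J + 1) → ℝ =>
        (iteratedSeries W f (J + 1) τ).sum ((Θ ∘ cl) (lastTime t₁ (J + 1) τ)) :=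
      continuous_sum_iteratedSeries hW hc (J + 1) (hM _) continuous_id
        (hΘc.comp (continuous_lastTime t₁ (J + 1))) fun _ => hΘcR _
    have e1 : ∫ τ in orderedTimes t₁ t₂ (J + 1),
        (iteratedSeries W f (J + 1) τ).sum (Θ (lastTime t₁ (J + 1) τ)) =
        ∫ τ in orderedTimes t₁ t₂ (J + 1),
        (iteratedSeries W f (J + 1) τ).sum ((Θ ∘ cl) (lastTime t₁ (J + 1) τ)) := by
      refine setIntegral_congr_fun (measurableSet_orderedTimes _ _ _) fun τ hτ => ?_
      simp only [Function.comp, hcle _ (hlast _ τ hτ)]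
    have e2 : ∫ τ in orderedTimes t₁ t₂ J, iteratedOp V f.sum J τ (Θ t₂) =
        ∫ τ in orderedTimes t₁ t₂ J, (iteratedSeries W f J τ).sum (Θ t₂) := by
      refine setIntegral_congr_fun (measurableSet_orderedTimes _ _ _) fun τ hτ => ?_
      exact iteratedOp_eq hRr hW hV hf hsf hsv J τ (fun i => orderedTimes_mem_uIcc hτ i) _
        (hΘR _ ht₂)
    rw [e1, e2, integral_orderedTimes_succ hF, integral_const_mul, pow_succ, mul_assoc,
      ← mul_assoc (orient t₁ t₂) (orient t₁ t₂)]
    have hoo : orient t₁ t₂ * orient t₁ t₂ = 1 := by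
      unfold orient
      split_ifs <;> norm_num
    rw [hoo, one_mul, ← mul_add]
    congr 1
    have hcont1 : Continuous fun τ : Fin J → ℝ => (iteratedSeries W f J τ).sum (Θ t₂) :=
      continuous_sum_iteratedSeries hW hc J (hM _) continuous_id continuous_const
        fun _ => (hΘR _ ht₂).le
    have hsnoc : ∀ τ : Fin J → ℝ,
        Continuous fun t : ℝ => (Fin.snoc (α := fun _ => ℝ) τ t : Fin (J + 1) → ℝ) := by
      intro τ
      refine continuous_pi fun i => ?_
      induction i using Fin.lastCases with
      | last => simpa using continuous_id'
      | cast i => simpa using continuous_const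
    -- Let `F` be the functional of order `J`. As `Θ' = -V(Θ)`, the function `t ↦ F (Θ t)` has the
    -- derivative `-(V_t · F)(Θ t)`. Integrating from the last time to `t₂` gives the value at `Θ
    -- t₂`, which enters the term of order `J`, plus an integral which enters the next remainder.
    have key : ∀ τ ∈ orderedTimes t₁ t₂ J,
        (iteratedSeries W f J τ).sum (Θ (lastTime t₁ J τ)) =
          (iteratedSeries W f J τ).sum (Θ t₂) + ∫ t in (lastTime t₁ J τ)..t₂,
            (iteratedSeries W f (J + 1) (Fin.snoc (α := fun _ => ℝ) τ t)).sum
              ((Θ ∘ cl) (lastTime t₁ (J + 1) (Fin.snoc (α := fun _ => ℝ) τ t))) := by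
      intro τ hτ
      have hl := hlast J τ hτ
      have hsub : uIcc (lastTime t₁ J τ) t₂ ⊆ uIcc t₁ t₂ := uIcc_subset_uIcc hl ht₂
      have hsub' : Ioo (min (lastTime t₁ J τ) t₂) (max (lastTime t₁ J τ) t₂) ⊆
          Ioo (min t₁ t₂) (max t₁ t₂) := by
        refine Ioo_subset_Ioo ?_ ?_
        · exact (hsub (⟨le_rfl, min_le_max⟩ : min (lastTime t₁ J τ) t₂ ∈ uIcc (lastTime t₁ J τ) t₂)).1
        · exact (hsub (⟨min_le_max, le_rfl⟩ : max (lastTime t₁ J τ) t₂ ∈ uIcc (lastTime t₁ J τ) t₂)).2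
      have hcG : Continuous fun t => (iteratedSeries W f J τ).sum ((Θ ∘ cl) t) :=
        continuous_sum_iteratedSeries hW hc J (hM _) continuous_const hΘc hΘcR
      have hcI : Continuous fun t =>
          (iteratedSeries W f (J + 1) (Fin.snoc (α := fun _ => ℝ) τ t)).sum
              ((Θ ∘ cl) (lastTime t₁ (J + 1) (Fin.snoc (α := fun _ => ℝ) τ t))) :=
        hF.comp (hsnoc τ)
      have hftc := intervalIntegral.integral_eq_sub_of_hasDeriv_right
        (f := fun t => -(iteratedSeries W f J τ).sum ((Θ ∘ cl) t)) (a := lastTime t₁ J τ) (b := t₂)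
        hcG.neg.continuousOn (fun t ht => ?_) (hcI.intervalIntegrable _ _)
      · rw [hftc]
        simp only [Function.comp, hcle _ hl, hcle _ ht₂]
        ring
      · have htI := hsub' ht
        have htm : t ∈ uIcc t₁ t₂ := Ioo_subset_Icc_self htI
        have hΘt : HasDerivAt (Θ ∘ cl) (-(V t (Θ t))) t := by
          have hnhds : uIcc t₁ t₂ ∈ 𝓝 t := Icc_mem_nhds htI.1 htI.2
          refine ((hΘ t htm).hasDerivAt hnhds).congr_of_eventuallyEq ?_
          filter_upwards [hnhds] with y hy
          simp only [Function.comp, hcle y hy]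
        have hx : ‖Θ t‖ < R := hΘR t htm
        obtain ⟨a', h1, h2⟩ := hasFDerivAt_sum_derivSeries (iteratedSeries_symm W hf J τ) (hW t)
          (norm_iteratedSeries_le hW (fun _ => le_rfl) J τ) (hM J)
          (hsv.of_nonneg_of_le (fun k => by have := hv k; positivity) fun k => by
            have := hv k; gcongr) hx (hV t htm _ (hx.trans hRr))
        have hct : (Θ ∘ cl) t = Θ t := by simp only [Function.comp, hcle t htm]
        rw [← hct] at h1
        have h3 := (h1.comp_hasDerivAt t hΘt).neg
        rw [map_neg, neg_neg, h2] at h3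
        refine HasDerivAt.hasDerivWithinAt ?_
        have e3 : (Θ ∘ cl) (lastTime t₁ (J + 1) (Fin.snoc (α := fun _ => ℝ) τ t)) = Θ t := by
          rw [show lastTime t₁ (J + 1) (Fin.snoc (α := fun _ => ℝ) τ t) = t from
            Fin.snoc_last (α := fun _ => ℝ) t τ, hct]
        have e4 : iteratedSeries W f (J + 1) (Fin.snoc (α := fun _ => ℝ) τ t) =
            derivSeries (W t) (iteratedSeries W f J τ) := by
          rw [iteratedSeries, Fin.snoc_last (α := fun _ => ℝ), Fin.init_snoc (α := fun _ => ℝ)]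
        rw [e3, e4]
        exact h3
    -- By `key`, the inner integral is a difference of two continuous functions of `τ` on the
    -- simplex, so its integrability needs no study of integrals with parameters.
    have hFτ : IntegrableOn (fun τ : Fin J → ℝ => ∫ t in (lastTime t₁ J τ)..t₂,
        (iteratedSeries W f (J + 1) (Fin.snoc (α := fun _ => ℝ) τ t)).sum
          ((Θ ∘ cl) (lastTime t₁ (J + 1) (Fin.snoc (α := fun _ => ℝ) τ t))))
        (orderedTimes t₁ t₂ J) := by
      have hcont2 : Continuous fun τ : Fin J → ℝ =>
          (iteratedSeries W f J τ).sum ((Θ ∘ cl) (lastTime t₁ J τ)) :=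
        continuous_sum_iteratedSeries hW hc J (hM _) continuous_id
          (hΘc.comp (continuous_lastTime t₁ J)) fun _ => hΘcR _
      refine ((integrableOn_orderedTimes hcont2).sub (integrableOn_orderedTimes hcont1)).congr_fun
        (fun τ hτ => ?_) (measurableSet_orderedTimes _ _ _)
      have := key τ hτ
      change (iteratedSeries W f J τ).sum ((Θ ∘ cl) (lastTime t₁ J τ)) -
        (iteratedSeries W f J τ).sum (Θ t₂) = _
      have h4 : (Θ ∘ cl) (lastTime t₁ J τ) = Θ (lastTime t₁ J τ) := by
        simp only [Function.comp, hcle _ (hlast J τ hτ)]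
      rw [h4, this]
      ring
    rw [← integral_add (integrableOn_orderedTimes hcont1) hFτ]
    exact setIntegral_congr_fun (measurableSet_orderedTimes _ _ _) key

/-- The chronological exponential of a time dependent analytic vector field exists for short
times, and describes the flow of the opposite vector field. -/
theorem exists_isChronExp {V : ℝ → X → X} {W : ℝ → FormalMultilinearSeries ℝ X X}
    {f : FormalMultilinearSeries ℝ X ℝ} {v : ℕ → ℝ} {r₀ R t₁ t₂ : ℝ} (hR : 0 < R) (hRr : R < r₀)
    (hW : ∀ t k, ‖W t k‖ ≤ v k) (hc : ∀ k x, Continuous fun t => W t k x)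
    (hV : ∀ t ∈ uIcc t₁ t₂, ∀ x, ‖x‖ < r₀ → HasSum (fun k => W t k fun _ => x) (V t x))
    (hf : SymmSeries f) (hsf : Summable fun p => ‖f p‖ * r₀ ^ p)
    (hsv : Summable fun k => v k * r₀ ^ k)
    (hsmall : |t₂ - t₁| * (Real.exp 1 * ∑' k, v k * r₀ ^ k) < r₀ - R) :
    ∃ g, IsChronExp V t₁ t₂ f R g ∧ ∀ Θ : ℝ → X, (∀ t ∈ uIcc t₁ t₂, ‖Θ t‖ < R) →
      (∀ t ∈ uIcc t₁ t₂, HasDerivWithinAt Θ (-(V t (Θ t))) (uIcc t₁ t₂) t) →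
        g.sum (Θ t₂) = f.sum (Θ t₁) := by
  have hd : 0 < r₀ - R := by linarith
  have hv : ∀ k, 0 ≤ v k := fun k => (norm_nonneg _).trans (hW 0 k)
  have hb : ∀ p, 0 ≤ ‖f p‖ := fun p => norm_nonneg _
  have hr0 : 0 ≤ r₀ := by linarith
  set K := ∑' k, v k * r₀ ^ k with hK
  set C := ∑' p, ‖f p‖ * r₀ ^ p with hC
  have hK0 : 0 ≤ K := tsum_nonneg fun k => by have := hv k; positivity
  have hC0 : 0 ≤ C := tsum_nonneg fun k => by positivity
  -- The ratio of the geometric series that dominates the expansion.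
  set θ := |t₂ - t₁| * (Real.exp 1 * K) / (r₀ - R) with hθ
  have hθ0 : 0 ≤ θ := by positivity
  have hθ1 : θ < 1 := by rw [hθ, div_lt_one hd]; exact hsmall
  set M := iteratedMajorant v (fun p => ‖f p‖) with hMdef
  have hM0 : ∀ j q, 0 ≤ M j q := iteratedMajorant_nonneg hv hb
  set w : ℕ → ℝ := fun j => |t₂ - t₁| ^ j / j.factorial with hw
  have hw0 : ∀ j, 0 ≤ w j := fun j => by positivity
  have hM : ∀ j, Summable (fun q => M j q * R ^ q) ∧ (∑' q, M j q * R ^ q) * w j ≤ C * θ ^ j :=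
    fun j => tsum_iteratedMajorant_le hv hb hR hRr (abs_nonneg _) hsf hsv j
  have hA : ∀ j τ p, ‖iteratedSeries W f j τ p‖ ≤ M j p := fun j τ p =>
    norm_iteratedSeries_le hW (fun _ => le_rfl) j τ p
  let T : ℕ → FormalMultilinearSeries ℝ X ℝ := fun j p =>
    integralForm t₁ t₂ (fun τ => iteratedSeries W f j τ p) (M j p) (fun τ => hA j τ p)
      (continuous_iteratedSeries hW hc j p)
  have hTn : ∀ j p, ‖T j p‖ * R ^ p ≤ M j p * R ^ p * w j := fun j p => by
    have : ‖T j p‖ ≤ M j p * w j := norm_integralForm_le _ _ _ _ _ _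
    calc _ ≤ M j p * w j * R ^ p := by gcongr
      _ = _ := by ring
  have hTs : ∀ j, Summable fun p => ‖T j p‖ * R ^ p := fun j =>
    ((hM j).1.mul_right (w j)).of_nonneg_of_le (fun p => by positivity) (hTn j)
  have hTt : ∀ j, ∑' p, ‖T j p‖ * R ^ p ≤ C * θ ^ j := fun j => by
    refine ((hTs j).tsum_le_tsum (hTn j) ((hM j).1.mul_right (w j))).trans ?_
    rw [tsum_mul_right]
    exact (hM j).2
  have hTθ : Summable fun j => ∑' p, ‖T j p‖ * R ^ p :=
    ((summable_geometric_of_lt_one hθ0 hθ1).mul_left C).of_nonneg_of_le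
      (fun j => tsum_nonneg fun p => by positivity) hTt
  -- Summability over the orders `j` and the degrees `p` jointly permits the interchanges that
  -- follow: the forms `T j p` can be added over `j` for each `p`, the resulting series lies in
  -- `𝔽_R`, and its sum is the sum of the chronological terms.
  have hT2 : Summable fun z : ℕ × ℕ => ‖T z.1 z.2‖ * R ^ z.2 :=
    (summable_prod_of_nonneg fun z => by positivity).2 ⟨hTs, hTθ⟩
  have hT2' : Summable fun z : ℕ × ℕ => ‖T z.2 z.1‖ * R ^ z.1 :=
    ((Equiv.prodComm ℕ ℕ).summable_iff (f := fun z : ℕ × ℕ => ‖T z.1 z.2‖ * R ^ z.2)).2 hT2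
  have hTj : ∀ p, Summable fun j => ‖T j p‖ := fun p => by
    have := (hT2'.prod_factor p).mul_right ((R ^ p)⁻¹)
    refine this.congr fun j => ?_
    have : R ^ p ≠ 0 := by positivity
    field_simp
  have hTsymm : ∀ j, SymmSeries (T j) := fun j p σ x => by
    simp only [T, integralForm_apply]
    congr 1
    refine integral_congr_ae (Eventually.of_forall fun τ => ?_)
    exact iteratedSeries_symm W hf j τ p σ x
  let g : FormalMultilinearSeries ℝ X ℝ := fun p => ∑' j, T j p
  have hg : ∀ p, HasSum (fun j => T j p) (g p) := fun p => (hTj p).of_norm.hasSum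
  have hgv : ∀ p x, HasSum (fun j => T j p x) (g p x) := fun p x =>
    (hg p).mapL (ContinuousMultilinearMap.apply ℝ (fun _ : Fin p => X) ℝ x)
  have hgn : ∀ p, ‖g p‖ * R ^ p ≤ ∑' j, ‖T j p‖ * R ^ p := fun p => by
    rw [tsum_mul_right]
    have := norm_tsum_le_tsum_norm (hTj p)
    gcongr
  have hgmem : MemFunctionals R g := by
    refine ⟨fun p σ x => ?_, ?_⟩
    · refine (hgv p (x ∘ σ)).unique ?_
      simp only [hTsymm _ p σ x]
      exact hgv p x
    · exact (hT2'.prod).of_nonneg_of_le (fun p => by positivity) hgn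
  have hop : ∀ j, ∀ τ ∈ orderedTimes t₁ t₂ j, ∀ x, ‖x‖ < R →
      iteratedOp V f.sum j τ x = (iteratedSeries W f j τ).sum x := fun j τ hτ x hx =>
    iteratedOp_eq hRr hW hV hf hsf hsv j τ (fun i => orderedTimes_mem_uIcc hτ i) x hx
  have hcs : ∀ j x, ‖x‖ < R → Continuous fun τ => (iteratedSeries W f j τ).sum x := fun j x hx =>
    continuous_sum_iteratedSeries hW hc j (hM j).1 continuous_id continuous_const fun _ => hx.le
  have hTsum : ∀ j x, ‖x‖ < R → (T j).sum x = chronTerm V t₁ t₂ f.sum j x := by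
    intro j x hx
    rw [chronTerm_eq, setIntegral_congr_fun (measurableSet_orderedTimes _ _ _)
      (fun τ hτ => hop j τ hτ x hx)]
    have h1 : ∀ p, Integrable (fun τ => iteratedSeries W f j τ p fun _ => x)
        (volume.restrict (orderedTimes t₁ t₂ j)) := fun p =>
      integrableOn_orderedTimes (continuous_iteratedSeries hW hc j p _)
    have h2 := hasSum_integral_of_summable_integral_norm h1 ?_
    · exact (h2.mul_left (orient t₁ t₂ ^ j)).tsum_eq
    · refine ((hM j).1.mul_right (w j)).of_nonneg_of_le
        (fun p => integral_nonneg fun _ => norm_nonneg _) fun p => ?_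
      refine (le_abs_self _).trans ?_
      have := hM0 j p
      refine norm_integral_orderedTimes_le (by positivity) fun τ => ?_
      rw [norm_norm]
      exact norm_apply_const_le _ (hA j τ p) hx.le
  refine ⟨g, ⟨?_, ?_, ⟨T, fun j => ⟨hTsymm j, hTs j⟩, hTsum, hTθ, hg⟩, hgmem⟩, ?_⟩
  · intro j τ hτ
    refine ⟨iteratedSeries W f j τ, ⟨iteratedSeries_symm W hf j τ, ?_⟩, hop j τ hτ⟩
    exact (hM j).1.of_nonneg_of_le (fun p => by positivity) fun p => by
      have := hA j τ p; gcongr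
  · intro j x hx
    exact (integrableOn_orderedTimes (hcs j x hx)).congr_fun (fun τ hτ => (hop j τ hτ x hx).symm)
      (measurableSet_orderedTimes _ _ _)
  · intro Θ hΘR hΘ
    have ht₂ := hΘR t₂ right_mem_uIcc
    have hgs : HasSum (fun j => chronTerm V t₁ t₂ f.sum j (Θ t₂)) (g.sum (Θ t₂)) := by
      have hbd : ∀ z : ℕ × ℕ, ‖T z.1 z.2 fun _ => Θ t₂‖ ≤ ‖T z.1 z.2‖ * R ^ z.2 := fun z =>
        norm_apply_const_le _ le_rfl ht₂.le
      have hs := Summable.of_norm_bounded hT2 hbd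
      have e : g.sum (Θ t₂) = ∑' j, chronTerm V t₁ t₂ f.sum j (Θ t₂) := by
        simp only [← hTsum _ _ ht₂, FormalMultilinearSeries.sum]
        simp only [← (hgv _ _).tsum_eq]
        exact (hs.tsum_comm)
      rw [e]
      refine Summable.hasSum (Summable.of_norm_bounded hTθ fun j => ?_)
      rw [← hTsum _ _ ht₂]
      refine (norm_tsum_le_tsum_norm ?_).trans (Summable.tsum_le_tsum (fun p => hbd (j, p)) ?_ (hTs j))
      · exact (hTs j).of_nonneg_of_le (fun _ => norm_nonneg _) fun p => hbd (j, p)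
      · exact (hTs j).of_nonneg_of_le (fun _ => norm_nonneg _) fun p => hbd (j, p)
    refine tendsto_nhds_unique hgs.tendsto_sum_nat ?_
    -- The remainder of order `J` obeys the same bound `C θ ^ J` as the term of order `J`, since the
    -- curve stays in the ball of radius `R`.
    have hrem : Tendsto (fun J => f.sum (Θ t₁) - ∑ j ∈ Finset.range J,
        chronTerm V t₁ t₂ f.sum j (Θ t₂)) atTop (𝓝 0) := by
      have hz : Tendsto (fun J : ℕ => C * θ ^ J) atTop (𝓝 0) := by
        simpa using (tendsto_pow_atTop_nhds_zero_of_lt_one hθ0 hθ1).const_mul C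
      refine squeeze_zero_norm (fun J => ?_) hz
      rw [sum_chronTerm_add_remainder hR hRr hW hc hV hf hsf hsv hΘR hΘ J, add_sub_cancel_left,
        norm_mul, Real.norm_eq_abs (orient t₁ t₂ ^ J), abs_orient_pow, one_mul]
      refine le_trans ?_ (hM J).2
      refine (norm_setIntegral_le_of_norm_le_const (volume_orderedTimes_lt_top t₁ t₂ J)
        (C := ∑' q, M J q * R ^ q) fun τ hτ => ?_).trans ?_
      · have hl : ‖Θ (lastTime t₁ J τ)‖ ≤ R := by
          cases J with
          | zero => exact (hΘR _ left_mem_uIcc).le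
          | succ J => exact (hΘR _ (orderedTimes_mem_uIcc hτ _)).le
        exact tsum_of_norm_bounded (hM J).1.hasSum fun q =>
          norm_apply_const_le _ (hA J τ q) hl
      · have : 0 ≤ ∑' q, M J q * R ^ q := tsum_nonneg fun q => by
          have := hM0 J q; positivity
        gcongr
        exact volume_orderedTimes_le t₁ t₂ J
    have := hrem.const_sub (f.sum (Θ t₁))
    simpa using this

end ChronExpExists

/-! ## Fourier transforms of distributions which are functions -/

section Weights

variable {n : ℕ} {m : ℝ} [hm : Fact (0 < m)]

theorem japanese_base_pos (ζ : Space n) : 0 < m ^ 2 + ‖(2 * Real.pi) • ζ‖ ^ 2 := by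
  have := hm.out
  positivity

theorem japanese_pos (s : ℝ) (ζ : Space n) : 0 < japanese n m s ζ :=
  Real.rpow_pos_of_pos (japanese_base_pos ζ) _

theorem japanese_add (s s' : ℝ) (ζ : Space n) :
    japanese n m (s + s') ζ = japanese n m s ζ * japanese n m s' ζ := by
  rw [japanese, add_div, Real.rpow_add (japanese_base_pos ζ)]
  rfl

theorem japanese_sub (s s' : ℝ) (ζ : Space n) :
    japanese n m (s - s') ζ = japanese n m s ζ / japanese n m s' ζ := by
  rw [japanese, sub_div, Real.rpow_sub (japanese_base_pos ζ)]
  rfl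

omit hm in
theorem japanese_zero (ζ : Space n) : japanese n m 0 ζ = 1 := by
  simp [japanese]

theorem continuous_japanese (s : ℝ) : Continuous (japanese n m s) := by
  unfold japanese
  exact Continuous.rpow_const (by fun_prop) fun ζ => Or.inl (japanese_base_pos ζ).ne'

theorem japanese_le_of_le {s s' : ℝ} (h : s' ≤ s) :
    ∃ C, 0 ≤ C ∧ ∀ ζ : Space n, japanese n m s' ζ ≤ C * japanese n m s ζ := by
  have hm0 := hm.out
  refine ⟨(m ^ 2) ^ ((s' - s) / 2), by positivity, fun ζ => ?_⟩
  have e : japanese n m s' ζ = japanese n m (s' - s) ζ * japanese n m s ζ := by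
    rw [← japanese_add]; congr 1; ring
  rw [e]
  have := japanese_pos (m := m) s ζ
  refine mul_le_mul_of_nonneg_right ?_ this.le
  refine Real.rpow_le_rpow_of_nonpos (by positivity) ?_ (by linarith)
  nlinarith [sq_nonneg ‖(2 * Real.pi) • ζ‖]

theorem sobWeight_pos (s : ℝ) (ζ : Space n) : 0 < sobWeight n m s ζ :=
  mul_pos (by positivity) (japanese_pos s ζ)

theorem continuous_sobWeight (s : ℝ) : Continuous (sobWeight n m s) :=
  continuous_const.mul (continuous_japanese s)

theorem sobWeight_mul_japanese (s s' : ℝ) (ζ : Space n) :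
    sobWeight n m s ζ * japanese n m (s' - s) ζ = sobWeight n m s' ζ := by
  rw [sobWeight, mul_assoc, ← japanese_add]
  simp [sobWeight]

end Weights

/-! ### Complex conjugation and the Fourier transform -/

section FourierConj

variable {n : ℕ}

theorem conj_fourier (f : Space n → ℂ) (x : Space n) :
    starRingEnd ℂ (𝓕 f x) = 𝓕 (fun ζ => starRingEnd ℂ (f (-ζ))) x := by
  rw [Real.fourier_eq', Real.fourier_eq', ← integral_conj, ← integral_neg_eq_self]
  refine integral_congr_ae (Eventually.of_forall fun v => ?_)
  simp [smul_eq_mul, ← Complex.exp_conj, Complex.conj_ofNat]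

/-- On the Fourier side, real test functions are those with Hermitian symmetry; this is how reality
of distributions is read off from their transforms. -/
theorem conj_fourierInv_of_real {h : SchwartzMap (Space n) ℂ} (hh : ∀ x, (h x).im = 0)
    (ζ : Space n) : starRingEnd ℂ ((𝓕⁻ h) ζ) = (𝓕⁻ h) (-ζ) := by
  have e : (fun x => starRingEnd ℂ (h x)) = h := funext fun x => Complex.conj_eq_iff_im.2 (hh x)
  rw [SchwartzMap.fourierInv_coe, Real.fourierInv_eq_fourier_neg, Real.fourierInv_eq_fourier_neg,
    conj_fourier, neg_neg, Real.fourier_eq', Real.fourier_eq', ← integral_neg_eq_self]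
  refine integral_congr_ae (Eventually.of_forall fun v => ?_)
  have := congrFun e v
  simp only [neg_neg] at this ⊢
  rw [this]
  simp

end FourierConj

/-- The Fourier transform of the distribution `T` is the function `F`. -/
def HasHat {n : ℕ} (T : Distr n) (F : Space n → ℂ) : Prop :=
  ∀ h : SchwartzMap (Space n) ℂ, Integrable (fun ζ => F ζ * (𝓕⁻ h) ζ) ∧
    T h = ∫ ζ, F ζ * (𝓕⁻ h) ζ

namespace HasHat

variable {n : ℕ} {T T' : Distr n} {F F' : Space n → ℂ}

theorem congr (h : HasHat T F) (e : F =ᵐ[volume] F') : HasHat T F' := by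
  intro k
  have e2 : (fun ζ => F ζ * (𝓕⁻ k) ζ) =ᵐ[volume] fun ζ => F' ζ * (𝓕⁻ k) ζ := by
    filter_upwards [e] with ζ hζ
    rw [hζ]
  exact ⟨(h k).1.congr e2, (h k).2.trans (integral_congr_ae e2)⟩

theorem unique (h : HasHat T F) (h' : HasHat T' F) : T = T' := by
  ext k
  rw [(h k).2, (h' k).2]

theorem add (h : HasHat T F) (h' : HasHat T' F') : HasHat (T + T') (F + F') := by
  intro k
  have e : (fun ζ => (F + F') ζ * (𝓕⁻ k) ζ) =
      fun ζ => F ζ * (𝓕⁻ k) ζ + F' ζ * (𝓕⁻ k) ζ := by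
    funext ζ
    simp [add_mul]
  rw [e]
  refine ⟨(h k).1.add (h' k).1, ?_⟩
  rw [integral_add (h k).1 (h' k).1, ← (h k).2, ← (h' k).2]
  simp

theorem zero : HasHat (0 : Distr n) 0 := by
  intro k
  simp

theorem sum {ι : Type*} {S : Finset ι} {T : ι → Distr n} {F : ι → Space n → ℂ}
    (h : ∀ i ∈ S, HasHat (T i) (F i)) : HasHat (∑ i ∈ S, T i) (∑ i ∈ S, F i) := by
  classical
  induction S using Finset.induction_on with
  | empty => simpa using zero
  | insert i S hi ih =>
    rw [Finset.sum_insert hi, Finset.sum_insert hi]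
    exact (h i (Finset.mem_insert_self i S)).add
      (ih fun j hj => h j (Finset.mem_insert_of_mem hj))

theorem smul (c : ℝ) (h : HasHat T F) : HasHat (c • T) (fun ζ => (c : ℂ) * F ζ) := by
  intro k
  have e : (fun ζ => (c : ℂ) * F ζ * (𝓕⁻ k) ζ) = fun ζ => (c : ℂ) * (F ζ * (𝓕⁻ k) ζ) := by
    funext ζ
    ring
  rw [e]
  refine ⟨(h k).1.const_mul _, ?_⟩
  rw [integral_const_mul, ← (h k).2]
  simp

/-- The derivative is transposed to the test function; the minus sign of the transposition cancels
the one in the inverse Fourier transform of a derivative. Here `ξ = 2π ζ`. -/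
theorem partialD (h : HasHat T F) (j : Fin n) :
    HasHat (partialD j T) fun ζ => (Complex.I * (((2 * Real.pi) • ζ) j : ℝ)) * F ζ := by
  intro k
  have e1 : _root_.partialD j T = LineDeriv.lineDerivOp (EuclideanSpace.single j (1 : ℝ)) T := rfl
  have hin : Function.HasTemperateGrowth
      fun x : Space n => inner ℝ x (EuclideanSpace.single j (1 : ℝ)) := by fun_prop
  have e2 : ∀ ζ, (𝓕⁻ (-LineDeriv.lineDerivOp (EuclideanSpace.single j (1 : ℝ)) k)) ζ =
      (Complex.I * (((2 * Real.pi) • ζ) j : ℝ)) * (𝓕⁻ k) ζ := by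
    intro ζ
    rw [FourierTransform.fourierInv_neg, SchwartzMap.fourierInv_lineDerivOp_eq]
    simp only [neg_smul, neg_neg, smul_apply,
      SchwartzMap.smulLeftCLM_apply_apply hin]
    rw [EuclideanSpace.inner_single_right]
    simp
    ring
  have e3 : (fun ζ => (Complex.I * (((2 * Real.pi) • ζ) j : ℝ)) * F ζ * (𝓕⁻ k) ζ) =
      fun ζ => F ζ * (𝓕⁻ (-LineDeriv.lineDerivOp (EuclideanSpace.single j (1 : ℝ)) k)) ζ := by
    funext ζ
    rw [e2]
    ring
  rw [e3, e1, TemperedDistribution.lineDerivOp_apply_apply]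
  exact h _

theorem partialD_pow (h : HasHat T F) (j : Fin n) (a : ℕ) :
    HasHat ((_root_.partialD j ^ a) T)
      fun ζ => (Complex.I * (((2 * Real.pi) • ζ) j : ℝ)) ^ a * F ζ := by
  induction a with
  | zero => simpa using h
  | succ a ih =>
    rw [pow_succ', Module.End.mul_apply]
    convert ih.partialD j using 2
    ring

theorem prod_partialD (h : HasHat T F) (a : Fin n → ℕ) (l : List (Fin n)) :
    HasHat ((l.map fun j => _root_.partialD j ^ a j).prod T)
      fun ζ => (l.map fun j => (Complex.I * (((2 * Real.pi) • ζ) j : ℝ)) ^ a j).prod * F ζ := by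
  induction l with
  | nil => simpa using h
  | cons j l ih =>
    simp only [List.map_cons, List.prod_cons, Module.End.mul_apply]
    convert ih.partialD_pow j (a j) using 2
    ring

theorem polyD (h : HasHat T F) (p : MvPolynomial (Fin n) ℝ) :
    HasHat (polyD p T) fun ζ =>
      MvPolynomial.aeval (fun j => Complex.I * (((2 * Real.pi) • ζ) j : ℂ)) p * F ζ := by
  have := HasHat.sum (S := p.support) (T := fun a => p.coeff a •
    ((List.finRange n).map fun j => _root_.partialD j ^ a j).prod T) fun a _ =>
      (h.prod_partialD a (List.finRange n)).smul (p.coeff a)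
  rw [_root_.polyD]
  simp only [LinearMap.sum_apply, LinearMap.smul_apply]
  convert this using 1
  funext ζ
  rw [MvPolynomial.aeval_def, MvPolynomial.eval₂_eq', Finset.sum_apply, Finset.sum_mul]
  refine Finset.sum_congr rfl fun a _ => ?_
  rw [← List.ofFn_eq_map, List.prod_ofFn]
  simp [mul_assoc]

end HasHat

/-! ## Sobolev spaces through their Fourier transforms -/

section SobHat

variable {n : ℕ} {m : ℝ} [hm : Fact (0 < m)]

theorem ofReal_sobWeight_ne_zero (s : ℝ) (ζ : Space n) : (sobWeight n m s ζ : ℂ) ≠ 0 :=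
  Complex.ofReal_ne_zero.2 (sobWeight_pos s ζ).ne'

theorem sobWeight_mul_neg (s : ℝ) (ζ : Space n) :
    sobWeight n m s ζ * sobWeight n m (-s) ζ =
      ((2 * Real.pi) ^ ((n : ℝ) / 2)) ^ 2 := by
  have : japanese n m s ζ * japanese n m (-s) ζ = 1 := by
    rw [← japanese_add, add_neg_cancel, japanese_zero]
  rw [sobWeight, sobWeight]
  linear_combination ((2 * Real.pi) ^ ((n : ℝ) / 2)) ^ 2 * this

theorem inv_sobWeight_temperate (s : ℝ) :
    Function.HasTemperateGrowth fun ζ : Space n => ((sobWeight n m s ζ : ℂ))⁻¹ := by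
  have e : (fun ζ : Space n => ((sobWeight n m s ζ : ℂ))⁻¹) =
      (fun _ => (((((2 * Real.pi) ^ ((n : ℝ) / 2)) ^ 2)⁻¹ : ℝ) : ℂ)) *
        fun ζ : Space n => (sobWeight n m (-s) ζ : ℂ) := by
    funext ζ
    simp only [Pi.mul_apply]
    rw [← sobWeight_mul_neg (m := m) s ζ, ← Complex.ofReal_mul, ← Complex.ofReal_inv]
    congr 1
    have h1 := (sobWeight_pos (m := m) s ζ).ne'
    have h2 := (sobWeight_pos (m := m) (-s) ζ).ne'
    field_simp
  rw [e]
  exact (Function.HasTemperateGrowth.const _).mul (sobWeight_temperate n m (-s))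

/-- The weight is moved to the test function, where division by it is harmless because the
reciprocal weight has temperate growth. The integral converges as that of a product of two `L²`
functions. -/
theorem HasSobSymbol.hasHat {s : ℝ} {T : Distr n} {g : Lp ℂ 2 (volume : Measure (Space n))}
    (hg : HasSobSymbol m s T g) : HasHat T fun ζ => g ζ / sobWeight n m s ζ := by
  intro h
  set k : SchwartzMap (Space n) ℂ :=
    SchwartzMap.smulLeftCLM ℂ (fun ζ : Space n => ((sobWeight n m s ζ : ℂ))⁻¹) (𝓕⁻ h) with hk
  have hk1 : ∀ ζ, k ζ = ((sobWeight n m s ζ : ℂ))⁻¹ * (𝓕⁻ h) ζ := fun ζ => by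
    rw [hk, SchwartzMap.smulLeftCLM_apply_apply (inv_sobWeight_temperate s), smul_eq_mul]
  have hk2 : SchwartzMap.smulLeftCLM ℂ (fun ζ : Space n => (sobWeight n m s ζ : ℂ)) k = 𝓕⁻ h := by
    ext ζ
    rw [SchwartzMap.smulLeftCLM_apply_apply (sobWeight_temperate n m s), hk1, smul_eq_mul,
      mul_inv_cancel_left₀ (ofReal_sobWeight_ne_zero s ζ)]
  have e : (fun ζ => g ζ / sobWeight n m s ζ * (𝓕⁻ h) ζ) = fun ζ => k ζ • g ζ := by
    funext ζ
    rw [hk1, smul_eq_mul]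
    ring
  rw [e]
  have h1 := congrArg (fun S : Distr n => S k) hg
  simp only [TemperedDistribution.smulLeftCLM_apply_apply, hk2,
    TemperedDistribution.fourier_apply, Lp.toTemperedDistribution_apply] at h1
  rw [FourierTransform.fourier_fourierInv_eq] at h1
  refine ⟨?_, h1⟩
  have h2 : Integrable (⇑k * ⇑g) := (k.memLp 2).integrable_mul (Lp.memLp g)
  exact h2

/-- A complex valued function with the Hermitian symmetry of the Fourier transforms of real
functions. -/
def HermSymm (F : Space n → ℂ) : Prop := ∀ᵐ ζ, F (-ζ) = starRingEnd ℂ (F ζ)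

/-- The distribution with the Fourier transform `F`, where `⟨ξ⟩^s F` is the `L²` function `g`. -/
theorem exists_hasSobSymbol (s : ℝ) (g : Lp ℂ 2 (volume : Measure (Space n))) :
    ∃ T : Distr n, HasSobSymbol m s T g := by
  refine ⟨𝓕⁻ (TemperedDistribution.smulLeftCLM ℂ
    (fun ζ : Space n => ((sobWeight n m s ζ : ℂ))⁻¹) (Lp.toTemperedDistribution g)), ?_⟩
  unfold HasSobSymbol
  rw [FourierTransform.fourier_fourierInv_eq,
    TemperedDistribution.smulLeftCLM_smulLeftCLM_apply (inv_sobWeight_temperate s)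
      (sobWeight_temperate n m s)]
  have e : ((fun ζ : Space n => ((sobWeight n m s ζ : ℂ))⁻¹) *
      fun ζ : Space n => (sobWeight n m s ζ : ℂ)) = fun _ => 1 := by
    funext ζ
    simp [inv_mul_cancel₀ (ofReal_sobWeight_ne_zero (m := m) s ζ)]
  rw [e, TemperedDistribution.smulLeftCLM_const, one_smul]

theorem HasHat.isRealDistr {T : Distr n} {F : Space n → ℂ} (h : HasHat T F) (hF : HermSymm F) :
    IsRealDistr T := by
  intro k hk
  rw [← Complex.conj_eq_iff_im, (h k).2, ← integral_conj, ← integral_neg_eq_self]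
  refine integral_congr_ae ?_
  filter_upwards [hF] with ζ hζ
  rw [hζ, map_mul, Complex.conj_conj, conj_fourierInv_of_real hk, neg_neg]

/-- If `T` is real, then `F` has real integrals against functions with Hermitian symmetry. Such
functions are built from an arbitrary real `g` and its reflection, and show that `F(-ζ)` and the
conjugate of `F(ζ)` have the same integral against `g`. -/
theorem HasHat.hermSymm {T : Distr n} {F : Space n → ℂ} (h : HasHat T F)
    (hF : LocallyIntegrable F volume) (hT : IsRealDistr T) : HermSymm F := by
  have hFn : LocallyIntegrable (fun ζ => F (-ζ)) volume := by
    have hF' := locallyIntegrable_iff.1 hF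
    rw [locallyIntegrable_iff]
    intro K hK
    have hp := Measure.measurePreserving_neg (volume : Measure (Space n))
    have := (hp.integrableOn_comp_preimage (Homeomorph.neg (Space n)).measurableEmbedding
      (f := F) (s := -K)).2 (hF' (-K) hK.neg)
    simpa [Function.comp_def] using this
  -- the distribution at the Fourier transforms of symmetric test functions is real
  have key : ∀ k : SchwartzMap (Space n) ℂ, (∀ ζ, k (-ζ) = starRingEnd ℂ (k ζ)) →
      (∫ ζ, F ζ * k ζ).im = 0 := by
    intro k hk
    have h1 := (h (𝓕 k)).2
    rw [FourierTransform.fourierInv_fourier_eq] at h1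
    rw [← h1]
    refine hT _ fun x => ?_
    have e : (fun ζ => starRingEnd ℂ (k (-ζ))) = k := by
      funext ζ
      rw [hk, Complex.conj_conj]
    rw [← Complex.conj_eq_iff_im, SchwartzMap.fourier_coe, conj_fourier, e]
  have hint : ∀ g : Space n → ℝ, ContDiff ℝ ∞ g → HasCompactSupport g →
      Integrable (fun ζ => (g ζ : ℂ) * F ζ) ∧ Integrable (fun ζ => (g ζ : ℂ) * F (-ζ)) := by
    intro g hg hgc
    have hc : Continuous fun ζ => (g ζ : ℂ) := Complex.continuous_ofReal.comp hg.continuous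
    have hs : HasCompactSupport fun ζ => (g ζ : ℂ) := hgc.comp_left Complex.ofReal_zero
    refine ⟨?_, ?_⟩
    · exact hF.integrable_smul_left_of_hasCompactSupport hc hs
    · exact hFn.integrable_smul_left_of_hasCompactSupport hc hs
  have main : ∀ᵐ ζ, F (-ζ) - starRingEnd ℂ (F ζ) = 0 := by
    have hL : LocallyIntegrable (fun ζ => F (-ζ) - starRingEnd ℂ (F ζ)) volume := by
      refine hFn.sub ?_
      intro x
      obtain ⟨U, hU, hi⟩ := hF x
      exact ⟨U, hU, (LinearIsometryEquiv.integrable_comp_iff Complex.conjLIE).2 hi⟩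
    refine ae_eq_zero_of_integral_contDiff_smul_eq_zero hL fun g hg hgc => ?_
    have hgn : ContDiff ℝ ∞ fun ζ => g (-ζ) := hg.comp contDiff_neg
    have hgnc : HasCompactSupport fun ζ => g (-ζ) :=
      hgc.comp_homeomorph (Homeomorph.neg (Space n))
    obtain ⟨hi1, hi2⟩ := hint g hg hgc
    obtain ⟨hi3, hi4⟩ := hint _ hgn hgnc
    have hof : ContDiff ℝ ∞ (Complex.ofReal : ℝ → ℂ) := Complex.ofRealCLM.contDiff
    have hck : ∀ u : Space n → ℝ, HasCompactSupport u →
        HasCompactSupport fun ζ => (u ζ : ℂ) := fun u hu => hu.comp_left Complex.ofReal_zero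
    -- The symmetric combinations `g + g(-·)` and `i (g - g(-·))` yield the imaginary and the real
    -- part of the identity.
    set k₁ := HasCompactSupport.toSchwartzMap
      ((hck _ hgc).add (hck _ hgnc)) ((hof.comp hg).add (hof.comp hgn)) with hk₁
    have e₁ : ∀ ζ, k₁ ζ = (g ζ : ℂ) + g (-ζ) := fun ζ => rfl
    have r₁ := key k₁ fun ζ => by
      rw [e₁, e₁, neg_neg, map_add, Complex.conj_ofReal, Complex.conj_ofReal, add_comm]
    set k₂ := HasCompactSupport.toSchwartzMap
      (((hck _ hgc).sub (hck _ hgnc)).smul_left (f := fun _ => Complex.I))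
      (contDiff_const.smul ((hof.comp hg).sub (hof.comp hgn))) with hk₂
    have e₂ : ∀ ζ, k₂ ζ = Complex.I * ((g ζ : ℂ) - g (-ζ)) := fun ζ => rfl
    have r₂ := key k₂ fun ζ => by
      rw [e₂, e₂, neg_neg, map_mul, map_sub, Complex.conj_ofReal, Complex.conj_ofReal,
        Complex.conj_I]
      ring
    have hsw : ∫ ζ, (g (-ζ) : ℂ) * F ζ = ∫ ζ, (g ζ : ℂ) * F (-ζ) := by
      rw [← integral_neg_eq_self]
      simp
    have i₁ : ∫ ζ, F ζ * k₁ ζ = (∫ ζ, (g ζ : ℂ) * F ζ) + ∫ ζ, (g ζ : ℂ) * F (-ζ) := by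
      rw [← hsw, ← integral_add hi1 hi3]
      refine integral_congr_ae (Eventually.of_forall fun ζ => ?_)
      simp only [e₁]
      ring
    have i₂ : ∫ ζ, F ζ * k₂ ζ =
        Complex.I * ((∫ ζ, (g ζ : ℂ) * F ζ) - ∫ ζ, (g ζ : ℂ) * F (-ζ)) := by
      rw [← hsw, ← integral_sub hi1 hi3, ← integral_const_mul]
      refine integral_congr_ae (Eventually.of_forall fun ζ => ?_)
      simp only [e₂]
      ring
    rw [i₁, Complex.add_im] at r₁
    rw [i₂, Complex.mul_im] at r₂
    simp only [Complex.I_re, Complex.I_im, zero_mul, one_mul, zero_add, Complex.sub_re] at r₂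
    have hc : ∫ ζ, (g ζ : ℂ) * starRingEnd ℂ (F ζ) = starRingEnd ℂ (∫ ζ, (g ζ : ℂ) * F ζ) := by
      rw [← integral_conj]
      simp
    have hi5 : Integrable fun ζ => (g ζ : ℂ) * starRingEnd ℂ (F ζ) := by
      have := (LinearIsometryEquiv.integrable_comp_iff Complex.conjLIE).2 hi1
      refine this.congr (Eventually.of_forall fun ζ => ?_)
      simp
    have e3 : (fun ζ => g ζ • (F (-ζ) - starRingEnd ℂ (F ζ))) =
        fun ζ => (g ζ : ℂ) * F (-ζ) - (g ζ : ℂ) * starRingEnd ℂ (F ζ) := by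
      funext ζ
      rw [Complex.real_smul, mul_sub]
    rw [e3, integral_sub hi2 hi5, hc]
    apply Complex.ext
    · simp; linarith
    · simp; linarith
  filter_upwards [main] with ζ hζ
  exact sub_eq_zero.1 hζ

namespace Sob

variable {s s' : ℝ}

/-- The Fourier transform of an element of `H^s`. -/
def hat (T : Sob n m s) (ζ : Space n) : ℂ := T.symbol ζ / sobWeight n m s ζ

theorem symbol_eq (T : Sob n m s) (ζ : Space n) : T.symbol ζ = sobWeight n m s ζ * T.hat ζ := by
  rw [hat, mul_div_cancel₀ _ (ofReal_sobWeight_ne_zero s ζ)]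

theorem hasHat (T : Sob n m s) : HasHat T.toDistr T.hat := T.hasSobSymbol.hasHat

theorem memLp_hat (T : Sob n m s) : MemLp (fun ζ => (sobWeight n m s ζ : ℂ) * T.hat ζ) 2 :=
  (Lp.memLp T.symbol).ae_eq (Eventually.of_forall fun ζ => T.symbol_eq ζ)

theorem aestronglyMeasurable_hat (T : Sob n m s) : AEStronglyMeasurable T.hat := by
  have h : Continuous fun ζ : Space n => ((sobWeight n m s ζ : ℂ))⁻¹ :=
    (Complex.continuous_ofReal.comp (continuous_sobWeight s)).inv₀
      fun ζ => ofReal_sobWeight_ne_zero s ζ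
  exact (Lp.aestronglyMeasurable T.symbol).mul h.aestronglyMeasurable

theorem locallyIntegrable_hat (T : Sob n m s) : LocallyIntegrable T.hat volume := by
  have h : Continuous fun ζ : Space n => ((sobWeight n m s ζ : ℂ))⁻¹ :=
    (Complex.continuous_ofReal.comp (continuous_sobWeight s)).inv₀
      fun ζ => ofReal_sobWeight_ne_zero s ζ
  exact LocallyIntegrable.mul_continuous h
    ((Lp.memLp T.symbol).locallyIntegrable (by norm_num))

theorem hermSymm_hat (T : Sob n m s) : HermSymm T.hat :=
  T.hasHat.hermSymm T.locallyIntegrable_hat T.2.1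

theorem norm_def (T : Sob n m s) : ‖T‖ = ‖T.symbol‖ := rfl

theorem ext_hat {T T' : Sob n m s} (h : T.hat =ᵐ[volume] T'.hat) : T = T' := by
  refine symbol_injective (Lp.ext ?_)
  filter_upwards [h] with ζ hζ
  rw [symbol_eq, symbol_eq, hζ]

omit hm in
theorem ext_toDistr {T T' : Sob n m s} (h : T.toDistr = T'.toDistr) : T = T' := Subtype.ext h

/-- Elements of `H^s` are produced in this way: weighted square integrability gives the symbol,
Hermitian symmetry gives reality. The equality holds almost everywhere because `hat` is built on a
chosen representative of a class in `L²`. -/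
theorem exists_hat_eq {F : Space n → ℂ} (h : MemLp (fun ζ => (sobWeight n m s ζ : ℂ) * F ζ) 2)
    (hF : HermSymm F) : ∃ T : Sob n m s, T.hat =ᵐ[volume] F := by
  obtain ⟨g, hg⟩ : ∃ g : Lp ℂ 2 (volume : Measure (Space n)),
      ∀ᵐ ζ, g ζ = (sobWeight n m s ζ : ℂ) * F ζ := ⟨h.toLp _, h.coeFn_toLp⟩
  obtain ⟨T, hT⟩ := exists_hasSobSymbol (m := m) s g
  have e : (fun ζ => g ζ / (sobWeight n m s ζ : ℂ)) =ᵐ[volume] F := by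
    filter_upwards [hg] with ζ hζ
    rw [hζ, mul_div_cancel_left₀ _ (ofReal_sobWeight_ne_zero s ζ)]
  let S : Sob n m s := ⟨T, (hT.hasHat.congr e).isRealDistr hF, g, hT⟩
  refine ⟨S, ?_⟩
  have : S.symbol = g := S.hasSobSymbol.unique hT
  refine EventuallyEq.trans (Eventually.of_forall fun ζ => ?_) e
  rw [hat, this]

omit hm in
theorem hat_add (T T' : Sob n m s) : (T + T').hat =ᵐ[volume] T.hat + T'.hat := by
  filter_upwards [Lp.coeFn_add T.symbol T'.symbol] with ζ hζ
  rw [hat, map_add, hζ, Pi.add_apply, Pi.add_apply, hat, hat, add_div]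

omit hm in
theorem hat_smul (c : ℝ) (T : Sob n m s) :
    (c • T).hat =ᵐ[volume] fun ζ => (c : ℂ) * T.hat ζ := by
  filter_upwards [Lp.coeFn_smul c T.symbol] with ζ hζ
  rw [hat, map_smul, hζ, Pi.smul_apply, hat, Complex.real_smul, mul_div_assoc]

omit hm in
theorem hat_sub (T T' : Sob n m s) : (T - T').hat =ᵐ[volume] T.hat - T'.hat := by
  filter_upwards [Lp.coeFn_sub T.symbol T'.symbol] with ζ hζ
  rw [hat, map_sub, hζ, Pi.sub_apply, Pi.sub_apply, hat, hat, sub_div]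

omit hm in
theorem hat_zero : (0 : Sob n m s).hat =ᵐ[volume] 0 := by
  filter_upwards [Lp.coeFn_zero ℂ 2 (volume : Measure (Space n))] with ζ hζ
  rw [hat, map_zero, hζ]
  simp

theorem norm_le_of_hat {T : Sob n m s} {T' : Sob n m s'} {C : ℝ}
    (h : ∀ᵐ ζ, sobWeight n m s' ζ * ‖T'.hat ζ‖ ≤ C * (sobWeight n m s ζ * ‖T.hat ζ‖)) :
    ‖T'‖ ≤ C * ‖T‖ := by
  rw [norm_def, norm_def]
  refine Lp.norm_le_mul_norm_of_ae_le_mul ?_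
  filter_upwards [h] with ζ hζ
  rw [symbol_eq, symbol_eq, norm_mul, norm_mul, Complex.norm_real, Complex.norm_real,
    Real.norm_of_nonneg (sobWeight_pos _ _).le, Real.norm_of_nonneg (sobWeight_pos _ _).le]
  exact hζ

theorem norm_sq_eq (T : Sob n m s) :
    ‖T‖ ^ 2 = ∫ ζ, (sobWeight n m s ζ * ‖T.hat ζ‖) ^ 2 := by
  rw [norm_def, ← @inner_self_eq_norm_sq ℂ, L2.inner_def, ← integral_re]
  · refine integral_congr_ae (Eventually.of_forall fun ζ => ?_)
    simp only
    rw [inner_self_eq_norm_sq, symbol_eq, norm_mul, Complex.norm_real,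
      Real.norm_of_nonneg (sobWeight_pos _ _).le]
  · exact L2.integrable_inner _ _

omit hm in
theorem toDistr_mk (T : Distr n) (hT : T ∈ sobolevSubmodule n m s) :
    toDistr (⟨T, hT⟩ : Sob n m s) = T := rfl

theorem incl_eq (h : s' ≤ s) (T : Sob n m s) : incl h T = ⟨T.toDistr, mem_of_le h T⟩ := rfl

theorem toDistr_incl (h : s' ≤ s) (T : Sob n m s) : (incl h T).toDistr = T.toDistr := by
  rw [incl_eq, toDistr_mk]

theorem hat_incl (h : s' ≤ s) (T : Sob n m s) : (incl h T).hat =ᵐ[volume] T.hat := by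
  have hmem : MemLp (fun ζ => (sobWeight n m s' ζ : ℂ) * T.hat ζ) 2 := by
    obtain ⟨C, hC0, hC⟩ := japanese_le_of_le (n := n) (m := m) h
    refine T.memLp_hat.of_le_mul (c := C) ?_ (Eventually.of_forall fun ζ => ?_)
    · exact (Complex.continuous_ofReal.comp (continuous_sobWeight s')).aestronglyMeasurable.mul
        T.aestronglyMeasurable_hat
    · rw [norm_mul, norm_mul, Complex.norm_real, Complex.norm_real,
        Real.norm_of_nonneg (sobWeight_pos _ _).le, Real.norm_of_nonneg (sobWeight_pos _ _).le,
        ← mul_assoc]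
      refine mul_le_mul_of_nonneg_right ?_ (norm_nonneg _)
      have := hC ζ
      rw [sobWeight, sobWeight, mul_left_comm]
      gcongr
  obtain ⟨S, hS⟩ := exists_hat_eq hmem T.hermSymm_hat
  have e : S = incl h T := by
    apply ext_toDistr
    rw [toDistr_incl]
    exact (S.hasHat.congr hS).unique T.hasHat
  rw [← e]
  exact hS

/-- Dominated convergence in `H^s`. -/
theorem tendsto_of_hat {ι : Type*} {l : Filter ι} [l.IsCountablyGenerated] {T : ι → Sob n m s}
    {T₀ : Sob n m s} {F : ι → Space n → ℂ} {H : Space n → ℝ} (hH : MemLp H 2)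
    (hF : ∀ᶠ i in l, (T i).hat =ᵐ[volume] F i)
    (hb : ∀ᶠ i in l, ∀ᵐ ζ, sobWeight n m s ζ * ‖F i ζ - T₀.hat ζ‖ ≤ H ζ)
    (ht : ∀ᵐ ζ, Tendsto (fun i => F i ζ) l (𝓝 (T₀.hat ζ))) : Tendsto T l (𝓝 T₀) := by
  rw [tendsto_iff_norm_sub_tendsto_zero]
  have h1 : Tendsto (fun i => ‖T i - T₀‖ ^ 2) l (𝓝 0) := by
    have h2 : Tendsto (fun i => ∫ ζ, (sobWeight n m s ζ * ‖(T i - T₀).hat ζ‖) ^ 2) l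
        (𝓝 (∫ ζ : Space n, (0 : ℝ))) := by
      have hcong : ∀ᶠ i in l, ∫ ζ, (sobWeight n m s ζ * ‖(T i - T₀).hat ζ‖) ^ 2 =
          ∫ ζ, (sobWeight n m s ζ * ‖F i ζ - T₀.hat ζ‖) ^ 2 := by
        filter_upwards [hF] with i hi
        refine integral_congr_ae ?_
        filter_upwards [hi, hat_sub (T i) T₀] with ζ h3 h4
        rw [h4, Pi.sub_apply, h3]
      rw [tendsto_congr' hcong]
      refine tendsto_integral_filter_of_dominated_convergence (fun ζ => H ζ ^ 2) ?_ ?_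
        hH.integrable_sq ?_
      · filter_upwards [hF] with i hi
        have hmeas : AEStronglyMeasurable (F i) :=
          (T i).aestronglyMeasurable_hat.congr hi
        exact (((continuous_sobWeight s).aestronglyMeasurable).mul
          (hmeas.sub T₀.aestronglyMeasurable_hat).norm).pow 2
      · filter_upwards [hb] with i hi
        filter_upwards [hi] with ζ hζ
        have := (sobWeight_pos (m := m) s ζ).le
        rw [Real.norm_of_nonneg (by positivity)]
        gcongr
      · filter_upwards [ht] with ζ hζ
        have h5 := (hζ.sub_const (T₀.hat ζ)).norm
        have h6 := (h5.const_mul (sobWeight n m s ζ)).pow 2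
        simpa using h6
    rw [integral_zero] at h2
    exact h2.congr fun i => (norm_sq_eq _).symm
  have h7 := h1.sqrt
  rw [Real.sqrt_zero] at h7
  exact h7.congr fun i => Real.sqrt_sq (norm_nonneg _)

end Sob

end SobHat

/-! ## Completeness of Sobolev spaces, and Fourier multipliers -/

section SobComplete

variable {n : ℕ} {m : ℝ} [hm : Fact (0 < m)]

/-- The test function `h`, moved to the symbol side. -/
def symbolTest (m s : ℝ) (h : SchwartzMap (Space n) ℂ) : SchwartzMap (Space n) ℂ :=
  SchwartzMap.smulLeftCLM ℂ (fun ζ : Space n => ((sobWeight n m s ζ : ℂ))⁻¹) (𝓕⁻ h)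

theorem HasSobSymbol.apply_eq {s : ℝ} {T : Distr n} {g : Lp ℂ 2 (volume : Measure (Space n))}
    (hg : HasSobSymbol m s T g) (h : SchwartzMap (Space n) ℂ) :
    T h = Lp.toTemperedDistributionCLM ℂ volume 2 g (symbolTest m s h) := by
  have e1 : ∀ ζ, symbolTest m s h ζ = ((sobWeight n m s ζ : ℂ))⁻¹ * (𝓕⁻ h) ζ := fun ζ => by
    rw [symbolTest, SchwartzMap.smulLeftCLM_apply_apply (inv_sobWeight_temperate s), smul_eq_mul]
  rw [(hg.hasHat h).2]
  change _ = Lp.toTemperedDistribution g (symbolTest m s h)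
  rw [Lp.toTemperedDistribution_apply]
  refine integral_congr_ae (Eventually.of_forall fun ζ => ?_)
  simp only [e1, smul_eq_mul]
  ring

omit hm in
theorem continuous_toTemperedDistribution_apply (k : SchwartzMap (Space n) ℂ) :
    Continuous fun g : Lp ℂ 2 (volume : Measure (Space n)) =>
      Lp.toTemperedDistributionCLM ℂ volume 2 g k :=
  (PointwiseConvergenceCLM.evalCLM (RingHom.id ℂ) ℂ k).continuous.comp
    (Lp.toTemperedDistributionCLM ℂ volume 2).continuous

namespace Sob

variable {s s' : ℝ}

theorem continuous_symbol : Continuous (symbol : Sob n m s → _) :=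
  (AddMonoidHomClass.isometry_of_norm (symbol : Sob n m s →ₗ[ℝ] _) fun _ => rfl).continuous

/-- Testing with `h`. -/
def testCLM (h : SchwartzMap (Space n) ℂ) : Sob n m s →L[ℝ] ℂ where
  toFun T := T.toDistr h
  map_add' T T' := by simp
  map_smul' c T := by simp
  cont := by
    have : (fun T : Sob n m s => T.toDistr h) = fun T =>
        Lp.toTemperedDistributionCLM ℂ volume 2 T.symbol (symbolTest m s h) :=
      funext fun T => T.hasSobSymbol.apply_eq h
    change Continuous fun T : Sob n m s => T.toDistr h
    rw [this]
    exact (continuous_toTemperedDistribution_apply _).comp continuous_symbol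

theorem testCLM_apply (h : SchwartzMap (Space n) ℂ) (T : Sob n m s) :
    testCLM h T = T.toDistr h := rfl

theorem ext_test {T T' : Sob n m s} (h : ∀ k, testCLM k T = testCLM k T') : T = T' := by
  apply ext_toDistr
  ext k
  exact h k

/-- `symbol` is an isometry into `L²`. A limit of symbols is the symbol of some distribution, and
this one is real because testing is continuous in the symbol. -/
instance : CompleteSpace (Sob n m s) := by
  refine UniformSpace.complete_of_cauchySeq_tendsto fun T hT => ?_
  have hiso : Isometry (symbol : Sob n m s → _) :=
    AddMonoidHomClass.isometry_of_norm (symbol : Sob n m s →ₗ[ℝ] _) fun _ => rfl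
  have hc : CauchySeq fun i => (T i).symbol := hT.map hiso.uniformContinuous
  obtain ⟨g, hg⟩ := cauchySeq_tendsto_of_complete hc
  obtain ⟨S, hS⟩ := exists_hasSobSymbol (m := m) s g
  have hr : IsRealDistr S := by
    intro h hh
    have h1 : Tendsto (fun i => ((T i).toDistr h).im) atTop (𝓝 (S h).im) := by
      refine (Complex.continuous_im.tendsto _).comp ?_
      rw [hS.apply_eq h]
      have := ((continuous_toTemperedDistribution_apply (symbolTest m s h)).tendsto g).comp hg
      exact this.congr fun i => ((T i).hasSobSymbol.apply_eq h).symm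
    have h2 : (fun i => ((T i).toDistr h).im) = fun _ => 0 := funext fun i => (T i).2.1 h hh
    rw [h2] at h1
    exact tendsto_nhds_unique h1 tendsto_const_nhds
  let S' : Sob n m s := ⟨S, hr, g, hS⟩
  have e : S'.symbol = g := S'.hasSobSymbol.unique hS
  refine ⟨S', ?_⟩
  rw [← e] at hg
  exact hiso.isUniformInducing.isInducing.tendsto_nhds_iff.2 hg

/-- The Fourier multiplier with symbol `a`. -/
theorem exists_mult {a : Space n → ℂ} (ha : AEStronglyMeasurable a) (hs : HermSymm a) {C : ℝ}
    (hC : ∀ ζ, ‖a ζ‖ ≤ C * japanese n m (s - s') ζ) :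
    ∃ A : Sob n m s →L[ℝ] Sob n m s', (∀ T, (A T).hat =ᵐ[volume] fun ζ => a ζ * T.hat ζ) ∧
      ∀ T, ‖A T‖ ≤ C * ‖T‖ := by
  have hb : ∀ (T : Sob n m s) ζ, sobWeight n m s' ζ * ‖a ζ * T.hat ζ‖ ≤
      C * (sobWeight n m s ζ * ‖T.hat ζ‖) := by
    intro T ζ
    have h1 := sobWeight_pos (m := m) s' ζ
    have h2 : sobWeight n m s' ζ * japanese n m (s - s') ζ = sobWeight n m s ζ :=
      sobWeight_mul_japanese s' s ζ
    rw [norm_mul, ← h2]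
    calc sobWeight n m s' ζ * (‖a ζ‖ * ‖T.hat ζ‖)
        ≤ sobWeight n m s' ζ * ((C * japanese n m (s - s') ζ) * ‖T.hat ζ‖) := by
          gcongr
          exact hC ζ
      _ = _ := by ring
  have hmem : ∀ T : Sob n m s, MemLp (fun ζ => (sobWeight n m s' ζ : ℂ) * (a ζ * T.hat ζ)) 2 := by
    intro T
    refine T.memLp_hat.of_le_mul (c := C) ?_ (Eventually.of_forall fun ζ => ?_)
    · exact (Complex.continuous_ofReal.comp (continuous_sobWeight s')).aestronglyMeasurable.mul
        (ha.mul T.aestronglyMeasurable_hat)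
    · have := hb T ζ
      rw [norm_mul (sobWeight n m s' ζ : ℂ), norm_mul (sobWeight n m s ζ : ℂ),
        Complex.norm_real, Complex.norm_real,
        Real.norm_of_nonneg (sobWeight_pos _ _).le, Real.norm_of_nonneg (sobWeight_pos _ _).le]
      exact this
  have hex : ∀ T : Sob n m s, ∃ T' : Sob n m s', T'.hat =ᵐ[volume] fun ζ => a ζ * T.hat ζ := by
    intro T
    refine exists_hat_eq (hmem T) ?_
    filter_upwards [hs, T.hermSymm_hat] with ζ h1 h2
    rw [h1, h2, map_mul]
  choose A hA using hex
  have hn : ∀ T, ‖A T‖ ≤ C * ‖T‖ := by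
    intro T
    refine norm_le_of_hat ?_
    filter_upwards [hA T] with ζ hζ
    rw [hζ]
    exact hb T ζ
  let A' : Sob n m s →ₗ[ℝ] Sob n m s' :=
    { toFun := A
      map_add' := fun T T' => by
        apply ext_hat
        filter_upwards [hA (T + T'), hat_add (A T) (A T'), hA T, hA T', hat_add T T'] with
          ζ h1 h2 h3 h4 h5
        rw [h1, h2, h5, Pi.add_apply, Pi.add_apply, h3, h4, mul_add]
      map_smul' := fun c T => by
        apply ext_hat
        filter_upwards [hA (c • T), hat_smul c (A T), hA T, hat_smul c T] with ζ h1 h2 h3 h4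
        rw [h1, RingHom.id_apply, h2, h3, h4]
        ring }
  exact ⟨A'.mkContinuous C hn, hA, hn⟩

/-- The continuous inclusion `H^s ⊆ H^{s'}`. -/
theorem exists_inclCLM (h : s' ≤ s) :
    ∃ A : Sob n m s →L[ℝ] Sob n m s', ∀ T, A T = incl h T := by
  obtain ⟨C, hC0, hC⟩ := japanese_le_of_le (n := n) (m := m) (sub_nonneg.2 h)
  obtain ⟨A, hA, -⟩ := exists_mult (n := n) (m := m) (s := s) (s' := s') (a := fun _ => 1)
    aestronglyMeasurable_const (Eventually.of_forall fun ζ => by simp) (C := C) (fun ζ => by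
      have := hC ζ
      rw [japanese_zero] at this
      simpa using this)
  refine ⟨A, fun T => ext_hat ?_⟩
  filter_upwards [hA T, hat_incl h T] with ζ h1 h2
  rw [h1, h2, one_mul]

/-- The continuous inclusion `H^s ⊆ H^{s'}`. -/
def inclCLM (h : s' ≤ s) : Sob n m s →L[ℝ] Sob n m s' := (exists_inclCLM h).choose

theorem inclCLM_apply (h : s' ≤ s) (T : Sob n m s) : inclCLM h T = incl h T :=
  (exists_inclCLM h).choose_spec T

omit hm in
theorem hat_sum {ι : Type*} (S : Finset ι) (T : ι → Sob n m s) :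
    (∑ i ∈ S, T i).hat =ᵐ[volume] fun ζ => ∑ i ∈ S, (T i).hat ζ := by
  classical
  induction S using Finset.induction_on with
  | empty => simp only [Finset.sum_empty]; exact hat_zero
  | insert i S hi ih =>
    rw [Finset.sum_insert hi]
    filter_upwards [hat_add (T i) (∑ i ∈ S, T i), ih] with ζ h1 h2
    rw [h1, Pi.add_apply, h2, Finset.sum_insert hi]

end Sob

/-! ### Matrices of Fourier multipliers -/

/-- The product of the spaces `H^{σ i}`. -/
abbrev SobProd (n : ℕ) (m : ℝ) {ι : Type} (σ : ι → ℝ) : Type := PiLp 1 fun i => Sob n m (σ i)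

/-- `a` is the symbol of a bounded Fourier multiplier from the product of the `H^{σ j}` to the
product of the `H^{σ' i}`. -/
structure IsMatMult {ι : Type} (m : ℝ) (σ σ' : ι → ℝ) (C : ℝ) (a : Space n → Matrix ι ι ℂ) :
    Prop where
  continuous : Continuous a
  symm : ∀ ζ i j, a (-ζ) i j = starRingEnd ℂ (a ζ i j)
  bound : ∀ ζ i j, ‖a ζ i j‖ ≤ C * japanese n m (σ j - σ' i) ζ

variable {ι : Type} [Fintype ι] {σ σ' : ι → ℝ}

/-- The operator `A` multiplies Fourier transforms with `a`. -/
def ActsAs (A : SobProd n m σ →L[ℝ] SobProd n m σ') (a : Space n → Matrix ι ι ℂ) : Prop :=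
  ∀ c i, (A c i).hat =ᵐ[volume] fun ζ => ∑ j, a ζ i j * (c j).hat ζ

theorem IsMatMult.exists_clm {C : ℝ} {a : Space n → Matrix ι ι ℂ}
    (ha : IsMatMult m σ σ' C a) : ∃ A : SobProd n m σ →L[ℝ] SobProd n m σ', ActsAs A a ∧
      ∀ c, ‖A c‖ ≤ Fintype.card ι * C * ‖c‖ := by
  have hex : ∀ i j, ∃ A : Sob n m (σ j) →L[ℝ] Sob n m (σ' i),
      (∀ T, (A T).hat =ᵐ[volume] fun ζ => a ζ i j * T.hat ζ) ∧ ∀ T, ‖A T‖ ≤ C * ‖T‖ := by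
    intro i j
    refine Sob.exists_mult ?_ (Eventually.of_forall fun ζ => ha.symm ζ i j)
      fun ζ => ha.bound ζ i j
    exact ((continuous_apply_apply i j).comp ha.continuous).aestronglyMeasurable
  choose A hA hn using hex
  let B : SobProd n m σ →L[ℝ] SobProd n m σ' :=
    (PiLp.continuousLinearEquiv 1 ℝ fun i => Sob n m (σ' i)).symm.toContinuousLinearMap.comp
      (ContinuousLinearMap.pi fun i => ∑ j, (A i j).comp
        (PiLp.proj 1 (𝕜 := ℝ) (fun i => Sob n m (σ i)) j))
  have hB : ∀ c i, B c i = ∑ j, A i j (c j) := by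
    intro c i
    simp [B]
  refine ⟨B, fun c i => ?_, fun c => ?_⟩
  · rw [hB]
    have := fun j => hA i j (c j)
    filter_upwards [Sob.hat_sum Finset.univ fun j => A i j (c j), ae_all_iff.2 this] with ζ h1 h2
    rw [h1]
    exact Finset.sum_congr rfl fun j _ => h2 j
  · rw [PiLp.norm_eq_of_L1, PiLp.norm_eq_of_L1]
    calc ∑ i, ‖B c i‖ ≤ ∑ i : ι, C * ∑ j, ‖c j‖ := by
          refine Finset.sum_le_sum fun i _ => ?_
          rw [hB, Finset.mul_sum]
          exact (norm_sum_le _ _).trans (Finset.sum_le_sum fun j _ => hn i j _)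
      _ = _ := by
          rw [Finset.sum_const, Finset.card_univ, nsmul_eq_mul]
          ring

omit [Fintype ι] in
theorem SobProd.ext_hat {c c' : SobProd n m σ}
    (h : ∀ i, (c i).hat =ᵐ[volume] (c' i).hat) :
    c = c' := by
  ext i
  exact Sob.ext_hat (h i)

/-- Strong continuity of a locally bounded family of multipliers. -/
theorem tendsto_of_actsAs {C : ℝ} {β : Type*} {l : Filter β} [l.IsCountablyGenerated]
    {A : β → SobProd n m σ →L[ℝ] SobProd n m σ'} {A₀ : SobProd n m σ →L[ℝ] SobProd n m σ'}
    {a : β → Space n → Matrix ι ι ℂ} {a₀ : Space n → Matrix ι ι ℂ}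
    (hA : ∀ᶠ b in l, ActsAs (A b) (a b)) (hA₀ : ActsAs A₀ a₀)
    (hb : ∀ᶠ b in l, ∀ ζ i j, ‖a b ζ i j‖ ≤ C * japanese n m (σ j - σ' i) ζ)
    (hb₀ : ∀ ζ i j, ‖a₀ ζ i j‖ ≤ C * japanese n m (σ j - σ' i) ζ)
    (ht : ∀ ζ i j, Tendsto (fun b => a b ζ i j) l (𝓝 (a₀ ζ i j))) (c : SobProd n m σ) :
    Tendsto (fun b => A b c) l (𝓝 (A₀ c)) := by
  have key : ∀ i, Tendsto (fun b => A b c i) l (𝓝 (A₀ c i)) := by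
    intro i
    refine Sob.tendsto_of_hat (F := fun b ζ => ∑ j, a b ζ i j * (c j).hat ζ)
      (H := fun ζ => ∑ j, 2 * C * ‖(sobWeight n m (σ j) ζ : ℂ) * (c j).hat ζ‖) ?_ ?_ ?_ ?_
    · exact memLp_finsetSum _ fun j _ => (c j).memLp_hat.norm.const_mul _
    · filter_upwards [hA] with b hb
      exact hb c i
    · filter_upwards [hb] with b hb
      filter_upwards [hA₀ c i] with ζ h0
      rw [h0, ← Finset.sum_sub_distrib]
      have hw := sobWeight_pos (m := m) (σ' i) ζ
      calc sobWeight n m (σ' i) ζ * ‖∑ j, (a b ζ i j * (c j).hat ζ - a₀ ζ i j * (c j).hat ζ)‖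
          ≤ sobWeight n m (σ' i) ζ * ∑ j, (C * japanese n m (σ j - σ' i) ζ +
              C * japanese n m (σ j - σ' i) ζ) * ‖(c j).hat ζ‖ := by
            gcongr
            refine (norm_sum_le _ _).trans (Finset.sum_le_sum fun j _ => ?_)
            rw [← sub_mul, norm_mul]
            gcongr
            exact (norm_sub_le _ _).trans (add_le_add (hb ζ i j) (hb₀ ζ i j))
        _ = _ := by
            rw [Finset.mul_sum]
            refine Finset.sum_congr rfl fun j _ => ?_
            rw [norm_mul, Complex.norm_real, Real.norm_of_nonneg (sobWeight_pos _ _).le,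
              ← sobWeight_mul_japanese (σ' i) (σ j) ζ]
            ring
    · filter_upwards [hA₀ c i] with ζ h0
      rw [h0]
      exact tendsto_finsetSum _ fun j _ => (ht ζ i j).mul_const _
  have h := tendsto_pi_nhds.2 key
  exact ((PiLp.continuous_toLp 1 fun i => Sob n m (σ' i)).tendsto _).comp h

end SobComplete

/-! ## The symbol of the linear evolution -/

section MatrixExp

attribute [local instance] Matrix.linftyOpNormedRing Matrix.linftyOpNormedAlgebra

variable {ι : Type} [Fintype ι] [DecidableEq ι]

theorem hasDerivAt_exp_mulVec (M : Matrix ι ι ℂ) (x : ι → ℂ) (t : ℝ) (i : ι) :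
    HasDerivAt (fun t : ℝ => (NormedSpace.exp (t • M)).mulVec x i)
      (M.mulVec ((NormedSpace.exp (t • M)).mulVec x) i) t := by
  have h := hasDerivAt_exp_smul_const' M t
  let Λ : Matrix ι ι ℂ →ₗ[ℝ] ℂ :=
    { toFun := fun A => A.mulVec x i
      map_add' := fun A B => by simp [Matrix.add_mulVec]
      map_smul' := fun c A => by simp [Matrix.smul_mulVec] }
  have h2 := (LinearMap.toContinuousLinearMap Λ).hasFDerivAt.comp_hasDerivAt t h
  have e : Λ (M * NormedSpace.exp (t • M)) =
      M.mulVec ((NormedSpace.exp (t • M)).mulVec x) i := by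
    change (M * NormedSpace.exp (t • M)).mulVec x i = _
    rw [Matrix.mulVec_mulVec]
  rw [← e]
  exact h2

theorem commute_exp_smul (M : Matrix ι ι ℂ) (t : ℝ) :
    M * NormedSpace.exp (t • M) = NormedSpace.exp (t • M) * M :=
  ((Commute.refl M).smul_right t).exp_right

theorem exp_smul_add (M : Matrix ι ι ℂ) (t t' : ℝ) :
    NormedSpace.exp ((t + t') • M) = NormedSpace.exp (t • M) * NormedSpace.exp (t' • M) := by
  rw [add_smul]
  exact Matrix.exp_add_of_commute _ _ (((Commute.refl M).smul_left t).smul_right t')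

theorem continuous_matrix_exp : Continuous (NormedSpace.exp : Matrix ι ι ℂ → Matrix ι ι ℂ) :=
  NormedSpace.exp_continuous

/-- Entrywise conjugation is the conjugate transpose followed by the transpose, and the exponential
commutes with both. It gives the symbol of the evolution its Hermitian symmetry, so that real data
evolve into real data. -/
theorem exp_smul_apply_conj {M M' : Matrix ι ι ℂ} (h : ∀ i j, M' i j = starRingEnd ℂ (M i j))
    (t : ℝ) (i j : ι) :
    NormedSpace.exp (t • M') i j = starRingEnd ℂ (NormedSpace.exp (t • M) i j) := by
  have e : t • M' = (t • M).conjTranspose.transpose := by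
    ext i j
    simp [h]
  rw [e, Matrix.exp_transpose, Matrix.exp_conjTranspose]
  rfl

end MatrixExp

/-! ### Size and symmetry of polynomial symbols -/

section PolyBound

variable {n : ℕ} {m : ℝ} [hm : Fact (0 < m)]

omit hm in
theorem abs_coord_le (ζ : Space n) (j : Fin n) :
    |((2 * Real.pi) • ζ) j| ≤ japanese n m 1 ζ := by
  have h1 : |((2 * Real.pi) • ζ) j| ≤ ‖(2 * Real.pi) • ζ‖ := by
    rw [← Real.norm_eq_abs]
    exact PiLp.norm_apply_le _ j
  refine h1.trans ?_
  rw [japanese, ← Real.sqrt_eq_rpow]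
  refine Real.le_sqrt_of_sq_le ?_
  nlinarith [sq_nonneg m]

theorem japanese_nat (k : ℕ) (ζ : Space n) : japanese n m k ζ = japanese n m 1 ζ ^ k := by
  rw [japanese, japanese, ← Real.rpow_natCast (_ ^ _), ← Real.rpow_mul (japanese_base_pos ζ).le]
  congr 1
  ring

/-- Every coordinate of `ξ` is at most `⟨ξ⟩`, so a monomial is bounded by the power of `⟨ξ⟩` of its
degree, which `⟨ξ⟩ ^ k` dominates up to a constant since `m > 0`. -/
theorem norm_aeval_le (p : MvPolynomial (Fin n) ℝ) {k : ℕ} (hp : p.totalDegree ≤ k) :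
    ∃ C, 0 ≤ C ∧ ∀ ζ : Space n,
      ‖MvPolynomial.aeval (fun j => Complex.I * (((2 * Real.pi) • ζ) j : ℂ)) p‖ ≤
        C * japanese n m k ζ := by
  have h : ∀ a ∈ p.support, ∃ C, 0 ≤ C ∧ ∀ ζ : Space n,
      ‖((p.coeff a : ℝ) : ℂ) * ∏ j, (Complex.I * (((2 * Real.pi) • ζ) j : ℂ)) ^ a j‖ ≤
        C * japanese n m k ζ := by
    intro a ha
    have hd : ∑ j, a j ≤ k := by
      refine le_trans ?_ hp
      refine le_trans ?_ (MvPolynomial.le_totalDegree ha)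
      rw [Finsupp.sum_fintype _ _ fun _ => rfl]
    obtain ⟨C, hC0, hC⟩ := japanese_le_of_le (n := n) (m := m)
      (s := k) (s' := (∑ j, a j : ℕ)) (by exact_mod_cast hd)
    refine ⟨‖((p.coeff a : ℝ) : ℂ)‖ * C, by positivity, fun ζ => ?_⟩
    rw [norm_mul, mul_assoc]
    refine mul_le_mul_of_nonneg_left (le_trans ?_ (hC ζ)) (norm_nonneg _)
    rw [japanese_nat, ← Finset.prod_pow_eq_pow_sum, norm_prod]
    refine Finset.prod_le_prod (fun _ _ => norm_nonneg _) fun j _ => ?_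
    rw [norm_pow, norm_mul, Complex.norm_I, one_mul, Complex.norm_real, Real.norm_eq_abs]
    exact pow_le_pow_left₀ (abs_nonneg _) (abs_coord_le ζ j) _
  choose! C hC0 hC using h
  refine ⟨∑ a ∈ p.support, C a, Finset.sum_nonneg hC0, fun ζ => ?_⟩
  rw [MvPolynomial.aeval_def, MvPolynomial.eval₂_eq', Finset.sum_mul]
  exact (norm_sum_le _ _).trans (Finset.sum_le_sum fun a ha => hC a ha ζ)

omit hm in
theorem aeval_neg (p : MvPolynomial (Fin n) ℝ) (ζ : Space n) :
    MvPolynomial.aeval (fun j => Complex.I * (((2 * Real.pi) • (-ζ)) j : ℂ)) p =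
      starRingEnd ℂ (MvPolynomial.aeval (fun j => Complex.I * (((2 * Real.pi) • ζ) j : ℂ)) p) := by
  rw [MvPolynomial.aeval_def, MvPolynomial.eval₂_eq', MvPolynomial.aeval_def,
    MvPolynomial.eval₂_eq', map_sum]
  refine Finset.sum_congr rfl fun a _ => ?_
  rw [map_mul, map_prod]
  congr 1
  · exact (Complex.conj_ofReal _).symm
  · refine Finset.prod_congr rfl fun j _ => ?_
    simp [Complex.conj_ofNat]

omit hm in
theorem continuous_aeval (p : MvPolynomial (Fin n) ℝ) :
    Continuous fun ζ : Space n =>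
      MvPolynomial.aeval (fun j => Complex.I * (((2 * Real.pi) • ζ) j : ℂ)) p := by
  simp only [MvPolynomial.aeval_def, MvPolynomial.eval₂_eq']
  fun_prop

end PolyBound

/-! ### The linear equation as a first-order system on the Fourier side -/

namespace LinOp

variable {n d₁ d₂ : ℕ} (L : LinOp n d₁ d₂)

/-- The indices of the components of Cauchy data `(u₁, u₂, ∂₀u₂)`. -/
abbrev DataIdx (d₁ d₂ : ℕ) : Type := Comp d₁ d₂ ⊕ Fin d₂

/-- The matrix `-(γ⁰)⁻¹ P₁(iξ)`. -/
def genMatrix₁ (ζ : Space n) : Matrix (Fin d₁) (Fin d₁) ℂ :=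
  -(L.γ₀⁻¹.map (fun a : ℝ => (a : ℂ)) * symbolMatrix L.P₁ ((2 * Real.pi) • ζ))

/-- The matrix `P₂(iξ)`. -/
def genMatrix₂ (ζ : Space n) : Matrix (Fin d₂) (Fin d₂) ℂ :=
  symbolMatrix L.P₂ ((2 * Real.pi) • ζ)

/-- The generator of the evolution of the Cauchy data `(u₁, u₂, ∂₀u₂)` under `L u = 0`. -/
def genMatrix (ζ : Space n) : Matrix (DataIdx d₁ d₂) (DataIdx d₁ d₂) ℂ :=
  Matrix.fromBlocks (Matrix.fromBlocks (L.genMatrix₁ ζ) 0 0 0) (Matrix.fromRows 0 1)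
    (Matrix.fromCols 0 (-L.genMatrix₂ ζ)) 0

/-- The symbol of the evolution. -/
def flowMatrix (t : ℝ) (ζ : Space n) : Matrix (DataIdx d₁ d₂) (DataIdx d₁ d₂) ℂ :=
  NormedSpace.exp (t • L.genMatrix ζ)

theorem genMatrix_mulVec₁ (ζ : Space n) (x : DataIdx d₁ d₂ → ℂ) (i : Fin d₁) :
    (L.genMatrix ζ).mulVec x (Sum.inl (Sum.inl i)) =
      (L.genMatrix₁ ζ).mulVec (fun j => x (Sum.inl (Sum.inl j))) i := by
  rw [genMatrix, Matrix.fromBlocks_mulVec, Matrix.fromBlocks_mulVec, Matrix.fromRows_mulVec]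
  simp [Function.comp_def]

theorem genMatrix_mulVec₂ (ζ : Space n) (x : DataIdx d₁ d₂ → ℂ) (i : Fin d₂) :
    (L.genMatrix ζ).mulVec x (Sum.inl (Sum.inr i)) = x (Sum.inr i) := by
  rw [genMatrix, Matrix.fromBlocks_mulVec, Matrix.fromBlocks_mulVec, Matrix.fromRows_mulVec]
  simp [Function.comp_def]

theorem genMatrix_mulVec₃ (ζ : Space n) (x : DataIdx d₁ d₂ → ℂ) (i : Fin d₂) :
    (L.genMatrix ζ).mulVec x (Sum.inr i) =
      -(L.genMatrix₂ ζ).mulVec (fun j => x (Sum.inl (Sum.inr j))) i := by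
  rw [genMatrix, Matrix.fromBlocks_mulVec, Matrix.fromCols_mulVec]
  simp [Function.comp_def, Matrix.neg_mulVec]

theorem continuous_genMatrix₁ : Continuous L.genMatrix₁ := by
  have : Continuous fun ζ : Space n => symbolMatrix L.P₁ ((2 * Real.pi) • ζ) :=
    continuous_matrix fun i j => continuous_aeval _
  exact (continuous_const.matrix_mul this).neg

theorem continuous_genMatrix₂ : Continuous L.genMatrix₂ :=
  continuous_matrix fun _ _ => continuous_aeval _

theorem continuous_genMatrix : Continuous L.genMatrix := by
  refine Continuous.matrix_fromBlocks ?_ continuous_const ?_ continuous_const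
  · exact Continuous.matrix_fromBlocks L.continuous_genMatrix₁ continuous_const continuous_const
      continuous_const
  · refine continuous_matrix fun i j => ?_
    rcases j with j | j
    · exact continuous_const
    · exact ((continuous_apply_apply i j).comp L.continuous_genMatrix₂).neg

theorem genMatrix_neg (ζ : Space n) (i j : DataIdx d₁ d₂) :
    L.genMatrix (-ζ) i j = starRingEnd ℂ (L.genMatrix ζ i j) := by
  have h1 : ∀ i j, symbolMatrix L.P₁ (-((2 * Real.pi) • ζ)) i j =
      starRingEnd ℂ (symbolMatrix L.P₁ ((2 * Real.pi) • ζ) i j) := fun i j => by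
    rw [← smul_neg]
    exact aeval_neg _ ζ
  have h2 : ∀ i j, symbolMatrix L.P₂ (-((2 * Real.pi) • ζ)) i j =
      starRingEnd ℂ (symbolMatrix L.P₂ ((2 * Real.pi) • ζ) i j) := fun i j => by
    rw [← smul_neg]
    exact aeval_neg _ ζ
  rcases i with (i | i) | i <;> rcases j with (j | j) | j <;>
    simp [genMatrix, genMatrix₁, genMatrix₂, Matrix.mul_apply, Matrix.one_apply, h1, h2,
      apply_ite (starRingEnd ℂ)]

theorem continuous_flowMatrix (t : ℝ) : Continuous (L.flowMatrix t) :=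
  continuous_matrix_exp.comp (L.continuous_genMatrix.const_smul t)

theorem flowMatrix_neg (t : ℝ) (ζ : Space n) (i j : DataIdx d₁ d₂) :
    L.flowMatrix t (-ζ) i j = starRingEnd ℂ (L.flowMatrix t ζ i j) :=
  exp_smul_apply_conj (L.genMatrix_neg ζ) t i j

theorem flowMatrix_zero (ζ : Space n) : L.flowMatrix 0 ζ = 1 := by
  rw [flowMatrix, zero_smul, NormedSpace.exp_zero]

theorem flowMatrix_add (t t' : ℝ) (ζ : Space n) :
    L.flowMatrix (t + t') ζ = L.flowMatrix t ζ * L.flowMatrix t' ζ := exp_smul_add _ _ _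

theorem genMatrix_mul_flowMatrix (t : ℝ) (ζ : Space n) :
    L.genMatrix ζ * L.flowMatrix t ζ = L.flowMatrix t ζ * L.genMatrix ζ := commute_exp_smul _ _

theorem hasDerivAt_flowMatrix_mulVec (t : ℝ) (ζ : Space n) (x : DataIdx d₁ d₂ → ℂ)
    (i : DataIdx d₁ d₂) :
    HasDerivAt (fun t => (L.flowMatrix t ζ).mulVec x i)
      ((L.genMatrix ζ).mulVec ((L.flowMatrix t ζ).mulVec x) i) t :=
  hasDerivAt_exp_mulVec _ _ _ _

end LinOp

/-! ### Energy estimates -/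

section Energy

variable {ι : Type} [Fintype ι]

theorem star_dotProduct_self (x : ι → ℂ) : star x ⬝ᵥ x = ((∑ i, ‖x i‖ ^ 2 : ℝ) : ℂ) := by
  rw [dotProduct, Complex.ofReal_sum]
  refine Finset.sum_congr rfl fun i _ => ?_
  rw [Pi.star_apply, RCLike.star_def, Complex.conj_mul']
  push_cast
  rfl

theorem hasDerivAt_dotProduct {x y : ℝ → ι → ℂ} {x' y' : ι → ℂ} {t : ℝ}
    (hx : ∀ i, HasDerivAt (fun t => x t i) (x' i) t)
    (hy : ∀ i, HasDerivAt (fun t => y t i) (y' i) t) :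
    HasDerivAt (fun t => star (x t) ⬝ᵥ y t) (star x' ⬝ᵥ y t + star (x t) ⬝ᵥ y') t := by
  simp only [dotProduct, ← Finset.sum_add_distrib]
  exact HasDerivAt.fun_sum fun i _ => (hx i).star.mul (hy i)

theorem star_mulVec_dotProduct {B : Matrix ι ι ℂ} (hB : B.IsHermitian) (x y : ι → ℂ) :
    star (B.mulVec x) ⬝ᵥ y = star x ⬝ᵥ B.mulVec y := by
  rw [Matrix.star_mulVec, hB.eq, Matrix.dotProduct_mulVec]

/-- Conservation of charge. -/
theorem sum_sq_eq_of_skew {A : Matrix ι ι ℂ} (hA : (Complex.I • A).IsHermitian)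
    {x : ℝ → ι → ℂ} (hx : ∀ t i, HasDerivAt (fun t => x t i) (A.mulVec (x t) i) t) (t : ℝ) :
    ∑ i, ‖x t i‖ ^ 2 = ∑ i, ‖x 0 i‖ ^ 2 := by
  have hskew : ∀ y : ι → ℂ, star (A.mulVec y) ⬝ᵥ y = -(star y ⬝ᵥ A.mulVec y) := by
    intro y
    have := star_mulVec_dotProduct hA y y
    rw [Matrix.smul_mulVec, star_smul, smul_dotProduct, dotProduct_smul, RCLike.star_def,
      Complex.conj_I, smul_eq_mul, smul_eq_mul, neg_mul, ← mul_neg] at this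
    have h2 := mul_left_cancel₀ Complex.I_ne_zero this
    rw [← h2, neg_neg]
  have hd : ∀ t, HasDerivAt (fun t => star (x t) ⬝ᵥ x t) 0 t := by
    intro t
    have := hasDerivAt_dotProduct (hx t) (hx t)
    rw [hskew, neg_add_cancel] at this
    exact this
  have h := is_const_of_deriv_eq_zero (fun t => (hd t).differentiableAt) (fun t => (hd t).deriv) t 0
  rw [star_dotProduct_self, star_dotProduct_self] at h
  exact_mod_cast h

/-- Conservation of energy. -/
theorem energy_eq {B : Matrix ι ι ℂ} (hB : B.IsHermitian) {x y : ℝ → ι → ℂ}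
    (hx : ∀ t i, HasDerivAt (fun t => x t i) (y t i) t)
    (hy : ∀ t i, HasDerivAt (fun t => y t i) (-B.mulVec (x t) i) t) (t : ℝ) :
    (star (x t) ⬝ᵥ B.mulVec (x t)).re + ∑ i, ‖y t i‖ ^ 2 =
      (star (x 0) ⬝ᵥ B.mulVec (x 0)).re + ∑ i, ‖y 0 i‖ ^ 2 := by
  have hBx : ∀ t i, HasDerivAt (fun t => B.mulVec (x t) i) (B.mulVec (y t) i) t := by
    intro t i
    simp only [Matrix.mulVec, dotProduct]
    exact HasDerivAt.fun_sum fun j _ => (hx t j).const_mul _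
  have hd : ∀ t, HasDerivAt
      (fun t => star (x t) ⬝ᵥ B.mulVec (x t) + star (y t) ⬝ᵥ y t) 0 t := by
    intro t
    have h1 := (hasDerivAt_dotProduct (hx t) (hBx t)).add (hasDerivAt_dotProduct (hy t) (hy t))
    have e : star (fun i => y t i) ⬝ᵥ B.mulVec (x t) + star (x t) ⬝ᵥ (fun i => B.mulVec (y t) i) +
        (star (fun i => -B.mulVec (x t) i) ⬝ᵥ y t +
          star (y t) ⬝ᵥ fun i => -B.mulVec (x t) i) = 0 := by
      have e1 : (fun i => -B.mulVec (x t) i) = -B.mulVec (x t) := rfl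
      have e2 := star_mulVec_dotProduct hB (x t) (y t)
      rw [e1, star_neg, neg_dotProduct, dotProduct_neg, e2]
      ring
    rw [e] at h1
    exact h1
  have h := is_const_of_deriv_eq_zero (fun t => (hd t).differentiableAt) (fun t => (hd t).deriv) t 0
  rw [star_dotProduct_self, star_dotProduct_self] at h
  have := congrArg Complex.re h
  simpa only [Complex.add_re, Complex.ofReal_re] using this

end Energy

/-! ### Bounds for the symbol of the evolution -/

namespace LinOp

variable {n d₁ d₂ : ℕ} (L : LinOp n d₁ d₂)

/-- The Sobolev orders of the components of Cauchy data. -/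
def dataOrder (s : ℝ) : DataIdx d₁ d₂ → ℝ := Sum.elim (fun _ => s) (fun _ => s - L.r)

theorem skew_genMatrix₁ (ζ : Space n) : (Complex.I • L.genMatrix₁ ζ).IsHermitian := by
  have := (L.hermitian ((2 * Real.pi) • ζ)).neg
  rwa [← smul_neg] at this

theorem isHermitian_genMatrix₂ (ζ : Space n) : (L.genMatrix₂ ζ).IsHermitian := by
  have h := (L.elliptic ((2 * Real.pi) • ζ)).isHermitian
  have h2 : (((L.α * (L.μ₀ + ‖(2 * Real.pi) • ζ‖ ^ (2 * L.r)) : ℝ) : ℂ) •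
      (1 : Matrix (Fin d₂) (Fin d₂) ℂ)).IsHermitian := by
    rw [Matrix.IsHermitian, Matrix.conjTranspose_smul, Matrix.conjTranspose_one, RCLike.star_def,
      Complex.conj_ofReal]
  have := h.add h2
  rwa [sub_add_cancel] at this

theorem genMatrix₂_ge (ζ : Space n) (x : Fin d₂ → ℂ) :
    L.α * (L.μ₀ + ‖(2 * Real.pi) • ζ‖ ^ (2 * L.r)) * ∑ i, ‖x i‖ ^ 2 ≤
      (star x ⬝ᵥ (L.genMatrix₂ ζ).mulVec x).re := by
  have h := (L.elliptic ((2 * Real.pi) • ζ)).dotProduct_mulVec_nonneg x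
  rw [Matrix.sub_mulVec, dotProduct_sub, Matrix.smul_mulVec, Matrix.one_mulVec, dotProduct_smul,
    star_dotProduct_self, smul_eq_mul, ← Complex.ofReal_mul] at h
  have h2 := (Complex.le_def.1 h).1
  rw [Complex.sub_re, Complex.ofReal_re, Complex.zero_re] at h2
  exact sub_nonneg.1 h2

section Bounds

variable {m : ℝ} [hm : Fact (0 < m)]

theorem exists_genMatrix₁_bound : ∃ C, 0 ≤ C ∧ ∀ (ζ : Space n) i j,
    ‖L.genMatrix₁ ζ i j‖ ≤ C * japanese n m L.r ζ := by
  choose C hC0 hC using fun i j => norm_aeval_le (m := m) _ (L.deg_P₁ i j)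
  refine ⟨∑ i, ∑ k, ∑ j, ‖(L.γ₀⁻¹ i k : ℂ)‖ * C k j,
    Finset.sum_nonneg fun i _ => Finset.sum_nonneg fun k _ => Finset.sum_nonneg fun j _ =>
      mul_nonneg (norm_nonneg _) (hC0 _ _), fun ζ i j => ?_⟩
  have hJ := (japanese_pos (m := m) L.r ζ).le
  rw [genMatrix₁, Matrix.neg_apply, norm_neg, Matrix.mul_apply]
  calc ‖∑ k, (L.γ₀⁻¹.map fun a : ℝ => (a : ℂ)) i k * symbolMatrix L.P₁ ((2 * Real.pi) • ζ) k j‖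
      ≤ ∑ k, (‖(L.γ₀⁻¹ i k : ℂ)‖ * C k j) * japanese n m L.r ζ := by
        refine (norm_sum_le _ _).trans (Finset.sum_le_sum fun k _ => ?_)
        rw [norm_mul, mul_assoc]
        exact mul_le_mul_of_nonneg_left (hC k j ζ) (norm_nonneg _)
    _ = (∑ k, (‖(L.γ₀⁻¹ i k : ℂ)‖ * C k j)) * japanese n m L.r ζ := by rw [Finset.sum_mul]
    _ ≤ _ := by
        refine mul_le_mul_of_nonneg_right ?_ hJ
        have h0 : ∀ i k j, 0 ≤ ‖(L.γ₀⁻¹ i k : ℂ)‖ * C k j :=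
          fun i k j => mul_nonneg (norm_nonneg _) (hC0 _ _)
        refine le_trans (Finset.sum_le_sum fun k _ => Finset.single_le_sum
          (f := fun j => ‖(L.γ₀⁻¹ i k : ℂ)‖ * C k j) (fun j _ => h0 i k j) (Finset.mem_univ j)) ?_
        exact Finset.single_le_sum (f := fun i => ∑ k, ∑ j, ‖(L.γ₀⁻¹ i k : ℂ)‖ * C k j)
          (fun i _ => Finset.sum_nonneg fun k _ => Finset.sum_nonneg fun j _ => h0 i k j)
          (Finset.mem_univ i)

theorem exists_genMatrix₂_bound : ∃ C, 0 ≤ C ∧ ∀ (ζ : Space n) i j,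
    ‖L.genMatrix₂ ζ i j‖ ≤ C * japanese n m (2 * L.r) ζ := by
  choose C hC0 hC using fun i j => norm_aeval_le (m := m) _ (L.deg_P₂ i j)
  refine ⟨∑ i, ∑ j, C i j, Finset.sum_nonneg fun i _ => Finset.sum_nonneg fun j _ => hC0 _ _,
    fun ζ i j => ?_⟩
  have hJ := (japanese_pos (m := m) (2 * L.r) ζ).le
  have h := hC i j ζ
  push_cast at h
  refine h.trans (mul_le_mul_of_nonneg_right ?_ hJ)
  refine le_trans (Finset.single_le_sum (f := fun j => C i j) (fun j _ => hC0 i j)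
    (Finset.mem_univ j)) ?_
  exact Finset.single_le_sum (f := fun i => ∑ j, C i j)
    (fun i _ => Finset.sum_nonneg fun j _ => hC0 _ _) (Finset.mem_univ i)

theorem japanese_sq (s : ℝ) (ζ : Space n) : japanese n m (2 * s) ζ = japanese n m s ζ ^ 2 := by
  rw [two_mul, japanese_add, sq]

/-- The symbol of the generator, as a multiplier of order `r`. -/
theorem isMatMult_genMatrix (s : ℝ) : ∃ C, IsMatMult m (L.dataOrder s)
    (fun i => L.dataOrder s i - L.r) C L.genMatrix := by
  obtain ⟨C₁, hC₁0, hC₁⟩ := L.exists_genMatrix₁_bound (m := m)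
  obtain ⟨C₂, hC₂0, hC₂⟩ := L.exists_genMatrix₂_bound (m := m)
  refine ⟨C₁ + C₂ + 1, L.continuous_genMatrix, L.genMatrix_neg, fun ζ i j => ?_⟩
  have hp : ∀ u : ℝ, 0 ≤ (C₁ + C₂ + 1) * japanese n m u ζ := fun u =>
    mul_nonneg (by linarith) (japanese_pos _ _).le
  rcases i with (i | i) | i <;> rcases j with (j | j) | j
  case inl.inl.inl.inl =>
    have e : s - (s - (L.r : ℝ)) = L.r := by ring
    simp only [genMatrix, Matrix.fromBlocks_apply₁₁, dataOrder, Sum.elim_inl, e]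
    refine (hC₁ ζ i j).trans (mul_le_mul_of_nonneg_right (by linarith) (japanese_pos _ _).le)
  case inl.inr.inr =>
    have e : s - (L.r : ℝ) - (s - L.r) = 0 := by ring
    simp only [genMatrix, Matrix.fromBlocks_apply₁₂, dataOrder, Sum.elim_inl, Sum.elim_inr, e,
      japanese_zero, Matrix.fromRows_apply_inr, Matrix.one_apply]
    split_ifs
    · simp; linarith
    · simp; linarith
  case inr.inl.inr =>
    have e : s - (s - (L.r : ℝ) - L.r) = 2 * L.r := by ring
    simp only [genMatrix, Matrix.fromBlocks_apply₂₁, dataOrder, Sum.elim_inl, Sum.elim_inr, e,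
      Matrix.fromCols_apply_inr, Matrix.neg_apply, norm_neg]
    refine (hC₂ ζ i j).trans (mul_le_mul_of_nonneg_right (by linarith) (japanese_pos _ _).le)
  all_goals
    simpa [genMatrix] using hp _


-- A dichotomy. Where `|ξ| ≥ 1`, and everywhere if `μ₀ > 0`, the lower bound of `P₂(iξ)` dominates
-- `⟨ξ⟩ ^ (2r)`, and the energy will control the position. In the remaining case, `μ₀ = 0` and `|ξ|
-- < 1`, the weight is bounded, and bounded times make up for the missing control.
omit hm in
theorem exists_lower_bound (T : ℝ) : ∃ C, 0 ≤ C ∧ ∀ t : ℝ, (0 < L.μ₀ ∨ |t| ≤ T) →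
    ∀ ζ : Space n, japanese n m (2 * L.r) ζ ≤
        C * (L.α * (L.μ₀ + ‖(2 * Real.pi) • ζ‖ ^ (2 * L.r))) ∨
      (japanese n m (2 * L.r) ζ ≤ C ∧ |t| ≤ T) := by
  have hα := L.α_pos
  have hμ := L.μ₀_nonneg
  set D := (m ^ 2 + 1) ^ L.r with hD
  have hD0 : 0 < D := by positivity
  have hJ : ∀ ζ : Space n, japanese n m (2 * L.r) ζ =
      (m ^ 2 + ‖(2 * Real.pi) • ζ‖ ^ 2) ^ L.r := by
    intro ζ
    rw [japanese, ← Real.rpow_natCast _ L.r]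
    congr 1
    ring
  -- One summand for each of the three cases; if `μ₀ = 0`, the middle one is `0` by the convention
  -- for division, and its case does not occur.
  refine ⟨D / L.α + D / (L.α * L.μ₀) + D, by positivity, fun t ht ζ => ?_⟩
  rw [hJ]
  set x := ‖(2 * Real.pi) • ζ‖ with hx
  have hx0 : 0 ≤ x := norm_nonneg _
  by_cases h1 : 1 ≤ x
  · left
    have h2 : (m ^ 2 + x ^ 2) ^ L.r ≤ D * x ^ (2 * L.r) := by
      rw [hD, pow_mul, ← mul_pow]
      refine pow_le_pow_left₀ (by positivity) ?_ _
      nlinarith [sq_nonneg m, mul_le_mul h1 h1 zero_le_one hx0, sq_nonneg (m * x)]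
    refine h2.trans ?_
    have h3 : D * x ^ (2 * L.r) = D / L.α * (L.α * x ^ (2 * L.r)) := by field_simp
    rw [h3]
    have h4 : 0 ≤ x ^ (2 * L.r) := by positivity
    refine mul_le_mul ?_ ?_ (by positivity) (by positivity)
    · have : 0 ≤ D / (L.α * L.μ₀) := by positivity
      linarith
    · exact mul_le_mul_of_nonneg_left (by linarith) hα.le
  · have h2 : (m ^ 2 + x ^ 2) ^ L.r ≤ D := by
      refine pow_le_pow_left₀ (by positivity) ?_ _
      push Not at h1
      nlinarith
    rcases hμ.eq_or_lt with h0 | h0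
    · right
      refine ⟨?_, ht.resolve_left h0.not_lt⟩
      have : 0 ≤ D / L.α + D / (L.α * L.μ₀) := by positivity
      linarith
    · left
      refine h2.trans ?_
      have h3 : D / (L.α * L.μ₀) * (L.α * L.μ₀) = D := by field_simp
      have h4 : 0 ≤ x ^ (2 * L.r) := by positivity
      refine h3.symm.le.trans (mul_le_mul ?_ ?_ (by positivity) (by positivity))
      · have : 0 ≤ D / L.α := by positivity
        linarith
      · exact mul_le_mul_of_nonneg_left (by linarith) hα.le

/-- Bounds for the components of solutions `(x₁, x₂, x₃)` of the ordinary differential equation. -/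
theorem flow_charge (ζ : Space n) (x : DataIdx d₁ d₂ → ℂ) (t : ℝ) :
    ∑ i, ‖(L.flowMatrix t ζ).mulVec x (Sum.inl (Sum.inl i))‖ ^ 2 =
      ∑ i, ‖x (Sum.inl (Sum.inl i))‖ ^ 2 := by
  have := sum_sq_eq_of_skew (L.skew_genMatrix₁ ζ)
    (x := fun t i => (L.flowMatrix t ζ).mulVec x (Sum.inl (Sum.inl i))) (fun t i => by
      have h := L.hasDerivAt_flowMatrix_mulVec t ζ x (Sum.inl (Sum.inl i))
      rwa [genMatrix_mulVec₁] at h) t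
  simpa only [flowMatrix_zero, Matrix.one_mulVec] using this

theorem flow_energy (ζ : Space n) (x : DataIdx d₁ d₂ → ℂ) (t : ℝ) :
    (star (fun i => (L.flowMatrix t ζ).mulVec x (Sum.inl (Sum.inr i))) ⬝ᵥ
        (L.genMatrix₂ ζ).mulVec fun i => (L.flowMatrix t ζ).mulVec x (Sum.inl (Sum.inr i))).re +
      ∑ i, ‖(L.flowMatrix t ζ).mulVec x (Sum.inr i)‖ ^ 2 =
    (star (fun i => x (Sum.inl (Sum.inr i))) ⬝ᵥ
        (L.genMatrix₂ ζ).mulVec fun i => x (Sum.inl (Sum.inr i))).re +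
      ∑ i, ‖x (Sum.inr i)‖ ^ 2 := by
  have := energy_eq (L.isHermitian_genMatrix₂ ζ)
    (x := fun t i => (L.flowMatrix t ζ).mulVec x (Sum.inl (Sum.inr i)))
    (y := fun t i => (L.flowMatrix t ζ).mulVec x (Sum.inr i))
    (fun t i => by
      have h := L.hasDerivAt_flowMatrix_mulVec t ζ x (Sum.inl (Sum.inr i))
      rwa [genMatrix_mulVec₂] at h)
    (fun t i => by
      have h := L.hasDerivAt_flowMatrix_mulVec t ζ x (Sum.inr i)
      rwa [genMatrix_mulVec₃] at h) t
  simpa only [flowMatrix_zero, Matrix.one_mulVec] using this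

/-- The potential energy is nonnegative, so the conserved energy bounds the velocity. -/
theorem sq_norm_flow₃_le (ζ : Space n) (x : DataIdx d₁ d₂ → ℂ) (t : ℝ) (i : Fin d₂) :
    ‖(L.flowMatrix t ζ).mulVec x (Sum.inr i)‖ ^ 2 ≤
      (star (fun i => x (Sum.inl (Sum.inr i))) ⬝ᵥ
        (L.genMatrix₂ ζ).mulVec fun i => x (Sum.inl (Sum.inr i))).re +
      ∑ i, ‖x (Sum.inr i)‖ ^ 2 := by
  rw [← L.flow_energy ζ x t]
  have h1 := L.genMatrix₂_ge ζ fun i => (L.flowMatrix t ζ).mulVec x (Sum.inl (Sum.inr i))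
  have hα := L.α_pos
  have hμ := L.μ₀_nonneg
  have h2 : 0 ≤ L.α * (L.μ₀ + ‖(2 * Real.pi) • ζ‖ ^ (2 * L.r)) *
      ∑ i, ‖(L.flowMatrix t ζ).mulVec x (Sum.inl (Sum.inr i))‖ ^ 2 := by positivity
  have h3 := Finset.single_le_sum (f := fun i => ‖(L.flowMatrix t ζ).mulVec x (Sum.inr i)‖ ^ 2)
    (fun i _ => by positivity) (Finset.mem_univ i)
  linarith

/-- Where the lower bound of `P₂(iξ)` dominates the weight, the conserved energy bounds the
position. In the remaining region, of bounded weight and bounded times, the position is bounded by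
integrating the velocity, which costs a factor `T ^ 2` in the squares. -/
theorem exists_flow₂_bound (T : ℝ) : ∃ C, 0 ≤ C ∧ ∀ t : ℝ, (0 < L.μ₀ ∨ |t| ≤ T) →
    ∀ (ζ : Space n) (x : DataIdx d₁ d₂ → ℂ) (i : Fin d₂),
      japanese n m (2 * L.r) ζ * ‖(L.flowMatrix t ζ).mulVec x (Sum.inl (Sum.inr i))‖ ^ 2 ≤
        C * (japanese n m (2 * L.r) ζ * ‖x (Sum.inl (Sum.inr i))‖ ^ 2 +
          ((star (fun i => x (Sum.inl (Sum.inr i))) ⬝ᵥ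
            (L.genMatrix₂ ζ).mulVec fun i => x (Sum.inl (Sum.inr i))).re +
            ∑ i, ‖x (Sum.inr i)‖ ^ 2)) := by
  obtain ⟨C, hC0, hC⟩ := L.exists_lower_bound (m := m) T
  refine ⟨C + 2 + 2 * T ^ 2 * C, by positivity, fun t ht ζ x i => ?_⟩
  set E := (star (fun i => x (Sum.inl (Sum.inr i))) ⬝ᵥ
    (L.genMatrix₂ ζ).mulVec fun i => x (Sum.inl (Sum.inr i))).re + ∑ i, ‖x (Sum.inr i)‖ ^ 2 with hE
  have hE3 : ∀ τ, ‖(L.flowMatrix τ ζ).mulVec x (Sum.inr i)‖ ^ 2 ≤ E := fun τ =>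
    L.sq_norm_flow₃_le ζ x τ i
  have hE0 : 0 ≤ E := le_trans (by positivity) (hE3 0)
  set J := japanese n m (2 * L.r) ζ with hJ
  have hJ0 : 0 ≤ J := (japanese_pos _ _).le
  set X := ‖x (Sum.inl (Sum.inr i))‖ with hX
  set Y := ‖(L.flowMatrix t ζ).mulVec x (Sum.inl (Sum.inr i))‖ with hY
  rcases hC t ht ζ with h | ⟨h, hT⟩
  · have h1 := L.genMatrix₂_ge ζ fun i => (L.flowMatrix t ζ).mulVec x (Sum.inl (Sum.inr i))
    have h2 := L.flow_energy ζ x t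
    have h3 : 0 ≤ ∑ i, ‖(L.flowMatrix t ζ).mulVec x (Sum.inr i)‖ ^ 2 := by positivity
    have h4 := Finset.single_le_sum
      (f := fun i => ‖(L.flowMatrix t ζ).mulVec x (Sum.inl (Sum.inr i))‖ ^ 2)
      (fun i _ => by positivity) (Finset.mem_univ i)
    have hα := L.α_pos
    have hμ := L.μ₀_nonneg
    set κ := L.α * (L.μ₀ + ‖(2 * Real.pi) • ζ‖ ^ (2 * L.r)) with hκ
    have hκ0 : 0 ≤ κ := by positivity
    have h5 : κ * Y ^ 2 ≤ E := (mul_le_mul_of_nonneg_left h4 hκ0).trans (by linarith)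
    calc J * Y ^ 2 ≤ (C * κ) * Y ^ 2 := by gcongr
      _ = C * (κ * Y ^ 2) := by ring
      _ ≤ C * E := by gcongr
      _ ≤ _ := by
        have : 0 ≤ J * X ^ 2 := by positivity
        gcongr
        · have : 0 ≤ T ^ 2 * C := mul_nonneg (sq_nonneg T) hC0
          linarith
        · linarith
  · have h1 : ‖(L.flowMatrix t ζ).mulVec x (Sum.inl (Sum.inr i)) - x (Sum.inl (Sum.inr i))‖ ≤
        Real.sqrt E * |t| := by
      have h2 := Convex.norm_image_sub_le_of_norm_hasDerivWithin_le (s := univ) (x := (0 : ℝ))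
        (y := t) (C := Real.sqrt E)
        (f := fun t => (L.flowMatrix t ζ).mulVec x (Sum.inl (Sum.inr i)))
        (f' := fun t => (L.flowMatrix t ζ).mulVec x (Sum.inr i))
        (fun τ _ => by
          have h := L.hasDerivAt_flowMatrix_mulVec τ ζ x (Sum.inl (Sum.inr i))
          rw [genMatrix_mulVec₂] at h
          exact h.hasDerivWithinAt)
        (fun τ _ => Real.le_sqrt_of_sq_le (hE3 τ)) convex_univ (mem_univ _) (mem_univ _)
      simpa only [flowMatrix_zero, Matrix.one_mulVec, sub_zero, Real.norm_eq_abs] using h2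
    have h2 : Y ≤ X + Real.sqrt E * |t| := by
      have := norm_le_norm_add_norm_sub' ((L.flowMatrix t ζ).mulVec x (Sum.inl (Sum.inr i)))
        (x (Sum.inl (Sum.inr i)))
      linarith
    have h3 : Y ^ 2 ≤ 2 * X ^ 2 + 2 * T ^ 2 * E := by
      have h4 : Y ^ 2 ≤ (X + Real.sqrt E * |t|) ^ 2 := pow_le_pow_left₀ (norm_nonneg _) h2 2
      have h5 : (Real.sqrt E * |t|) ^ 2 ≤ E * T ^ 2 := by
        rw [mul_pow, Real.sq_sqrt hE0]
        have : |t| ^ 2 ≤ T ^ 2 := pow_le_pow_left₀ (abs_nonneg _) hT 2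
        gcongr
      nlinarith [sq_nonneg (X - Real.sqrt E * |t|)]
    have h6 : J * Y ^ 2 ≤ 2 * (J * X ^ 2) + 2 * T ^ 2 * (J * E) := by nlinarith
    have h7 : J * E ≤ C * E := by gcongr
    have h8 : 0 ≤ J * X ^ 2 := by positivity
    have h9 : 0 ≤ T ^ 2 := sq_nonneg T
    calc J * Y ^ 2 ≤ 2 * (J * X ^ 2) + 2 * T ^ 2 * (C * E) := by
          have := mul_le_mul_of_nonneg_left h7 (mul_nonneg zero_le_two h9)
          linarith
      _ ≤ _ := by
          have h10 := mul_nonneg (mul_nonneg h9 hC0) h8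
          have h11 := mul_nonneg hC0 h8
          have h12 := mul_nonneg hC0 hE0
          rw [← sub_nonneg]
          have e : (C + 2 + 2 * T ^ 2 * C) * (J * X ^ 2 + E) -
              (2 * (J * X ^ 2) + 2 * T ^ 2 * (C * E)) =
              C * (J * X ^ 2) + C * E + 2 * (T ^ 2 * C * (J * X ^ 2)) + 2 * E := by ring
          rw [e]
          positivity

/-- The symbol of the evolution is a multiplier of order `0`. -/
theorem exists_flow_bound (T : ℝ) : ∃ C, 0 ≤ C ∧ ∀ t : ℝ, (0 < L.μ₀ ∨ |t| ≤ T) →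
    ∀ (s : ℝ) (ζ : Space n) (i j : DataIdx d₁ d₂), ‖L.flowMatrix t ζ i j‖ ≤
      C * japanese n m (L.dataOrder s j - L.dataOrder s i) ζ := by
  obtain ⟨C₁, hC₁0, hC₁⟩ := L.exists_flow₂_bound (m := m) T
  obtain ⟨C₂, hC₂0, hC₂⟩ := L.exists_genMatrix₂_bound (m := m)
  -- The summands bound, in this order: the blocks of `u₁` and from velocity to velocity, then the
  -- blocks from position to velocity, from position to position, and from velocity to position.
  set D := 1 + Real.sqrt C₂ + Real.sqrt (C₁ * (1 + C₂)) + Real.sqrt C₁ with hD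
  have hD0 : 0 ≤ D := by positivity
  refine ⟨D, hD0, fun t ht s ζ i j => ?_⟩
  -- Column `j` of the symbol is the solution whose initial data are the `j`-th basis vector, so the
  -- conservation laws bound its entries.
  have hcol : L.flowMatrix t ζ i j = (L.flowMatrix t ζ).mulVec (Pi.single j 1) i := by
    rw [Matrix.mulVec_single_one]
    rfl
  rw [hcol]
  set x : DataIdx d₁ d₂ → ℂ := Pi.single j 1 with hx
  set w := japanese n m L.r ζ with hw
  have hw0 : 0 < w := japanese_pos _ _
  have hw2 : japanese n m (2 * L.r) ζ = w ^ 2 := japanese_sq _ _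
  have hE₃ := L.sq_norm_flow₃_le ζ x t
  have hE₂ := hC₁ t ht ζ x
  have hE₁ := L.flow_charge ζ x t
  have hle : ∀ {a b : ℝ}, 0 ≤ b → a ^ 2 ≤ b → a ≤ Real.sqrt b := fun _ h => Real.le_sqrt_of_sq_le h
  have h1 : ∀ k, ‖(L.flowMatrix t ζ).mulVec x (Sum.inl (Sum.inl k))‖ ^ 2 ≤
      ∑ i, ‖x (Sum.inl (Sum.inl i))‖ ^ 2 := fun k => by
    rw [← hE₁]
    exact Finset.single_le_sum
      (f := fun i => ‖(L.flowMatrix t ζ).mulVec x (Sum.inl (Sum.inl i))‖ ^ 2)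
      (fun i _ => by positivity) (Finset.mem_univ k)
  have hs1 : 0 ≤ Real.sqrt C₂ := Real.sqrt_nonneg _
  have hs2 : 0 ≤ Real.sqrt (C₁ * (1 + C₂)) := Real.sqrt_nonneg _
  have hs3 : 0 ≤ Real.sqrt C₁ := Real.sqrt_nonneg _
  have hneg : japanese n m (-L.r) ζ = w⁻¹ := by
    rw [← zero_sub, japanese_sub, japanese_zero, one_div]
  have zero_of : ∀ {a : ℂ} {u : ℝ}, ‖a‖ ^ 2 ≤ 0 → ‖a‖ ≤ D * japanese n m u ζ := by
    intro a u ha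
    have : ‖a‖ = 0 := by
      have := sq_nonneg ‖a‖
      exact pow_eq_zero_iff two_ne_zero |>.1 (le_antisymm ha this)
    rw [this]
    exact mul_nonneg hD0 (japanese_pos _ _).le
  have zero_of' : ∀ {a : ℂ} {u : ℝ}, w ^ 2 * ‖a‖ ^ 2 ≤ 0 → ‖a‖ ≤ D * japanese n m u ζ := by
    intro a u ha
    refine zero_of (le_of_mul_le_mul_left ?_ (pow_pos hw0 2))
    rwa [mul_zero]
  rcases j with (j | j) | j
  · have x1 : ∑ i, ‖x (Sum.inl (Sum.inl i))‖ ^ 2 = 1 := by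
      rw [Finset.sum_eq_single j]
      · simp [hx]
      · intro b _ hb
        simp [hx, hb]
      · simp
    have x2 : (fun i => x (Sum.inl (Sum.inr i))) = 0 := by
      funext i
      simp [hx]
    have x3 : ∀ i, x (Sum.inr i) = 0 := fun i => by simp [hx]
    simp only [x2, x3, star_zero, zero_dotProduct, Complex.zero_re, norm_zero, ne_eq,
      OfNat.ofNat_ne_zero, not_false_eq_true, zero_pow, Finset.sum_const_zero, add_zero] at hE₃ hE₂
    rcases i with (i | i) | i
    · simp only [dataOrder, Sum.elim_inl, sub_self, japanese_zero, mul_one]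
      have := h1 i
      rw [x1] at this
      have h3 := (sq_le_one_iff₀ (norm_nonneg _)).1 this
      linarith
    · have h4 := hE₂ i
      have h5 : x (Sum.inl (Sum.inr i)) = 0 := congrFun x2 i
      rw [h5, hw2] at h4
      exact zero_of' (h4.trans (by simp))
    · exact zero_of (hE₃ i)
  · have x1 : ∑ i, ‖x (Sum.inl (Sum.inl i))‖ ^ 2 = 0 := by
      simp [hx]
    have x2 : (fun i => x (Sum.inl (Sum.inr i))) = Pi.single j 1 := by
      funext i
      simp [hx, Pi.single_apply]
    have x3 : ∀ i, x (Sum.inr i) = 0 := fun i => by simp [hx]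
    have hq : (star (Pi.single j 1 : Fin d₂ → ℂ) ⬝ᵥ
        (L.genMatrix₂ ζ).mulVec (Pi.single j 1)).re ≤ C₂ * w ^ 2 := by
      rw [Matrix.mulVec_single_one, ← hw2]
      have e : star (Pi.single j 1 : Fin d₂ → ℂ) ⬝ᵥ (L.genMatrix₂ ζ).col j =
          L.genMatrix₂ ζ j j := by
        rw [← Pi.single_star, star_one, single_one_dotProduct]
        rfl
      rw [e]
      exact (Complex.re_le_norm _).trans (hC₂ ζ j j)
    simp only [x2, x3, norm_zero, ne_eq, OfNat.ofNat_ne_zero, not_false_eq_true, zero_pow,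
      Finset.sum_const_zero, add_zero] at hE₃ hE₂
    rcases i with (i | i) | i
    · exact zero_of ((h1 i).trans x1.le)
    · simp only [dataOrder, Sum.elim_inl, sub_self, japanese_zero, mul_one]
      have h4 := hE₂ i
      rw [hw2] at h4
      have h5 : ‖x (Sum.inl (Sum.inr i))‖ ^ 2 ≤ 1 := by
        have := congrFun x2 i
        rw [this, Pi.single_apply]
        split_ifs <;> simp
      have h6 : w ^ 2 * ‖(L.flowMatrix t ζ).mulVec x (Sum.inl (Sum.inr i))‖ ^ 2 ≤
          w ^ 2 * (C₁ * (1 + C₂)) := by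
        refine h4.trans ?_
        have : w ^ 2 * ‖x (Sum.inl (Sum.inr i))‖ ^ 2 ≤ w ^ 2 * 1 := by gcongr
        calc C₁ * _ ≤ C₁ * (w ^ 2 * 1 + C₂ * w ^ 2) := by gcongr
          _ = _ := by ring
      have h7 := le_of_mul_le_mul_left h6 (pow_pos hw0 2)
      have := hle (by positivity) h7
      linarith
    · have e : s - (s - (L.r : ℝ)) = L.r := by ring
      simp only [dataOrder, Sum.elim_inl, Sum.elim_inr, e]
      have h4 := hle (by positivity) ((hE₃ i).trans hq)
      rw [Real.sqrt_mul hC₂0, Real.sqrt_sq hw0.le] at h4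
      refine h4.trans (mul_le_mul_of_nonneg_right (by linarith) hw0.le)
  · have x1 : ∑ i, ‖x (Sum.inl (Sum.inl i))‖ ^ 2 = 0 := by
      simp [hx]
    have x2 : (fun i => x (Sum.inl (Sum.inr i))) = 0 := by
      funext i
      simp [hx]
    have x3 : ∑ i, ‖x (Sum.inr i)‖ ^ 2 = 1 := by
      rw [Finset.sum_eq_single j]
      · simp [hx]
      · intro b _ hb
        simp [hx, hb]
      · simp
    simp only [x2, x3, star_zero, zero_dotProduct, Complex.zero_re, zero_add] at hE₃ hE₂
    rcases i with (i | i) | i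
    · exact zero_of ((h1 i).trans x1.le)
    · have e : s - (L.r : ℝ) - s = -L.r := by ring
      simp only [dataOrder, Sum.elim_inl, Sum.elim_inr, e, hneg]
      have h4 := hE₂ i
      have h5 : x (Sum.inl (Sum.inr i)) = 0 := congrFun x2 i
      rw [h5, hw2] at h4
      simp only [norm_zero, ne_eq, OfNat.ofNat_ne_zero, not_false_eq_true, zero_pow, mul_zero,
        zero_add, mul_one, ← mul_pow] at h4
      have h6 := hle hC₁0 h4
      rw [← div_eq_mul_inv, le_div_iff₀ hw0, mul_comm]
      linarith
    · simp only [dataOrder, Sum.elim_inr, sub_self, japanese_zero, mul_one]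
      have h3 := (sq_le_one_iff₀ (norm_nonneg _)).1 (hE₃ i)
      linarith

end Bounds

end LinOp

/-! ## The evolution of Cauchy data -/

section ActsAs

variable {n : ℕ} {m : ℝ} [hm : Fact (0 < m)] {ι : Type} [Fintype ι] {σ σ' σ'' : ι → ℝ}

/-- Operators are identified by their symbols. The group law and the commutation of the evolution
with the generator and the inclusion thus reduce to matrix identities at each frequency. -/
theorem ActsAs.unique {A B : SobProd n m σ →L[ℝ] SobProd n m σ'} {a : Space n → Matrix ι ι ℂ}
    (hA : ActsAs A a) (hB : ActsAs B a) : A = B := by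
  ext1 c
  refine SobProd.ext_hat fun i => ?_
  filter_upwards [hA c i, hB c i] with ζ h1 h2
  rw [h1, h2]

theorem ActsAs.comp {A : SobProd n m σ →L[ℝ] SobProd n m σ'}
    {B : SobProd n m σ' →L[ℝ] SobProd n m σ''} {a b : Space n → Matrix ι ι ℂ}
    (hB : ActsAs B b) (hA : ActsAs A a) : ActsAs (B.comp A) fun ζ => b ζ * a ζ := by
  intro c i
  filter_upwards [hB (A c) i, ae_all_iff.2 fun j => hA c j] with ζ h1 h2
  rw [ContinuousLinearMap.comp_apply, h1]
  simp_rw [h2, Matrix.mul_apply, Finset.sum_mul, Finset.mul_sum]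
  rw [Finset.sum_comm]
  exact Finset.sum_congr rfl fun j _ => Finset.sum_congr rfl fun k _ => by ring

theorem ActsAs.sub {A B : SobProd n m σ →L[ℝ] SobProd n m σ'} {a b : Space n → Matrix ι ι ℂ}
    (hA : ActsAs A a) (hB : ActsAs B b) : ActsAs (A - B) fun ζ => a ζ - b ζ := by
  intro c i
  filter_upwards [hA c i, hB c i, Sob.hat_sub (A c i) (B c i)] with ζ h1 h2 h3
  change (A c i - B c i).hat ζ = _
  rw [h3, Pi.sub_apply, h1, h2, ← Finset.sum_sub_distrib]
  exact Finset.sum_congr rfl fun j _ => by rw [Matrix.sub_apply, sub_mul]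

theorem ActsAs.smul {A : SobProd n m σ →L[ℝ] SobProd n m σ'} {a : Space n → Matrix ι ι ℂ}
    (hA : ActsAs A a) (r : ℝ) : ActsAs (r • A) fun ζ => r • a ζ := by
  intro c i
  filter_upwards [hA c i, Sob.hat_smul r (A c i)] with ζ h1 h3
  change (r • A c i).hat ζ = _
  rw [h3, h1, Finset.mul_sum]
  exact Finset.sum_congr rfl fun j _ => by
    rw [Matrix.smul_apply, Complex.real_smul, mul_assoc]

theorem ActsAs.id [DecidableEq ι] :
    ActsAs (ContinuousLinearMap.id ℝ (SobProd n m σ)) fun _ => 1 := by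
  intro c i
  refine Eventually.of_forall fun ζ => ?_
  simp [Matrix.one_apply]

theorem ActsAs.congr {A : SobProd n m σ →L[ℝ] SobProd n m σ'} {a b : Space n → Matrix ι ι ℂ}
    (hA : ActsAs A a) (h : ∀ ζ, a ζ = b ζ) : ActsAs A b := by
  rwa [← funext h]

end ActsAs

namespace LinOp

variable {n d₁ d₂ : ℕ} (L : LinOp n d₁ d₂) {m : ℝ} [hm : Fact (0 < m)]

/-- Cauchy data, as families of elements of Sobolev spaces. -/
abbrev DataProd (m s : ℝ) : Type := SobProd n m (L.dataOrder s)

variable (s : ℝ)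

theorem isMatMult_flowMatrix (T : ℝ) : ∃ C, 0 ≤ C ∧ ∀ t : ℝ, (0 < L.μ₀ ∨ |t| ≤ T) →
    ∀ s, IsMatMult m (L.dataOrder s) (L.dataOrder s) C (L.flowMatrix t) := by
  obtain ⟨C, hC0, hC⟩ := L.exists_flow_bound (m := m) T
  exact ⟨C, hC0, fun t ht s => ⟨L.continuous_flowMatrix t, L.flowMatrix_neg t, hC t ht s⟩⟩

theorem exists_flow (t : ℝ) : ∃ A : L.DataProd m s →L[ℝ] L.DataProd m s,
    ActsAs A (L.flowMatrix t) := by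
  obtain ⟨C, -, hC⟩ := L.isMatMult_flowMatrix (m := m) |t|
  obtain ⟨A, hA, -⟩ := (hC t (Or.inr le_rfl) s).exists_clm
  exact ⟨A, hA⟩

/-- The evolution of Cauchy data under `L u = 0`. -/
def flow (m : ℝ) [Fact (0 < m)] (s t : ℝ) : L.DataProd m s →L[ℝ] L.DataProd m s :=
  (L.exists_flow s t).choose

theorem actsAs_flow (t : ℝ) : ActsAs (L.flow m s t) (L.flowMatrix t) :=
  (L.exists_flow s t).choose_spec

theorem exists_norm_flow_le (T : ℝ) : ∃ C, 0 ≤ C ∧ ∀ t : ℝ, (0 < L.μ₀ ∨ |t| ≤ T) →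
    ∀ c, ‖L.flow m s t c‖ ≤ C * ‖c‖ := by
  obtain ⟨C, hC0, hC⟩ := L.isMatMult_flowMatrix (m := m) T
  refine ⟨Fintype.card (DataIdx d₁ d₂) * C, by positivity, fun t ht c => ?_⟩
  obtain ⟨A, hA, hn⟩ := (hC t ht s).exists_clm
  rw [(L.actsAs_flow s t).unique hA]
  exact hn c

theorem flow_zero : L.flow m s 0 = ContinuousLinearMap.id ℝ _ :=
  (L.actsAs_flow s 0).unique (ActsAs.id.congr fun ζ => (L.flowMatrix_zero ζ).symm)

theorem flow_add (t t' : ℝ) (c : L.DataProd m s) :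
    L.flow m s (t + t') c = L.flow m s t (L.flow m s t' c) := by
  have := (L.actsAs_flow (m := m) s (t + t')).unique
    (((L.actsAs_flow s t).comp (L.actsAs_flow s t')).congr
      fun ζ => (L.flowMatrix_add t t' ζ).symm)
  rw [this]
  rfl

/-- The symbols converge at each frequency and are bounded uniformly for times near `t₀`; dominated
convergence gives continuity on each vector. -/
theorem continuous_flow (c : L.DataProd m s) : Continuous fun t => L.flow m s t c := by
  rw [continuous_iff_continuousAt]
  intro t₀
  obtain ⟨C, -, hC⟩ := L.exists_flow_bound (m := m) (|t₀| + 1)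
  refine tendsto_of_actsAs (C := C) (Eventually.of_forall fun t => L.actsAs_flow s t)
    (L.actsAs_flow s t₀) ?_ (hC t₀ (Or.inr (by linarith)) s) (fun ζ i j => ?_) c
  · have : ∀ᶠ t in 𝓝 t₀, |t| < |t₀| + 1 :=
      continuous_abs.continuousAt.eventually_lt continuousAt_const (by linarith)
    filter_upwards [this] with t ht
    exact hC t (Or.inr ht.le) s
  · have h := (L.hasDerivAt_flowMatrix_mulVec t₀ ζ (Pi.single j 1) i).continuousAt
    simp only [Matrix.mulVec_single_one, Matrix.col_apply] at h
    exact h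

theorem dataOrder_sub (i : DataIdx d₁ d₂) : L.dataOrder (s - L.r) i = L.dataOrder s i - L.r := by
  rcases i with i | i <;> rfl

theorem exists_gen : ∃ A : L.DataProd m s →L[ℝ] L.DataProd m (s - L.r),
    ActsAs A L.genMatrix := by
  obtain ⟨C, hC⟩ := L.isMatMult_genMatrix (m := m) s
  rw [← funext (L.dataOrder_sub s)] at hC
  obtain ⟨A, hA, -⟩ := hC.exists_clm
  exact ⟨A, hA⟩

/-- The generator of the evolution. -/
def gen (m : ℝ) [Fact (0 < m)] (s : ℝ) : L.DataProd m s →L[ℝ] L.DataProd m (s - L.r) :=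
  (L.exists_gen s).choose

theorem actsAs_gen : ActsAs (L.gen m s) L.genMatrix := (L.exists_gen s).choose_spec

theorem norm_one_apply_le {C : ℝ} (hC : 0 ≤ C)
    (h : ∀ ζ : Space n, japanese n m 0 ζ ≤ C * japanese n m L.r ζ) (ζ : Space n)
    (i j : DataIdx d₁ d₂) : ‖(1 : Matrix (DataIdx d₁ d₂) (DataIdx d₁ d₂) ℂ) i j‖ ≤
      C * japanese n m (L.dataOrder s j - L.dataOrder (s - L.r) i) ζ := by
  rw [Matrix.one_apply]
  split_ifs with e
  · rw [← e, L.dataOrder_sub, sub_sub_cancel, norm_one, ← japanese_zero (m := m) ζ]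
    exact h ζ
  · rw [norm_zero]
    exact mul_nonneg hC (japanese_pos _ _).le

theorem exists_inclData : ∃ A : L.DataProd m s →L[ℝ] L.DataProd m (s - L.r),
    ActsAs A fun _ => 1 := by
  obtain ⟨C, hC0, hC⟩ := japanese_le_of_le (n := n) (m := m) (s := L.r) (s' := 0)
    (Nat.cast_nonneg _)
  have : IsMatMult m (L.dataOrder s) (L.dataOrder (s - L.r)) C
      (fun _ : Space n => (1 : Matrix (DataIdx d₁ d₂) (DataIdx d₁ d₂) ℂ)) :=
    ⟨continuous_const, fun ζ i j => by simp [Matrix.one_apply, apply_ite (starRingEnd ℂ)],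
      L.norm_one_apply_le s hC0 hC⟩
  obtain ⟨A, hA, -⟩ := this.exists_clm
  exact ⟨A, hA⟩

/-- The inclusion of the spaces of Cauchy data. -/
def inclData (m : ℝ) [Fact (0 < m)] (s : ℝ) : L.DataProd m s →L[ℝ] L.DataProd m (s - L.r) :=
  (L.exists_inclData s).choose

theorem actsAs_inclData : ActsAs (L.inclData m s) fun _ => 1 := (L.exists_inclData s).choose_spec

theorem hat_inclData (c : L.DataProd m s) (i : DataIdx d₁ d₂) :
    (L.inclData m s c i).hat =ᵐ[volume] (c i).hat := by
  filter_upwards [L.actsAs_inclData s c i] with ζ h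
  rw [h]
  simp [Matrix.one_apply]

theorem toDistr_inclData (c : L.DataProd m s) (i : DataIdx d₁ d₂) :
    (L.inclData m s c i).toDistr = (c i).toDistr :=
  ((L.inclData m s c i).hasHat.congr (L.hat_inclData s c i)).unique (c i).hasHat

/-- It allows identities between data of order `s` to be proved in the larger spaces, where the
evolution is differentiable. -/
theorem inclData_injective : Function.Injective (L.inclData m s) := by
  intro c c' h
  refine SobProd.ext_hat fun i => ?_
  filter_upwards [L.hat_inclData s c i, L.hat_inclData s c' i] with ζ h1 h2
  rw [← h1, ← h2, h]

theorem inclData_flow (t : ℝ) (c : L.DataProd m s) :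
    L.inclData m s (L.flow m s t c) = L.flow m (s - L.r) t (L.inclData m s c) := by
  have h1 := (L.actsAs_inclData (m := m) s).comp (L.actsAs_flow s t)
  have h2 := (L.actsAs_flow (m := m) (s - L.r) t).comp (L.actsAs_inclData s)
  have := h1.unique (h2.congr fun ζ => by rw [one_mul, mul_one])
  exact congrArg (fun A => A c) this

theorem gen_flow (t : ℝ) (c : L.DataProd m s) :
    L.gen m s (L.flow m s t c) = L.flow m (s - L.r) t (L.gen m s c) := by
  have h1 := (L.actsAs_gen (m := m) s).comp (L.actsAs_flow s t)
  have h2 := (L.actsAs_flow (m := m) (s - L.r) t).comp (L.actsAs_gen s)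
  have := h1.unique (h2.congr fun ζ => (L.genMatrix_mul_flowMatrix t ζ).symm)
  exact congrArg (fun A => A c) this

/-- The evolution is strongly differentiable in the larger space. -/
theorem hasDerivAt_inclData_flow (c : L.DataProd m s) (t : ℝ) :
    HasDerivAt (fun t => L.inclData m s (L.flow m s t c)) (L.flow m (s - L.r) t (L.gen m s c))
      t := by
  rw [hasDerivAt_iff_tendsto_slope]
  obtain ⟨C, hC0, hC⟩ := L.exists_flow_bound (m := m) (|t| + 1)
  obtain ⟨D, hD⟩ := L.isMatMult_genMatrix (m := m) s
  rw [← funext (L.dataOrder_sub s)] at hD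
  have hd : ∀ ζ i j τ, HasDerivAt (fun τ => L.flowMatrix τ ζ i j)
      ((L.flowMatrix τ ζ * L.genMatrix ζ) i j) τ := by
    intro ζ i j τ
    have h := L.hasDerivAt_flowMatrix_mulVec τ ζ (Pi.single j 1) i
    simp only [Matrix.mulVec_mulVec, L.genMatrix_mul_flowMatrix] at h
    simpa only [Matrix.mulVec_single_one, Matrix.col_apply] using h
  -- The derivative of the symbol is a multiplier of order `0` times the generator, of order `r`.
  -- The bound is uniform for times near `t`, and the mean value inequality passes it on to the
  -- difference quotients, to which dominated convergence applies.
  have hb : ∀ τ, |τ| ≤ |t| + 1 → ∀ ζ i j, ‖(L.flowMatrix τ ζ * L.genMatrix ζ) i j‖ ≤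
      (Fintype.card (DataIdx d₁ d₂) * (C * D)) *
        japanese n m (L.dataOrder s j - L.dataOrder (s - L.r) i) ζ := by
    intro τ hτ ζ i j
    rw [Matrix.mul_apply]
    calc ‖∑ k, L.flowMatrix τ ζ i k * L.genMatrix ζ k j‖
        ≤ ∑ k : DataIdx d₁ d₂, (C * D) *
          japanese n m (L.dataOrder s j - L.dataOrder (s - L.r) i) ζ := by
          refine (norm_sum_le _ _).trans (Finset.sum_le_sum fun k _ => ?_)
          rw [norm_mul]
          have h1 := hC τ (Or.inr hτ) (s - L.r) ζ i k
          have h2 := hD.bound ζ k j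
          refine (mul_le_mul h1 h2 (norm_nonneg _) (mul_nonneg hC0 (japanese_pos _ _).le)).trans ?_
          have e : L.dataOrder s j - L.dataOrder (s - L.r) i =
            (L.dataOrder (s - L.r) k - L.dataOrder (s - L.r) i) +
              (L.dataOrder s j - L.dataOrder (s - L.r) k) := by ring
          rw [e, japanese_add]
          exact le_of_eq (by ring)
      _ = _ := by
          rw [Finset.sum_const, Finset.card_univ, nsmul_eq_mul]
          ring
  refine (tendsto_of_actsAs (C := Fintype.card (DataIdx d₁ d₂) * (C * D))
    (A := fun τ => (τ - t)⁻¹ • ((L.inclData m s).comp (L.flow m s τ) -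
      (L.inclData m s).comp (L.flow m s t)))
    (A₀ := (L.flow m (s - L.r) t).comp (L.gen m s))
    (a := fun τ ζ => (τ - t)⁻¹ • (L.flowMatrix τ ζ - L.flowMatrix t ζ))
    (a₀ := fun ζ => L.flowMatrix t ζ * L.genMatrix ζ) (l := 𝓝[≠] t)
    (Eventually.of_forall fun τ => ?_) ((L.actsAs_flow _ t).comp (L.actsAs_gen s)) ?_
    (hb t (by linarith)) (fun ζ i j => ?_) c).congr fun τ => ?_
  · have h := fun τ => (L.actsAs_inclData (m := m) s).comp (L.actsAs_flow s τ)
    exact (((h τ).sub (h t)).smul _).congr fun ζ => by rw [one_mul, one_mul]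
  · have hnear : ∀ᶠ τ in 𝓝[≠] t, |τ| < |t| + 1 :=
      (continuous_abs.continuousAt.eventually_lt continuousAt_const (by linarith)).filter_mono
        nhdsWithin_le_nhds
    filter_upwards [hnear, self_mem_nhdsWithin] with τ hτ hne ζ i j
    have hne' : τ - t ≠ 0 := sub_ne_zero.2 hne
    have h2 := Convex.norm_image_sub_le_of_norm_hasDerivWithin_le (s := Icc (-(|t| + 1)) (|t| + 1))
      (x := t) (y := τ) (f := fun τ => L.flowMatrix τ ζ i j)
      (f' := fun τ => (L.flowMatrix τ ζ * L.genMatrix ζ) i j)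
      (fun τ _ => (hd ζ i j τ).hasDerivWithinAt)
      (fun τ hτ => hb τ (abs_le.2 hτ) ζ i j) (convex_Icc _ _) (abs_le.1 (by linarith))
      (abs_le.1 hτ.le)
    rw [Matrix.smul_apply, Matrix.sub_apply, norm_smul, norm_inv,
      inv_mul_le_iff₀ (norm_pos_iff.2 hne')]
    rw [mul_comm ‖τ - t‖]
    exact h2
  · exact (hasDerivAt_iff_tendsto_slope.1 (hd ζ i j t)).congr fun τ => by
      rw [slope_def_module, Matrix.smul_apply, Matrix.sub_apply]
  · rw [slope_def_module]
    rfl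

end LinOp

/-! ## Weak derivatives in time -/

section WeakDeriv

/-- The product vanishes off the support of `η`, so nothing is required of `v` outside `U`. -/
theorem continuous_smul_of_tsupport {η : ℝ → ℝ} {U : Set ℝ} (hη : Continuous η)
    (hU : IsOpen U) (hs : tsupport η ⊆ U) {v : ℝ → ℂ} (hv : ContinuousOn v U) :
    Continuous fun t => (η t : ℂ) * v t := by
  refine continuous_of_tsupport fun t ht => ?_
  have h1 : t ∈ tsupport η := by
    refine closure_mono ?_ ht
    intro x hx hx'
    exact hx (by simp [hx'])
  exact (Complex.continuous_ofReal.comp hη).continuousAt.mul (hv.continuousAt (hU.mem_nhds (hs h1)))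

theorem integrable_smul_of_tsupport {η : ℝ → ℝ} {U : Set ℝ} (hη : Continuous η)
    (hc : HasCompactSupport η) (hU : IsOpen U) (hs : tsupport η ⊆ U) {v : ℝ → ℂ}
    (hv : ContinuousOn v U) : Integrable fun t => (η t : ℂ) * v t := by
  refine (continuous_smul_of_tsupport hη hU hs hv).integrable_of_hasCompactSupport ?_
  exact (hc.comp_left (g := fun x : ℝ => (x : ℂ)) Complex.ofReal_zero).mul_right

/-- Integration by parts against test functions. -/
theorem integral_deriv_smul_add {η : ℝ → ℝ} {U : Set ℝ} (hη : ContDiff ℝ ∞ η)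
    (hc : HasCompactSupport η) (hU : IsOpen U) (hs : tsupport η ⊆ U) {v v' : ℝ → ℂ}
    (hv : ∀ t ∈ U, HasDerivAt v (v' t) t) (hv' : ContinuousOn v' U) :
    Integrable (fun t => ((deriv η t : ℝ) : ℂ) * v t) ∧ Integrable (fun t => (η t : ℂ) * v' t) ∧
      ∫ t, ((deriv η t : ℝ) : ℂ) * v t = -∫ t, (η t : ℂ) * v' t := by
  have hvc : ContinuousOn v U := fun t ht => (hv t ht).continuousAt.continuousWithinAt
  have hs' : tsupport (deriv η) ⊆ U :=
    (closure_minimal (support_deriv_subset (f := η)) (isClosed_tsupport η)).trans hs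
  have i1 := integrable_smul_of_tsupport (hη.continuous_deriv (by simp)) hc.deriv hU hs' hvc
  have i2 := integrable_smul_of_tsupport hη.continuous hc hU hs hv'
  have i3 := integrable_smul_of_tsupport hη.continuous hc hU hs hvc
  refine ⟨i1, i2, ?_⟩
  rw [eq_neg_iff_add_eq_zero, ← integral_add i1 i2]
  refine integral_eq_zero_of_hasDerivAt_of_integrable (f := fun t => (η t : ℂ) * v t)
    (fun t => ?_) (i1.add i2) i3
  have hηd : HasDerivAt (fun t => (η t : ℂ)) ((deriv η t : ℝ) : ℂ) t :=
    ((hη.differentiable (by simp)) t).hasDerivAt.ofReal_comp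
  by_cases ht : t ∈ tsupport η
  · exact hηd.mul (hv t (hs ht))
  · have h0 : η =ᶠ[𝓝 t] 0 := notMem_tsupport_iff_eventuallyEq.1 ht
    have h1 : (fun t => (η t : ℂ) * v t) =ᶠ[𝓝 t] fun _ => 0 := by
      filter_upwards [h0] with τ hτ
      simp [hτ]
    have h2 : deriv η t = 0 := by
      rw [h0.deriv_eq]
      simp
    have h3 : η t = 0 := h0.self_of_nhds
    have e : ((deriv η t : ℝ) : ℂ) * v t + (η t : ℂ) * v' t = 0 := by simp [h2, h3]
    rw [e]
    exact (hasDerivAt_const t (0 : ℂ)).congr_of_eventuallyEq h1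

/-- Primitives of test functions with integral zero are test functions. -/
theorem exists_primitive_of_integral_eq_zero {φ : ℝ → ℝ} {a b : ℝ} (hab : a ≤ b)
    (hφ : ContDiff ℝ ∞ φ)
    (hs : Function.support φ ⊆ Icc a b) (hi : ∫ t, φ t = 0) :
    ∃ η : ℝ → ℝ, ContDiff ℝ ∞ η ∧ HasCompactSupport η ∧ tsupport η ⊆ Icc a b ∧ deriv η = φ := by
  set η : ℝ → ℝ := fun t => ∫ τ in a..t, φ τ with hη
  have hd : ∀ t, HasDerivAt η (φ t) t := fun t =>
    (hφ.continuous.integral_hasStrictDerivAt a t).hasDerivAt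
  have hd' : deriv η = φ := funext fun t => (hd t).deriv
  have hφ0 : ∀ t, t ∉ Icc a b → φ t = 0 := fun t ht => by
    by_contra h
    exact ht (hs h)
  have hts : tsupport η ⊆ Icc a b := by
    refine closure_minimal (fun t ht => ?_) isClosed_Icc
    by_contra hn
    apply ht
    rw [mem_Icc, not_and_or, not_le, not_le] at hn
    rcases hn with h | h
    · change ∫ τ in a..t, φ τ = 0
      rw [intervalIntegral.integral_symm, neg_eq_zero]
      rw [intervalIntegral.integral_of_le h.le]
      rw [← integral_Ico_eq_integral_Ioc]
      refine setIntegral_eq_zero_of_forall_eq_zero fun τ hτ => hφ0 τ fun hh => ?_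
      exact absurd hτ.2 (not_lt.2 hh.1)
    · change ∫ τ in a..t, φ τ = 0
      rw [intervalIntegral.integral_of_le (hab.trans h.le), ← integral_Icc_eq_integral_Ioc,
        setIntegral_eq_integral_of_forall_compl_eq_zero, hi]
      intro τ hτ
      refine hφ0 τ fun hh => hτ ⟨hh.1, hh.2.trans h.le⟩
  refine ⟨η, ?_, IsCompact.of_isClosed_subset isCompact_Icc (isClosed_tsupport η) hts, hts, hd'⟩
  rw [contDiff_infty_iff_deriv, hd']
  exact ⟨fun t => (hd t).differentiableAt, hφ⟩

/-- The lemma of du Bois-Reymond. -/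
theorem eq_of_integral_deriv_mul_eq_zero {f : ℝ → ℂ} {a b : ℝ} (hf : ContinuousOn f (Ioo a b))
    (h : ∀ η : ℝ → ℝ, ContDiff ℝ ∞ η → HasCompactSupport η → tsupport η ⊆ Ioo a b →
      ∫ t, ((deriv η t : ℝ) : ℂ) * f t = 0) {t t' : ℝ} (ht : t ∈ Ioo a b) (ht' : t' ∈ Ioo a b) :
    f t = f t' := by
  obtain ⟨a', ha', ha2⟩ := exists_between (lt_min ht.1 ht'.1)
  obtain ⟨b', hb2, hb'⟩ := exists_between (max_lt ht.2 ht'.2)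
  rw [lt_min_iff] at ha2
  rw [max_lt_iff] at hb2
  have hab' : a' < b' := ha2.1.trans hb2.1
  have hsub : Icc a' b' ⊆ Ioo a b := fun x hx => ⟨ha'.trans_le hx.1, hx.2.trans_lt hb'⟩
  -- a normalized test function
  let χ : ContDiffBump ((a' + b') / 2) := ⟨(b' - a') / 4, (b' - a') / 2, by linarith, by linarith⟩
  set χ₀ : ℝ → ℝ := χ.normed volume with hχ₀
  have hχd : ContDiff ℝ ∞ χ₀ := χ.contDiff_normed
  have hχs : Function.support χ₀ ⊆ Icc a' b' := by
    rw [hχ₀, χ.support_normed_eq]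
    intro x hx
    have hx1 : |x - (a' + b') / 2| < (b' - a') / 2 := hx
    rw [abs_lt] at hx1
    constructor <;> linarith
  have hχc : HasCompactSupport χ₀ := χ.hasCompactSupport_normed
  have hχi : ∫ t, χ₀ t = 1 := χ.integral_normed
  have hχts : tsupport χ₀ ⊆ Ioo a b := (closure_minimal hχs isClosed_Icc).trans hsub
  set c : ℂ := ∫ t, (χ₀ t : ℂ) * f t with hc
  -- Subtracting `(∫ g) χ₀` from `g` leaves a function of integral zero, hence the derivative of a
  -- test function. Therefore `∫ g f = (∫ g) c`, so `f - c` is orthogonal to every `g`.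
  have key : ∀ g : ℝ → ℝ, ContDiff ℝ ∞ g → HasCompactSupport g → tsupport g ⊆ Ioo a' b' →
      ∫ t, g t • (f t - c) = 0 := by
    intro g hg hgc hgs
    have hgs' : Function.support g ⊆ Icc a' b' :=
      (subset_tsupport g).trans (hgs.trans Ioo_subset_Icc_self)
    have hgi : Integrable g := hg.continuous.integrable_of_hasCompactSupport hgc
    have hχint : Integrable χ₀ := hχd.continuous.integrable_of_hasCompactSupport hχc
    set I := ∫ t, g t with hI
    obtain ⟨η, h1, h2, h3, h4⟩ := exists_primitive_of_integral_eq_zero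
      (φ := fun t => g t - I * χ₀ t) hab'.le (hg.sub (contDiff_const.mul hχd))
      (fun x hx => by
        by_contra hn
        apply hx
        have e1 : g x = 0 := by
          by_contra h
          exact hn (hgs' h)
        have e2 : χ₀ x = 0 := by
          by_contra h
          exact hn (hχs h)
        simp [e1, e2])
      (by
        rw [integral_sub hgi (hχint.const_mul _), integral_const_mul, hχi]
        simp [hI])
    have h5 := h η h1 h2 (h3.trans hsub)
    rw [h4] at h5
    have i1 : Integrable fun t => (g t : ℂ) * f t := integrable_smul_of_tsupport hg.continuous hgc
      isOpen_Ioo (hgs.trans (Ioo_subset_Icc_self.trans hsub)) hf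
    have i2 : Integrable fun t => (χ₀ t : ℂ) * f t := integrable_smul_of_tsupport hχd.continuous hχc
      isOpen_Ioo hχts hf
    have e3 : ∫ t, ((g t - I * χ₀ t : ℝ) : ℂ) * f t = (∫ t, (g t : ℂ) * f t) - I * c := by
      rw [hc, ← integral_const_mul, ← integral_sub i1 (i2.const_mul _)]
      refine integral_congr_ae (Eventually.of_forall fun t => ?_)
      simp only
      push_cast
      ring
    rw [e3] at h5
    have e4 : ∫ t, g t • (f t - c) = (∫ t, (g t : ℂ) * f t) - I * c := by
      have e5 : (I : ℂ) * c = ∫ t, (g t : ℂ) * c := by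
        rw [integral_mul_const, integral_complex_ofReal]
      have i3 : Integrable fun t => (g t : ℂ) * c := hgi.ofReal.mul_const c
      rw [e5, ← integral_sub i1 i3]
      refine integral_congr_ae (Eventually.of_forall fun t => ?_)
      simp only [Complex.real_smul]
      ring
    rw [e4, h5]
  have hloc : LocallyIntegrableOn (fun t => f t - c) (Ioo a' b') :=
    ((hf.mono (Ioo_subset_Icc_self.trans hsub)).sub continuousOn_const).locallyIntegrableOn
      measurableSet_Ioo
  have hae := isOpen_Ioo.ae_eq_zero_of_integral_contDiff_smul_eq_zero hloc key
  have heq : EqOn (fun t => f t - c) (fun _ => 0) (Ioo a' b') := by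
    refine Measure.eqOn_open_of_ae_eq (μ := volume) ?_ isOpen_Ioo
      ((hf.mono (Ioo_subset_Icc_self.trans hsub)).sub continuousOn_const) continuousOn_const
    rw [EventuallyEq, ae_restrict_iff' measurableSet_Ioo]
    exact hae
  have e1 := heq (show t ∈ Ioo a' b' from ⟨ha2.1, hb2.1⟩)
  have e2 := heq (show t' ∈ Ioo a' b' from ⟨ha2.2, hb2.2⟩)
  simp only at e1 e2
  rw [sub_eq_zero.1 e1, sub_eq_zero.1 e2]

/-- Continuous functions with a continuous weak derivative. -/
theorem eq_add_integral_of_weak {p q : ℝ → ℂ} {a b : ℝ} (hab : a < b)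
    (hp : ContinuousOn p (Icc a b)) (hq : Continuous q)
    (h : ∀ η : ℝ → ℝ, ContDiff ℝ ∞ η → HasCompactSupport η → tsupport η ⊆ Ioo a b →
      ∫ t, ((deriv η t : ℝ) : ℂ) * p t = -∫ t, (η t : ℂ) * q t) {t : ℝ} (ht : t ∈ Icc a b) :
    p t = p a + ∫ τ in a..t, q τ := by
  have hQ : ∀ t, HasDerivAt (fun t => ∫ τ in a..t, q τ) (q t) t := fun t =>
    (hq.integral_hasStrictDerivAt a t).hasDerivAt
  have hQc : Continuous fun t => ∫ τ in a..t, q τ :=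
    continuous_iff_continuousAt.2 fun t => (hQ t).continuousAt
  have hfc : ContinuousOn (fun t => p t - ∫ τ in a..t, q τ) (Icc a b) := hp.sub hQc.continuousOn
  have h1 : ∀ t ∈ Ioo a b, ∀ t' ∈ Ioo a b,
      p t - ∫ τ in a..t, q τ = p t' - ∫ τ in a..t', q τ := by
    intro t ht t' ht'
    refine eq_of_integral_deriv_mul_eq_zero (f := fun t => p t - ∫ τ in a..t, q τ)
      (hfc.mono Ioo_subset_Icc_self) (fun η h1 h2 h3 => ?_) ht ht'
    obtain ⟨i1, i2, i3⟩ := integral_deriv_smul_add h1 h2 isOpen_univ (subset_univ _)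
      (fun t _ => hQ t) hq.continuousOn
    have hs' : tsupport (deriv η) ⊆ Ioo a b :=
      (closure_minimal (support_deriv_subset (f := η)) (isClosed_tsupport η)).trans h3
    have i4 := integrable_smul_of_tsupport (h1.continuous_deriv (by simp)) h2.deriv isOpen_Ioo hs'
      (hp.mono Ioo_subset_Icc_self)
    simp only [mul_sub]
    rw [integral_sub i4 i1, h η h1 h2 h3, i3, sub_self]
  obtain ⟨c, hc⟩ := exists_between hab
  have h2 : EqOn (fun t => p t - ∫ τ in a..t, q τ) (fun _ => p c - ∫ τ in a..c, q τ)
      (Icc a b) := by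
    refine EqOn.of_subset_closure (s := Ioo a b) (fun t ht => h1 t ht c hc) hfc continuousOn_const
      Ioo_subset_Icc_self ?_
    rw [closure_Ioo hab.ne]
  have e1 := h2 ht
  have e2 := h2 (left_mem_Icc.2 hab.le)
  simp only [intervalIntegral.integral_same, sub_zero] at e1 e2
  rw [e2, ← e1]
  ring

variable {n : ℕ} {m : ℝ} [hm : Fact (0 < m)] {s : ℝ}

/-- Continuous functions with values in `H^s` with a continuous weak derivative. -/
theorem Sob.hasDerivWithinAt_of_weak {y g : ℝ → Sob n m s} {a b : ℝ} (hab : a < b)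
    (hg : ContinuousOn g (Icc a b))
    (hy : ∀ k, ContinuousOn (fun t => testCLM k (y t)) (Icc a b))
    (h : ∀ k, ∀ η : ℝ → ℝ, ContDiff ℝ ∞ η → HasCompactSupport η → tsupport η ⊆ Ioo a b →
      ∫ t, ((deriv η t : ℝ) : ℂ) * testCLM k (y t) = -∫ t, (η t : ℂ) * testCLM k (g t))
    {t : ℝ} (ht : t ∈ Icc a b) : HasDerivWithinAt y (g t) (Icc a b) t := by
  set g' : ℝ → Sob n m s := fun t => g (projIcc a b hab.le t) with hg'
  have hg'c : Continuous g' := hg.comp_continuous (continuous_subtype_val.comp continuous_projIcc)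
    fun t => (projIcc a b hab.le t).2
  have hgg : ∀ t ∈ Icc a b, g' t = g t := fun t ht => by
    rw [hg']
    simp only
    rw [projIcc_of_mem hab.le ht]
  -- Elements of `H^s` are determined by their values on test functions, so the scalar statement
  -- suffices. The primitive of a continuous function is then differentiable in the norm of `H^s`.
  have e : ∀ t ∈ Icc a b, y t = y a + ∫ τ in a..t, g' τ := by
    intro t ht
    refine ext_test fun k => ?_
    rw [map_add, ← ContinuousLinearMap.intervalIntegral_comp_comm _
      (hg'c.intervalIntegrable _ _)]
    refine eq_add_integral_of_weak hab (hy k) ((testCLM k).continuous.comp hg'c)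
      (fun η h1 h2 h3 => ?_) ht
    rw [h k η h1 h2 h3]
    congr 1
    refine integral_congr_ae (Eventually.of_forall fun τ => ?_)
    simp only
    by_cases hτ : τ ∈ Icc a b
    · rw [Function.comp_apply, hgg τ hτ]
    · rw [image_eq_zero_of_notMem_tsupport fun hh => hτ (Ioo_subset_Icc_self (h3 hh))]
      simp
  have h1 : HasDerivWithinAt (fun t => y a + ∫ τ in a..t, g' τ) (g t) (Icc a b) t := by
    rw [← hgg t ht]
    exact ((hg'c.integral_hasStrictDerivAt a t).hasDerivAt.const_add _).hasDerivWithinAt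
  exact h1.congr e (e t ht)

end WeakDeriv

/-! ## Cauchy data of weak solutions -/

namespace HasHat

theorem neg {n : ℕ} {T : Distr n} {F : Space n → ℂ} (h : HasHat T F) :
    HasHat (-T) fun ζ => -F ζ := by
  have := h.smul (-1)
  convert this using 1
  · ext k
    simp
  · funext ζ
    simp

end HasHat

namespace LinOp

variable {n d₁ d₂ : ℕ} (L : LinOp n d₁ d₂) {m s : ℝ} [hm : Fact (0 < m)]

/-- The components `u₁|_t`, `u₂|_t` of Cauchy data. -/
def posComp (k : Comp d₁ d₂) : L.DataProd m s →L[ℝ] Sob n m s :=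
  PiLp.proj 1 (𝕜 := ℝ) (fun i => Sob n m (L.dataOrder s i)) (Sum.inl k)

/-- The components `∂₀u₂|_t` of Cauchy data. -/
def velComp (k : Fin d₂) : L.DataProd m s →L[ℝ] Sob n m (s - L.r) :=
  PiLp.proj 1 (𝕜 := ℝ) (fun i => Sob n m (L.dataOrder s i)) (Sum.inr k)

/-- Cauchy data with given components. -/
def mkData (p : Comp d₁ d₂ → Sob n m s) (v : Fin d₂ → Sob n m (s - L.r)) : L.DataProd m s :=
  WithLp.toLp 1 fun k => Sum.rec (motive := fun k => Sob n m (L.dataOrder s k)) p v k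

variable {L} in
theorem data_ext {c c' : L.DataProd m s} (h₁ : ∀ k, L.posComp k c = L.posComp k c')
    (h₂ : ∀ k, L.velComp k c = L.velComp k c') : c = c' := by
  ext k
  rcases k with k | k
  · exact h₁ k
  · exact h₂ k

theorem norm_data_eq (c : L.DataProd m s) :
    ‖c‖ = ∑ k, ‖L.posComp k c‖ + ∑ k, ‖L.velComp k c‖ := by
  rw [PiLp.norm_eq_of_L1, Fintype.sum_sum_type]
  rfl

/-- The two descriptions of Cauchy data. -/
def toData : L.Cau m s ≃ₗᵢ[ℝ] L.DataProd m s where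
  toFun c := L.mkData (fun k => c.fst k) fun k => c.snd k
  invFun c := WithLp.toLp 1 (WithLp.toLp 1 fun k => L.posComp k c, WithLp.toLp 1 fun k => L.velComp k c)
  map_add' c c' := data_ext (fun _ => rfl) fun _ => rfl
  map_smul' a c := data_ext (fun _ => rfl) fun _ => rfl
  left_inv c := rfl
  right_inv c := data_ext (fun _ => rfl) fun _ => rfl
  norm_map' c := by
    rw [norm_data_eq]
    have h : ‖c‖ = ‖c.fst‖ + ‖c.snd‖ := WithLp.prod_norm_eq_of_L1 c
    rw [h, PiLp.norm_eq_of_L1, PiLp.norm_eq_of_L1]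
    rfl

theorem posComp_toData (c : L.Cau m s) (k : Comp d₁ d₂) : L.posComp k (L.toData c) = c.fst k := rfl

theorem velComp_toData (c : L.Cau m s) (k : Fin d₂) : L.velComp k (L.toData c) = c.snd k := rfl

theorem posComp_inclData (c : L.DataProd m s) (k : Comp d₁ d₂) :
    L.posComp k (L.inclData m s c) = Sob.incl (L.sub_le s) (L.posComp k c) := by
  apply Sob.ext_toDistr
  rw [Sob.toDistr_incl]
  exact L.toDistr_inclData s c (Sum.inl k)

theorem velComp_inclData (c : L.DataProd m s) (k : Fin d₂) :
    (L.velComp k (L.inclData m s c)).toDistr = (L.velComp k c).toDistr :=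
  L.toDistr_inclData s c (Sum.inr k)

theorem hat_posComp_gen₁ (c : L.DataProd m s) (i : Fin d₁) :
    (L.posComp (Sum.inl i) (L.gen m s c)).hat =ᵐ[volume] fun ζ =>
      ∑ j, L.genMatrix₁ ζ i j * (L.posComp (Sum.inl j) c).hat ζ := by
  have h := L.actsAs_gen s c (Sum.inl (Sum.inl i))
  have e := fun ζ => L.genMatrix_mulVec₁ ζ (fun k => (c k).hat ζ) i
  exact h.trans (Eventually.of_forall fun ζ => e ζ)

theorem hat_posComp_gen₂ (c : L.DataProd m s) (i : Fin d₂) :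
    (L.posComp (Sum.inr i) (L.gen m s c)).hat =ᵐ[volume] (L.velComp i c).hat := by
  have h := L.actsAs_gen s c (Sum.inl (Sum.inr i))
  have e := fun ζ => L.genMatrix_mulVec₂ ζ (fun k => (c k).hat ζ) i
  exact h.trans (Eventually.of_forall fun ζ => e ζ)

theorem hat_velComp_gen (c : L.DataProd m s) (i : Fin d₂) :
    (L.velComp i (L.gen m s c)).hat =ᵐ[volume] fun ζ =>
      -∑ j, L.genMatrix₂ ζ i j * (L.posComp (Sum.inr j) c).hat ζ := by
  have h := L.actsAs_gen s c (Sum.inr i)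
  have e := fun ζ => L.genMatrix_mulVec₃ ζ (fun k => (c k).hat ζ) i
  exact h.trans (Eventually.of_forall fun ζ => e ζ)

theorem toDistr_posComp_gen₁ (c : L.DataProd m s) (i : Fin d₁) :
    (L.posComp (Sum.inl i) (L.gen m s c)).toDistr = -∑ k, L.γ₀⁻¹ i k •
      ∑ j, polyD (L.P₁ k j) (L.posComp (Sum.inl j) c).toDistr := by
  refine ((L.posComp (Sum.inl i) (L.gen m s c)).hasHat.congr (L.hat_posComp_gen₁ c i)).unique ?_
  have h := (HasHat.sum (S := Finset.univ) fun k _ => (HasHat.sum (S := Finset.univ) fun j _ =>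
    (L.posComp (Sum.inl j) c).hasHat.polyD (L.P₁ k j)).smul (L.γ₀⁻¹ i k)).neg
  convert h using 1
  funext ζ
  simp only [genMatrix₁, Matrix.neg_apply, Matrix.mul_apply, Matrix.map_apply, symbolMatrix,
    Finset.sum_apply, neg_mul, Finset.sum_neg_distrib, Finset.sum_mul, Finset.mul_sum]
  rw [Finset.sum_comm]
  simp only [mul_assoc]

theorem toDistr_posComp_gen₂ (c : L.DataProd m s) (i : Fin d₂) :
    (L.posComp (Sum.inr i) (L.gen m s c)).toDistr = (L.velComp i c).toDistr :=
  ((L.posComp (Sum.inr i) (L.gen m s c)).hasHat.congr (L.hat_posComp_gen₂ c i)).unique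
    (L.velComp i c).hasHat

theorem toDistr_velComp_gen (c : L.DataProd m s) (i : Fin d₂) :
    (L.velComp i (L.gen m s c)).toDistr =
      -∑ j, polyD (L.P₂ i j) (L.posComp (Sum.inr j) c).toDistr := by
  refine ((L.velComp i (L.gen m s c)).hasHat.congr (L.hat_velComp_gen c i)).unique ?_
  have h := (HasHat.sum (S := Finset.univ) fun j _ =>
    (L.posComp (Sum.inr j) c).hasHat.polyD (L.P₂ i j)).neg
  convert h using 1
  funext ζ
  simp only [genMatrix₂, symbolMatrix, Matrix.map_apply, Finset.sum_apply]

theorem γ₀_mul_inv (k j : Fin d₁) : ∑ i, L.γ₀⁻¹ k i * L.γ₀ i j = if k = j then 1 else 0 := by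
  have h := Matrix.nonsing_inv_mul L.γ₀ L.γ₀_inv
  have := congrFun (congrFun h k) j
  rwa [Matrix.mul_apply, Matrix.one_apply] at this

theorem γ₀_inv_mul (k j : Fin d₁) : ∑ i, L.γ₀ k i * L.γ₀⁻¹ i j = if k = j then 1 else 0 := by
  have h := Matrix.mul_nonsing_inv L.γ₀ L.γ₀_inv
  have := congrFun (congrFun h k) j
  rwa [Matrix.mul_apply, Matrix.one_apply] at this

/-! ### Weak solutions satisfy the evolution equation -/

section Duhamel

variable {J : Set ℝ} {u : ℝ → SobVec n m s (Comp d₁ d₂)} {F : ℝ → Comp d₁ d₂ → Distr n}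
  {G : ℝ → L.DataProd m s} {a b : ℝ}

theorem continuousOn_cauchyData (hJ : UniqueDiffOn ℝ J) (hu : L.MemF J u) :
    ContinuousOn (L.cauchyData J u) J := by
  have h2 : ∀ i, ContinuousOn (derivWithin
      (fun τ => Sob.incl (L.sub_le s) (u τ (Sum.inr i))) J) J := fun i =>
    (hu.2 (Sum.inr i)).continuousOn_derivWithin hJ le_rfl
  have h3 : ContinuousOn (fun t => (WithLp.toLp 1 fun i =>
      derivWithin (fun τ => Sob.incl (L.sub_le s) (u τ (Sum.inr i))) J t :
        SobVec n m (s - L.r) (Fin d₂))) J :=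
    (PiLp.continuous_toLp 1 _).comp_continuousOn (continuousOn_pi.2 h2)
  exact (WithLp.prod_continuous_toLp 1 _ _).comp_continuousOn (hu.1.prodMk h3)

/-- The time derivative of the Cauchy data of a weak solution. -/
theorem hasDerivWithinAt_inclData (hJ : UniqueDiffOn ℝ J) (hu : L.MemF J u)
    (hw : L.WeakEq J (distrs u) F) (hab : a < b) (hI : Icc a b ⊆ J)
    (hG : ContinuousOn G (Icc a b))
    (hG₁ : ∀ t ∈ Icc a b, ∀ i, (L.posComp (Sum.inl i) (G t)).toDistr =
      ∑ j, L.γ₀⁻¹ i j • F t (Sum.inl j))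
    (hG₂ : ∀ t ∈ Icc a b, ∀ i, (L.posComp (Sum.inr i) (G t)).toDistr = 0)
    (hG₃ : ∀ t ∈ Icc a b, ∀ i, (L.velComp i (G t)).toDistr = F t (Sum.inr i))
    {t : ℝ} (ht : t ∈ Icc a b) :
    HasDerivWithinAt (fun t => L.inclData m s (L.toData (L.cauchyData J u t)))
      (L.gen m s (L.toData (L.cauchyData J u t)) - L.inclData m s (G t)) (Icc a b) t := by
  have hIJ : Ioo a b ⊆ interior J :=
    interior_maximal (Ioo_subset_Icc_self.trans hI) isOpen_Ioo
  have hc : ContinuousOn (fun t => L.toData (L.cauchyData J u t)) (Icc a b) :=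
    L.toData.continuous.comp_continuousOn ((L.continuousOn_cauchyData hJ hu).mono hI)
  set g : ℝ → L.DataProd m (s - L.r) := fun t =>
    L.gen m s (L.toData (L.cauchyData J u t)) - L.inclData m s (G t) with hg
  have hgc : ContinuousOn g (Icc a b) :=
    ((L.gen m s).continuous.comp_continuousOn hc).sub
      ((L.inclData m s).continuous.comp_continuousOn hG)
  have hic : ContinuousOn (fun t => L.inclData m s (L.toData (L.cauchyData J u t))) (Icc a b) :=
    (L.inclData m s).continuous.comp_continuousOn hc
  have hinc : ∀ t k, L.posComp k (L.inclData m s (L.toData (L.cauchyData J u t))) =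
      Sob.incl (L.sub_le s) (u t k) := fun t k => L.posComp_inclData _ k
  -- the velocity is the derivative of the position
  have hvel : ∀ t ∈ J, ∀ i, HasDerivWithinAt (fun t => Sob.incl (L.sub_le s) (u t (Sum.inr i)))
      (L.velComp i (L.toData (L.cauchyData J u t))) J t := fun t ht i =>
    ((hu.2 (Sum.inr i)).differentiableOn one_ne_zero t ht).hasDerivWithinAt
  have hG₁' : ∀ i, ∀ t ∈ Icc a b, ∀ k, (L.posComp (Sum.inl i) (g t)).toDistr k =
      -∑ j, (L.γ₀⁻¹ i j : ℂ) * (∑ l, polyD (L.P₁ j l) (u t (Sum.inl l)).toDistr k +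
        F t (Sum.inl j) k) := by
    intro i t ht k
    have e1 : (L.posComp (Sum.inl i) (L.inclData m s (G t))).toDistr =
        (L.posComp (Sum.inl i) (G t)).toDistr := by
      rw [posComp_inclData, Sob.toDistr_incl]
    simp only [hg, map_sub, toDistr_posComp_gen₁, e1, hG₁ t ht]
    simp only [posComp_toData]
    change -((∑ j, L.γ₀⁻¹ i j • ∑ l, polyD (L.P₁ j l) (u t (Sum.inl l)).toDistr : Distr n) k) -
      (∑ j, L.γ₀⁻¹ i j • F t (Sum.inl j) : Distr n) k = _
    have hs : ∀ (S : Fin d₁ → Distr n), (∑ j, S j) k = ∑ j, S j k := fun S => by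
      simp
    rw [hs, hs, ← neg_add', ← Finset.sum_add_distrib]
    congr 1
    refine Finset.sum_congr rfl fun j _ => ?_
    rw [mul_add, ← hs]
    simp
  have hG₃' : ∀ i, ∀ t ∈ Icc a b, ∀ k, (L.velComp i (g t)).toDistr k =
      -(∑ j, polyD (L.P₂ i j) (u t (Sum.inr j)).toDistr k + F t (Sum.inr i) k) := by
    intro i t ht k
    simp only [hg, map_sub, toDistr_velComp_gen, velComp_inclData, hG₃ t ht]
    simp only [posComp_toData]
    change -((∑ j, polyD (L.P₂ i j) (u t (Sum.inr j)).toDistr : Distr n) k) -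
      F t (Sum.inr i) k = _
    rw [neg_add']
    congr 2
    simp
  -- The weak equations are multiplied by `(γ⁰)⁻¹` and summed, which solves them for the weak time
  -- derivative of `u₁`.
  have key₁ : ∀ i, HasDerivWithinAt (fun t => L.posComp (Sum.inl i)
      (L.inclData m s (L.toData (L.cauchyData J u t)))) (L.posComp (Sum.inl i) (g t))
      (Icc a b) t := by
    intro i
    refine Sob.hasDerivWithinAt_of_weak hab ((L.posComp _).continuous.comp_continuousOn hgc)
      (fun k => ((Sob.testCLM k).comp (L.posComp (Sum.inl i))).continuous.comp_continuousOn hic)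
      (fun k η h1 h2 h3 => ?_) ht
    have hw1 := fun j => (hw η h1 h2 (h3.trans hIJ) k).1 j
    have hsum : ∫ t, ∑ j, (L.γ₀⁻¹ i j : ℂ) * L.pairing₁ (distrs u) F η k j t = 0 := by
      rw [integral_finsetSum _ fun j _ => (hw1 j).1.const_mul _]
      exact Finset.sum_eq_zero fun j _ => by rw [integral_const_mul, (hw1 j).2, mul_zero]
    have hpt : ∀ t, ∑ j, (L.γ₀⁻¹ i j : ℂ) * L.pairing₁ (distrs u) F η k j t =
        -(((deriv η t : ℝ) : ℂ) * Sob.testCLM k (L.posComp (Sum.inl i)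
          (L.inclData m s (L.toData (L.cauchyData J u t))))) -
        (η t : ℂ) * Sob.testCLM k (L.posComp (Sum.inl i) (g t)) := by
      intro t
      have e1 : ∑ j, (L.γ₀⁻¹ i j : ℂ) * ∑ l, (L.γ₀ j l : ℂ) * (u t (Sum.inl l)).toDistr k =
          (u t (Sum.inl i)).toDistr k := by
        simp_rw [Finset.mul_sum, ← mul_assoc]
        rw [Finset.sum_comm]
        have e0 : ∀ l, ∑ j, (L.γ₀⁻¹ i j : ℂ) * (L.γ₀ j l : ℂ) = if i = l then 1 else 0 := by
          intro l
          have := L.γ₀_mul_inv i l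
          split_ifs at this ⊢ <;> exact_mod_cast this
        simp only [← Finset.sum_mul, e0, ite_mul, one_mul, zero_mul, Finset.sum_ite_eq,
          Finset.mem_univ, if_true]
      rw [hinc, Sob.testCLM_apply, Sob.toDistr_incl, ← e1, Sob.testCLM_apply]
      have e2 : (η t : ℂ) * (L.posComp (Sum.inl i) (g t)).toDistr k = (η t : ℂ) *
          -∑ j, (L.γ₀⁻¹ i j : ℂ) * (∑ l, polyD (L.P₁ j l) (u t (Sum.inl l)).toDistr k +
            F t (Sum.inl j) k) := by
        by_cases hτ : t ∈ Icc a b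
        · rw [hG₁' i t hτ]
        · rw [image_eq_zero_of_notMem_tsupport fun hh => hτ (Ioo_subset_Icc_self (h3 hh))]
          simp
      rw [e2, Finset.mul_sum, mul_neg, sub_neg_eq_add, Finset.mul_sum, ← Finset.sum_neg_distrib,
        ← Finset.sum_add_distrib]
      refine Finset.sum_congr rfl fun j _ => ?_
      simp only [pairing₁, distrs]
      ring
    have hc1 : ContinuousOn (fun t => Sob.testCLM k (L.posComp (Sum.inl i)
        (L.inclData m s (L.toData (L.cauchyData J u t))))) (Ioo a b) :=
      (((Sob.testCLM k).comp (L.posComp (Sum.inl i))).continuous.comp_continuousOn hic).mono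
        Ioo_subset_Icc_self
    have hc2 : ContinuousOn (fun t => Sob.testCLM k (L.posComp (Sum.inl i) (g t))) (Ioo a b) :=
      (((Sob.testCLM k).comp (L.posComp (Sum.inl i))).continuous.comp_continuousOn hgc).mono
        Ioo_subset_Icc_self
    have hs' : tsupport (deriv η) ⊆ Ioo a b := tsupport_deriv_subset.trans h3
    have i1 := integrable_smul_of_tsupport (h1.continuous_deriv (by simp)) h2.deriv isOpen_Ioo hs'
      hc1
    have i2 := integrable_smul_of_tsupport h1.continuous h2 isOpen_Ioo h3 hc2
    have i1' : Integrable fun t => -(((deriv η t : ℝ) : ℂ) * Sob.testCLM k (L.posComp (Sum.inl i)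
      (L.inclData m s (L.toData (L.cauchyData J u t))))) := i1.neg
    rw [integral_congr_ae (Eventually.of_forall hpt), integral_sub i1' i2, integral_neg,
      sub_eq_zero] at hsum
    exact neg_eq_iff_eq_neg.1 hsum
  -- For the positions `u₂`, the evolution equation is the definition of the velocity in the Cauchy
  -- data, the forcing having no component there.
  have key₂ : ∀ i, HasDerivWithinAt (fun t => L.posComp (Sum.inr i)
      (L.inclData m s (L.toData (L.cauchyData J u t)))) (L.posComp (Sum.inr i) (g t))
      (Icc a b) t := by
    intro i
    have e : L.posComp (Sum.inr i) (g t) = L.velComp i (L.toData (L.cauchyData J u t)) := by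
      apply Sob.ext_toDistr
      simp only [hg, map_sub, toDistr_posComp_gen₂]
      rw [posComp_inclData, Sob.toDistr_incl, hG₂ t ht, sub_zero]
    rw [e]
    simp only [hinc]
    exact (hvel t (hI ht) i).mono hI
  -- The weak equation of second order contains `η''`. One integration by parts moves a derivative
  -- to `u₂`, which is `C¹` in time, and leaves a weak equation of first order for the velocity.
  have key₃ : ∀ i, HasDerivWithinAt (fun t => L.velComp i
      (L.inclData m s (L.toData (L.cauchyData J u t)))) (L.velComp i (g t)) (Icc a b) t := by
    intro i
    refine Sob.hasDerivWithinAt_of_weak hab ((L.velComp _).continuous.comp_continuousOn hgc)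
      (fun k => ((Sob.testCLM k).comp (L.velComp i)).continuous.comp_continuousOn hic)
      (fun k η h1 h2 h3 => ?_) ht
    obtain ⟨iw, hw2⟩ := (hw η h1 h2 (h3.trans hIJ) k).2 i
    have hc1 : ContinuousOn (fun t => Sob.testCLM k (L.velComp i
        (L.inclData m s (L.toData (L.cauchyData J u t))))) (Ioo a b) :=
      (((Sob.testCLM k).comp (L.velComp i)).continuous.comp_continuousOn hic).mono
        Ioo_subset_Icc_self
    have hc2 : ContinuousOn (fun t => Sob.testCLM k (L.velComp i (g t))) (Ioo a b) :=
      (((Sob.testCLM k).comp (L.velComp i)).continuous.comp_continuousOn hgc).mono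
        Ioo_subset_Icc_self
    have hs' : tsupport (deriv η) ⊆ Ioo a b := tsupport_deriv_subset.trans h3
    have hdη : ContDiff ℝ ∞ (deriv η) := (contDiff_infty_iff_deriv.1 h1).2
    have hder : ∀ t ∈ Ioo a b, HasDerivAt
        (fun t => Sob.testCLM k (Sob.incl (L.sub_le s) (u t (Sum.inr i))))
        (Sob.testCLM k (L.velComp i (L.inclData m s (L.toData (L.cauchyData J u t))))) t := by
      intro t ht
      have h := (hvel t (interior_subset (hIJ ht)) i).hasDerivAt (mem_interior_iff_mem_nhds.1 (hIJ ht))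
      have h' := (Sob.testCLM k).hasFDerivAt.comp_hasDerivAt t h
      have e : Sob.testCLM k (L.velComp i (L.inclData m s (L.toData (L.cauchyData J u t)))) =
          Sob.testCLM k (L.velComp i (L.toData (L.cauchyData J u t))) := by
        rw [Sob.testCLM_apply, velComp_inclData, Sob.testCLM_apply]
      rw [e]
      exact h'
    obtain ⟨j1, j2, j3⟩ := integral_deriv_smul_add hdη h2.deriv isOpen_Ioo hs' hder hc1
    have i2 := integrable_smul_of_tsupport h1.continuous h2 isOpen_Ioo h3 hc2
    have hpt : ∀ t, L.pairing₂ (distrs u) F η k i t =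
        ((deriv (deriv η) t : ℝ) : ℂ) *
          Sob.testCLM k (Sob.incl (L.sub_le s) (u t (Sum.inr i))) -
        (η t : ℂ) * Sob.testCLM k (L.velComp i (g t)) := by
      intro t
      have e2 : (η t : ℂ) * (L.velComp i (g t)).toDistr k = (η t : ℂ) *
          -(∑ j, polyD (L.P₂ i j) (u t (Sum.inr j)).toDistr k + F t (Sum.inr i) k) := by
        by_cases hτ : t ∈ Icc a b
        · rw [hG₃' i t hτ]
        · rw [image_eq_zero_of_notMem_tsupport fun hh => hτ (Ioo_subset_Icc_self (h3 hh))]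
          simp
      rw [Sob.testCLM_apply, Sob.testCLM_apply, e2, Sob.toDistr_incl]
      simp only [pairing₂, distrs, iteratedDeriv_succ, iteratedDeriv_zero]
      ring
    rw [integral_congr_ae (Eventually.of_forall hpt), integral_sub j1 i2, j3, sub_eq_zero] at hw2
    exact neg_eq_iff_eq_neg.1 hw2
  have hpi : HasDerivWithinAt (fun t (k : DataIdx d₁ d₂) =>
      L.inclData m s (L.toData (L.cauchyData J u t)) k) (fun k => g t k) (Icc a b) t := by
    rw [hasDerivWithinAt_pi]
    rintro ((i | i) | i)
    · exact key₁ i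
    · exact key₂ i
    · exact key₃ i
  exact ((PiLp.continuousLinearEquiv 1 ℝ fun i =>
    Sob n m (L.dataOrder (s - L.r) i)).symm.toContinuousLinearMap.hasFDerivAt.comp_hasDerivWithinAt
      t hpi)

end Duhamel

end LinOp

/-! ## The formula of Duhamel -/

namespace LinOp

variable {n d₁ d₂ : ℕ} (L : LinOp n d₁ d₂) {m s : ℝ} [hm : Fact (0 < m)]

/-- Continuity on each vector and boundedness for bounded times together give joint continuity in
time and data. -/
theorem tendsto_flow {β : Type*} {l : Filter β} {τ : β → ℝ} {x : β → L.DataProd m s} {τ₀ : ℝ}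
    {x₀ : L.DataProd m s} (hτ : Tendsto τ l (𝓝 τ₀)) (hx : Tendsto x l (𝓝 x₀)) :
    Tendsto (fun b => L.flow m s (τ b) (x b)) l (𝓝 (L.flow m s τ₀ x₀)) := by
  obtain ⟨C, hC0, hC⟩ := L.exists_norm_flow_le (m := m) s (|τ₀| + 1)
  have hnear : ∀ᶠ b in l, |τ b| < |τ₀| + 1 :=
    (hτ.abs).eventually_lt tendsto_const_nhds (by linarith)
  have h1 : Tendsto (fun b => L.flow m s (τ b) x₀) l (𝓝 (L.flow m s τ₀ x₀)) :=
    ((L.continuous_flow s x₀).tendsto τ₀).comp hτ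
  have h2 : Tendsto (fun b => L.flow m s (τ b) (x b - x₀)) l (𝓝 0) := by
    refine squeeze_zero_norm' (a := fun b => C * ‖x b - x₀‖) ?_ ?_
    · filter_upwards [hnear] with b hb
      exact hC _ (Or.inr hb.le) _
    · have := (tendsto_iff_norm_sub_tendsto_zero.1 hx).const_mul C
      rwa [mul_zero] at this
  have := h2.add h1
  rw [zero_add] at this
  refine this.congr fun b => ?_
  rw [← map_add, sub_add_cancel]

theorem flow_neg_flow (t : ℝ) (c : L.DataProd m s) : L.flow m s t (L.flow m s (-t) c) = c := by
  rw [← flow_add, add_neg_cancel, flow_zero]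
  rfl

/-- The product rule for the evolution. -/
theorem hasDerivWithinAt_flow_comp {w : ℝ → L.DataProd m s} {w' : L.DataProd m (s - L.r)}
    {S : Set ℝ} {t t₀ : ℝ} (hw : HasDerivWithinAt (fun t => L.inclData m s (w t)) w' S t) :
    HasDerivWithinAt (fun τ => L.inclData m s (L.flow m s (t₀ - τ) (w τ)))
      (L.flow m (s - L.r) (t₀ - t) (w' - L.gen m s (w t))) S t := by
  -- The increment of `w` and the motion of the fixed vector `w t` are differentiated separately:
  -- the former by joint continuity of the evolution applied to the slopes, the latter by strong
  -- differentiability.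
  have h1 : HasDerivWithinAt
      (fun τ => L.flow m (s - L.r) (t₀ - τ) (L.inclData m s (w τ) - L.inclData m s (w t)))
      (L.flow m (s - L.r) (t₀ - t) w') S t := by
    rw [hasDerivWithinAt_iff_tendsto_slope] at hw ⊢
    have h2 : Tendsto (fun τ : ℝ => t₀ - τ) (𝓝[S \ {t}] t) (𝓝 (t₀ - t)) :=
      ((continuous_const.sub continuous_id).tendsto t).mono_left nhdsWithin_le_nhds
    refine (L.tendsto_flow h2 hw).congr fun τ => ?_
    rw [slope_def_module, slope_def_module, sub_self, map_zero, sub_zero, map_smul]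
  have h3 : HasDerivWithinAt (fun τ => L.inclData m s (L.flow m s (t₀ - τ) (w t)))
      (-(L.flow m (s - L.r) (t₀ - t) (L.gen m s (w t)))) S t := by
    have h4 : HasDerivAt (fun τ : ℝ => t₀ - τ) (-1) t := by
      simpa using (hasDerivAt_id t).const_sub t₀
    have := (L.hasDerivAt_inclData_flow s (w t) (t₀ - t)).scomp t h4
    rw [neg_smul, one_smul] at this
    exact this.hasDerivWithinAt
  have h5 := h1.add h3
  rw [← sub_eq_add_neg, ← map_sub] at h5
  refine h5.congr_of_eventuallyEq (Eventually.of_forall fun τ => ?_) ?_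
  · simp only [Pi.add_apply, inclData_flow, map_sub, sub_add_cancel]
  · simp only [Pi.add_apply, inclData_flow, map_sub, sub_add_cancel]

/-- The formula of Duhamel. -/
theorem hasDerivWithinAt_flow_cauchyData {J : Set ℝ} {u : ℝ → SobVec n m s (Comp d₁ d₂)}
    {F : ℝ → Comp d₁ d₂ → Distr n} {G : ℝ → L.DataProd m s} {a b : ℝ} (hJ : UniqueDiffOn ℝ J)
    (hu : L.MemF J u)
    (hw : L.WeakEq J (distrs u) F) (hab : a < b) (hI : Icc a b ⊆ J)
    (hG : ContinuousOn G (Icc a b))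
    (hG₁ : ∀ t ∈ Icc a b, ∀ i, (L.posComp (Sum.inl i) (G t)).toDistr =
      ∑ j, L.γ₀⁻¹ i j • F t (Sum.inl j))
    (hG₂ : ∀ t ∈ Icc a b, ∀ i, (L.posComp (Sum.inr i) (G t)).toDistr = 0)
    (hG₃ : ∀ t ∈ Icc a b, ∀ i, (L.velComp i (G t)).toDistr = F t (Sum.inr i))
    (t₀ : ℝ) {t : ℝ} (ht : t ∈ Icc a b) :
    HasDerivWithinAt (fun t => L.flow m s (t₀ - t) (L.toData (L.cauchyData J u t)))
      (-(L.flow m s (t₀ - t) (G t))) (Icc a b) t := by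
  set g : ℝ → L.DataProd m s := fun t =>
    L.flow m s (t₀ - projIcc a b hab.le t) (G (projIcc a b hab.le t)) with hg
  have hgg : ∀ t ∈ Icc a b, g t = L.flow m s (t₀ - t) (G t) := fun t ht => by
    simp only [hg]
    rw [projIcc_of_mem hab.le ht]
  have hgc : Continuous g := by
    have hG' : Continuous fun t => G (projIcc a b hab.le t) :=
      hG.comp_continuous (continuous_subtype_val.comp continuous_projIcc)
        fun t => (projIcc a b hab.le t).2
    have hp : Continuous fun t : ℝ => t₀ - (projIcc a b hab.le t : ℝ) :=
      continuous_const.sub (continuous_subtype_val.comp continuous_projIcc)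
    rw [continuous_iff_continuousAt]
    intro t
    exact L.tendsto_flow (hp.tendsto t) (hG'.tendsto t)
  set y : ℝ → L.DataProd m s := fun t => L.flow m s (t₀ - t) (L.toData (L.cauchyData J u t)) with hy
  have hQ : ∀ t, HasDerivAt (fun t => ∫ τ in a..t, g τ) (g t) t := fun t =>
    (hgc.integral_hasStrictDerivAt a t).hasDerivAt
  -- So far the derivative exists only in spaces with `r` orders less. There `y + ∫ g` has
  -- derivative zero; as the inclusion is injective, `y = y a - ∫ g` in the original space, where
  -- the right side is differentiable because `g` is continuous. No order of regularity is lost.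
  have hz : ∀ t ∈ Icc a b, HasDerivWithinAt
      (fun t => L.inclData m s (y t) + L.inclData m s (∫ τ in a..t, g τ)) 0 (Icc a b) t := by
    intro t ht
    have h1 := L.hasDerivWithinAt_flow_comp (t₀ := t₀)
      (L.hasDerivWithinAt_inclData hJ hu hw hab hI hG hG₁ hG₂ hG₃ ht)
    have h2 := ((L.inclData m s).hasFDerivAt.comp_hasDerivAt t (hQ t)).hasDerivWithinAt
      (s := Icc a b)
    have h3 := h1.add h2
    rw [hgg t ht, sub_sub_cancel_left, map_neg, ← inclData_flow, neg_add_cancel] at h3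
    exact h3
  have hconst := constant_of_derivWithin_zero
    (fun t ht => (hz t ht).differentiableWithinAt)
    (fun t ht => (hz t (Ico_subset_Icc_self ht)).derivWithin
      ((uniqueDiffOn_Icc hab) t (Ico_subset_Icc_self ht)))
  have e : ∀ t ∈ Icc a b, y t = y a - ∫ τ in a..t, g τ := by
    intro t ht
    have h1 := hconst t ht
    simp only [intervalIntegral.integral_same, map_zero, add_zero] at h1
    rw [← map_add] at h1
    rw [eq_sub_iff_add_eq]
    exact L.inclData_injective s h1
  have h1 : HasDerivWithinAt (fun t => y a - ∫ τ in a..t, g τ) (-(g t)) (Icc a b) t :=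
    ((hQ t).const_sub _).hasDerivWithinAt
  rw [← hgg t ht]
  exact h1.congr e (e t ht)

/-! ## Solutions of the linear equation -/

/-- The solution of `L u = 0` with the Cauchy data `c` at time `t₀`. -/
def orbit (t₀ : ℝ) (c : L.DataProd m s) (t : ℝ) : SobVec n m s (Comp d₁ d₂) :=
  WithLp.toLp 1 fun k => L.posComp k (L.flow m s (t - t₀) c)

theorem orbit_apply (t₀ : ℝ) (c : L.DataProd m s) (t : ℝ) (k : Comp d₁ d₂) :
    L.orbit t₀ c t k = L.posComp k (L.flow m s (t - t₀) c) := rfl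

theorem continuous_flow_sub (t₀ : ℝ) (c : L.DataProd m s) :
    Continuous fun t => L.flow m s (t - t₀) c :=
  (L.continuous_flow s c).comp (continuous_id.sub continuous_const)

theorem hasDerivAt_inclData_flow_sub (t₀ : ℝ) (c : L.DataProd m s) (t : ℝ) :
    HasDerivAt (fun t => L.inclData m s (L.flow m s (t - t₀) c))
      (L.gen m s (L.flow m s (t - t₀) c)) t := by
  rw [gen_flow]
  exact (L.hasDerivAt_inclData_flow s c (t - t₀)).comp_sub_const t t₀

theorem hasDerivAt_incl_orbit (t₀ : ℝ) (c : L.DataProd m s) (t : ℝ) (k : Comp d₁ d₂) :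
    HasDerivAt (fun t => Sob.incl (L.sub_le s) (L.orbit t₀ c t k))
      (L.posComp k (L.gen m s (L.flow m s (t - t₀) c))) t := by
  have h := (L.posComp k).hasFDerivAt.comp_hasDerivAt t (L.hasDerivAt_inclData_flow_sub t₀ c t)
  refine h.congr_of_eventuallyEq (Eventually.of_forall fun τ => ?_)
  exact (L.posComp_inclData _ k).symm

theorem memF_orbit (I : Set ℝ) (t₀ : ℝ) (c : L.DataProd m s) : L.MemF I (L.orbit t₀ c) := by
  refine ⟨Continuous.continuousOn ?_, fun k => ContDiff.contDiffOn ?_⟩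
  · exact (PiLp.continuous_toLp 1 _).comp (continuous_pi fun k =>
      (L.posComp k).continuous.comp (L.continuous_flow_sub t₀ c))
  · rw [contDiff_one_iff_deriv]
    refine ⟨fun t => (L.hasDerivAt_incl_orbit t₀ c t k).differentiableAt, ?_⟩
    rw [show deriv (fun t => Sob.incl (L.sub_le s) (L.orbit t₀ c t k)) = fun t =>
      L.posComp k (L.gen m s (L.flow m s (t - t₀) c)) from
        funext fun t => (L.hasDerivAt_incl_orbit t₀ c t k).deriv]
    exact ((L.posComp k).comp (L.gen m s)).continuous.comp (L.continuous_flow_sub t₀ c)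

theorem cauchyData_orbit {I : Set ℝ} (hI : UniqueDiffOn ℝ I) (t₀ : ℝ) (c : L.DataProd m s) {t : ℝ}
    (ht : t ∈ I) : L.toData (L.cauchyData I (L.orbit t₀ c) t) = L.flow m s (t - t₀) c := by
  refine data_ext (fun k => rfl) fun k => ?_
  rw [velComp_toData]
  change derivWithin (fun τ => Sob.incl (L.sub_le s) (L.orbit t₀ c τ (Sum.inr k))) I t = _
  rw [(L.hasDerivAt_incl_orbit t₀ c t (Sum.inr k)).hasDerivWithinAt.derivWithin (hI t ht)]
  exact Sob.ext_toDistr (L.toDistr_posComp_gen₂ _ k)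

/-- The orbit is differentiable in the larger spaces for all times and satisfies the evolution
equation there. Integrating by parts against `η`, once for the first components and twice for the
last ones, gives the weak equation. -/
theorem weakEq_orbit (I : Set ℝ) (t₀ : ℝ) (c : L.DataProd m s) :
    L.WeakEq I (distrs (L.orbit t₀ c)) 0 := by
  intro η h1 h2 _ k
  set D : ℝ → L.DataProd m s := fun t => L.flow m s (t - t₀) c with hD
  have hDc : Continuous D := L.continuous_flow_sub t₀ c
  have hgc : Continuous fun t => L.gen m s (D t) := (L.gen m s).continuous.comp hDc
  have hp : ∀ i t, HasDerivAt (fun t => Sob.testCLM k (L.posComp i (D t)))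
      (Sob.testCLM k (L.posComp i (L.gen m s (D t)))) t := by
    intro i t
    have h := ((Sob.testCLM k).comp (L.posComp i)).hasFDerivAt.comp_hasDerivAt t
      (L.hasDerivAt_inclData_flow_sub t₀ c t)
    refine h.congr_of_eventuallyEq (Eventually.of_forall fun τ => ?_)
    change (L.posComp i (D τ)).toDistr k = (L.posComp i (L.inclData m s (D τ))).toDistr k
    rw [posComp_inclData, Sob.toDistr_incl]
  have hv : ∀ i t, HasDerivAt (fun t => Sob.testCLM k (L.velComp i (D t)))
      (Sob.testCLM k (L.velComp i (L.gen m s (D t)))) t := by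
    intro i t
    have h := ((Sob.testCLM k).comp (L.velComp i)).hasFDerivAt.comp_hasDerivAt t
      (L.hasDerivAt_inclData_flow_sub t₀ c t)
    refine h.congr_of_eventuallyEq (Eventually.of_forall fun τ => ?_)
    change (L.velComp i (D τ)).toDistr k = (L.velComp i (L.inclData m s (D τ))).toDistr k
    rw [velComp_inclData]
  have hpc : ∀ i, Continuous fun t => Sob.testCLM k (L.posComp i (L.gen m s (D t))) := fun i =>
    ((Sob.testCLM k).comp (L.posComp i)).continuous.comp hgc
  have hvc : ∀ i, Continuous fun t => Sob.testCLM k (L.velComp i (L.gen m s (D t))) := fun i =>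
    ((Sob.testCLM k).comp (L.velComp i)).continuous.comp hgc
  have hvc0 : ∀ i, Continuous fun t => Sob.testCLM k (L.velComp i (D t)) := fun i =>
    ((Sob.testCLM k).comp (L.velComp i)).continuous.comp hDc
  refine ⟨fun i => ?_, fun i => ?_⟩
  · obtain ⟨i1, i2, i3⟩ := integral_deriv_smul_add h1 h2 isOpen_univ (subset_univ _)
      (v := fun t => ∑ j, (L.γ₀ i j : ℂ) * Sob.testCLM k (L.posComp (Sum.inl j) (D t)))
      (v' := fun t => ∑ j, (L.γ₀ i j : ℂ) * Sob.testCLM k (L.posComp (Sum.inl j) (L.gen m s (D t))))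
      (fun t _ => HasDerivAt.fun_sum fun j _ => (hp _ t).const_mul _)
      (continuous_finsetSum _ fun j _ => continuous_const.mul (hpc _)).continuousOn
    have hpt : ∀ t, L.pairing₁ (distrs (L.orbit t₀ c)) 0 η k i t =
        -(((deriv η t : ℝ) : ℂ) *
          ∑ j, (L.γ₀ i j : ℂ) * Sob.testCLM k (L.posComp (Sum.inl j) (D t))) -
        (η t : ℂ) *
          ∑ j, (L.γ₀ i j : ℂ) * Sob.testCLM k (L.posComp (Sum.inl j) (L.gen m s (D t))) := by
      intro t
      have e : ∑ j, (L.γ₀ i j : ℂ) * Sob.testCLM k (L.posComp (Sum.inl j) (L.gen m s (D t))) =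
          -∑ l, polyD (L.P₁ i l) (L.posComp (Sum.inl l) (D t)).toDistr k := by
        have hs : ∀ (S : Fin d₁ → Distr n), (∑ j, S j) k = ∑ j, S j k := fun S => by simp
        have e1 : ∀ j, Sob.testCLM k (L.posComp (Sum.inl j) (L.gen m s (D t))) =
            -∑ x, (L.γ₀⁻¹ j x : ℂ) *
              ∑ l, polyD (L.P₁ x l) (L.posComp (Sum.inl l) (D t)).toDistr k := by
          intro j
          rw [Sob.testCLM_apply, toDistr_posComp_gen₁]
          change -((∑ x, L.γ₀⁻¹ j x •
            ∑ l, polyD (L.P₁ x l) (L.posComp (Sum.inl l) (D t)).toDistr : Distr n) k) = _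
          rw [hs]
          congr 1
          refine Finset.sum_congr rfl fun x _ => ?_
          rw [← hs]
          simp
        simp_rw [e1, mul_neg, Finset.sum_neg_distrib, Finset.mul_sum _ _ (L.γ₀ i _ : ℂ),
          ← mul_assoc]
        rw [Finset.sum_comm]
        have e0 : ∀ l, ∑ j, (L.γ₀ i j : ℂ) * (L.γ₀⁻¹ j l : ℂ) = if i = l then 1 else 0 := by
          intro l
          have := L.γ₀_inv_mul i l
          split_ifs at this ⊢ <;> exact_mod_cast this
        simp only [← Finset.sum_mul, e0, ite_mul, one_mul, zero_mul, Finset.sum_ite_eq,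
          Finset.mem_univ, if_true]
      rw [e]
      simp only [pairing₁, distrs, orbit_apply, Sob.testCLM_apply, Pi.zero_apply]
      change _ + _ * (_ + (0 : ℂ)) = _
      ring
    have i1' := i1.neg
    have hfun := funext hpt
    rw [hfun]
    refine ⟨i1.neg.sub i2, ?_⟩
    refine (integral_sub i1.neg i2).trans ?_
    rw [integral_neg', i3, neg_neg, sub_self]
  · obtain ⟨i1, i2, i3⟩ := integral_deriv_smul_add (contDiff_infty_iff_deriv.1 h1).2 h2.deriv
      isOpen_univ (subset_univ _)
      (v := fun t => Sob.testCLM k (L.posComp (Sum.inr i) (D t)))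
      (v' := fun t => Sob.testCLM k (L.velComp i (D t)))
      (fun t _ => by
        have e : Sob.testCLM k (L.velComp i (D t)) =
            Sob.testCLM k (L.posComp (Sum.inr i) (L.gen m s (D t))) := by
          rw [Sob.testCLM_apply, Sob.testCLM_apply, toDistr_posComp_gen₂]
        rw [e]
        exact hp _ t) (hvc0 i).continuousOn
    obtain ⟨j1, j2, j3⟩ := integral_deriv_smul_add h1 h2 isOpen_univ (subset_univ _)
      (fun t _ => hv i t) (hvc i).continuousOn
    have hpt : ∀ t, L.pairing₂ (distrs (L.orbit t₀ c)) 0 η k i t =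
        ((deriv (deriv η) t : ℝ) : ℂ) * Sob.testCLM k (L.posComp (Sum.inr i) (D t)) -
        (η t : ℂ) * Sob.testCLM k (L.velComp i (L.gen m s (D t))) := by
      intro t
      have e : Sob.testCLM k (L.velComp i (L.gen m s (D t))) =
          -∑ j, polyD (L.P₂ i j) (L.posComp (Sum.inr j) (D t)).toDistr k := by
        rw [Sob.testCLM_apply, toDistr_velComp_gen]
        change -((∑ j, polyD (L.P₂ i j) (L.posComp (Sum.inr j) (D t)).toDistr : Distr n) k) = _
        simp
      rw [e]
      simp only [pairing₂, distrs, orbit_apply, Sob.testCLM_apply, Pi.zero_apply,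
        iteratedDeriv_succ, iteratedDeriv_zero]
      change _ + _ * (_ + (0 : ℂ)) = _
      ring
    rw [funext hpt]
    refine ⟨i1.sub j2, ?_⟩
    rw [integral_sub i1 j2, i3, j3, neg_neg, sub_self]

end LinOp

/-! ## The space of solutions of the linear equation -/

theorem uniqueDiffOn_of_ordConnected {I : Set ℝ} (hI : I.OrdConnected) (hn : I.Nontrivial) :
    UniqueDiffOn ℝ I := by
  obtain ⟨a, ha, b, hb, hab⟩ := hn.exists_lt
  have hIcc : Icc a b ⊆ I := hI.out ha hb
  refine uniqueDiffOn_convex hI.convex ?_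
  obtain ⟨c, hc⟩ := exists_between hab
  exact ⟨c, interior_maximal (Ioo_subset_Icc_self.trans hIcc) isOpen_Ioo hc⟩

namespace LinOp

variable {n d₁ d₂ : ℕ} (L : LinOp n d₁ d₂) {m s : ℝ} [hm : Fact (0 < m)] {I : Set ℝ}

theorem dataAt_of_mem (φ : L.E₀ m s I) {t : ℝ} (ht : t ∈ I) : L.dataAt φ t = φ.1 ⟨t, ht⟩ := by
  rw [dataAt, dif_pos ht]

theorem E₀_ext {φ ψ : L.E₀ m s I} (h : ∀ t ∈ I, L.dataAt φ t = L.dataAt ψ t) : φ = ψ := by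
  apply Subtype.ext
  ext1 t
  have := h t t.2
  rwa [dataAt_of_mem _ _ t.2, dataAt_of_mem _ _ t.2] at this

theorem norm_dataAt_le (φ : L.E₀ m s I) (t : ℝ) : ‖L.dataAt φ t‖ ≤ ‖φ‖ := by
  by_cases ht : t ∈ I
  · rw [dataAt_of_mem _ _ ht]
    exact φ.1.norm_coe_le_norm _
  · rw [dataAt, dif_neg ht, norm_zero]
    exact norm_nonneg _

/-- The Cauchy data at time `t`. -/
def dataCLM (m s : ℝ) [Fact (0 < m)] (I : Set ℝ) (t : ℝ) : L.E₀ m s I →L[ℝ] L.DataProd m s :=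
  LinearMap.mkContinuous
    { toFun := fun φ => L.toData (L.dataAt φ t)
      map_add' := fun φ ψ => by
        rw [← map_add]
        congr 1
        by_cases ht : t ∈ I
        · simp only [dataAt_of_mem _ _ ht]
          rfl
        · simp only [dataAt, dif_neg ht, add_zero]
      map_smul' := fun c φ => by
        rw [RingHom.id_apply, ← map_smul]
        congr 1
        by_cases ht : t ∈ I
        · simp only [dataAt_of_mem _ _ ht]
          rfl
        · simp only [dataAt, dif_neg ht, smul_zero] } 1 fun φ => by
    rw [one_mul]
    exact (L.toData.norm_map _).le.trans (L.norm_dataAt_le φ t)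

theorem dataCLM_apply (φ : L.E₀ m s I) (t : ℝ) :
    L.dataCLM m s I t φ = L.toData (L.dataAt φ t) := rfl

theorem norm_dataCLM_le (t : ℝ) (φ : L.E₀ m s I) : ‖L.dataCLM m s I t φ‖ ≤ ‖φ‖ :=
  (L.toData.norm_map _).le.trans (L.norm_dataAt_le φ t)

theorem E₀_ext_data {φ ψ : L.E₀ m s I}
    (h : ∀ t ∈ I, L.dataCLM m s I t φ = L.dataCLM m s I t ψ) : φ = ψ :=
  L.E₀_ext fun t ht => L.toData.injective (h t ht)

/-- Solutions of the linear equation are determined by their Cauchy data. -/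
theorem dataCLM_eq_flow (hI : I.OrdConnected) (hn : I.Nontrivial) (φ : L.E₀ m s I) {t t₀ : ℝ}
    (ht : t ∈ I) (ht₀ : t₀ ∈ I) :
    L.dataCLM m s I t φ = L.flow m s (t - t₀) (L.dataCLM m s I t₀ φ) := by
  have hU := uniqueDiffOn_of_ordConnected hI hn
  obtain ⟨u, hu, hc, hw⟩ := φ.2
  have hD : ∀ τ ∈ I, L.dataCLM m s I τ φ = L.toData (L.cauchyData I u τ) := fun τ hτ => by
    rw [dataCLM_apply, dataAt_of_mem _ _ hτ, hc]
  -- The formula of Duhamel without forcing: the data transported to time `t₀` by the linear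
  -- evolution do not depend on the time from which they are taken.
  have key : ∀ a ∈ I, ∀ b ∈ I, a < b → ∀ τ ∈ Icc a b,
      L.flow m s (t₀ - τ) (L.toData (L.cauchyData I u τ)) =
      L.flow m s (t₀ - a) (L.toData (L.cauchyData I u a)) := by
    intro a ha b hb hab
    have hz : ∀ τ ∈ Icc a b, HasDerivWithinAt
        (fun t => L.flow m s (t₀ - t) (L.toData (L.cauchyData I u t))) 0 (Icc a b) τ := by
      intro τ hτ
      have h := L.hasDerivWithinAt_flow_cauchyData hU hu hw hab (hI.out ha hb)
        (G := fun _ => 0) continuousOn_const (fun t _ i => by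
          rw [map_zero, map_zero]
          exact (Finset.sum_eq_zero fun _ _ => smul_zero _).symm) (fun t _ i => by simp)
        (fun t _ i => by simp) t₀ hτ
      simpa using h
    exact constant_of_derivWithin_zero (fun t ht => (hz t ht).differentiableWithinAt)
      (fun t ht => (hz t (Ico_subset_Icc_self ht)).derivWithin
        ((uniqueDiffOn_Icc hab) t (Ico_subset_Icc_self ht)))
  have h0 : L.flow m s (t₀ - t) (L.toData (L.cauchyData I u t)) =
      L.flow m s (t₀ - t₀) (L.toData (L.cauchyData I u t₀)) := by
    rcases lt_trichotomy t t₀ with h | h | h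
    · exact (key t ht t₀ ht₀ h t₀ (right_mem_Icc.2 h.le)).symm
    · rw [h]
    · exact key t₀ ht₀ t ht h t (right_mem_Icc.2 h.le)
  rw [hD t ht, hD t₀ ht₀]
  rw [sub_self, flow_zero, ContinuousLinearMap.id_apply] at h0
  rw [← h0, ← neg_sub t t₀, flow_neg_flow]

variable (m s) in
/-- The solution operator, for intervals on which the energy estimates are uniform. -/
theorem exists_solutionOp (T : ℝ) : ∃ C, 1 ≤ C ∧
    (∀ t, (0 < L.μ₀ ∨ |t| ≤ T) → ∀ c, ‖L.flow m s t c‖ ≤ C * ‖c‖) ∧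
    ∀ I : Set ℝ, I.OrdConnected → I.Nontrivial →
    (∀ t ∈ I, ∀ t' ∈ I, 0 < L.μ₀ ∨ |t - t'| ≤ T) → ∀ t₀ ∈ I,
    ∃ Ψ : L.DataProd m s →L[ℝ] L.E₀ m s I,
      (∀ c, ∀ t ∈ I, L.dataCLM m s I t (Ψ c) = L.flow m s (t - t₀) c) ∧ ∀ c, ‖Ψ c‖ ≤ C * ‖c‖ := by
  obtain ⟨C, hC0, hC⟩ := L.exists_norm_flow_le (m := m) s T
  refine ⟨C + 1, by linarith, fun t ht c => (hC t ht c).trans (by gcongr; linarith),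
    fun I hI hn hT t₀ ht₀ => ?_⟩
  have hU := uniqueDiffOn_of_ordConnected hI hn
  have hb : ∀ c (t : I), ‖L.toData.symm (L.flow m s (t - t₀) c)‖ ≤ C * ‖c‖ := fun c t => by
    rw [LinearIsometryEquiv.norm_map]
    exact hC _ (hT t t.2 t₀ ht₀) c
  let B : L.DataProd m s → (I →ᵇ L.Cau m s) := fun c =>
    BoundedContinuousFunction.ofNormedAddCommGroup (fun t : I => L.toData.symm (L.flow m s (t - t₀) c))
      (L.toData.symm.continuous.comp ((L.continuous_flow_sub t₀ c).comp continuous_subtype_val))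
      (C * ‖c‖) (hb c)
  have hB : ∀ c, B c ∈ L.E₀ m s I := fun c =>
    ⟨L.orbit t₀ c, L.memF_orbit I t₀ c, fun t => by
      change L.toData.symm (L.flow m s (t - t₀) c) = _
      rw [← L.cauchyData_orbit hU t₀ c t.2, LinearIsometryEquiv.symm_apply_apply],
      L.weakEq_orbit I t₀ c⟩
  have hd : ∀ c, ∀ t ∈ I, L.dataCLM m s I t ⟨B c, hB c⟩ = L.flow m s (t - t₀) c := by
    intro c t ht
    rw [dataCLM_apply, dataAt_of_mem _ _ ht]
    exact L.toData.apply_symm_apply _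
  let Ψ : L.DataProd m s →ₗ[ℝ] L.E₀ m s I :=
    { toFun := fun c => ⟨B c, hB c⟩
      map_add' := fun c c' => L.E₀_ext_data fun t ht => by
        rw [map_add, hd _ _ ht, hd _ _ ht, hd _ _ ht, map_add]
      map_smul' := fun r c => L.E₀_ext_data fun t ht => by
        rw [RingHom.id_apply, map_smul, hd _ _ ht, hd _ _ ht, map_smul] }
  have hn : ∀ c, ‖Ψ c‖ ≤ (C + 1) * ‖c‖ := fun c => by
    refine (BoundedContinuousFunction.norm_ofNormedAddCommGroup_le _ (by positivity)
      (hb c)).trans ?_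
    gcongr
    linarith
  exact ⟨Ψ.mkContinuous _ hn, hd, hn⟩

/-- Existence and uniqueness of solutions with given Cauchy data. -/
theorem existsUnique_dataAt (hI : I.OrdConnected) (hn : I.Nontrivial) {t₀ : ℝ} (ht₀ : t₀ ∈ I)
    {Ψ : L.DataProd m s →L[ℝ] L.E₀ m s I}
    (hΨ : ∀ c, ∀ t ∈ I, L.dataCLM m s I t (Ψ c) = L.flow m s (t - t₀) c) (c : L.Cau m s)  :
    ∃! φ : L.E₀ m s I, L.dataAt φ t₀ = c := by
  refine ⟨Ψ (L.toData c), ?_, fun φ hφ => L.E₀_ext_data fun t ht => ?_⟩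
  · apply L.toData.injective
    change L.dataCLM m s I t₀ _ = _
    rw [hΨ _ _ ht₀, sub_self, flow_zero]
    rfl
  · rw [hΨ _ _ ht, L.dataCLM_eq_flow hI hn φ ht ht₀, ← hφ]
    rfl

theorem dataAt_Phi (hI : I.OrdConnected) (hn : I.Nontrivial) {t₀ : ℝ} (ht₀ : t₀ ∈ I)
    {Ψ : L.DataProd m s →L[ℝ] L.E₀ m s I}
    (hΨ : ∀ c, ∀ t ∈ I, L.dataCLM m s I t (Ψ c) = L.flow m s (t - t₀) c) (c : L.Cau m s) :
    L.dataAt (L.Phi I t₀ c) t₀ = c := by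
  have h := (L.existsUnique_dataAt hI hn ht₀ hΨ c).exists
  rw [Phi, dif_pos h]
  exact h.choose_spec

end LinOp

/-! ## Distributions which are functions -/

section Repr

variable {n : ℕ}

/-- Cutoffs, by which statements about products with Schwartz functions become local statements
about the function itself. -/
theorem exists_schwartz_eq_one (R : ℝ) :
    ∃ k : SchwartzMap (Space n) ℂ, ∀ x, ‖x‖ ≤ R → k x = 1 := by
  have hR : 0 < max R 0 + 1 := by positivity
  let f : ContDiffBump (0 : Space n) := ⟨max R 0 + 1, max R 0 + 2, hR, by linarith⟩
  have h1 : HasCompactSupport fun x => ((f x : ℝ) : ℂ) :=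
    f.hasCompactSupport.comp_left Complex.ofReal_zero
  have h2 : ContDiff ℝ ∞ fun x => ((f x : ℝ) : ℂ) := Complex.ofRealCLM.contDiff.comp f.contDiff
  refine ⟨h1.toSchwartzMap h2, fun x hx => ?_⟩
  have : f x = 1 := f.one_of_mem_closedBall (by
    rw [mem_closedBall_zero_iff]
    exact hx.trans ((le_max_left R 0).trans (by change max R 0 ≤ max R 0 + 1; linarith)))
  change ((f x : ℝ) : ℂ) = 1
  rw [this, Complex.ofReal_one]

theorem isRepr_zero : IsRepr (0 : Distr n) 0 :=
  ⟨aestronglyMeasurable_const, fun h => by simp⟩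

namespace IsRepr

variable {T T' : Distr n} {w w' : Space n → ℝ}

theorem congr (h : IsRepr T w) (e : w =ᵐ[volume] w') : IsRepr T w' := by
  refine ⟨h.1.congr e, fun k => ?_⟩
  have e2 : (fun x => k x * (w x : ℂ)) =ᵐ[volume] fun x => k x * (w' x : ℂ) := by
    filter_upwards [e] with ζ hζ
    rw [hζ]
  exact ⟨(h.2 k).1.congr e2, (h.2 k).2.trans (integral_congr_ae e2)⟩

theorem eq (h : IsRepr T w) (h' : IsRepr T' w) : T = T' := by
  ext k
  rw [(h.2 k).2, (h'.2 k).2]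

theorem add (h : IsRepr T w) (h' : IsRepr T' w') : IsRepr (T + T') (w + w') := by
  refine ⟨h.1.add h'.1, fun k => ?_⟩
  have e : (fun x => k x * (((w + w') x : ℝ) : ℂ)) =
      fun x => k x * (w x : ℂ) + k x * (w' x : ℂ) := by
    funext ζ
    simp [mul_add]
  rw [e]
  refine ⟨(h.2 k).1.add (h'.2 k).1, ?_⟩
  rw [integral_add (h.2 k).1 (h'.2 k).1, ← (h.2 k).2, ← (h'.2 k).2]
  simp

theorem smul (c : ℝ) (h : IsRepr T w) : IsRepr (c • T) (c • w) := by
  refine ⟨h.1.const_smul c, fun k => ?_⟩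
  have e : (fun x => k x * (((c • w) x : ℝ) : ℂ)) = fun x => (c : ℂ) * (k x * (w x : ℂ)) := by
    funext ζ
    simp
    ring
  rw [e]
  refine ⟨(h.2 k).1.const_mul _, ?_⟩
  rw [integral_const_mul, ← (h.2 k).2]
  simp

theorem sub (h : IsRepr T w) (h' : IsRepr T' w') : IsRepr (T - T') (w - w') := by
  have := h.add (h'.smul (-1))
  have e : (-1 : ℝ) • T' = -T' := by ext k; simp
  rwa [e, neg_one_smul, ← sub_eq_add_neg, ← sub_eq_add_neg] at this

theorem sum {ι : Type*} {S : Finset ι} {T : ι → Distr n} {w : ι → Space n → ℝ}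
    (h : ∀ i ∈ S, IsRepr (T i) (w i)) : IsRepr (∑ i ∈ S, T i) (∑ i ∈ S, w i) := by
  classical
  induction S using Finset.induction_on with
  | empty => simpa using isRepr_zero
  | insert i S hi ih =>
    rw [Finset.sum_insert hi, Finset.sum_insert hi]
    exact (h i (Finset.mem_insert_self i S)).add
      (ih fun j hj => h j (Finset.mem_insert_of_mem hj))

theorem locallyIntegrable (h : IsRepr T w) : LocallyIntegrable w volume := by
  intro x
  obtain ⟨k, hk⟩ := exists_schwartz_eq_one (n := n) (‖x‖ + 1)
  refine ⟨Metric.closedBall x 1, Metric.closedBall_mem_nhds x one_pos, ?_⟩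
  have h1 : IntegrableOn (fun y => (k y * (w y : ℂ)).re) (Metric.closedBall x 1) :=
    (h.2 k).1.re.integrableOn
  refine h1.congr_fun (fun y hy => ?_) Metric.isClosed_closedBall.measurableSet
  have : ‖y‖ ≤ ‖x‖ + 1 := by
    have h2 : ‖y - x‖ ≤ 1 := mem_closedBall_iff_norm.1 hy
    have := norm_le_norm_add_norm_sub' y x
    linarith
  simp [hk y this]

/-- The fundamental lemma of the calculus of variations. It makes the choice in `reprFun` irrelevant
up to null sets. -/
theorem ae_eq (h : IsRepr T w) (h' : IsRepr T w') : w =ᵐ[volume] w' := by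
  have h0 := h.sub h'
  rw [sub_self] at h0
  have : ∀ᵐ x, (w - w') x = 0 := by
    refine ae_eq_zero_of_integral_contDiff_smul_eq_zero h0.locallyIntegrable fun g hg hgc => ?_
    have h1 : HasCompactSupport fun x => (g x : ℂ) := hgc.comp_left Complex.ofReal_zero
    have h2 : ContDiff ℝ ∞ fun x => (g x : ℂ) := Complex.ofRealCLM.contDiff.comp hg
    have h3 := (h0.2 (h1.toSchwartzMap h2)).2
    have e : (fun x => h1.toSchwartzMap h2 x * (((w - w') x : ℝ) : ℂ)) =
        fun x => ((g x • (w - w') x : ℝ) : ℂ) := by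
      funext x
      change (g x : ℂ) * _ = _
      simp
    rw [e, integral_complex_ofReal] at h3
    have h4 : (0 : Distr n) (h1.toSchwartzMap h2) = 0 := rfl
    rw [h4] at h3
    exact_mod_cast h3.symm
  filter_upwards [this] with x hx
  exact sub_eq_zero.1 hx

theorem reprFun_ae_eq (h : IsRepr T w) : reprFun T =ᵐ[volume] w := by
  have hex : ∃ w, IsRepr T w := ⟨w, h⟩
  have e : reprFun T = hex.choose := by
    unfold reprFun
    exact dif_pos hex
  rw [e]
  exact hex.choose_spec.ae_eq h

theorem isRepr_reprFun (h : IsRepr T w) : IsRepr T (reprFun T) := h.congr h.reprFun_ae_eq.symm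

/-- A real distribution which is a complex valued function is represented by its real part. -/
theorem of_complex {G : Space n → ℂ} (hG : LocallyIntegrable G volume)
    (h : ∀ k : SchwartzMap (Space n) ℂ, Integrable (fun x => k x * G x) ∧ T k = ∫ x, k x * G x)
    (hT : IsRealDistr T) : (∀ᵐ x, G x = ((G x).re : ℂ)) ∧ IsRepr T fun x => (G x).re := by
  have h0 : ∀ᵐ x, (G x).im = 0 := by
    refine ae_eq_zero_of_integral_contDiff_smul_eq_zero (fun x => ?_) fun g hg hgc => ?_
    · obtain ⟨U, hU, hi⟩ := hG x
      exact ⟨U, hU, hi.im⟩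
    have h1 : HasCompactSupport fun x => (g x : ℂ) := hgc.comp_left Complex.ofReal_zero
    have h2 : ContDiff ℝ ∞ fun x => (g x : ℂ) := Complex.ofRealCLM.contDiff.comp hg
    have h3 := h (h1.toSchwartzMap h2)
    have h4 := hT (h1.toSchwartzMap h2) fun x => by
      change ((g x : ℂ)).im = 0
      simp
    rw [h3.2] at h4
    have h5 := integral_im h3.1
    change ∫ x, (h1.toSchwartzMap h2 x * G x).im = (∫ x, h1.toSchwartzMap h2 x * G x).im at h5
    rw [h4] at h5
    rw [← h5]
    refine integral_congr_ae (Eventually.of_forall fun x => ?_)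
    change _ = ((g x : ℂ) * G x).im
    simp
  have h1 : ∀ᵐ x, G x = ((G x).re : ℂ) := by
    filter_upwards [h0] with x hx
    exact Complex.ext rfl (by simpa using hx)
  refine ⟨h1, hG.aestronglyMeasurable.re, fun k => ?_⟩
  have e : (fun x => k x * G x) =ᵐ[volume] fun x => k x * ((G x).re : ℂ) := by
    filter_upwards [h1] with x hx
    rw [← hx]
  exact ⟨(h k).1.congr e, (h k).2.trans (integral_congr_ae e)⟩

end IsRepr

namespace Sob

variable {m σ a : ℝ} [hm : Fact (0 < m)]

theorem stronglyMeasurable_hat (T : Sob n m σ) : StronglyMeasurable T.hat := by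
  have h : Continuous fun ζ : Space n => ((sobWeight n m σ ζ : ℂ))⁻¹ :=
    (Complex.continuous_ofReal.comp (continuous_sobWeight σ)).inv₀
      fun ζ => ofReal_sobWeight_ne_zero σ ζ
  exact (Lp.stronglyMeasurable T.symbol).mul h.stronglyMeasurable

/-- The elements of `L²` are functions. -/
theorem exists_isRepr_L2 (T : Sob n m 0) : ∃ w : Space n → ℝ, IsRepr T.toDistr w ∧
    MemLp w 2 ∧ ∀ k : SchwartzMap (Space n) ℂ,
      ∫ x, ‖k x * (w x : ℂ)‖ ≤ ‖k.toLp 2 volume‖ * ((2 * Real.pi) ^ (-((n : ℝ) / 2)) * ‖T‖) := by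
  set c : ℝ := (2 * Real.pi) ^ ((n : ℝ) / 2) with hc
  have hc0 : 0 < c := by positivity
  -- For order `0` the weight is the constant `c`, so the symbol divided by `c` is the Fourier
  -- transform of `T`. By Plancherel's theorem `T` is an `L²` function of norm `c⁻¹ ‖T‖`.
  set g : Lp ℂ 2 (volume : Measure (Space n)) := ((c⁻¹ : ℝ) : ℂ) • T.symbol with hg
  have hTg : 𝓕 T.toDistr = Lp.toTemperedDistribution g := by
    have h := T.hasSobSymbol
    unfold HasSobSymbol at h
    have e : (fun ζ : Space n => (sobWeight n m 0 ζ : ℂ)) = fun _ => (c : ℂ) := by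
      funext ζ
      simp [sobWeight, japanese_zero, hc]
    rw [e, TemperedDistribution.smulLeftCLM_const] at h
    have h2 : Lp.toTemperedDistribution g = ((c⁻¹ : ℝ) : ℂ) • Lp.toTemperedDistribution T.symbol :=
      (Lp.toTemperedDistributionCLM ℂ volume 2).map_smul _ T.symbol
    rw [h2, ← h, smul_smul, ← Complex.ofReal_mul, inv_mul_cancel₀ hc0.ne', Complex.ofReal_one,
      one_smul]
  set G : Lp ℂ 2 (volume : Measure (Space n)) := 𝓕⁻ g with hGd
  have hTG : T.toDistr = Lp.toTemperedDistribution G := by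
    rw [hGd, ← Lp.fourierInv_toTemperedDistribution_eq, ← hTg,
      FourierTransform.fourierInv_fourier_eq]
  have hloc : LocallyIntegrable G volume := (Lp.memLp G).locallyIntegrable (by norm_num)
  have hrep : ∀ k : SchwartzMap (Space n) ℂ,
      Integrable (fun x => k x * G x) ∧ T.toDistr k = ∫ x, k x * G x := by
    intro k
    rw [hTG, Lp.toTemperedDistribution_apply]
    exact ⟨(k.memLp 2).integrable_mul (Lp.memLp G), rfl⟩
  obtain ⟨h1, h2⟩ := IsRepr.of_complex hloc hrep T.2.1
  refine ⟨_, h2, (Lp.memLp G).re, fun k => ?_⟩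
  have hnG : ‖G‖ = c⁻¹ * ‖T‖ := by
    have : ‖𝓕 G‖ = ‖G‖ := Lp.norm_fourier_eq G
    rw [← this, hGd, FourierTransform.fourier_fourierInv_eq, hg, norm_smul, Complex.norm_real,
      Real.norm_of_nonneg (by positivity), norm_def]
  have e : ∫ x, ‖k x * ((G x).re : ℂ)‖ = ∫ x, ‖k x‖ * ‖G x‖ := by
    refine integral_congr_ae ?_
    filter_upwards [h1] with x hx
    rw [← hx, norm_mul]
  rw [e, Real.rpow_neg (by positivity), ← hnG, Lp.norm_def, Lp.norm_def]
  have hk := k.memLp 2 (volume : Measure (Space n))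
  have h3 := integral_mul_le_Lp_mul_Lq_of_nonneg (μ := (volume : Measure (Space n)))
    (p := 2) (q := 2) (f := fun x => ‖k x‖) (g := fun x => ‖G x‖)
    Real.HolderConjugate.two_two (Eventually.of_forall fun x => norm_nonneg _)
    (Eventually.of_forall fun x => norm_nonneg _) (by simpa using hk.norm)
    (by simpa using (Lp.memLp G).norm)
  refine h3.trans_eq ?_
  rw [eLpNorm_congr_ae (SchwartzMap.coeFn_toLp k 2 volume), hk.eLpNorm_eq_integral_rpow_norm (by norm_num)
    (by norm_num), (Lp.memLp G).eLpNorm_eq_integral_rpow_norm (by norm_num) (by norm_num),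
    ENNReal.toReal_ofReal (by positivity), ENNReal.toReal_ofReal (by positivity)]
  norm_num

theorem exists_isRepr (hσ : 0 ≤ σ) (T : Sob n m σ) : ∃ w : Space n → ℝ, IsRepr T.toDistr w := by
  obtain ⟨w, hw, -⟩ := exists_isRepr_L2 (incl hσ T)
  rw [toDistr_incl] at hw
  exact ⟨w, hw⟩

theorem isRepr_reprFun (hσ : 0 ≤ σ) (T : Sob n m σ) : IsRepr T.toDistr (reprFun T.toDistr) := by
  obtain ⟨w, hw⟩ := exists_isRepr hσ T
  exact hw.isRepr_reprFun

/-- It allows a series that converges absolutely in `H^σ` to be integrated term by term against a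
test function. -/
theorem exists_integral_reprFun_le (hσ : 0 ≤ σ) (k : SchwartzMap (Space n) ℂ) :
    ∃ C, ∀ (T : Sob n m σ) (w : Space n → ℝ), IsRepr T.toDistr w →
      ∫ x, ‖k x * (w x : ℂ)‖ ≤ C * ‖T‖ := by
  refine ⟨‖k.toLp 2 volume‖ * ((2 * Real.pi) ^ (-((n : ℝ) / 2)) *
    ‖inclCLM (n := n) (m := m) hσ‖), fun T w hw => ?_⟩
  obtain ⟨w', hw', -, h⟩ := exists_isRepr_L2 (incl hσ T)
  rw [toDistr_incl] at hw'
  have e := hw.ae_eq hw'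
  have e2 : ∫ x, ‖k x * (w x : ℂ)‖ = ∫ x, ‖k x * (w' x : ℂ)‖ := by
    refine integral_congr_ae ?_
    filter_upwards [e] with x hx
    rw [hx]
  rw [e2]
  refine (h k).trans ?_
  rw [← inclCLM_apply, mul_assoc, mul_assoc]
  gcongr
  exact (inclCLM hσ).le_opNorm T

/-- A convergent series of functions in `H^σ`, `σ ≥ 0`, converges almost everywhere. -/
theorem hasSum_isRepr (hσ : 0 ≤ σ) {T : ℕ → Sob n m σ} {w : ℕ → Space n → ℝ}
    (hw : ∀ k, IsRepr (T k).toDistr (w k)) (hT : Summable fun k => ‖T k‖) :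
    (∀ᵐ x, Summable fun k => w k x) ∧ IsRepr (∑' k, T k).toDistr fun x => ∑' k, w k x := by
  have hint : ∀ h : SchwartzMap (Space n) ℂ,
      Summable fun k => ∫ x, ‖h x * (w k x : ℂ)‖ := by
    intro h
    obtain ⟨C, hC⟩ := exists_integral_reprFun_le (m := m) hσ h
    exact Summable.of_nonneg_of_le (fun k => integral_nonneg fun x => norm_nonneg _)
      (fun k => hC (T k) (w k) (hw k)) (hT.mul_left C)
  have hlin : ∀ h : SchwartzMap (Space n) ℂ, ∫⁻ x, ∑' k, ‖h x * (w k x : ℂ)‖ₑ ≠ ⊤ := by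
    intro h
    rw [lintegral_tsum fun k => ((hw k).2 h).1.1.enorm]
    have h2 : ∀ k, ∫⁻ x, ‖h x * (w k x : ℂ)‖ₑ = ENNReal.ofReal (∫ x, ‖h x * (w k x : ℂ)‖) :=
      fun k => (ofReal_integral_norm_eq_lintegral_enorm ((hw k).2 h).1).symm
    simp_rw [h2]
    exact (hint h).tsum_ofReal_ne_top
  have hae : ∀ h : SchwartzMap (Space n) ℂ, ∀ᵐ x, Summable fun k => ‖h x * (w k x : ℂ)‖ := by
    intro h
    have h3 : ∀ᵐ x, ∑' k, ‖h x * (w k x : ℂ)‖ₑ < ⊤ :=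
      ae_lt_top' (AEMeasurable.tsum fun k => ((hw k).2 h).1.1.enorm) (hlin h)
    filter_upwards [h3] with x hx
    have h4 := ENNReal.summable_toReal hx.ne
    simpa using h4
  have hsum : ∀ᵐ x, Summable fun k => w k x := by
    -- Cutoffs equal to `1` on balls that exhaust the space remove the test function from the
    -- summability statement.
    choose h hh using fun j : ℕ => exists_schwartz_eq_one (n := n) j
    filter_upwards [ae_all_iff.2 fun j => hae (h j)] with x hx
    obtain ⟨j, hj⟩ := exists_nat_ge ‖x‖
    have := hx j
    rw [hh j x hj] at this
    refine Summable.of_norm ?_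
    simpa using this
  have hmeas : AEStronglyMeasurable fun x => ∑' k, w k x := by
    have h1 : ∀ j, AEStronglyMeasurable (fun x => ∑ k ∈ Finset.range j, w k x) :=
      fun j => Finset.aestronglyMeasurable_fun_sum _ fun k _ => (hw k).1
    refine aestronglyMeasurable_of_tendsto_ae atTop h1 ?_
    filter_upwards [hsum] with x hx
    exact hx.hasSum.tendsto_sum_nat
  refine ⟨hsum, hmeas, fun h => ?_⟩
  · have e : (fun x => ∑' k, h x * (w k x : ℂ)) = fun x => h x * ((∑' k, w k x : ℝ) : ℂ) := by
      funext x
      rw [tsum_mul_left, Complex.ofReal_tsum]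
    have h1 := hasSum_integral_of_summable_integral_norm (fun k => ((hw k).2 h).1) (hint h)
    rw [e] at h1
    refine ⟨?_, ?_⟩
    · refine ⟨h.continuous.aestronglyMeasurable.mul
        (Complex.continuous_ofReal.comp_aestronglyMeasurable hmeas), ?_⟩
      refine lt_of_le_of_lt (lintegral_mono fun x => ?_) (hlin h).lt_top
      have e' := congrFun e x
      simp only at e' ⊢
      rw [← e']
      exact enorm_tsum_le_tsum_enorm
    · have h3 : HasSum (fun k => testCLM h (T k)) (testCLM h (∑' k, T k)) :=
        (testCLM h).hasSum hT.of_norm.hasSum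
      simp only [testCLM_apply] at h3
      have h4 : (fun k => (T k).toDistr h) = fun k => ∫ x, h x * (w k x : ℂ) :=
        funext fun k => ((hw k).2 h).2
      rw [h4] at h3
      exact h3.unique h1

end Sob

end Repr

/-! ## Products in Sobolev spaces -/

section Weights

variable {n : ℕ} {m : ℝ} [hm : Fact (0 < m)]

theorem japanese_eq_rpow (σ : ℝ) (ζ : Space n) : japanese n m σ ζ = japanese n m 1 ζ ^ σ := by
  rw [japanese, japanese, ← Real.rpow_mul (japanese_base_pos ζ).le]
  congr 1
  ring

theorem japanese_one_add_le (η ζ : Space n) :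
    japanese n m 1 (η + ζ) ≤ japanese n m 1 η + japanese n m 1 ζ := by
  have h1 := japanese_pos (m := m) 1 η
  have h2 := japanese_pos (m := m) 1 ζ
  have sq : ∀ ξ : Space n, japanese n m 1 ξ ^ 2 = m ^ 2 + ‖(2 * Real.pi) • ξ‖ ^ 2 := fun ξ => by
    rw [japanese, ← Real.rpow_natCast (_ ^ _), ← Real.rpow_mul (japanese_base_pos ξ).le]
    norm_num
  have h3 : ‖(2 * Real.pi) • η‖ ≤ japanese n m 1 η :=
    le_of_sq_le_sq (by rw [sq]; nlinarith [sq_nonneg m]) h1.le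
  have h4 : ‖(2 * Real.pi) • ζ‖ ≤ japanese n m 1 ζ :=
    le_of_sq_le_sq (by rw [sq]; nlinarith [sq_nonneg m]) h2.le
  refine le_of_sq_le_sq ?_ (by positivity)
  have h5 : ‖(2 * Real.pi) • (η + ζ)‖ ≤ ‖(2 * Real.pi) • η‖ + ‖(2 * Real.pi) • ζ‖ := by
    rw [smul_add]
    exact norm_add_le _ _
  have h6 : ‖(2 * Real.pi) • (η + ζ)‖ ^ 2 ≤ (‖(2 * Real.pi) • η‖ + ‖(2 * Real.pi) • ζ‖) ^ 2 := by
    gcongr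
  have h7 : ‖(2 * Real.pi) • η‖ * ‖(2 * Real.pi) • ζ‖ ≤ japanese n m 1 η * japanese n m 1 ζ := by
    gcongr
  rw [sq]
  nlinarith [sq η, sq ζ, sq_nonneg m]

/-- The larger frequency dominates: `⟨η + ζ⟩ ≤ 2 max(⟨η⟩, ⟨ζ⟩)`. If it is `ζ`, the factors in `η`
cancel; if it is `η`, the excess `a - σ ≥ 0` is shifted from `⟨ζ⟩` to `⟨η⟩`. What remains are
weights of order `-a`, which are square integrable for `a > n/2`. -/
theorem japanese_add_le {a σ : ℝ} (h0 : 0 ≤ σ) (hσ : σ ≤ a) (η ζ : Space n) :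
    japanese n m σ (η + ζ) ≤ 2 ^ σ * ((japanese n m (-a) η + japanese n m (-a) ζ) *
      (japanese n m a η * japanese n m σ ζ)) := by
  have hp := japanese_pos (m := m) 1 η
  have hq := japanese_pos (m := m) 1 ζ
  have hr := japanese_pos (m := m) 1 (η + ζ)
  have h1 := japanese_one_add_le (m := m) η ζ
  rw [japanese_eq_rpow σ (η + ζ), japanese_eq_rpow (-a) η, japanese_eq_rpow (-a) ζ,
    japanese_eq_rpow a η, japanese_eq_rpow σ ζ]
  set p := japanese n m 1 η
  set q := japanese n m 1 ζ
  rcases le_total p q with hpq | hpq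
  · calc japanese n m 1 (η + ζ) ^ σ ≤ (2 * q) ^ σ := by gcongr; linarith
      _ = 2 ^ σ * (p ^ (-a) * (p ^ a * q ^ σ)) := by
        rw [Real.mul_rpow (by norm_num) hq.le, Real.rpow_neg hp.le]
        have := (Real.rpow_pos_of_pos hp a).ne'
        field_simp
      _ ≤ _ := by
        gcongr
        have := Real.rpow_pos_of_pos hq (-a)
        linarith
  · calc japanese n m 1 (η + ζ) ^ σ ≤ (2 * p) ^ σ := by gcongr; linarith
      _ = 2 ^ σ * (q ^ (-(a - σ)) * (q ^ (a - σ) * p ^ σ)) := by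
        rw [Real.mul_rpow (by norm_num) hp.le, Real.rpow_neg hq.le]
        have := (Real.rpow_pos_of_pos hq (a - σ)).ne'
        field_simp
      _ ≤ 2 ^ σ * (q ^ (-(a - σ)) * (p ^ (a - σ) * p ^ σ)) := by
        gcongr
      _ = 2 ^ σ * (q ^ (-a) * (p ^ a * q ^ σ)) := by
        rw [← Real.rpow_add hp, show -(a - σ) = -a + σ by ring, Real.rpow_add hq]
        ring_nf
      _ ≤ _ := by
        gcongr
        have := Real.rpow_pos_of_pos hp (-a)
        linarith

theorem memLp_japanese_neg {a : ℝ} (ha : (n : ℝ) / 2 < a) :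
    MemLp (fun ζ : Space n => japanese n m (-a) ζ) 2 := by
  have hm0 := hm.out
  have ha0 : 0 < a := lt_of_le_of_lt (by positivity) ha
  have h1 := integrable_rpow_neg_one_add_norm_sq (E := Space n) (r := 2 * a)
    (μ := volume) (by rw [finrank_euclideanSpace_fin]; linarith)
  have hmeas := (continuous_japanese (n := n) (m := m) (-a)).aestronglyMeasurable (μ := volume)
  rw [memLp_two_iff_integrable_sq hmeas]
  set c := min (m ^ 2) 1 with hc
  have hc0 : 0 < c := by positivity
  refine (h1.const_mul (c ^ (-a))).mono' (hmeas.pow 2) (Eventually.of_forall fun ζ => ?_)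
  have e : japanese n m (-a) ζ ^ 2 = (m ^ 2 + ‖(2 * Real.pi) • ζ‖ ^ 2) ^ (-a) := by
    rw [japanese, ← Real.rpow_natCast (_ ^ _), ← Real.rpow_mul (japanese_base_pos ζ).le]
    congr 1
    push_cast
    ring
  rw [Real.norm_of_nonneg (by positivity), e, show -(2 * a) / 2 = -a by ring,
    ← Real.mul_rpow hc0.le (by positivity)]
  refine Real.rpow_le_rpow_of_nonpos (by positivity) ?_ (by linarith)
  rw [norm_smul, mul_pow, Real.norm_of_nonneg (by positivity), mul_add, mul_one]
  have h2 : c ≤ m ^ 2 := min_le_left _ _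
  have h3 : c ≤ 1 := min_le_right _ _
  have h4 : (1 : ℝ) ≤ (2 * Real.pi) ^ 2 := by nlinarith [Real.pi_gt_three]
  have h5 : c * ‖ζ‖ ^ 2 ≤ (2 * Real.pi) ^ 2 * ‖ζ‖ ^ 2 := by
    gcongr
    linarith
  linarith

end Weights

/-! ### A weighted convolution inequality -/

section Convolution

variable {n : ℕ}

/-- The weighted Young inequality behind the product estimates. -/
theorem lintegral_conv_sq_le {k u v : Space n → ℝ≥0∞} (hk : Measurable k) (hu : Measurable u)
    (hv : Measurable v) :
    ∫⁻ ξ, (∫⁻ η, (k η + k (ξ - η)) * (u η * v (ξ - η))) ^ (2 : ℝ) ≤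
      4 * (∫⁻ η, k η ^ (2 : ℝ)) * ((∫⁻ η, u η ^ (2 : ℝ)) * ∫⁻ η, v η ^ (2 : ℝ)) := by
  -- Cauchy–Schwarz in `η` for fixed `ξ`; `k η` and `k (ξ - η)` have the same square integral. The
  -- double integral that remains factors by Tonelli's theorem.
  have h1 : ∀ ξ, (∫⁻ η, (k η + k (ξ - η)) * (u η * v (ξ - η))) ^ (2 : ℝ) ≤
      4 * (∫⁻ η, k η ^ (2 : ℝ)) * ∫⁻ η, u η ^ (2 : ℝ) * v (ξ - η) ^ (2 : ℝ) := by
    intro ξ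
    have hsub : Measurable fun η : Space n => ξ - η := measurable_const.sub measurable_id
    have h2 := ENNReal.lintegral_mul_le_Lp_mul_Lq (volume : Measure (Space n))
      Real.HolderConjugate.two_two
      (f := fun η => k η + k (ξ - η)) (g := fun η => u η * v (ξ - η))
      (hk.add (hk.comp hsub)).aemeasurable (hu.mul (hv.comp hsub)).aemeasurable
    have h3 := ENNReal.rpow_le_rpow h2 (show (0 : ℝ) ≤ 2 by norm_num)
    rw [ENNReal.mul_rpow_of_nonneg _ _ (by norm_num : (0 : ℝ) ≤ 2), ← ENNReal.rpow_mul,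
      ← ENNReal.rpow_mul] at h3
    norm_num only [ENNReal.rpow_one] at h3
    refine h3.trans ?_
    simp_rw [ENNReal.mul_rpow_of_nonneg _ _ (by norm_num : (0 : ℝ) ≤ 2)]
    gcongr
    calc ∫⁻ η, (k η + k (ξ - η)) ^ (2 : ℝ)
        ≤ ∫⁻ η, 2 * (k η ^ (2 : ℝ) + k (ξ - η) ^ (2 : ℝ)) := by
          refine lintegral_mono fun η => ?_
          refine (ENNReal.rpow_add_le_mul_rpow_add_rpow _ _ (by norm_num)).trans_eq ?_
          norm_num
      _ = 2 * ((∫⁻ η, k η ^ (2 : ℝ)) + ∫⁻ η, k (ξ - η) ^ (2 : ℝ)) := by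
          rw [lintegral_const_mul _ (by fun_prop), lintegral_add_left (by fun_prop)]
      _ = _ := by
          rw [lintegral_sub_left_eq_self fun η => k η ^ (2 : ℝ)]
          ring
  refine (lintegral_mono h1).trans ?_
  rw [lintegral_const_mul _ (by fun_prop), lintegral_lintegral_swap (by fun_prop)]
  gcongr
  rw [← lintegral_mul_const _ (by fun_prop)]
  refine lintegral_mono fun η => ?_
  simp only
  rw [lintegral_const_mul _ (by fun_prop), lintegral_sub_right_eq_self fun ξ => v ξ ^ (2 : ℝ)]

end Convolution

/-! ### The product of functions in `H^a` and `H^σ` -/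

section Product

variable {n : ℕ} {m a σ : ℝ} [hm : Fact (0 < m)]

/-- The convolution of complex functions. -/
def conv (F G : Space n → ℂ) (ξ : Space n) : ℂ := ∫ η, F η * G (ξ - η)

theorem stronglyMeasurable_conv_integrand {F G : Space n → ℂ} (hF : StronglyMeasurable F)
    (hG : StronglyMeasurable G) :
    StronglyMeasurable fun p : Space n × Space n => F p.2 * G (p.1 - p.2) :=
  (hF.comp_measurable measurable_snd).mul (hG.comp_measurable measurable_sub)

theorem HermSymm.conv {F G : Space n → ℂ} (hF : HermSymm F) (hG : HermSymm G) :
    HermSymm (conv F G) := by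
  refine Eventually.of_forall fun ξ => ?_
  rw [_root_.conv, _root_.conv, ← integral_conj, ← integral_neg_eq_self]
  refine integral_congr_ae ?_
  have h1 : ∀ᵐ η, G (-(ξ - η)) = starRingEnd ℂ (G (ξ - η)) :=
    (Measure.measurePreserving_sub_left volume ξ).quasiMeasurePreserving.ae hG
  filter_upwards [hF, h1] with η h2 h3
  rw [map_mul, ← h2, ← h3]
  congr 2
  abel

/-- The absolute convolution of two functions, in the weighted `L²` norm. -/
theorem lintegral_abs_conv_le (h0 : 0 ≤ σ) (hσ : σ ≤ a) (ha : (n : ℝ) / 2 < a) :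
    ∃ C : ℝ≥0∞, C ≠ ⊤ ∧ ∀ (f : Sob n m a) (g : Sob n m σ),
      ∫⁻ ξ, (‖(sobWeight n m σ ξ : ℂ)‖ₑ * ∫⁻ η, ‖f.hat η‖ₑ * ‖g.hat (ξ - η)‖ₑ) ^ (2 : ℝ) ≤
        C * (‖f‖ₑ ^ (2 : ℝ) * ‖g‖ₑ ^ (2 : ℝ)) := by
  set c : ℝ := (2 * Real.pi) ^ ((n : ℝ) / 2) with hc
  have hc0 : 0 < c := by positivity
  have hk := memLp_japanese_neg (m := m) ha
  set κ : ℝ≥0∞ := ∫⁻ η, ‖japanese n m (-a) η‖ₑ ^ (2 : ℝ) with hκ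
  have hκ1 : κ ≠ ⊤ := by
    have := lintegral_rpow_enorm_lt_top_of_eLpNorm_lt_top (by norm_num) (by norm_num) hk.2
    simpa [hκ] using this.ne
  refine ⟨ENNReal.ofReal (2 ^ σ * c⁻¹) ^ (2 : ℝ) * (4 * κ), by finiteness, fun f g => ?_⟩
  have key : ∀ ξ, ‖(sobWeight n m σ ξ : ℂ)‖ₑ * ∫⁻ η, ‖f.hat η‖ₑ * ‖g.hat (ξ - η)‖ₑ ≤
      ENNReal.ofReal (2 ^ σ * c⁻¹) * ∫⁻ η, (‖japanese n m (-a) η‖ₑ + ‖japanese n m (-a) (ξ - η)‖ₑ) *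
        (‖(sobWeight n m a η : ℂ) * f.hat η‖ₑ * ‖(sobWeight n m σ (ξ - η) : ℂ) * g.hat (ξ - η)‖ₑ) := by
    intro ξ
    rw [← lintegral_const_mul' _ _ (by simp), ← lintegral_const_mul' _ _ (by simp)]
    refine lintegral_mono fun η => ?_
    simp only [enorm_mul]
    have h1 := japanese_add_le (m := m) h0 hσ η (ξ - η)
    rw [add_sub_cancel] at h1
    have h2 : sobWeight n m σ ξ ≤ (2 ^ σ * c⁻¹) * ((japanese n m (-a) η + japanese n m (-a) (ξ - η)) *
        (sobWeight n m a η * sobWeight n m σ (ξ - η))) := by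
      calc sobWeight n m σ ξ = c * japanese n m σ ξ := rfl
        _ ≤ c * (2 ^ σ * ((japanese n m (-a) η + japanese n m (-a) (ξ - η)) *
            (japanese n m a η * japanese n m σ (ξ - η)))) := by gcongr
        _ = _ := by
          rw [sobWeight, sobWeight, ← hc]
          field_simp
    have e1 : ∀ (τ : ℝ) (x : Space n), ‖(sobWeight n m τ x : ℂ)‖ₑ =
        ENNReal.ofReal (sobWeight n m τ x) := fun τ x => by
      rw [← ofReal_norm, Complex.norm_real, Real.norm_of_nonneg (sobWeight_pos _ _).le]
    have e2 : ∀ (τ : ℝ) (x : Space n), ‖japanese n m τ x‖ₑ =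
        ENNReal.ofReal (japanese n m τ x) := fun τ x => by
      rw [← ofReal_norm, Real.norm_of_nonneg (japanese_pos _ _).le]
    have h3 : ‖(sobWeight n m σ ξ : ℂ)‖ₑ ≤ ENNReal.ofReal (2 ^ σ * c⁻¹) *
        ((‖japanese n m (-a) η‖ₑ + ‖japanese n m (-a) (ξ - η)‖ₑ) *
        (‖(sobWeight n m a η : ℂ)‖ₑ * ‖(sobWeight n m σ (ξ - η) : ℂ)‖ₑ)) := by
      have j1 := (japanese_pos (m := m) (-a) η).le
      have j2 := (japanese_pos (m := m) (-a) (ξ - η)).le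
      have j3 := (sobWeight_pos (m := m) a η).le
      rw [e1, e1, e1, e2, e2, ← ENNReal.ofReal_mul j3, ← ENNReal.ofReal_add j1 j2,
        ← ENNReal.ofReal_mul (by positivity), ← ENNReal.ofReal_mul (by positivity)]
      exact ENNReal.ofReal_le_ofReal h2
    calc _ ≤ (ENNReal.ofReal (2 ^ σ * c⁻¹) *
        ((‖japanese n m (-a) η‖ₑ + ‖japanese n m (-a) (ξ - η)‖ₑ) *
        (‖(sobWeight n m a η : ℂ)‖ₑ * ‖(sobWeight n m σ (ξ - η) : ℂ)‖ₑ))) *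
          (‖f.hat η‖ₑ * ‖g.hat (ξ - η)‖ₑ) := by gcongr
      _ = _ := by ring
  have hn : ∀ {τ : ℝ} (T : Sob n m τ),
      ∫⁻ η, ‖(sobWeight n m τ η : ℂ) * T.hat η‖ₑ ^ (2 : ℝ) = ‖T‖ₑ ^ (2 : ℝ) := by
    intro τ T
    have h1 : ‖T‖ₑ = eLpNorm T.symbol 2 volume := Lp.enorm_def T.symbol
    rw [h1, eLpNorm_eq_lintegral_rpow_enorm_toReal (by norm_num) (by norm_num)]
    rw [← ENNReal.rpow_mul]
    simp only [ENNReal.toReal_ofNat, one_div, ne_eq, OfNat.ofNat_ne_zero, not_false_eq_true,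
      inv_mul_cancel₀, ENNReal.rpow_one, Sob.symbol_eq]
  have hw : ∀ τ : ℝ, Measurable fun ζ : Space n => (sobWeight n m τ ζ : ℂ) := fun τ =>
    (Complex.continuous_ofReal.comp (continuous_sobWeight τ)).measurable
  calc _ ≤ ∫⁻ ξ, (ENNReal.ofReal (2 ^ σ * c⁻¹) * ∫⁻ η, (‖japanese n m (-a) η‖ₑ +
        ‖japanese n m (-a) (ξ - η)‖ₑ) * (‖(sobWeight n m a η : ℂ) * f.hat η‖ₑ *
          ‖(sobWeight n m σ (ξ - η) : ℂ) * g.hat (ξ - η)‖ₑ)) ^ (2 : ℝ) := by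
        refine lintegral_mono fun ξ => ?_
        simp only
        exact ENNReal.rpow_le_rpow (key ξ) (by norm_num)
    _ = ENNReal.ofReal (2 ^ σ * c⁻¹) ^ (2 : ℝ) * ∫⁻ ξ, (∫⁻ η, (‖japanese n m (-a) η‖ₑ +
        ‖japanese n m (-a) (ξ - η)‖ₑ) * (‖(sobWeight n m a η : ℂ) * f.hat η‖ₑ *
          ‖(sobWeight n m σ (ξ - η) : ℂ) * g.hat (ξ - η)‖ₑ)) ^ (2 : ℝ) := by
        simp_rw [ENNReal.mul_rpow_of_nonneg _ _ (by norm_num : (0 : ℝ) ≤ 2)]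
        rw [lintegral_const_mul' _ _ (by finiteness)]
    _ ≤ _ := by
        have h := lintegral_conv_sq_le (n := n) (k := fun η => ‖japanese n m (-a) η‖ₑ)
          (u := fun η => ‖(sobWeight n m a η : ℂ) * f.hat η‖ₑ)
          (v := fun η => ‖(sobWeight n m σ η : ℂ) * g.hat η‖ₑ)
          (continuous_japanese _).measurable.enorm
          ((hw a).mul f.stronglyMeasurable_hat.measurable).enorm
          ((hw σ).mul g.stronglyMeasurable_hat.measurable).enorm
        simp only [hn] at h
        rw [mul_assoc]
        gcongr

/-- Cauchy–Schwarz: the transform is the product of `⟨ξ⟩^{-a}`, square integrable for `a > n/2`,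
with the square integrable function `⟨ξ⟩^a f̂`. -/
theorem Sob.integrable_hat (ha : (n : ℝ) / 2 < a) (f : Sob n m a) : Integrable f.hat := by
  have h1 : MemLp (fun ζ : Space n => ((japanese n m (-a) ζ : ℝ) : ℂ)) 2 :=
    (memLp_japanese_neg ha).ofReal
  have h2 := h1.integrable_mul f.memLp_hat
  refine (h2.const_mul (((2 * Real.pi) ^ ((n : ℝ) / 2) : ℝ) : ℂ)⁻¹).congr
    (Eventually.of_forall fun ζ => ?_)
  have e : japanese n m (-a) ζ * japanese n m a ζ = 1 := by
    rw [← japanese_add, neg_add_cancel, japanese_zero]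
  have hc : ((((2 * Real.pi) ^ ((n : ℝ) / 2) : ℝ)) : ℂ) ≠ 0 :=
    Complex.ofReal_ne_zero.2 (by positivity)
  have e' : (japanese n m (-a) ζ : ℂ) * (japanese n m a ζ : ℂ) = 1 := by exact_mod_cast e
  simp only [Pi.mul_apply, sobWeight, Complex.ofReal_mul]
  rw [inv_mul_eq_iff_eq_mul₀ hc]
  linear_combination ((((2 * Real.pi) ^ ((n : ℝ) / 2) : ℝ)) : ℂ) * f.hat ζ * e'

/-- The inversion formula for the elements of `H^a`, `a > n/2`. -/
theorem Sob.fourierInv_hat (ha : (n : ℝ) / 2 < a) (f : Sob n m a) :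
    (∀ᵐ x, 𝓕⁻ f.hat x = ((𝓕⁻ f.hat x).re : ℂ)) ∧
      IsRepr f.toDistr fun x => (𝓕⁻ f.hat x).re := by
  have hi := f.integrable_hat ha
  have hcont : Continuous (𝓕⁻ f.hat) :=
    VectorFourier.fourierIntegral_continuous Real.continuous_fourierChar
      (by simp only [LinearMap.neg_apply]; exact continuous_inner.neg) hi
  refine IsRepr.of_complex hcont.locallyIntegrable (fun k => ?_) f.2.1
  have hb : ∀ x, ‖𝓕⁻ f.hat x‖ ≤ ∫ ζ, ‖f.hat ζ‖ := fun x =>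
    VectorFourier.norm_fourierIntegral_le_integral_norm _ _ _ _ _
  refine ⟨k.integrable.mul_bdd hcont.aestronglyMeasurable (Eventually.of_forall hb), ?_⟩
  rw [(f.hasHat k).2]
  have h := VectorFourier.integral_fourierIntegral_smul_eq_flip (L := -innerₗ (Space n))
    (μ := volume) (ν := volume) (f := f.hat) (g := k) Real.continuous_fourierChar
    (by simp only [LinearMap.neg_apply]; exact continuous_inner.neg) hi k.integrable
  have hflip : (-innerₗ (Space n)).flip = -innerₗ (Space n) := by
    ext x y
    simp [real_inner_comm]
  rw [hflip] at h
  simp only [smul_eq_mul] at h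
  rw [SchwartzMap.fourierInv_coe]
  refine h.symm.trans (integral_congr_ae (Eventually.of_forall fun x => ?_))
  exact mul_comm _ _

end Product

section Product

variable {n : ℕ} {m a σ : ℝ} [hm : Fact (0 < m)]

/-- Modulating a test function translates its inverse transform. This identifies the inverse
transform of `k w'` with an integral over the transform of `w'`, although the latter is known only
through pairings with Schwartz functions. -/
theorem exists_schwartz_shift (k : SchwartzMap (Space n) ℂ) (η : Space n) :
    ∃ l : SchwartzMap (Space n) ℂ, (∀ x, l x = Real.fourierChar (inner ℝ η x) • k x) ∧
      ∀ ζ, (𝓕⁻ l) ζ = (𝓕⁻ k) (η + ζ) := by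
  set H : SchwartzMap (Space n) ℂ := (𝓕⁻ k).compSubConstCLM ℂ (-η) with hH
  refine ⟨𝓕 H, fun x => ?_, fun ζ => ?_⟩
  · have h := congrFun (VectorFourier.fourierIntegral_comp_add_right Real.fourierChar volume
      (innerₗ (Space n)) (⇑(𝓕⁻ k : SchwartzMap (Space n) ℂ)) η) x
    have e : ((⇑(𝓕⁻ k : SchwartzMap (Space n) ℂ)) ∘ fun v => v + η) = H := by
      funext v
      simp [hH, SchwartzMap.compSubConstCLM_apply]
    rw [e] at h
    have e2 : VectorFourier.fourierIntegral Real.fourierChar volume (innerₗ (Space n))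
        (⇑(𝓕⁻ k : SchwartzMap (Space n) ℂ)) x = k x := by
      change 𝓕 (⇑(𝓕⁻ k : SchwartzMap (Space n) ℂ)) x = k x
      rw [← SchwartzMap.fourier_coe, FourierTransform.fourier_fourierInv_eq]
    rw [e2] at h
    rw [SchwartzMap.fourier_coe]
    exact h
  · rw [FourierTransform.fourierInv_fourier_eq, hH, SchwartzMap.compSubConstCLM_apply]
    congr 1
    abel

/-- Multiplication by functions in `H^a`, `a > n/2`, in the space `H^σ`, `0 ≤ σ ≤ a`. -/
theorem Sob.exists_mul (h0 : 0 ≤ σ) (hσ : σ ≤ a) (ha : (n : ℝ) / 2 < a) :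
    ∃ C : ℝ, 0 ≤ C ∧ ∀ (f : Sob n m a) (g : Sob n m σ), ∃ p : Sob n m σ, ‖p‖ ≤ C * (‖f‖ * ‖g‖) ∧
      ∀ w w', IsRepr f.toDistr w → IsRepr g.toDistr w' → IsRepr p.toDistr (w * w') := by
  obtain ⟨C, hC, hb⟩ := lintegral_abs_conv_le (m := m) h0 hσ ha
  refine ⟨(C ^ (1 / 2 : ℝ)).toReal, by positivity, fun f g => ?_⟩
  -- The product is defined by its transform, the convolution of the two transforms; afterwards it
  -- is shown to be represented by the pointwise product.
  set F := conv f.hat g.hat with hF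
  have hsm := stronglyMeasurable_conv_integrand f.stronglyMeasurable_hat g.stronglyMeasurable_hat
  have hFm : StronglyMeasurable F := hsm.integral_prod_right'
  have hw : ∀ τ : ℝ, StronglyMeasurable fun ζ : Space n => (sobWeight n m τ ζ : ℂ) := fun τ =>
    (Complex.continuous_ofReal.comp (continuous_sobWeight τ)).stronglyMeasurable
  set A : Space n → ℝ≥0∞ := fun ξ => ∫⁻ η, ‖f.hat η‖ₑ * ‖g.hat (ξ - η)‖ₑ with hA
  have hAm : Measurable A := by
    have : Measurable fun p : Space n × Space n => ‖f.hat p.2‖ₑ * ‖g.hat (p.1 - p.2)‖ₑ :=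
      (f.stronglyMeasurable_hat.measurable.comp measurable_snd).enorm.mul
        (g.stronglyMeasurable_hat.measurable.comp measurable_sub).enorm
    exact this.lintegral_prod_right'
  have hFA : ∀ ξ, ‖F ξ‖ₑ ≤ A ξ := fun ξ => by
    refine (enorm_integral_le_lintegral_enorm _).trans_eq ?_
    simp [hA]
  have hL : eLpNorm (fun ζ => (sobWeight n m σ ζ : ℂ) * F ζ) 2 volume ≤
      C ^ (1 / 2 : ℝ) * (‖f‖ₑ * ‖g‖ₑ) := by
    rw [eLpNorm_eq_lintegral_rpow_enorm_toReal (by norm_num) (by norm_num), ENNReal.toReal_ofNat]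
    have h1 : ∫⁻ ζ, ‖(sobWeight n m σ ζ : ℂ) * F ζ‖ₑ ^ (2 : ℝ) ≤
        C * (‖f‖ₑ ^ (2 : ℝ) * ‖g‖ₑ ^ (2 : ℝ)) := by
      refine (lintegral_mono fun ζ => ?_).trans (hb f g)
      rw [enorm_mul]
      exact ENNReal.rpow_le_rpow (mul_le_mul_right (hFA ζ) _) (by norm_num)
    refine (ENNReal.rpow_le_rpow h1 (by norm_num : (0 : ℝ) ≤ 1 / 2)).trans_eq ?_
    rw [ENNReal.mul_rpow_of_nonneg _ _ (by norm_num), ENNReal.mul_rpow_of_nonneg _ _ (by norm_num),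
      ← ENNReal.rpow_mul, ← ENNReal.rpow_mul]
    norm_num
  have hmem : MemLp (fun ζ => (sobWeight n m σ ζ : ℂ) * F ζ) 2 :=
    ⟨((hw σ).mul hFm).aestronglyMeasurable, hL.trans_lt (by finiteness)⟩
  obtain ⟨p, hp⟩ := Sob.exists_hat_eq hmem (f.hermSymm_hat.conv g.hermSymm_hat)
  refine ⟨p, ?_, fun w w' hw1 hw2 => ?_⟩
  · have h1 : ‖p‖ = (eLpNorm (fun ζ => (sobWeight n m σ ζ : ℂ) * F ζ) 2 volume).toReal := by
      rw [norm_def, Lp.norm_def]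
      congr 1
      refine eLpNorm_congr_ae ?_
      filter_upwards [hp] with ζ hζ
      rw [symbol_eq, hζ]
    rw [h1]
    have h2 := ENNReal.toReal_mono (by finiteness) hL
    rwa [ENNReal.toReal_mul, ENNReal.toReal_mul, toReal_enorm, toReal_enorm] at h2
  obtain ⟨hre, hrep⟩ := f.fourierInv_hat ha
  have hww : (fun x => (w x : ℂ)) =ᵐ[volume] 𝓕⁻ f.hat := by
    filter_upwards [hw1.ae_eq hrep, hre] with x h1 h2
    rw [h1, ← h2]
  have hi := f.integrable_hat ha
  have hcL : Continuous fun p : Space n × Space n => (-innerₗ (Space n)) p.1 p.2 := by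
    simp only [LinearMap.neg_apply]; exact continuous_inner.neg
  have hcont : Continuous (𝓕⁻ f.hat) :=
    VectorFourier.fourierIntegral_continuous Real.continuous_fourierChar hcL hi
  have hbd : ∀ x, ‖𝓕⁻ f.hat x‖ ≤ ∫ ζ, ‖f.hat ζ‖ := fun x =>
    VectorFourier.norm_fourierIntegral_le_integral_norm _ _ _ _ _
  refine ⟨hw1.1.mul hw2.1, fun k => ?_⟩
  have hk := hw2.2 k
  have e1 : (fun x => k x * (((w * w') x : ℝ) : ℂ)) =ᵐ[volume]
      fun x => (k x * (w' x : ℂ)) * 𝓕⁻ f.hat x := by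
    filter_upwards [hww] with x hx
    rw [← hx, Pi.mul_apply, Complex.ofReal_mul]
    ring
  have hint := hk.1.mul_bdd hcont.aestronglyMeasurable (Eventually.of_forall hbd)
  refine ⟨hint.congr e1.symm, ?_⟩
  rw [integral_congr_ae e1]
  -- move the Fourier transform to the other factor
  have hflip : (-innerₗ (Space n)).flip = -innerₗ (Space n) := by
    ext x y
    simp [real_inner_comm]
  have e2 := VectorFourier.integral_fourierIntegral_smul_eq_flip (L := -innerₗ (Space n))
    (μ := volume) (ν := volume) (f := f.hat) (g := fun x => k x * (w' x : ℂ))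
    Real.continuous_fourierChar hcL hi hk.1
  rw [hflip] at e2
  simp only [smul_eq_mul] at e2
  have e3 : ∀ η, 𝓕⁻ (fun x => k x * (w' x : ℂ)) η = ∫ ξ, g.hat (ξ - η) * (𝓕⁻ k) ξ := by
    intro η
    obtain ⟨l, hl1, hl2⟩ := exists_schwartz_shift k η
    have h1 := (hw2.2 l).2
    rw [(g.hasHat l).2] at h1
    rw [← integral_add_right_eq_self _ η]
    simp only [add_sub_cancel_right]
    calc _ = ∫ x, l x * (w' x : ℂ) := by
          rw [Real.fourierInv_eq]
          refine integral_congr_ae (Eventually.of_forall fun x => ?_)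
          simp only
          rw [hl1, real_inner_comm, smul_mul_assoc]
      _ = _ := by
          rw [← h1]
          refine integral_congr_ae (Eventually.of_forall fun ζ => ?_)
          simp only
          rw [hl2, add_comm]
  have e4 : ∫ x, k x * (w' x : ℂ) * 𝓕⁻ f.hat x =
      ∫ η, ∫ ξ, f.hat η * (g.hat (ξ - η) * (𝓕⁻ k) ξ) := by
    calc _ = ∫ x, 𝓕⁻ f.hat x * (k x * (w' x : ℂ)) :=
          integral_congr_ae (Eventually.of_forall fun x => mul_comm _ _)
      _ = ∫ η, f.hat η * 𝓕⁻ (fun x => k x * (w' x : ℂ)) η := e2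
      _ = _ := by
          refine integral_congr_ae (Eventually.of_forall fun η => ?_)
          simp only
          rw [e3, integral_const_mul]
  have e5 : p.toDistr k = ∫ ξ, ∫ η, f.hat η * (g.hat (ξ - η) * (𝓕⁻ k) ξ) := by
    rw [(p.hasHat k).2]
    refine integral_congr_ae ?_
    filter_upwards [hp] with ξ hξ
    rw [hξ, hF, conv, ← integral_mul_const]
    refine integral_congr_ae (Eventually.of_forall fun η => ?_)
    simp only
    ring
  rw [e4, e5]
  -- Fubini's theorem. Absolute integrability comes from the weighted bound for the absolute
  -- convolution, because the weight of order `σ ≥ 0` is bounded below.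
  refine integral_integral_swap (μ := volume) (ν := volume) (f := fun ξ η => f.hat η * (g.hat (ξ - η) * (𝓕⁻ k) ξ)) ?_
  have hjm : AEStronglyMeasurable (Function.uncurry fun ξ η =>
      f.hat η * (g.hat (ξ - η) * (𝓕⁻ k) ξ)) (volume.prod volume) := by
    have : StronglyMeasurable fun p : Space n × Space n => (𝓕⁻ k) p.1 :=
      (𝓕⁻ k).continuous.stronglyMeasurable.comp_measurable measurable_fst
    refine (hsm.mul this).aestronglyMeasurable.congr (Eventually.of_forall fun p => ?_)
    simp only [Pi.mul_apply, Function.uncurry]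
    ring
  refine ⟨hjm, ?_⟩
  rw [HasFiniteIntegral, lintegral_prod _ hjm.enorm]
  have h3 : ∀ ξ, ∫⁻ η, ‖(Function.uncurry fun ξ η => f.hat η * (g.hat (ξ - η) * (𝓕⁻ k) ξ)) (ξ, η)‖ₑ
      = A ξ * ‖(𝓕⁻ k) ξ‖ₑ := by
    intro ξ
    simp only [Function.uncurry, enorm_mul, hA]
    rw [← lintegral_mul_const' _ _ (by simp)]
    refine lintegral_congr fun η => ?_
    ring
  simp_rw [h3]
  obtain ⟨K, hK0, hK⟩ := japanese_le_of_le (n := n) (m := m) h0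
  set c : ℝ := (2 * Real.pi) ^ ((n : ℝ) / 2) with hc
  have hc0 : 0 < c := by positivity
  have h4 : ∀ ξ : Space n, (1 : ℝ≥0∞) ≤ ENNReal.ofReal (K * c⁻¹) * ‖(sobWeight n m σ ξ : ℂ)‖ₑ := by
    intro ξ
    have h5 := hK ξ
    rw [japanese_zero] at h5
    rw [← ofReal_norm, Complex.norm_real, Real.norm_of_nonneg (sobWeight_pos _ _).le,
      ← ENNReal.ofReal_mul (by positivity), ← ENNReal.ofReal_one]
    refine ENNReal.ofReal_le_ofReal (h5.trans_eq ?_)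
    rw [sobWeight, ← hc]
    field_simp
  have h6 := ENNReal.lintegral_mul_le_Lp_mul_Lq (volume : Measure (Space n))
    Real.HolderConjugate.two_two (f := fun ξ => ‖(sobWeight n m σ ξ : ℂ)‖ₑ * A ξ)
    (g := fun ξ => ‖(𝓕⁻ k) ξ‖ₑ) (((hw σ).measurable.enorm.mul hAm).aemeasurable)
    (𝓕⁻ k).continuous.measurable.enorm.aemeasurable
  have h7 : ∫⁻ ξ, ‖(𝓕⁻ k) ξ‖ₑ ^ (2 : ℝ) < ⊤ := by
    have := lintegral_rpow_enorm_lt_top_of_eLpNorm_lt_top (by norm_num) (by norm_num)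
      ((𝓕⁻ k).memLp 2 volume).2
    simpa using this
  have h8 : ∫⁻ ξ, (‖(sobWeight n m σ ξ : ℂ)‖ₑ * A ξ) ^ (2 : ℝ) < ⊤ :=
    (hb f g).trans_lt (by finiteness)
  calc ∫⁻ ξ, A ξ * ‖(𝓕⁻ k) ξ‖ₑ
      ≤ ∫⁻ ξ, ENNReal.ofReal (K * c⁻¹) * ((‖(sobWeight n m σ ξ : ℂ)‖ₑ * A ξ) * ‖(𝓕⁻ k) ξ‖ₑ) := by
        refine lintegral_mono fun ξ => ?_
        simp only
        rw [← mul_assoc, ← mul_assoc]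
        refine mul_le_mul_left ?_ _
        calc A ξ = 1 * A ξ := (one_mul _).symm
          _ ≤ _ := mul_le_mul_left (h4 ξ) _
    _ = ENNReal.ofReal (K * c⁻¹) * ∫⁻ ξ, (‖(sobWeight n m σ ξ : ℂ)‖ₑ * A ξ) * ‖(𝓕⁻ k) ξ‖ₑ :=
        lintegral_const_mul' _ _ (by simp)
    _ < ⊤ := by
        refine ENNReal.mul_lt_top (by simp) (h6.trans_lt ?_)
        exact ENNReal.mul_lt_top (ENNReal.rpow_lt_top_of_nonneg (by norm_num) h8.ne)
          (ENNReal.rpow_lt_top_of_nonneg (by norm_num) h7.ne)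

end Product

/-! ## Analytic functions of elements of Sobolev spaces -/

section Analytic

variable {n : ℕ} {m a σ : ℝ} [hm : Fact (0 < m)]

/-- One factor of `H^a` is multiplied on at a time. The constant is taken at least `1` so that
powers with different exponents can be compared later. -/
theorem Sob.exists_prod (h0 : 0 ≤ σ) (hσ : σ ≤ a) (ha : (n : ℝ) / 2 < a) :
    ∃ C : ℝ, 1 ≤ C ∧ ∀ {κ : Type} (S : Finset κ) (f : κ → Sob n m a) (g : Sob n m σ),
      ∃ p : Sob n m σ, ‖p‖ ≤ C ^ S.card * ((∏ l ∈ S, ‖f l‖) * ‖g‖) ∧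
        IsRepr p.toDistr fun x =>
          (∏ l ∈ S, reprFun (f l).toDistr x) * reprFun g.toDistr x := by
  classical
  obtain ⟨C, hC, h⟩ := Sob.exists_mul (m := m) h0 hσ ha
  refine ⟨max C 1, le_max_right _ _, fun {κ} S f g => ?_⟩
  induction S using Finset.induction_on with
  | empty => exact ⟨g, by simp, by simp [g.isRepr_reprFun h0]⟩
  | insert l S hl ih =>
    obtain ⟨p, hp, hw⟩ := ih
    obtain ⟨p', hp', hw'⟩ := h (f l) p
    refine ⟨p', hp'.trans ?_, ?_⟩
    · rw [Finset.prod_insert hl, Finset.card_insert_of_notMem hl, pow_succ]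
      calc C * (‖f l‖ * ‖p‖) ≤ max C 1 * (‖f l‖ * (max C 1 ^ S.card *
            ((∏ l ∈ S, ‖f l‖) * ‖g‖))) := by
            gcongr
            exact le_max_left _ _
        _ = _ := by ring
    · refine (hw' _ _ ((f l).isRepr_reprFun (h0.trans hσ)) hw).congr
        (Eventually.of_forall fun x => ?_)
      simp only [Pi.mul_apply]
      rw [Finset.prod_insert hl, mul_assoc]

variable {X E : Type} [NormedAddCommGroup X] [NormedSpace ℝ X] [NormedAddCommGroup E]
  [NormedSpace ℝ E] {ι : Type} [Fintype ι]

/-- Representing functions determine distributions, so multilinearity need only be checked pointwise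
almost everywhere, where it is that of `B`. What is left to supply is, for each `c`, an element with
a norm bound. -/
theorem exists_multilinear_of_isRepr {k : ℕ} {U : Fin k → X → Space n → E}
    (hadd : ∀ l x y, U l (x + y) =ᵐ[volume] U l x + U l y)
    (hsmul : ∀ l (r : ℝ) x, U l (r • x) =ᵐ[volume] r • U l x)
    (B : ContinuousMultilinearMap ℝ (fun _ : Fin k => E) ℝ) {M : ℝ} (hM : 0 ≤ M)
    (h : ∀ c : Fin k → X, ∃ q : Sob n m σ, ‖q‖ ≤ M * ∏ l, ‖c l‖ ∧
      IsRepr q.toDistr fun x => B fun l => U l (c l) x) :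
    ∃ Q : ContinuousMultilinearMap ℝ (fun _ : Fin k => X) (Sob n m σ), ‖Q‖ ≤ M ∧
      ∀ c, IsRepr (Q c).toDistr fun x => B fun l => U l (c l) x := by
  choose q hq hr using h
  have hup : ∀ [DecidableEq (Fin k)] (c : Fin k → X) (l : Fin k) (z : X) (x : Space n),
      (fun l' => U l' (Function.update c l z l') x) =
        Function.update (fun l' => U l' (c l') x) l (U l z x) := by
    intro _ c l z x
    funext l'
    by_cases hl : l' = l
    · subst hl
      simp
    · simp [hl]
  let Q : MultilinearMap ℝ (fun _ : Fin k => X) (Sob n m σ) :=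
    { toFun := q
      map_update_add' := fun {_} c l y z => by
        apply Sob.ext_toDistr
        have h1 := (hr (Function.update c l y)).add (hr (Function.update c l z))
        rw [map_add]
        refine (hr (Function.update c l (y + z))).eq (h1.congr ?_)
        filter_upwards [hadd l y z] with x hx
        simp only [Pi.add_apply, hup]
        rw [hx, Pi.add_apply, B.map_update_add]
      map_update_smul' := fun {_} c l r y => by
        apply Sob.ext_toDistr
        have h1 := (hr (Function.update c l y)).smul r
        rw [map_smul]
        refine (hr (Function.update c l (r • y))).eq (h1.congr ?_)
        filter_upwards [hsmul l r y] with x hx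
        simp only [Pi.smul_apply, hup]
        rw [hx, Pi.smul_apply, B.map_update_smul] }
  exact ⟨Q.mkContinuous M hq, Q.mkContinuous_norm_le hM hq, hr⟩

/-- The function with values in `E` whose coordinates are given by elements of `H^σ`. -/
def sobFun (b : ι → E) (α : ι → X →L[ℝ] Sob n m σ) (c : X) (x : Space n) : E :=
  ∑ j, reprFun (α j c).toDistr x • b j

theorem sobFun_add (h0 : 0 ≤ σ) (b : ι → E) (α : ι → X →L[ℝ] Sob n m σ) (c c' : X) :
    sobFun b α (c + c') =ᵐ[volume] sobFun b α c + sobFun b α c' := by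
  have h : ∀ j, ∀ᵐ x, reprFun (α j (c + c')).toDistr x =
      reprFun (α j c).toDistr x + reprFun (α j c').toDistr x := fun j => by
    have h1 := ((α j c).isRepr_reprFun h0).add ((α j c').isRepr_reprFun h0)
    rw [← map_add, ← map_add] at h1
    exact h1.reprFun_ae_eq
  filter_upwards [ae_all_iff.2 h] with x hx
  simp only [sobFun, Pi.add_apply, hx, add_smul, Finset.sum_add_distrib]

theorem sobFun_smul (h0 : 0 ≤ σ) (b : ι → E) (α : ι → X →L[ℝ] Sob n m σ) (r : ℝ) (c : X) :
    sobFun b α (r • c) =ᵐ[volume] r • sobFun b α c := by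
  have h : ∀ j, ∀ᵐ x, reprFun (α j (r • c)).toDistr x = r * reprFun (α j c).toDistr x :=
      fun j => by
    have h1 := ((α j c).isRepr_reprFun h0).smul r
    rw [← map_smul, ← map_smul] at h1
    exact h1.reprFun_ae_eq
  filter_upwards [ae_all_iff.2 h] with x hx
  simp only [sobFun, Pi.smul_apply, hx, mul_smul, Finset.smul_sum]

/-- A multilinear form, with one entry in `H^σ` and the others in the algebra `H^a`. -/
theorem exists_multilinear_sobFun (h0 : 0 ≤ σ) (hσ : σ ≤ a) (ha : (n : ℝ) / 2 < a) (b : ι → E)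
    (α : ι → X →L[ℝ] Sob n m a) (β : ι → X →L[ℝ] Sob n m σ) :
    ∃ K : ℝ, 0 ≤ K ∧ ∀ (k : ℕ) (B : ContinuousMultilinearMap ℝ (fun _ : Fin k => E) ℝ)
      (i₀ : Fin k), ∃ Q : ContinuousMultilinearMap ℝ (fun _ : Fin k => X) (Sob n m σ),
        ‖Q‖ ≤ ‖B‖ * K ^ k ∧ ∀ c, IsRepr (Q c).toDistr fun x =>
          B fun l => (if l = i₀ then sobFun b β else sobFun b α) (c l) x := by
  classical
  obtain ⟨C, hC, hprod⟩ := Sob.exists_prod (m := m) h0 hσ ha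
  set D : ℝ := ∑ j, (‖α j‖ + ‖β j‖) with hD
  set b₀ : ℝ := ∑ j, ‖b j‖ with hb₀
  have hD0 : 0 ≤ D := Finset.sum_nonneg fun j _ => by positivity
  have hb0 : 0 ≤ b₀ := Finset.sum_nonneg fun j _ => norm_nonneg _
  have hbj : ∀ j, ‖b j‖ ≤ b₀ := fun j =>
    Finset.single_le_sum (f := fun j => ‖b j‖) (fun j _ => norm_nonneg _) (Finset.mem_univ j)
  have hDj : ∀ j, ‖α j‖ + ‖β j‖ ≤ D := fun j =>
    Finset.single_le_sum (f := fun j => ‖α j‖ + ‖β j‖) (fun j _ => by positivity)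
      (Finset.mem_univ j)
  -- Expansion in the vectors `b j` yields `(card ι) ^ k` products; each is bounded by `‖B‖ b₀ ^ k`
  -- from the form and by `(C D) ^ k` from the product estimate.
  refine ⟨Fintype.card ι * (b₀ * (C * D)), by positivity, fun k B i₀ => ?_⟩
  refine exists_multilinear_of_isRepr
    (U := fun l => if l = i₀ then sobFun b β else sobFun b α) (fun l x y => ?_)
    (fun l r x => ?_) B (by positivity) fun c => ?_
  · split_ifs
    · exact sobFun_add h0 b β x y
    · exact sobFun_add (h0.trans hσ) b α x y
  · split_ifs
    · exact sobFun_smul h0 b β r x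
    · exact sobFun_smul (h0.trans hσ) b α r x
  choose p hp hr using fun f : Fin k → ι => hprod (Finset.univ.erase i₀)
    (fun l => α (f l) (c l)) (β (f i₀) (c i₀))
  refine ⟨∑ f, B (fun l => b (f l)) • p f, ?_, ?_⟩
  · have hpf : ∀ f, ‖p f‖ ≤ (C * D) ^ k * ∏ l, ‖c l‖ := by
      intro f
      have h1 : ∏ l ∈ Finset.univ.erase i₀, ‖α (f l) (c l)‖ ≤
          ∏ l ∈ Finset.univ.erase i₀, (D * ‖c l‖) := by
        refine Finset.prod_le_prod (fun l _ => norm_nonneg _) fun l _ => ?_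
        refine ((α (f l)).le_opNorm _).trans ?_
        gcongr
        have := hDj (f l)
        have := norm_nonneg (β (f l))
        linarith
      have h2 : ‖β (f i₀) (c i₀)‖ ≤ D * ‖c i₀‖ := by
        refine ((β (f i₀)).le_opNorm _).trans ?_
        gcongr
        have := hDj (f i₀)
        have := norm_nonneg (α (f i₀))
        linarith
      have hcard : (Finset.univ.erase i₀).card ≤ k :=
        Finset.card_erase_le.trans_eq (Finset.card_fin k)
      calc ‖p f‖ ≤ C ^ (Finset.univ.erase i₀).card *
            ((∏ l ∈ Finset.univ.erase i₀, ‖α (f l) (c l)‖) * ‖β (f i₀) (c i₀)‖) := hp f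
        _ ≤ C ^ k * ((∏ l ∈ Finset.univ.erase i₀, (D * ‖c l‖)) * (D * ‖c i₀‖)) := by
            have := Finset.prod_nonneg fun l (_ : l ∈ Finset.univ.erase i₀) =>
              norm_nonneg (α (f l) (c l))
            gcongr
        _ = _ := by
            rw [Finset.prod_erase_mul _ _ (Finset.mem_univ i₀), Finset.prod_mul_distrib,
              Finset.prod_const, Finset.card_univ, Fintype.card_fin, mul_pow]
            ring
    calc ‖∑ f, B (fun l => b (f l)) • p f‖
        ≤ ∑ _f : Fin k → ι, (‖B‖ * b₀ ^ k) * ((C * D) ^ k * ∏ l, ‖c l‖) := by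
          refine (norm_sum_le _ _).trans (Finset.sum_le_sum fun f _ => ?_)
          rw [norm_smul]
          refine mul_le_mul ?_ (hpf f) (norm_nonneg _) (by positivity)
          refine (B.le_opNorm _).trans ?_
          gcongr
          calc ∏ l, ‖b (f l)‖ ≤ ∏ _l : Fin k, b₀ :=
                Finset.prod_le_prod (fun l _ => norm_nonneg _) fun l _ => hbj _
            _ = b₀ ^ k := by simp
      _ = _ := by
          rw [Finset.sum_const, Finset.card_univ, Fintype.card_fun, Fintype.card_fin, nsmul_eq_mul]
          push_cast
          rw [mul_pow, mul_pow]
          ring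
  · rw [map_sum]
    have hs : ∀ f, IsRepr (B (fun l => b (f l)) • p f).toDistr fun x =>
        B (fun l => b (f l)) * ((∏ l ∈ Finset.univ.erase i₀,
          reprFun (α (f l) (c l)).toDistr x) * reprFun (β (f i₀) (c i₀)).toDistr x) := fun f => by
      rw [map_smul]
      exact (hr f).smul _
    refine (IsRepr.sum fun f _ => hs f).congr (Eventually.of_forall fun x => ?_)
    · have e : (fun l => (if l = i₀ then sobFun b β else sobFun b α) (c l) x) = fun l =>
          ∑ j, (if l = i₀ then reprFun (β j (c l)).toDistr x else
            reprFun (α j (c l)).toDistr x) • b j := by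
        funext l
        split_ifs <;> rfl
      simp only [Finset.sum_apply]
      rw [e, B.map_sum]
      refine Finset.sum_congr rfl fun f _ => ?_
      rw [B.map_smul_univ, smul_eq_mul, ← Finset.prod_erase_mul _ _ (Finset.mem_univ i₀),
        if_pos rfl, mul_comm]
      congr 2
      refine Finset.prod_congr rfl fun l hl => ?_
      rw [if_neg (Finset.ne_of_mem_erase hl)]

/-- The power series of `c ↦ A(v) + (d/dε) A(v + ε v')`, where `v` takes values in the algebra
`H^a` and `v'` in `H^σ`. -/
theorem exists_series_sobFun (h0 : 0 ≤ σ) (hσ : σ ≤ a) (ha : (n : ℝ) / 2 < a) (b : ι → E)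
    (α : ι → X →L[ℝ] Sob n m a) (β : ι → X →L[ℝ] Sob n m σ)
    (A : FormalMultilinearSeries ℝ E ℝ) (hA : 0 < A.radius) (hA0 : A 0 = 0) :
    ∃ ρ : ℝ, 0 < ρ ∧ ∃ Q : FormalMultilinearSeries ℝ X (Sob n m σ),
      (Summable fun k => ‖Q k‖ * ρ ^ k) ∧ ∀ k c, IsRepr (Q k fun _ => c).toDistr fun x =>
        A k (fun _ => sobFun b α c x) +
          ∑ i, A k (Function.update (fun _ => sobFun b α c x) i (sobFun b β c x)) := by
  obtain ⟨K₁, hK₁, h₁⟩ := exists_multilinear_sobFun h0 hσ ha b α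
    fun j => (Sob.inclCLM hσ).comp (α j)
  obtain ⟨K₂, hK₂, h₂⟩ := exists_multilinear_sobFun h0 hσ ha b α β
  set K := K₁ + K₂ + 1 with hK
  have hex : ∀ k, ∃ Q : ContinuousMultilinearMap ℝ (fun _ : Fin k => X) (Sob n m σ),
      ‖Q‖ ≤ ‖A k‖ * (2 * K) ^ k ∧ ∀ c : X, IsRepr (Q fun _ => c).toDistr fun x =>
        A k (fun _ => sobFun b α c x) +
          ∑ i, A k (Function.update (fun _ => sobFun b α c x) i (sobFun b β c x)) := by
    intro k
    cases k with
    | zero =>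
      -- The term of degree `0` must vanish, since nonzero constants do not in general belong to
      -- `H^σ`.
      refine ⟨0, by rw [norm_zero]; positivity, fun c => ?_⟩
      refine isRepr_zero.congr (Eventually.of_forall fun x => ?_)
      simp [hA0]
    | succ k =>
      obtain ⟨Q₁, hQ₁, hr₁⟩ := h₁ (k + 1) (A (k + 1)) 0
      choose Q₂ hQ₂ hr₂ using h₂ (k + 1) (A (k + 1))
      refine ⟨Q₁ + ∑ i, Q₂ i, ?_, fun c => ?_⟩
      · have b₁ : ‖Q₁‖ ≤ ‖A (k + 1)‖ * K ^ (k + 1) := hQ₁.trans (by gcongr; linarith)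
        have b₂ : ∀ i, ‖Q₂ i‖ ≤ ‖A (k + 1)‖ * K ^ (k + 1) :=
          fun i => (hQ₂ i).trans (by gcongr; linarith)
        -- The number `k + 2` of summands is absorbed into `2 ^ (k + 1)`, at the price of half the
        -- radius.
        have hn : ((k + 1 : ℕ) : ℝ) + 1 ≤ 2 ^ (k + 1) := by
          have : k + 1 + 1 ≤ 2 ^ (k + 1) := Nat.lt_two_pow_self
          exact_mod_cast this
        calc ‖Q₁ + ∑ i, Q₂ i‖ ≤ ‖A (k + 1)‖ * K ^ (k + 1) +
              ∑ _i : Fin (k + 1), ‖A (k + 1)‖ * K ^ (k + 1) :=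
              (norm_add_le _ _).trans (add_le_add b₁
                ((norm_sum_le _ _).trans (Finset.sum_le_sum fun i _ => b₂ i)))
          _ = (((k + 1 : ℕ) : ℝ) + 1) * (‖A (k + 1)‖ * K ^ (k + 1)) := by
              rw [Finset.sum_const, Finset.card_univ, Fintype.card_fin, nsmul_eq_mul]
              ring
          _ ≤ 2 ^ (k + 1) * (‖A (k + 1)‖ * K ^ (k + 1)) := by gcongr
          _ = _ := by rw [mul_pow]; ring
      · rw [add_apply, sum_apply, map_add,
          map_sum]
        have e₁ := hr₁ fun _ => c
        have e₂ := IsRepr.sum (S := Finset.univ) fun i _ => hr₂ i fun _ => c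
        refine (e₁.add e₂).congr (Eventually.of_forall fun x => ?_)
        simp only [Pi.add_apply, Finset.sum_apply]
        congr 1
        · congr 1
          funext l
          split_ifs
          · simp only [sobFun, ContinuousLinearMap.comp_apply, Sob.inclCLM_apply,
              Sob.toDistr_incl]
          · rfl
        · refine Finset.sum_congr rfl fun i _ => ?_
          congr 1
          funext l
          by_cases hl : l = i
          · subst hl
            simp
          · simp [hl]
  choose Q hQ hr using hex
  obtain ⟨r, hr0, hrA⟩ := ENNReal.lt_iff_exists_nnreal_btwn.1 hA
  have hr0' : (0 : ℝ) < r := by exact_mod_cast hr0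
  have hKp : 0 < K := by positivity
  refine ⟨r / (2 * K), by positivity, Q, ?_, hr⟩
  refine Summable.of_nonneg_of_le (fun k => by positivity) (fun k => ?_)
    (A.summable_norm_mul_pow hrA)
  calc ‖Q k‖ * (r / (2 * K)) ^ k ≤ ‖A k‖ * (2 * K) ^ k * (r / (2 * K)) ^ k := by
        gcongr
        exact hQ k
    _ = ‖A k‖ * r ^ k := by
        rw [mul_assoc, ← mul_pow, mul_div_cancel₀ _ (by positivity)]

end Analytic

/-! ### Derivatives, and forms which are affine along a line -/

section Derivatives

variable {n : ℕ} {m s s' : ℝ} [hm : Fact (0 < m)]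

/-- The partial derivatives, as operators between Sobolev spaces. -/
theorem Sob.exists_partialD (h : s' ≤ s - 1) (j : Fin n) :
    ∃ A : Sob n m s →L[ℝ] Sob n m s', ∀ T, (A T).toDistr = partialD j T.toDistr := by
  obtain ⟨C, hC0, hC⟩ := japanese_le_of_le (n := n) (m := m) (s := s - s') (s' := 1) (by linarith)
  obtain ⟨A, hA, -⟩ := Sob.exists_mult (n := n) (m := m) (s := s) (s' := s')
    (a := fun ζ => Complex.I * (((2 * Real.pi) • ζ) j : ℝ)) (C := C)
    (by fun_prop) (Eventually.of_forall fun ζ => by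
      have e : ((2 * Real.pi) • (-ζ)) j = -((2 * Real.pi) • ζ) j := by simp
      simp only
      rw [e, map_mul, Complex.conj_I, Complex.conj_ofReal]
      push_cast
      ring) (fun ζ => by
      rw [norm_mul, Complex.norm_I, one_mul, Complex.norm_real, Real.norm_eq_abs]
      exact (abs_coord_le ζ j).trans (hC ζ))
  exact ⟨A, fun T => ((A T).hasHat.congr (hA T)).unique (T.hasHat.partialD j)⟩

end Derivatives

section Affine

variable {E : Type} [NormedAddCommGroup E] [NormedSpace ℝ E]

/-- An affine function of `t` is its own Taylor polynomial of first order at `t = 0`, and the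
derivative of a multilinear form on the diagonal replaces one entry at a time. -/
theorem ContinuousMultilinearMap.sum_update_of_affine {k : ℕ}
    (A : ContinuousMultilinearMap ℝ (fun _ : Fin k => E) ℝ) {v e : E}
    (h : ∀ t : ℝ, A (fun _ => v + t • e) = (1 - t) * A (fun _ => v) + t * A fun _ => v + e) :
    A (fun _ => v + e) = A (fun _ => v) + ∑ i, A (Function.update (fun _ => v) i e) := by
  have h1 : HasDerivAt (fun t : ℝ => fun _ : Fin k => v + t • e) (fun _ => e) 0 := by
    rw [hasDerivAt_pi]
    intro _
    simpa using ((hasDerivAt_id (0 : ℝ)).smul_const e).const_add v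
  have h2 := (A.hasFDerivAt (fun _ : Fin k => v + (0 : ℝ) • e)).comp_hasDerivAt (0 : ℝ) h1
  have h3 : HasDerivAt (fun t : ℝ => (1 - t) * A (fun _ => v) + t * A fun _ => v + e)
      (-1 * A (fun _ => v) + 1 * A fun _ => v + e) 0 :=
    (((hasDerivAt_id (0 : ℝ)).const_sub 1).mul_const _).add ((hasDerivAt_id (0 : ℝ)).mul_const _)
  have e1 : (⇑A ∘ fun t : ℝ => fun _ : Fin k => v + t • e) =
      fun t : ℝ => (1 - t) * A (fun _ => v) + t * A fun _ => v + e := funext h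
  rw [e1] at h2
  have h4 := h2.unique h3
  rw [ContinuousMultilinearMap.linearDeriv_apply] at h4
  simp only [zero_smul, add_zero] at h4
  linarith

end Affine

/-! ### The nonlinearity as a power series in the Cauchy data -/

section Jets

variable {n d₁ d₂ : ℕ} {L : LinOp n d₁ d₂} {m s : ℝ} [hm : Fact (0 < m)]
variable {E : Type} [NormedAddCommGroup E] [NormedSpace ℝ E] {ι : Type} [Fintype ι]

/-- The functions `∑ W k c`, for small Cauchy data `c`, are given by the power series `Q`. -/
def IsSeriesOf {σ : ℝ} (Q : FormalMultilinearSeries ℝ (L.DataProd m s) (Sob n m σ))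
    (W : ℕ → L.Cau m s → Space n → ℝ) : Prop :=
  ∀ᶠ ρ in 𝓝[>] (0 : ℝ), (Summable fun k => ‖Q k‖ * ρ ^ k) ∧ ∀ c : L.Cau m s, ‖c‖ ≤ ρ →
    (∀ᵐ x, Summable fun k => W k c x) ∧
      IsRepr (∑' k, Q k fun _ => L.toData c).toDistr fun x => ∑' k, W k c x

theorem summable_norm_series_apply {X Y : Type} [NormedAddCommGroup X] [NormedSpace ℝ X]
    [NormedAddCommGroup Y] [NormedSpace ℝ Y] {Q : FormalMultilinearSeries ℝ X Y} {ρ : ℝ}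
    (h : Summable fun k => ‖Q k‖ * ρ ^ k) {c : X} (hc : ‖c‖ ≤ ρ) :
    Summable fun k => ‖Q k fun _ => c‖ := by
  refine Summable.of_nonneg_of_le (fun k => norm_nonneg _) (fun k => ?_) h
  refine ((Q k).le_opNorm _).trans ?_
  simp only [Finset.prod_const, Finset.card_univ, Fintype.card_fin]
  gcongr

/-- The common core of all cases: the form is evaluated at a jet in the algebra `H^a`, plus a linear
correction in `H^σ`, and the result is included in `H^σ'`. The identity `hW` is required almost
everywhere only, as representing functions are determined up to null sets. -/
theorem exists_series_of_ae {a σ σ' : ℝ} (h0 : 0 ≤ σ) (hσ : σ ≤ a) (ha : (n : ℝ) / 2 < a)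
    (hσ' : σ' ≤ σ) (b : ι → E) (α : ι → L.DataProd m s →L[ℝ] Sob n m a)
    (β : ι → L.DataProd m s →L[ℝ] Sob n m σ) (A : FormalMultilinearSeries ℝ E ℝ)
    (hA : 0 < A.radius) (hA0 : A 0 = 0) {W : ℕ → L.Cau m s → Space n → ℝ}
    (hW : ∀ k c, ∀ᵐ x, W k c x = A k (fun _ => sobFun b α (L.toData c) x) +
      ∑ i, A k (Function.update (fun _ => sobFun b α (L.toData c) x) i
        (sobFun b β (L.toData c) x))) :
    ∃ Q : FormalMultilinearSeries ℝ (L.DataProd m s) (Sob n m σ'), IsSeriesOf Q W := by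
  obtain ⟨ρ, hρ, Q, hQ, hr⟩ := exists_series_sobFun h0 hσ ha b α β A hA hA0
  refine ⟨fun k => (Sob.inclCLM hσ').compContinuousMultilinearMap (Q k), ?_⟩
  filter_upwards [Ioo_mem_nhdsGT hρ] with ρ' hρ'
  have hρ0 := hρ'.1.le
  refine ⟨?_, fun c hc => ?_⟩
  · refine Summable.of_nonneg_of_le (fun k => by positivity) (fun k => ?_)
      (hQ.mul_left ‖Sob.inclCLM (n := n) (m := m) hσ'‖)
    rw [← mul_assoc]
    gcongr
    · exact ContinuousLinearMap.norm_compContinuousMultilinearMap_le _ _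
    · exact hρ'.2.le
  · have hsum := summable_norm_series_apply hQ (c := L.toData c)
      (by rw [LinearIsometryEquiv.norm_map]; exact hc.trans hρ'.2.le)
    have h1 := Sob.hasSum_isRepr h0 (fun k => (hr k (L.toData c)).congr (w' := W k c) (by
      filter_upwards [hW k c] with x hx
      rw [hx])) hsum
    refine ⟨h1.1, ?_⟩
    simp only [ContinuousLinearMap.compContinuousMultilinearMap_coe, Function.comp_apply]
    rw [← (Sob.inclCLM hσ').map_tsum hsum.of_norm, Sob.inclCLM_apply, Sob.toDistr_incl]
    exact h1.2

theorem reprFun_zero : reprFun (0 : Distr n) =ᵐ[volume] 0 := isRepr_zero.reprFun_ae_eq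

/-- The components of a formal series. -/
theorem exists_comp_series {d : ℕ} (A : FormalMultilinearSeries ℝ E (Fin d → ℝ))
    (hA : 0 < A.radius) (hA0 : A 0 = 0) (i : Fin d) :
    ∃ B : FormalMultilinearSeries ℝ E ℝ, 0 < B.radius ∧ B 0 = 0 ∧
      ∀ k v, B k v = A k v i := by
  refine ⟨(ContinuousLinearMap.proj (R := ℝ) (φ := fun _ : Fin d => ℝ)
    i).compFormalMultilinearSeries A, ?_, ?_, fun k v => rfl⟩
  · exact hA.trans_le (FormalMultilinearSeries.radius_le_radius_continuousLinearMap_comp A _)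
  · ext v
    simp [ContinuousLinearMap.compFormalMultilinearSeries, hA0]

namespace Nonlinearity

variable (N : Nonlinearity n d₁ d₂)

theorem Admissible.lt {N : Nonlinearity n d₁ d₂} (h : N.Admissible L s) : (n : ℝ) / 2 < s := by
  rcases h.2.2.2.2 with h | h | h
  · exact h.2
  · exact h.2.1
  · linarith [h.1]

/-- `N₁` depends on `u` alone, whose components lie in the algebra `H^s`; hence no linear
correction. -/
theorem exists_series₁ (hN : N.Admissible L s) (i : Fin d₁) :
    ∃ Q : FormalMultilinearSeries ℝ (L.DataProd m s) (Sob n m s),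
      IsSeriesOf Q fun k c x => N.N₁ k (fun _ => (jetFun c x).1) i := by
  obtain ⟨B, hB, hB0, hBA⟩ := exists_comp_series N.N₁ hN.1 hN.2.2.1 i
  have hs := hN.lt
  have hs0 : (0 : ℝ) ≤ s := le_trans (by positivity) hs.le
  refine exists_series_of_ae hs0 le_rfl hs le_rfl (fun j => Pi.single j (1 : ℝ))
    (fun j => L.posComp j) (fun _ => 0) B hB hB0 fun k c => ?_
  filter_upwards [reprFun_zero] with x hx
  have e1 : sobFun (fun j => Pi.single j (1 : ℝ)) (fun j => L.posComp j) (L.toData c) x =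
      (jetFun c x).1 := by
    funext j
    simp [sobFun, Finset.sum_apply, Pi.single_apply, jetFun, L.posComp_toData]
  have e2 : sobFun (n := n) (m := m) (σ := s) (fun j : Comp d₁ d₂ => Pi.single j (1 : ℝ))
      (fun _ => (0 : L.DataProd m s →L[ℝ] Sob n m s)) (L.toData c) x = 0 := by
    simp [sobFun, hx]
  rw [e1, e2, ← hBA]
  rw [Finset.sum_eq_zero fun l _ => (B k).map_coord_zero l (by simp), add_zero]

/-- The basis vectors of the space of the values of `(u, ∂₀u₂, ∂₁u, …, ∂ₙu)`. -/
def jetBasis (n d₁ d₂ : ℕ) : Comp d₁ d₂ ⊕ Fin d₂ ⊕ (Fin n × Comp d₁ d₂) → FirstJet n d₁ d₂ :=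
  Sum.elim (fun j => (Pi.single j 1, 0, 0)) (Sum.elim (fun j => (0, Pi.single j 1, 0))
    fun j => (0, 0, Pi.single j.1 (Pi.single j.2 1)))

theorem sobFun_jetBasis {σ : ℝ} {X : Type} [NormedAddCommGroup X] [NormedSpace ℝ X]
    (α₁ : Comp d₁ d₂ → X →L[ℝ] Sob n m σ) (α₂ : Fin d₂ → X →L[ℝ] Sob n m σ)
    (α₃ : Fin n × Comp d₁ d₂ → X →L[ℝ] Sob n m σ) (c : X) (x : Space n) :
    sobFun (jetBasis n d₁ d₂) (Sum.elim α₁ (Sum.elim α₂ α₃)) c x =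
      (fun j => reprFun (α₁ j c).toDistr x, fun j => reprFun (α₂ j c).toDistr x,
        fun j k => reprFun (α₃ (j, k) c).toDistr x) := by
  rw [sobFun, Fintype.sum_sum_type, @Fintype.sum_sum_type (Fin d₂) (Fin n × Comp d₁ d₂)]
  simp only [jetBasis, Sum.elim_inl, Sum.elim_inr]
  refine Prod.ext ?_ (Prod.ext ?_ ?_)
  · funext j
    simp [-Fintype.sum_sum_type, Prod.fst_sum, Finset.sum_apply, Pi.single_apply]
  · funext j
    simp [-Fintype.sum_sum_type, Prod.fst_sum, Prod.snd_sum, Finset.sum_apply, Pi.single_apply]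
  · funext j k
    simp only [Prod.snd_add, Prod.snd_sum, Prod.smul_mk, smul_zero, Finset.sum_const_zero,
      zero_add, Finset.sum_apply, Pi.smul_apply, smul_eq_mul]
    rw [Finset.sum_eq_single (j, k)]
    · simp
    · rintro ⟨j', k'⟩ - h
      by_cases hj : j = j'
      · subst hj
        have hk : k ≠ k' := fun hk => h (by rw [hk])
        simp [hk]
      · simp [hj]
    · simp

/-- The target is `H^{s-r}`, the regularity of `∂₀u₂`. Entries of the jet that occur in arbitrary
powers must lie in an algebra `H^a` with `a > n/2`; each alternative in `Admissible` provides one.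
-/
theorem exists_series₂ (hN : N.Admissible L s) (i : Fin d₂) :
    ∃ Q : FormalMultilinearSeries ℝ (L.DataProd m s) (Sob n m (s - L.r)),
      IsSeriesOf Q fun k c x => N.N₂ k (fun _ => jetFun c x) i := by
  obtain ⟨B, hB, hB0, hBA⟩ := exists_comp_series N.N₂ hN.2.1 hN.2.2.2.1 i
  have hs := hN.lt
  have hs0 : (0 : ℝ) ≤ s := le_trans (by positivity) hs.le
  have hr : (1 : ℝ) ≤ L.r := by exact_mod_cast L.r_pos
  have hn0 : (0 : ℝ) ≤ (n : ℝ) / 2 := by positivity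
  have hzero : ∀ (k : ℕ) (v : FirstJet n d₁ d₂),
      ∑ i, B k (Function.update (fun _ => v) i 0) = 0 := fun k v =>
    Finset.sum_eq_zero fun i _ => (B k).map_coord_zero i (by simp)
  have hz : ∀ (σ : ℝ) (c : L.DataProd m s) (x : Space n), reprFun (0 : Distr n) x = 0 →
      sobFun (n := n) (m := m) (σ := σ) (jetBasis n d₁ d₂) (fun _ => 0) c x = 0 := by
    intro σ c x hx
    simp [sobFun, hx]
  rcases hN.2.2.2.2 with ⟨hI, -⟩ | ⟨hI, -, h1, h2⟩ | ⟨h1, h2 | hI⟩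
  -- No derivatives: the algebra is `H^s`, and the derivative entries of the jet may be replaced by
  -- `0`.
  · refine exists_series_of_ae hs0 le_rfl hs (L.sub_le s) (jetBasis n d₁ d₂)
      (Sum.elim (fun j => L.posComp j) (Sum.elim (fun _ => 0) fun _ => 0)) (fun _ => 0) B hB hB0
      fun k c => ?_
    filter_upwards [reprFun_zero] with x hx
    rw [hz _ _ _ hx, hzero, sobFun_jetBasis, add_zero, hBA]
    exact congrFun (hI k _ _ _) i
  -- Affine case: `u` lies in the algebra `H^s`, and the derivatives, in `H^{s-r}` with `0 ≤ s - r ≤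
  -- s`, form the linear correction. The spatial ones lie there because `r ≥ 1`.
  · choose D hD using fun j => Sob.exists_partialD (n := n) (m := m) (s := s) (s' := s - L.r)
      (by linarith) j
    refine exists_series_of_ae h2 (L.sub_le s) hs le_rfl (jetBasis n d₁ d₂)
      (Sum.elim (fun j => L.posComp j) (Sum.elim (fun _ => 0) fun _ => 0))
      (Sum.elim (fun _ => 0) (Sum.elim (fun j => L.velComp j)
        fun j => (D j.1).comp (L.posComp j.2))) B hB hB0 fun k c => ?_
    filter_upwards [reprFun_zero] with x hx
    have e1 : sobFun (jetBasis n d₁ d₂) (Sum.elim (fun j => L.posComp j)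
        (Sum.elim (fun _ => 0) fun _ => 0)) (L.toData c) x = ((jetFun c x).1, 0, 0) := by
      rw [sobFun_jetBasis]
      refine Prod.ext rfl (Prod.ext ?_ ?_)
      · funext j
        simpa using hx
      · funext j j'
        simpa using hx
    have e2 : sobFun (jetBasis n d₁ d₂) (Sum.elim (fun _ => 0) (Sum.elim (fun j => L.velComp j)
        fun j => (D j.1).comp (L.posComp j.2))) (L.toData c) x = (0, (jetFun c x).2) := by
      rw [sobFun_jetBasis]
      refine Prod.ext ?_ (Prod.ext rfl ?_)
      · funext j
        simpa using hx
      · funext j j'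
        simp only [ContinuousLinearMap.comp_apply, hD]
        rfl
    rw [e1, e2]
    have e3 : jetFun c x = ((jetFun c x).1, (0, 0)) + (0, (jetFun c x).2) := by
      refine Prod.ext (by simp) (Prod.ext (by simp) (by simp))
    rw [← (B k).sum_update_of_affine (v := ((jetFun c x).1, 0, 0)) (e := (0, (jetFun c x).2)),
      hBA, ← e3]
    intro t
    have h4 := congrFun (hI k (jetFun c x).1 0 (jetFun c x).2 t) i
    have e4 : ((jetFun c x).1, ((0 : Fin d₂ → ℝ), (0 : Fin n → Comp d₁ d₂ → ℝ))) +
        t • ((0 : Comp d₁ d₂ → ℝ), (jetFun c x).2) =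
        ((jetFun c x).1, (1 - t) • (0 : (Fin d₂ → ℝ) × (Fin n → Comp d₁ d₂ → ℝ)) +
          t • (jetFun c x).2) := by
      refine Prod.ext (by simp) (Prod.ext (by simp) (by simp))
    rw [← e3, hBA, hBA, hBA, e4]
    exact h4
  -- Here `s - r > n/2`, and all entries of the jet lie in the algebra `H^{s-r}`.
  · choose D hD using fun j => Sob.exists_partialD (n := n) (m := m) (s := s) (s' := s - L.r)
      (by linarith) j
    refine exists_series_of_ae (hn0.trans h2.le) le_rfl h2 le_rfl (jetBasis n d₁ d₂)
      (Sum.elim (fun j => (Sob.inclCLM (L.sub_le s)).comp (L.posComp j))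
        (Sum.elim (fun j => L.velComp j) fun j => (D j.1).comp (L.posComp j.2)))
      (fun _ => 0) B hB hB0 fun k c => ?_
    filter_upwards [reprFun_zero] with x hx
    rw [hz _ _ _ hx, hzero, sobFun_jetBasis, add_zero, hBA]
    simp only [ContinuousLinearMap.comp_apply, hD, Sob.inclCLM_apply, Sob.toDistr_incl]
    rfl
  -- Without `∂₀u₂`, the entries lie in the algebra `H^{s-1}`, which is contained in `H^{s-r}`.
  · choose D hD using fun j => Sob.exists_partialD (n := n) (m := m) (s := s) (s' := s - 1)
      le_rfl j
    refine exists_series_of_ae (a := s - 1) (by linarith) le_rfl (by linarith) (by linarith)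
      (jetBasis n d₁ d₂)
      (Sum.elim (fun j => (Sob.inclCLM (by linarith)).comp (L.posComp j))
        (Sum.elim (fun j => 0) fun j => (D j.1).comp (L.posComp j.2)))
      (fun _ => 0) B hB hB0 fun k c => ?_
    filter_upwards [reprFun_zero] with x hx
    rw [hz _ _ _ hx, hzero, sobFun_jetBasis, add_zero, hBA]
    simp only [ContinuousLinearMap.comp_apply, hD, Sob.inclCLM_apply, Sob.toDistr_incl]
    exact congrFun (hI k _ _ _ _) i

end Nonlinearity

end Jets

/-! ## The Lagrange–Duhamel vector field -/

section Field

variable {n d₁ d₂ : ℕ} {L : LinOp n d₁ d₂} {m s : ℝ} [hm : Fact (0 < m)]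

namespace LinOp

theorem exists_data_multilinear {X : Type} [NormedAddCommGroup X] [NormedSpace ℝ X] {k : ℕ}
    (p : Comp d₁ d₂ → ContinuousMultilinearMap ℝ (fun _ : Fin k => X) (Sob n m s))
    (v : Fin d₂ → ContinuousMultilinearMap ℝ (fun _ : Fin k => X) (Sob n m (s - L.r))) :
    ∃ G : ContinuousMultilinearMap ℝ (fun _ : Fin k => X) (L.DataProd m s),
      (∀ i x, L.posComp i (G x) = p i x) ∧ (∀ i x, L.velComp i (G x) = v i x) ∧
        ‖G‖ ≤ ∑ i, ‖p i‖ + ∑ i, ‖v i‖ := by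
  let q : ∀ i, ContinuousMultilinearMap ℝ (fun _ : Fin k => X) (Sob n m (L.dataOrder s i)) :=
    fun i => Sum.rec (motive := fun i =>
      ContinuousMultilinearMap ℝ (fun _ : Fin k => X) (Sob n m (L.dataOrder s i))) p v i
  let G : ContinuousMultilinearMap ℝ (fun _ : Fin k => X) (L.DataProd m s) :=
    (PiLp.continuousLinearEquiv 1 ℝ
      fun i => Sob n m (L.dataOrder s i)).symm.toContinuousLinearMap.compContinuousMultilinearMap
        (ContinuousMultilinearMap.pi q)
  have hp : ∀ i x, L.posComp i (G x) = p i x := fun i x => rfl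
  have hv : ∀ i x, L.velComp i (G x) = v i x := fun i x => rfl
  refine ⟨G, hp, hv, ContinuousMultilinearMap.opNorm_le_bound (by positivity) fun x => ?_⟩
  rw [L.norm_data_eq, add_mul, Finset.sum_mul, Finset.sum_mul]
  refine add_le_add (Finset.sum_le_sum fun i _ => ?_) (Finset.sum_le_sum fun i _ => ?_)
  · rw [hp]
    exact (p i).le_opNorm x
  · rw [hv]
    exact (v i).le_opNorm x

end LinOp

theorem hasSum_series_apply {X Y : Type} [NormedAddCommGroup X] [NormedSpace ℝ X]
    [NormedAddCommGroup Y] [NormedSpace ℝ Y] [CompleteSpace Y]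
    {Q : FormalMultilinearSeries ℝ X Y} {ρ : ℝ}
    (h : Summable fun k => ‖Q k‖ * ρ ^ k) {c : X} (hc : ‖c‖ ≤ ρ) :
    HasSum (fun k => Q k fun _ => c) (Q.sum c) :=
  (summable_norm_series_apply h hc).of_norm.hasSum

theorem continuousOn_series_sum {X Y : Type} [NormedAddCommGroup X] [NormedSpace ℝ X]
    [NormedAddCommGroup Y] [NormedSpace ℝ Y] [CompleteSpace Y]
    {Q : FormalMultilinearSeries ℝ X Y} {ρ : ℝ} (h : Summable fun k => ‖Q k‖ * ρ ^ k) :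
    ContinuousOn Q.sum {c | ‖c‖ ≤ ρ} := by
  refine continuousOn_tsum (fun k => ?_) h fun k c hc => ?_
  · exact ((Q k).cont.comp (continuous_pi fun _ => continuous_id)).continuousOn
  · refine ((Q k).le_opNorm _).trans ?_
    simp only [Finset.prod_const, Finset.card_univ, Fintype.card_fin]
    have : ‖c‖ ≤ ρ := hc
    gcongr

namespace Nonlinearity

variable {N : Nonlinearity n d₁ d₂}

/-- The data `g` are `((γ⁰)⁻¹ M₁, 0, M₂)`. -/
structure IsForcing (g : L.DataProd m s) (M : Comp d₁ d₂ → Distr n) : Prop where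
  fst : ∀ i, (L.posComp (Sum.inl i) g).toDistr = ∑ j, L.γ₀⁻¹ i j • M (Sum.inl j)
  snd : ∀ i, (L.posComp (Sum.inr i) g).toDistr = 0
  vel : ∀ i, (L.velComp i g).toDistr = M (Sum.inr i)

theorem IsForcing.unique {g g' : L.DataProd m s} {M : Comp d₁ d₂ → Distr n} (h : IsForcing g M)
    (h' : IsForcing g' M) : g = g' := by
  refine LinOp.data_ext (fun k => Sob.ext_toDistr ?_) fun k => Sob.ext_toDistr ?_
  · rcases k with k | k
    · rw [h.fst, h'.fst]
    · rw [h.snd, h'.snd]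
  · rw [h.vel, h'.vel]

/-- The nonlinearity is an analytic function of the Cauchy data. -/
theorem Admissible.exists_field (hN : N.Admissible L s) :
    ∃ ρ : ℝ, 0 < ρ ∧ ∃ G : FormalMultilinearSeries ℝ (L.DataProd m s) (L.DataProd m s),
      (Summable fun k => ‖G k‖ * ρ ^ k) ∧ ∀ c : L.Cau m s, ‖c‖ ≤ ρ →
        ∃ M, N.IsValue c M ∧ (∀ M', N.IsValue c M' → M' = M) ∧ IsForcing (G.sum (L.toData c)) M := by
  choose Q₁ h₁ using fun i => N.exists_series₁ (m := m) hN i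
  choose Q₂ h₂ using fun i => N.exists_series₂ (m := m) hN i
  -- The convergence statements hold for all small positive radii, so the finitely many components
  -- share one.
  obtain ⟨ρ, hρ₁, hρ₂, hρ⟩ := ((eventually_all.2 h₁).and ((eventually_all.2 h₂).and
    self_mem_nhdsWithin)).exists
  have hρ0 : (0 : ℝ) < ρ := hρ
  choose G hGp hGv hGn using fun k => LinOp.exists_data_multilinear (L := L) (m := m) (s := s)
    (Sum.elim (fun i => ∑ j, L.γ₀⁻¹ i j • Q₁ j k) fun _ => 0) fun i => Q₂ i k
  have hsum : Summable fun k => ‖G k‖ * ρ ^ k := by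
    have hb : Summable fun k => ∑ i : Fin d₁, ∑ j, |L.γ₀⁻¹ i j| * (‖Q₁ j k‖ * ρ ^ k) +
        ∑ i, ‖Q₂ i k‖ * ρ ^ k :=
      (summable_sum fun i _ => summable_sum fun j _ => (hρ₁ j).1.mul_left _).add
        (summable_sum fun i _ => (hρ₂ i).1)
    refine Summable.of_nonneg_of_le (fun k => by positivity) (fun k => ?_) hb
    have h3 := hGn k
    rw [Fintype.sum_sum_type] at h3
    simp only [Sum.elim_inl, Sum.elim_inr, norm_zero, Finset.sum_const_zero, add_zero] at h3
    have h4 : ∀ i, ‖∑ j, L.γ₀⁻¹ i j • Q₁ j k‖ ≤ ∑ j, |L.γ₀⁻¹ i j| * ‖Q₁ j k‖ := fun i =>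
      (norm_sum_le _ _).trans (Finset.sum_le_sum fun j _ => by
        rw [norm_smul, Real.norm_eq_abs])
    calc ‖G k‖ * ρ ^ k ≤ (∑ i, ∑ j, |L.γ₀⁻¹ i j| * ‖Q₁ j k‖ + ∑ i, ‖Q₂ i k‖) * ρ ^ k := by
          gcongr
          exact h3.trans (by gcongr with i; exact h4 i)
      _ = _ := by
          rw [add_mul, Finset.sum_mul, Finset.sum_mul]
          congr 1
          refine Finset.sum_congr rfl fun i _ => ?_
          rw [Finset.sum_mul]
          exact Finset.sum_congr rfl fun j _ => by ring
  refine ⟨ρ, hρ0, G, hsum, fun c hc => ?_⟩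
  have hcd : ‖L.toData c‖ ≤ ρ := by rwa [LinearIsometryEquiv.norm_map]
  let M : Comp d₁ d₂ → Distr n := Sum.elim
    (fun i => (∑' k, Q₁ i k fun _ => L.toData c).toDistr)
    fun i => (∑' k, Q₂ i k fun _ => L.toData c).toDistr
  let y : Space n → Comp d₁ d₂ → ℝ := fun x => Sum.elim
    (fun i => ∑' k, N.N₁ k (fun _ => (jetFun c x).1) i) fun i => ∑' k, N.N₂ k (fun _ => jetFun c x) i
  have hMy : ∀ i, IsRepr (M i) fun x => y x i := by
    rintro (i | i)
    · exact ((hρ₁ i).2 c hc).2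
    · exact ((hρ₂ i).2 c hc).2
  have hy : ∀ᵐ x, HasSum (fun k => N.N₁ k (fun _ => (jetFun c x).1)) (fun i => y x (Sum.inl i)) ∧
      HasSum (fun k => N.N₂ k (fun _ => jetFun c x)) (fun i => y x (Sum.inr i)) := by
    filter_upwards [ae_all_iff.2 fun i => ((hρ₁ i).2 c hc).1,
      ae_all_iff.2 fun i => ((hρ₂ i).2 c hc).1] with x hx₁ hx₂
    exact ⟨Pi.hasSum.2 fun i => (hx₁ i).hasSum, Pi.hasSum.2 fun i => (hx₂ i).hasSum⟩
  refine ⟨M, ⟨y, hMy, hy⟩, ?_, ?_⟩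
  · rintro M' ⟨y', hMy', hy'⟩
    funext i
    refine (hMy' i).eq ((hMy i).congr ?_)
    filter_upwards [hy, hy'] with x hx hx'
    rcases i with i | i
    · exact congrFun (hx.1.unique hx'.1) i
    · exact congrFun (hx.2.unique hx'.2) i
  · have hG := hasSum_series_apply hsum hcd
    refine ⟨fun i => ?_, fun i => ?_, fun i => ?_⟩
    · have e1 := (hG.mapL (L.posComp (Sum.inl i))).tsum_eq
      rw [← e1]
      simp only [hGp, Sum.elim_inl, sum_apply,
        smul_apply]
      have hs : ∀ j, Summable fun k => L.γ₀⁻¹ i j • Q₁ j k fun _ => L.toData c := fun j =>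
        (summable_norm_series_apply (hρ₁ j).1 hcd).of_norm.const_smul _
      rw [Summable.tsum_finsetSum fun j _ => hs j, map_sum]
      refine Finset.sum_congr rfl fun j _ => ?_
      rw [tsum_const_smul'', map_smul]
      rfl
    · have e1 := (hG.mapL (L.posComp (Sum.inr i))).tsum_eq
      rw [← e1]
      simp [hGp]
    · have e1 := (hG.mapL (L.velComp i)).tsum_eq
      rw [← e1]
      simp only [hGv]
      rfl

end Nonlinearity

end Field

/-! ### A priori bounds for nonlinear solutions -/

section Solutions

/-- A bound which is strict as long as it holds is preserved. -/
theorem lt_of_forall_lt_of_forall_le {f : ℝ → ℝ} {B : ℝ} (hf : ContinuousOn f (Icc 0 1))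
    (h0 : f 0 < B) (h : ∀ x ∈ Icc (0 : ℝ) 1, (∀ y ∈ Icc 0 x, f y ≤ B) → f x < B) : f 1 < B := by
  by_contra! h1
  have hne : ({z | z ∈ Icc (0 : ℝ) 1 ∧ f z = B}).Nonempty := by
    obtain ⟨z, hz, hzB⟩ := intermediate_value_Icc zero_le_one hf ⟨h0.le, h1⟩
    exact ⟨z, hz, hzB⟩
  have hc : IsCompact {z | z ∈ Icc (0 : ℝ) 1 ∧ f z = B} := by
    refine isCompact_Icc.of_isClosed_subset ?_ fun z hz => hz.1
    exact hf.preimage_isClosed_of_isClosed isClosed_Icc isClosed_singleton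
  -- The first point at which the bound is attained. Up to it the bound holds, so the hypothesis
  -- makes it strict there, a contradiction.
  obtain ⟨z, ⟨hz, hzB⟩, hmin⟩ := hc.exists_isMinOn hne continuousOn_id
  refine (h z hz fun y hy => ?_).ne hzB
  by_contra! hyB
  have hy1 : y ∈ Icc (0 : ℝ) 1 := ⟨hy.1, hy.2.trans hz.2⟩
  obtain ⟨w, hw, hwB⟩ := intermediate_value_Icc hy.1
    (hf.mono (Icc_subset_Icc_right hy1.2)) ⟨h0.le, hyB.le⟩
  have h2 : z ≤ w := hmin ⟨⟨hw.1, hw.2.trans hy1.2⟩, hwB⟩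
  have h3 : y = z := le_antisymm hy.2 (h2.trans hw.2)
  rw [h3, hzB] at hyB
  exact lt_irrefl _ hyB

variable {n d₁ d₂ : ℕ} {L : LinOp n d₁ d₂} {m s : ℝ} [hm : Fact (0 < m)]

namespace Nonlinearity

variable {N : Nonlinearity n d₁ d₂}

/-- On the ball of radius `ρ`, the function `((γ⁰)⁻¹ N₁, 0, N₂)` of the Cauchy data is the sum of
the power series `G`. -/
structure IsField (N : Nonlinearity n d₁ d₂) (ρ : ℝ)
    (G : FormalMultilinearSeries ℝ (L.DataProd m s) (L.DataProd m s)) : Prop where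
  summable : Summable fun k => ‖G k‖ * ρ ^ k
  value : ∀ c : L.Cau m s, ‖c‖ ≤ ρ → ∃ M, N.IsValue c M ∧ (∀ M', N.IsValue c M' → M' = M) ∧
    IsForcing (G.sum (L.toData c)) M

namespace IsField

variable {ρ : ℝ} {G : FormalMultilinearSeries ℝ (L.DataProd m s) (L.DataProd m s)}
  (hG : N.IsField ρ G)
include hG

theorem norm_sum_le {c : L.DataProd m s} (hc : ‖c‖ ≤ ρ) : ‖G.sum c‖ ≤ ∑' k, ‖G k‖ * ρ ^ k := by
  have h := summable_norm_series_apply hG.summable hc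
  refine (norm_tsum_le_tsum_norm h).trans (h.tsum_le_tsum (fun k => ?_) hG.summable)
  refine ((G k).le_opNorm _).trans ?_
  simp only [Finset.prod_const, Finset.card_univ, Fintype.card_fin]
  gcongr

theorem isForcing {c : L.Cau m s} (hc : ‖c‖ ≤ ρ) {M : Comp d₁ d₂ → Distr n}
    (hM : N.IsValue c M) : IsForcing (G.sum (L.toData c)) M := by
  obtain ⟨M', -, hu, hF⟩ := hG.value c hc
  rwa [hu M hM]

/-- For small `φ` the nonlinearity at the data of `φ` is the sum of `G`, so the relation becomes an
equation between data at the single time `t`. -/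
theorem isLagrangeDuhamel_iff {I : Set ℝ} {t : ℝ} {φ ψ : L.E₀ m s I} (hφ : ‖φ‖ ≤ ρ) :
    N.IsLagrangeDuhamel t φ ψ ↔ L.dataCLM m s I t ψ = G.sum (L.dataCLM m s I t φ) := by
  have hc : ‖L.dataAt φ t‖ ≤ ρ := (L.norm_dataAt_le φ t).trans hφ
  constructor
  · rintro ⟨M, hM, h1, h2, h3⟩
    exact IsForcing.unique (M := M) ⟨h1, h2, h3⟩ (hG.isForcing hc hM)
  · intro h
    obtain ⟨M, hM, -, hF⟩ := hG.value _ hc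
    rw [← L.dataCLM_apply φ, ← h] at hF
    exact ⟨M, hM, hF.fst, hF.snd, hF.vel⟩

theorem existsUnique_isLagrangeDuhamel {I : Set ℝ} (hI : I.OrdConnected) (hn : I.Nontrivial)
    {t : ℝ} (ht : t ∈ I) {Ψ : L.DataProd m s →L[ℝ] L.E₀ m s I}
    (hΨ : ∀ c, ∀ τ ∈ I, L.dataCLM m s I τ (Ψ c) = L.flow m s (τ - t) c) {φ : L.E₀ m s I}
    (hφ : ‖φ‖ ≤ ρ) : ∃! ψ, N.IsLagrangeDuhamel t φ ψ := by
  simp only [hG.isLagrangeDuhamel_iff hφ]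
  obtain ⟨ψ, hψ, hu⟩ := L.existsUnique_dataAt hI hn ht hΨ
    (L.toData.symm (G.sum (L.dataCLM m s I t φ)))
  refine ⟨ψ, ?_, fun ψ' hψ' => hu ψ' ?_⟩
  · simp only [L.dataCLM_apply ψ]
    rw [hψ, LinearIsometryEquiv.apply_symm_apply]
  · simp only
    rw [← hψ', L.dataCLM_apply ψ', LinearIsometryEquiv.symm_apply_apply]

theorem dataCLM_V {I : Set ℝ} {t : ℝ} {φ : L.E₀ m s I} (hφ : ‖φ‖ ≤ ρ)
    (h : ∃ ψ, N.IsLagrangeDuhamel t φ ψ) :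
    L.dataCLM m s I t (N.V I t φ) = G.sum (L.dataCLM m s I t φ) := by
  rw [← hG.isLagrangeDuhamel_iff hφ, V, dif_pos h]
  exact h.choose_spec

variable {J : Set ℝ} {u : ℝ → SobVec n m s (Comp d₁ d₂)}

theorem hasDerivWithinAt (hJ : UniqueDiffOn ℝ J) (hu : N.IsSolution L J u) {a b : ℝ}
    (hab : a < b) (hI : Icc a b ⊆ J) (hc : ∀ t ∈ Icc a b, ‖L.cauchyData J u t‖ ≤ ρ) (t₀ : ℝ)
    {t : ℝ} (ht : t ∈ Icc a b) :
    HasDerivWithinAt (fun t => L.flow m s (t₀ - t) (L.toData (L.cauchyData J u t)))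
      (-(L.flow m s (t₀ - t) (G.sum (L.toData (L.cauchyData J u t))))) (Icc a b) t := by
  obtain ⟨hu, F, hF, hw⟩ := hu
  have hf : ∀ t ∈ Icc a b, IsForcing (G.sum (L.toData (L.cauchyData J u t))) (F t) :=
    fun t ht => hG.isForcing (hc t ht) (hF t (hI ht))
  refine L.hasDerivWithinAt_flow_cauchyData (G := fun t => G.sum (L.toData (L.cauchyData J u t)))
    hJ hu hw hab hI ?_ (fun t ht => (hf t ht).fst) (fun t ht => (hf t ht).snd)
    (fun t ht => (hf t ht).vel) t₀ ht
  refine (continuousOn_series_sum hG.summable).comp (t := {c | ‖c‖ ≤ ρ}) ?_ fun t ht => ?_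
  · exact L.toData.continuous.comp_continuousOn ((L.continuousOn_cauchyData hJ hu).mono hI)
  · change ‖L.toData _‖ ≤ ρ
    rw [LinearIsometryEquiv.norm_map]
    exact hc t ht

/-- The energy estimate for the nonlinear equation. -/
theorem norm_cauchyData_le (hJ : UniqueDiffOn ℝ J) (hu : N.IsSolution L J u) {C : ℝ} (hC1 : 1 ≤ C)
    (hC : ∀ t ∈ J, ∀ t' ∈ J, ∀ c, ‖L.flow m s (t - t') c‖ ≤ C * ‖c‖) {t x : ℝ}
    (hI : uIcc t x ⊆ J) (hc : ∀ y ∈ uIcc t x, ‖L.cauchyData J u y‖ ≤ ρ) :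
    ‖L.cauchyData J u x‖ ≤
      C * (‖L.cauchyData J u t‖ + C * (∑' k, ‖G k‖ * ρ ^ k) * |x - t|) := by
  set K := ∑' k, ‖G k‖ * ρ ^ k with hK
  have hρ : 0 ≤ ρ := (norm_nonneg _).trans (hc t left_mem_uIcc)
  have hK0 : 0 ≤ K := tsum_nonneg fun k => by positivity
  have hC0 : 0 ≤ C := by linarith
  rcases eq_or_ne t x with rfl | htx
  · rw [sub_self, abs_zero, mul_zero, add_zero]
    exact le_mul_of_one_le_left (norm_nonneg _) hC1
  have hab : min t x < max t x := min_lt_max.2 htx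
  -- For the data transported back to time `t` the derivative is the transported forcing alone,
  -- bounded by `C K`. The outer factor `C` in the estimate is the cost of returning to time `x`.
  set y : ℝ → L.DataProd m s := fun τ => L.flow m s (t - τ) (L.toData (L.cauchyData J u τ)) with hy
  have hd : ∀ τ ∈ uIcc t x, HasDerivWithinAt y
      (-(L.flow m s (t - τ) (G.sum (L.toData (L.cauchyData J u τ))))) (uIcc t x) τ :=
    fun τ hτ => hG.hasDerivWithinAt hJ hu hab hI hc t hτ
  have hb : ∀ τ ∈ uIcc t x,
      ‖-(L.flow m s (t - τ) (G.sum (L.toData (L.cauchyData J u τ))))‖ ≤ C * K := by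
    intro τ hτ
    rw [norm_neg]
    refine (hC t (hI left_mem_uIcc) τ (hI hτ) _).trans ?_
    gcongr
    refine hG.norm_sum_le ?_
    rw [LinearIsometryEquiv.norm_map]
    exact hc τ hτ
  have h1 := (convex_uIcc t x).norm_image_sub_le_of_norm_hasDerivWithin_le hd hb
    left_mem_uIcc right_mem_uIcc
  have h2 : y t = L.toData (L.cauchyData J u t) := by
    simp only [hy, sub_self, LinOp.flow_zero]
    rfl
  have h3 : L.flow m s (x - t) (y x) = L.toData (L.cauchyData J u x) := by
    simp only [hy]
    rw [← neg_sub x t, L.flow_neg_flow]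
  have h4 : ‖y x‖ ≤ ‖L.cauchyData J u t‖ + C * K * |x - t| := by
    have h5 : ‖y t‖ = ‖L.cauchyData J u t‖ := by rw [h2, LinearIsometryEquiv.norm_map]
    have h6 := norm_le_norm_add_norm_sub' (y x) (y t)
    rw [Real.norm_eq_abs] at h1
    linarith
  rw [← L.toData.norm_map, ← h3]
  refine (hC x (hI right_mem_uIcc) t (hI left_mem_uIcc) _).trans ?_
  gcongr

/-- Small solutions stay small, for short times. -/
theorem norm_cauchyData_lt (hJ : UniqueDiffOn ℝ J) (hu : N.IsSolution L J u) {C : ℝ} (hC1 : 1 ≤ C)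
    (hC : ∀ t ∈ J, ∀ t' ∈ J, ∀ c, ‖L.flow m s (t - t') c‖ ≤ C * ‖c‖) {t x B : ℝ}
    (hI : uIcc t x ⊆ J) (hρ : 0 ≤ ρ) (hB : B ≤ ρ)
    (hx : C * (‖L.cauchyData J u t‖ + C * (∑' k, ‖G k‖ * ρ ^ k) * |x - t|) < B) :
    ‖L.cauchyData J u x‖ < B := by
  set K := ∑' k, ‖G k‖ * ρ ^ k with hK
  have hC0 : 0 ≤ C := by linarith
  have hK0 : 0 ≤ K := tsum_nonneg fun k => by positivity
  -- The segment from `t` to `x`, in either direction, is parametrized by `[0, 1]` for the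
  -- continuity argument.
  set p : ℝ → ℝ := fun σ => t + σ * (x - t) with hp
  have hpu : ∀ σ ∈ Icc (0 : ℝ) 1, p σ ∈ uIcc t x := by
    intro σ hσ
    rw [← segment_eq_uIcc]
    refine ⟨1 - σ, σ, by linarith [hσ.2], hσ.1, by ring, ?_⟩
    simp only [hp, smul_eq_mul]
    ring
  have hp1 : p 1 = x := by simp [hp]
  have hp0 : p 0 = t := by simp [hp]
  have hcont : ContinuousOn (fun σ => ‖L.cauchyData J u (p σ)‖) (Icc 0 1) := by
    refine ((L.continuousOn_cauchyData hJ hu.1).comp (by fun_prop) fun σ hσ => hI (hpu σ hσ)).norm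
  have h := lt_of_forall_lt_of_forall_le (B := B) hcont ?_ fun σ hσ hle => ?_
  · rwa [hp1] at h
  · rw [hp0]
    refine lt_of_le_of_lt ?_ hx
    have h1 : 0 ≤ C * K * |x - t| := by positivity
    calc ‖L.cauchyData J u t‖ ≤ C * ‖L.cauchyData J u t‖ :=
          le_mul_of_one_le_left (norm_nonneg _) hC1
      _ ≤ _ := by gcongr; linarith
  · have hsub : uIcc t (p σ) ⊆ uIcc t x := uIcc_subset_uIcc_left (hpu σ hσ)
    have habs : |p σ - t| ≤ |x - t| := by
      simp only [hp, add_sub_cancel_left]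
      rw [abs_mul, abs_of_nonneg hσ.1]
      exact mul_le_of_le_one_left (abs_nonneg _) hσ.2
    have h1 := hG.norm_cauchyData_le hJ hu hC1 hC (hsub.trans hI) (fun y hy => ?_)
    · exact h1.trans_lt (lt_of_le_of_lt (by gcongr) hx)
    · rw [← segment_eq_uIcc] at hy
      obtain ⟨w', w, hw', hw, hww, rfl⟩ := hy
      have e : w' • t + w • p σ = p (w * σ) := by
        simp only [hp, smul_eq_mul]
        linear_combination t * hww
      rw [e]
      exact (hle (w * σ) ⟨mul_nonneg hw hσ.1,
        mul_le_of_le_one_left hσ.1 (by linarith)⟩).trans hB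

end IsField

end Nonlinearity

end Solutions

/-! ### The vector field and the curve `Θ` on a fixed interval -/

section Interval

variable {n d₁ d₂ : ℕ} {L : LinOp n d₁ d₂} {m s : ℝ} [hm : Fact (0 < m)]
  {N : Nonlinearity n d₁ d₂} {I : Set ℝ}

/-- The terms of the Taylor series of the Lagrange–Duhamel vector field at time `θ`. -/
def LinOp.fieldSeries (Ψ : L.DataProd m s →L[ℝ] L.E₀ m s I)
    (G : FormalMultilinearSeries ℝ (L.DataProd m s) (L.DataProd m s)) (t₀ θ : ℝ) :
    FormalMultilinearSeries ℝ (L.E₀ m s I) (L.E₀ m s I) :=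
  -- Evaluation of the data at time `θ`, the nonlinearity, transport back to `t₀`, and the solution
  -- operator at `t₀`: a single `Ψ` serves all times.
  fun k => (Ψ.comp (L.flow m s (t₀ - θ))).compContinuousMultilinearMap
    ((G k).compContinuousLinearMap fun _ => L.dataCLM m s I θ)

theorem LinOp.fieldSeries_apply (Ψ : L.DataProd m s →L[ℝ] L.E₀ m s I)
    (G : FormalMultilinearSeries ℝ (L.DataProd m s) (L.DataProd m s)) (t₀ θ : ℝ) (k : ℕ)
    (x : Fin k → L.E₀ m s I) : L.fieldSeries Ψ G t₀ θ k x =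
      Ψ (L.flow m s (t₀ - θ) (G k fun i => L.dataCLM m s I θ (x i))) := rfl

theorem LinOp.norm_fieldSeries_le {Ψ : L.DataProd m s →L[ℝ] L.E₀ m s I}
    {G : FormalMultilinearSeries ℝ (L.DataProd m s) (L.DataProd m s)} {t₀ θ C : ℝ} (hC : 0 ≤ C)
    (hΨ : ∀ c, ‖Ψ c‖ ≤ C * ‖c‖) (hf : ∀ c, ‖L.flow m s (t₀ - θ) c‖ ≤ C * ‖c‖) (k : ℕ) :
    ‖L.fieldSeries Ψ G t₀ θ k‖ ≤ C ^ 2 * ‖G k‖ := by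
  refine ContinuousMultilinearMap.opNorm_le_bound (by positivity) fun x => ?_
  rw [L.fieldSeries_apply]
  calc _ ≤ C * (C * (‖G k‖ * ∏ i, ‖L.dataCLM m s I θ (x i)‖)) := by
        refine (hΨ _).trans ?_
        gcongr
        refine (hf _).trans ?_
        gcongr
        exact (G k).le_opNorm _
    _ ≤ C * (C * (‖G k‖ * ∏ i, ‖x i‖)) := by
        gcongr with i
        exact L.norm_dataCLM_le θ (x i)
    _ = _ := by ring

/-- The data of a fixed solution are moved by the evolution, which is jointly continuous in time and
data. The function `θ` keeps the times in `I`, where `dataCLM` gives the data rather than its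
default value `0`. -/
theorem LinOp.continuous_fieldSeries (hI : I.OrdConnected) (hn : I.Nontrivial)
    (Ψ : L.DataProd m s →L[ℝ] L.E₀ m s I)
    (G : FormalMultilinearSeries ℝ (L.DataProd m s) (L.DataProd m s)) {t₀ : ℝ} (ht₀ : t₀ ∈ I)
    {θ : ℝ → ℝ} (hθ : Continuous θ) (hθI : ∀ t, θ t ∈ I) (k : ℕ) (x : Fin k → L.E₀ m s I) :
    Continuous fun t => L.fieldSeries Ψ G t₀ (θ t) k x := by
  simp only [L.fieldSeries_apply]
  refine Ψ.continuous.comp (continuous_iff_continuousAt.2 fun t => ?_)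
  refine L.tendsto_flow (by exact (continuous_const.sub hθ).tendsto t) ?_
  refine ((G k).cont.comp (continuous_pi fun i => ?_)).tendsto t
  have e : (fun t => L.dataCLM m s I (θ t) (x i)) =
      fun t => L.flow m s (θ t - t₀) (L.dataCLM m s I t₀ (x i)) :=
    funext fun t => L.dataCLM_eq_flow hI hn (x i) (hθI t) ht₀
  rw [e]
  exact (L.continuous_flow s _).comp (hθ.sub continuous_const)

theorem LinOp.flow_flow_neg_sub (t t' : ℝ) (c : L.DataProd m s) :
    L.flow m s (t - t') (L.flow m s (t' - t) c) = c := by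
  rw [← neg_sub t t', L.flow_neg_flow]

namespace Nonlinearity.IsField

variable {ρ : ℝ} {G : FormalMultilinearSeries ℝ (L.DataProd m s) (L.DataProd m s)}
  (hG : N.IsField ρ G) {t₀ : ℝ} {Ψ : L.DataProd m s →L[ℝ] L.E₀ m s I}
include hG

theorem V_eq (hI : I.OrdConnected) (hn : I.Nontrivial)
    (hΨ : ∀ c, ∀ t ∈ I, L.dataCLM m s I t (Ψ c) = L.flow m s (t - t₀) c) {t : ℝ} (ht : t ∈ I)
    {φ : L.E₀ m s I} (hφ : ‖φ‖ ≤ ρ) (h : ∃ ψ, N.IsLagrangeDuhamel t φ ψ) :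
    N.V I t φ = Ψ (L.flow m s (t₀ - t) (G.sum (L.dataCLM m s I t φ))) := by
  refine L.E₀_ext_data fun τ hτ => ?_
  rw [L.dataCLM_eq_flow hI hn _ hτ ht, L.dataCLM_eq_flow hI hn (Ψ _) hτ ht, hΨ _ _ ht,
    hG.dataCLM_V hφ h, L.flow_flow_neg_sub]

theorem hasSum_fieldSeries (hI : I.OrdConnected) (hn : I.Nontrivial)
    (hΨ : ∀ c, ∀ t ∈ I, L.dataCLM m s I t (Ψ c) = L.flow m s (t - t₀) c) {t : ℝ} (ht : t ∈ I)
    {φ : L.E₀ m s I} (hφ : ‖φ‖ ≤ ρ) (h : ∃ ψ, N.IsLagrangeDuhamel t φ ψ) :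
    HasSum (fun k => L.fieldSeries Ψ G t₀ t k fun _ => φ) (N.V I t φ) := by
  rw [hG.V_eq hI hn hΨ ht hφ h]
  exact (hasSum_series_apply hG.summable ((L.norm_dataCLM_le t φ).trans hφ)).mapL
    (Ψ.comp (L.flow m s (t₀ - t)))

end Nonlinearity.IsField

/-- With `Θ_t u` written as one fixed operator applied to the data transported to `t₀`, its
derivative in `t` is given by the formula of Duhamel. -/
theorem LinOp.Theta_eq (hI : I.OrdConnected) (hn : I.Nontrivial) {t₀ t : ℝ} (ht : t ∈ I)
    {Ψ Ψ' : L.DataProd m s →L[ℝ] L.E₀ m s I}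
    (hΨ : ∀ c, ∀ τ ∈ I, L.dataCLM m s I τ (Ψ c) = L.flow m s (τ - t₀) c)
    (hΨ' : ∀ c, ∀ τ ∈ I, L.dataCLM m s I τ (Ψ' c) = L.flow m s (τ - t) c)
    (J : Set ℝ) (u : ℝ → SobVec n m s (Comp d₁ d₂)) :
    L.Theta I J t u = Ψ (L.flow m s (t₀ - t) (L.toData (L.cauchyData J u t))) := by
  refine L.E₀_ext_data fun τ hτ => ?_
  rw [L.dataCLM_eq_flow hI hn _ hτ ht, L.dataCLM_eq_flow hI hn (Ψ _) hτ ht, hΨ _ _ ht,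
    L.flow_flow_neg_sub, L.dataCLM_apply, Theta, L.dataAt_Phi hI hn ht hΨ']

end Interval

end

/-! ### Choice of the constants and conclusion -/

theorem theorem2 {n d₁ d₂ : ℕ} (m : ℝ) [Fact (0 < m)] (L : LinOp n d₁ d₂)
    (N : Nonlinearity n d₁ d₂) (s : ℝ) (hN : N.Admissible L s) (ℓ : ℝ≥0∞)
    (hℓ : 0 < L.μ₀ ∨ ℓ < ⊤) (r : ℝ) (hr : 0 < r) :
    ∃ tbar R R' : ℝ, 0 < tbar ∧ 0 < R ∧ R ≤ R' ∧
      ∀ I : Set ℝ, I.OrdConnected → I.Nontrivial → Metric.ediam I ≤ ℓ →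
        (∀ t ∈ I, ∀ c : L.Cau m s, ∃! φ : L.E₀ m s I, L.dataAt φ t = c) ∧
        (∀ t ∈ I, ∀ φ : L.E₀ m s I, ‖φ‖ < R' →
          ∃! ψ : L.E₀ m s I, N.IsLagrangeDuhamel t φ ψ) ∧
        ∀ t₁ ∈ I, ∀ t₂ ∈ I, |t₂ - t₁| < tbar →
          ∀ f : FormalMultilinearSeries ℝ (L.E₀ m s I) ℝ, SymmSeries f →
            ENNReal.ofReal r ≤ f.radius →
            ∃ g : FormalMultilinearSeries ℝ (L.E₀ m s I) ℝ,
              IsChronExp (N.V I) t₁ t₂ f R' g ∧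
              ∀ J : Set ℝ, J.OrdConnected → J.Nontrivial → J ⊆ I → t₁ ∈ J → t₂ ∈ J →
                ∀ u : ℝ → SobVec n m s (Comp d₁ d₂), N.IsSolution L J u →
                  ∀ t ∈ uIcc t₁ t₂, ‖L.cauchyData J u t‖ < R →
                    ‖L.Theta I J t₁ u‖ < r ∧ ‖L.Theta I J t₂ u‖ < R' ∧
                      g.sum (L.Theta I J t₂ u) = f.sum (L.Theta I J t₁ u) := by
  obtain ⟨ρ, hρ, G, hGs, hGv⟩ := hN.exists_field (m := m)
  have hG : N.IsField ρ G := ⟨hGs, hGv⟩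
  obtain ⟨C, hC1, hflow, hsol⟩ := L.exists_solutionOp m s ℓ.toReal
  set K := ∑' k, ‖G k‖ * ρ ^ k with hK
  have hK0 : 0 ≤ K := tsum_nonneg fun k => by positivity
  have hC0 : 0 < C := by linarith
  -- The functional `f` must converge absolutely at `r₀`, hence `r₀ < r`; the vector field must be
  -- analytic up to `r₀`, hence `r₀ ≤ ρ`.
  set r₀ := min ρ (r / 2) with hr₀
  have hr₀0 : 0 < r₀ := by positivity
  have hr₀ρ : r₀ ≤ ρ := min_le_left _ _
  have hr₀r : r₀ < r := (min_le_right _ _).trans_lt (by linarith)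
  set R' := r₀ / 2 with hR'
  have hR'0 : 0 < R' := by positivity
  -- The first summand makes the chronological series converge, the second keeps the solution small
  -- between `t₁` and `t₂`, and the last makes `D` positive.
  set D := Real.exp 1 * (C ^ 2 * K) + C ^ 4 * K + 1 with hD
  have hD0 : 0 < D := by positivity
  -- In `C ^ 3`, two factors come from passing from the data to `Θ`, and one from the energy
  -- estimate.
  refine ⟨R' / (4 * D), R' / (4 * C ^ 3), R', by positivity, by positivity,
    div_le_self hR'0.le (by nlinarith [one_le_pow₀ hC1 (n := 3)]), fun I hI hn hIℓ => ?_⟩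
  have hdist : ∀ t ∈ I, ∀ t' ∈ I, 0 < L.μ₀ ∨ |t - t'| ≤ ℓ.toReal := by
    intro t ht t' ht'
    refine hℓ.imp id fun hℓ => ?_
    have h1 := (Metric.edist_le_ediam_of_mem ht ht').trans hIℓ
    have h2 := ENNReal.toReal_mono hℓ.ne h1
    rwa [edist_dist, ENNReal.toReal_ofReal dist_nonneg, Real.dist_eq] at h2
  have hfI : ∀ t ∈ I, ∀ t' ∈ I, ∀ c, ‖L.flow m s (t - t') c‖ ≤ C * ‖c‖ :=
    fun t ht t' ht' => hflow _ (hdist t ht t' ht')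
  have hLD : ∀ t ∈ I, ∀ φ : L.E₀ m s I, ‖φ‖ ≤ ρ → ∃! ψ, N.IsLagrangeDuhamel t φ ψ := by
    intro t ht φ hφ
    obtain ⟨Ψ, hΨ, -⟩ := hsol I hI hn hdist t ht
    exact hG.existsUnique_isLagrangeDuhamel hI hn ht hΨ hφ
  refine ⟨fun t ht c => ?_, fun t ht φ hφ => hLD t ht φ (by linarith), ?_⟩
  · obtain ⟨Ψ, hΨ, -⟩ := hsol I hI hn hdist t ht
    exact L.existsUnique_dataAt hI hn ht hΨ c
  intro t₁ ht₁ t₂ ht₂ ht f hf hfr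
  have hsub : uIcc t₁ t₂ ⊆ I := hI.uIcc_subset ht₁ ht₂
  obtain ⟨Ψ, hΨ, hΨn⟩ := hsol I hI hn hdist t₁ ht₁
  have hle : min t₁ t₂ ≤ max t₁ t₂ := min_le_max
  -- Times are clamped between `t₁` and `t₂`, so that the coefficients are bounded and continuous
  -- for all real times, as `exists_isChronExp` asks.
  set θ : ℝ → ℝ := fun t => projIcc (min t₁ t₂) (max t₁ t₂) hle t with hθ
  have hθI : ∀ t, θ t ∈ I := fun t => hsub (projIcc _ _ hle t).2
  have hθc : Continuous θ := continuous_subtype_val.comp continuous_projIcc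
  have hθe : ∀ t ∈ uIcc t₁ t₂, θ t = t := fun t ht => by
    simp only [hθ]
    rw [projIcc_of_mem hle ht]
  have htb : |t₂ - t₁| * D ≤ R' / 4 := by
    have := (lt_div_iff₀ (by positivity)).1 ht
    linarith
  have hvK : Summable fun k => C ^ 2 * ‖G k‖ * r₀ ^ k := by
    refine Summable.of_nonneg_of_le (fun k => by positivity) (fun k => ?_) (hGs.mul_left (C ^ 2))
    rw [← mul_assoc]
    gcongr
  have hvle : ∑' k, C ^ 2 * ‖G k‖ * r₀ ^ k ≤ C ^ 2 * K := by
    rw [hK, ← tsum_mul_left]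
    refine hvK.tsum_le_tsum (fun k => ?_) (hGs.mul_left (C ^ 2))
    rw [← mul_assoc]
    gcongr
  obtain ⟨g, hg, hΘ⟩ := exists_isChronExp (V := N.V I)
    (W := fun t => L.fieldSeries Ψ G t₁ (θ t)) (f := f) (v := fun k => C ^ 2 * ‖G k‖) (r₀ := r₀)
    (R := R') (t₁ := t₁) (t₂ := t₂) hR'0 (by linarith)
    (fun t k => LinOp.norm_fieldSeries_le hC0.le hΨn (hfI t₁ ht₁ _ (hθI t)) k)
    (fun k x => LinOp.continuous_fieldSeries hI hn Ψ G ht₁ hθc hθI k x)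
    (fun t ht φ hφ => by
      simp only [hθe t ht]
      exact hG.hasSum_fieldSeries hI hn hΨ (hsub ht) (hφ.le.trans hr₀ρ)
        (hLD t (hsub ht) φ (hφ.le.trans hr₀ρ)).exists)
    hf (by
      have h1 : (r₀.toNNReal : ℝ≥0∞) < f.radius := by
        refine lt_of_lt_of_le ?_ hfr
        change ENNReal.ofReal r₀ < _
        exact (ENNReal.ofReal_lt_ofReal_iff hr).2 hr₀r
      have h2 := f.summable_norm_mul_pow h1
      simpa [Real.coe_toNNReal _ hr₀0.le] using h2) hvK (by
      calc |t₂ - t₁| * (Real.exp 1 * ∑' k, C ^ 2 * ‖G k‖ * r₀ ^ k)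
          ≤ |t₂ - t₁| * (Real.exp 1 * (C ^ 2 * K)) := by gcongr
        _ ≤ |t₂ - t₁| * D := by
            gcongr
            rw [hD]
            have : 0 ≤ C ^ 4 * K := by positivity
            linarith
        _ < r₀ - R' := by linarith)
  refine ⟨g, hg, fun J hJ hJn hJI ht₁J ht₂J u hu t htu hut => ?_⟩
  have hJsub : uIcc t₁ t₂ ⊆ J := hJ.uIcc_subset ht₁J ht₂J
  have hU := uniqueDiffOn_of_ordConnected hJ hJn
  -- The bound `R' / C ^ 2` for the data gives `‖Θ‖ < R'`, since the transport to `t₁` and the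
  -- solution operator each cost a factor `C`.
  have hsmall : ∀ x ∈ uIcc t₁ t₂, ‖L.cauchyData J u x‖ < R' / C ^ 2 := by
    intro x hx
    have hux : uIcc t x ⊆ uIcc t₁ t₂ := uIcc_subset_uIcc htu hx
    refine hG.norm_cauchyData_lt hU hu hC1 (fun t ht t' ht' => hfI t (hJI ht) t' (hJI ht'))
      (hux.trans hJsub) hρ.le ?_ ?_
    · have := div_le_self hR'0.le (one_le_pow₀ hC1 (n := 2))
      linarith
    · have h1 : |x - t| ≤ |t₂ - t₁| := abs_sub_le_of_uIcc_subset_uIcc hux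
      rw [lt_div_iff₀ (by positivity)] at hut ⊢
      have h2 : |x - t| * (C ^ 4 * K) ≤ R' / 4 := by
        refine le_trans ?_ htb
        gcongr
        rw [hD]
        have : 0 ≤ Real.exp 1 * (C ^ 2 * K) := by positivity
        linarith
      calc C * (‖L.cauchyData J u t‖ + C * K * |x - t|) * C ^ 2
          = ‖L.cauchyData J u t‖ * (4 * C ^ 3) / 4 + |x - t| * (C ^ 4 * K) := by ring
        _ < R' := by linarith
  have hsmall' : ∀ x ∈ uIcc t₁ t₂, ‖L.cauchyData J u x‖ ≤ ρ := fun x hx => by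
    have := div_le_self hR'0.le (one_le_pow₀ hC1 (n := 2))
    linarith [hsmall x hx]
  have hΘeq : ∀ x ∈ uIcc t₁ t₂, L.Theta I J x u =
      Ψ (L.flow m s (t₁ - x) (L.toData (L.cauchyData J u x))) := fun x hx => by
    obtain ⟨Ψ', hΨ', -⟩ := hsol I hI hn hdist x (hsub hx)
    exact L.Theta_eq hI hn (hsub hx) hΨ hΨ' J u
  have hΘn : ∀ x ∈ uIcc t₁ t₂, ‖L.Theta I J x u‖ < R' := fun x hx => by
    rw [hΘeq x hx]
    calc _ ≤ C * (C * ‖L.toData (L.cauchyData J u x)‖) :=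
          (hΨn _).trans (by gcongr; exact hfI t₁ ht₁ x (hsub hx) _)
      _ = ‖L.cauchyData J u x‖ * C ^ 2 := by rw [LinearIsometryEquiv.norm_map]; ring
      _ < R' := (lt_div_iff₀ (by positivity)).1 (hsmall x hx)
  refine ⟨(hΘn t₁ left_mem_uIcc).trans (by linarith), hΘn t₂ right_mem_uIcc,
    hΘ (fun t => L.Theta I J t u) hΘn fun x hx => ?_⟩
  -- The data of `Θ_x u` at time `x` are those of `u`, so the vector field there is the image of the
  -- forcing of the nonlinear solution. Comparison with the formula of Duhamel shows that `Θ` is an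
  -- integral curve of `-V`.
  have hV : N.V I x (L.Theta I J x u) =
      Ψ (L.flow m s (t₁ - x) (G.sum (L.toData (L.cauchyData J u x)))) := by
    have hx' : ‖L.Theta I J x u‖ ≤ ρ := by linarith [hΘn x hx]
    rw [hG.V_eq hI hn hΨ (hsub hx) hx' (hLD x (hsub hx) _ hx').exists]
    congr 3
    rw [hΘeq x hx, hΨ _ _ (hsub hx), L.flow_flow_neg_sub]
  rw [hV]
  -- If `t₁ = t₂`, the interval is a point, within which every value is a derivative.
  rcases eq_or_ne t₁ t₂ with h12 | h12
  · subst h12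
    rw [uIcc_self] at hx ⊢
    rw [mem_singleton_iff.1 hx]
    exact HasFDerivWithinAt.of_subsingleton subsingleton_singleton
  · have h1 := hG.hasDerivWithinAt hU hu (min_lt_max.2 h12) hJsub hsmall' t₁ hx
    have h2 := Ψ.hasFDerivAt.comp_hasDerivWithinAt x h1
    rw [map_neg] at h2
    exact h2.congr (fun y hy => hΘeq y hy) (hΘeq x hx)
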